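/- Let $n\ge 2$ and consider the functional equation $$\sum_{i=1}^{n+1}\frac{\partial}{\partial x_i}\prod_{j\ne i} f(x_i-x_j)=0 \qquad (*)$$ required at all real $x_1,\dots,x_{n+1}$ such that $f$ is regular at every difference $x_i-x_j$, $i\neq j$. Let $\mathcal B$ be the class of complex-valued functions $f$ that are analytic in a neighbourhood of the real axis except for a double pole at $0$, and bounded on the real axis away from $0$. Let $\mathcal B_{2\pi}$ be the class of $2\pi$-periodic functions that are analytic in a neighbourhood of the real axis except for double poles at the points $2\pi m$, $m\in\mathbb Z$. The generalised Fourier transform $\hat f(k)$ is the mean of the two integrals $\int f(z)e^{-ikz}\,dz$ along the real axis indented above and below the pole. For $f\in\mathcal B$, $\hat f(0)$ is this integral at $k=0$, taken as $\lim_{T\to\infty}$ of the integrals from $-T$ to $T$, and "$\hat f(0)\ne0$" means that these do not converge to $0$. For $f\in\mathcal B_{2\pi}$, $\hat f=\sum_p a_p\,\delta(k-p)$ with $f(x)=\frac1{2\pi}\sum_p a_pe^{ipx}$, where $a_p$ is the integral over the period $[-\pi,\pi]$, indented at $0$ in the same way, and "$\hat f(0)\neq0$" means $a_0\ne0$. Let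 $\wp(z;g_2,g_3)$ be the Weierstrass function, the meromorphic solution of $\wp'^2=4\wp^3-g_2\wp-g_3$ with $z^2\wp(z)\to1$ as $z\to0$, including the degenerate cases $z^{-2}$ and $c^2/\sinh^2(cz)+c^2/3$, $c\neq0$. Let $f\in\mathcal B\cup\mathcal B_{2\pi}$ be even. (1) If $n$ is even, then $f$ satisfies $(*)$ if and only if $f(z)=a+b\,\wp(z;g_2,g_3)$ near the real axis for some $a,b,g_2,g_3\in\mathbb C$. (2) If $n$ is odd and $\hat f(0)\ne0$, then $f$ satisfies $(*)$ if and only if $f(z)=a+b\,\wp(z;g_2,g_3)$ near the real axis for some $a,b,g_2,g_3\in\mathbb C$. -/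

import Mathlib

open Filter Topology

noncomputable section

namespace PoincareFE

/-- `f` solves the functional equation
`∑_{i=1}^{n+1} ∂/∂x_i ∏_{j ≠ i} f (x_i - x_j) = 0`:
it holds at all real points `x_1, …, x_{n+1}` such that `f` is regular at all the differences
`x_i - x_j`, `i ≠ j`. The `i`-th product depends on `x_i` through its first argument only, so that
its partial derivative is the derivative in `t = x_i` with the other coordinates fixed. -/
def SolvesEquation (n : ℕ) (f : ℂ → ℂ) : Prop :=
  ∀ x : Fin (n + 1) → ℝ,
    (∀ i j, i ≠ j → AnalyticAt ℂ f ((x i - x j : ℝ) : ℂ)) →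
      ∑ i, deriv (fun t : ℝ => ∏ j ∈ Finset.univ.erase i, f ((t - x j : ℝ) : ℂ)) (x i) = 0

/-- The functions that are analytic at the points of the real axis apart from a double pole at the
origin, and bounded on the real axis away from the origin. -/
structure ClassB (f : ℂ → ℂ) : Prop where
  analytic : ∀ x : ℝ, x ≠ 0 → AnalyticAt ℂ f x
  pole : meromorphicOrderAt f 0 = ((-2 : ℤ) : WithTop ℤ)
  bounded : ∀ δ : ℝ, 0 < δ → ∃ C : ℝ, ∀ x : ℝ, δ ≤ |x| → ‖f x‖ ≤ C

/-- The functions with period `2π` that are analytic at the points of the real axis apart from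
double poles at the points `2πm`, `m ∈ ℤ`. By periodicity and compactness they are bounded on
the real axis away from these poles. -/
structure ClassBTwoPi (f : ℂ → ℂ) : Prop where
  periodic : ∀ x : ℝ, f ((x + 2 * Real.pi : ℝ) : ℂ) = f x
  analytic : ∀ x : ℝ, (∀ m : ℤ, x ≠ 2 * Real.pi * m) → AnalyticAt ℂ f x
  pole : ∀ m : ℤ, meromorphicOrderAt f ((2 * Real.pi * m : ℝ) : ℂ) = ((-2 : ℤ) : WithTop ℤ)

/-- The integral of `f z * exp (-i k z)` along the real axis from `-T` to `T`, except that the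
segment from `-r` to `r` is replaced by a semicircle of radius `r` around the origin: the one in
the upper half plane for `σ = 1`, the one in the lower half plane for `σ = -1`. -/
def indentedIntegral (f : ℂ → ℂ) (σ r T k : ℝ) : ℂ :=
  (∫ x in (-T)..(-r), f x * Complex.exp (-Complex.I * k * x)) +
  (∫ θ in (0 : ℝ)..Real.pi,
    f (-r * Complex.exp (-Complex.I * σ * θ)) *
      Complex.exp (-Complex.I * k * (-r * Complex.exp (-Complex.I * σ * θ))) *
      (Complex.I * σ * r * Complex.exp (-Complex.I * σ * θ))) +
  (∫ x in r..T, f x * Complex.exp (-Complex.I * k * x))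

/-- The mean of the integrals over the paths indented above and below the origin. -/
def meanIntegral (f : ℂ → ℂ) (r T k : ℝ) : ℂ :=
  (indentedIntegral f 1 r T k + indentedIntegral f (-1) r T k) / 2

/-- The generalised Fourier transform of `f` has the value `L` at `k`, as an improper integral:
the limit `T → ∞` of the mean of the two indented integrals (the radius `r` of the indentation is
any sufficiently small one, its value being immaterial). -/
def HasTransformValue (f : ℂ → ℂ) (k : ℝ) (L : ℂ) : Prop :=
  ∀ᶠ r in 𝓝[>] (0 : ℝ), Tendsto (fun T : ℝ => meanIntegral f r T k) atTop (𝓝 L)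

/-- For `f` of period `2π` the generalised Fourier transform is `∑_p a_p δ(k - p)`, where
`f(x) = (1/2π) ∑_p a_p e^{ipx}`. This says that `a_p = L`, where `a_p` is the integral of
`f(x) e^{-ipx}` over the period from `-π` to `π`, indented at the origin. -/
def HasTransformCoeff (f : ℂ → ℂ) (p : ℤ) (L : ℂ) : Prop :=
  ∀ᶠ r in 𝓝[>] (0 : ℝ), meanIntegral f r Real.pi p = L

/-- The condition `f̂(0) ≠ 0`. For functions in the first class it also counts as satisfied if
the integral for `f̂(0)` does not converge (as for a function with a nonzero mean value, whose
transform has a point mass at the origin). For periodic functions it is the condition on `a_0`. -/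
def TransformNeZeroAtZero (f : ℂ → ℂ) : Prop :=
  (ClassB f ∧ ¬ HasTransformValue f 0 0) ∨ (ClassBTwoPi f ∧ ¬ HasTransformCoeff f 0 0)

/-- `P` is the Weierstrass function `℘(z; g₂, g₃)`, i.e. the meromorphic solution of
`P'^2 = 4 P^3 - g₂ P - g₃` with `z^2 P(z) → 1` as `z → 0`. It is the `℘` function of a lattice if
the cubic has distinct roots; the other constructors are the degenerate cases, in which one
period or both are infinite. -/
inductive IsWeierstrassP : ℂ → ℂ → (ℂ → ℂ) → Prop
  | elliptic (L : PeriodPair) : IsWeierstrassP L.g₂ L.g₃ L.weierstrassP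
  | trigonometric (c : ℂ) (hc : c ≠ 0) :
      IsWeierstrassP (4 * c ^ 4 / 3) (-8 * c ^ 6 / 27)
        (fun z => c ^ 2 / Complex.sinh (c * z) ^ 2 + c ^ 2 / 3)
  | rational : IsWeierstrassP 0 0 (fun z => 1 / z ^ 2)

/-- Near the real axis, `f` is of the form `a + b ℘(z; g₂, g₃)`. -/
def IsWeierstrassForm (f : ℂ → ℂ) : Prop :=
  ∃ (a b g₂ g₃ : ℂ) (P : ℂ → ℂ), IsWeierstrassP g₂ g₃ P ∧
    ∀ x : ℝ, ∀ᶠ z in 𝓝[≠] (x : ℂ), f z = a + b * P z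

end PoincareFE

end

set_option linter.unusedSectionVars false
set_option linter.unusedFintypeInType false
set_option linter.unusedDecidableInType false

/-! Sufficiency. Let φ = a + b℘. As a function of one variable the left hand side has the periods of
φ, and it can be singular only where this variable meets another one modulo periods. There the two
singular terms combine to φ'(u)(R(y + u) − R(y)) + φ(u)(R'(y + u) + R'(y)) with R regular, and this
has a finite limit as u → 0 because φ(u) = β/u² + (regular) without residue (`tendsto_coalescence`).
Since φ is bounded away from its poles, in the degenerate cases as well, Liouville's theorem makes
the sum constant in each variable (`IsDoublePeriodic.exists_divSum_addPoint_eq_const`). Moving the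
points one by one shows that a configuration and a generic reflection of it give the same value; as
φ is even, the reflection reverses the sign, so the value is 0.

Necessity for three points. Letting two of the points coalesce gives βf'''/6 + 2g(0)f' = 2ff', which
integrates twice to the Weierstrass equation for (f − g(0))/β (`exists_weierstrass_ode`). This
equation determines the function with its given double pole, and all g₂, g₃ are realised: the
elliptic case is uniformised by a zero of a modular form AE₄³ − BE₆² (`exists_isWeierstrassP`). It
remains to descend from n + 1 points to three.

Descent on the line, n ≥ 3. Configurations with one dominating coefficient turn the equation into a
contraction for increments, so that f and f' are Lipschitz near infinity
(`IsLineFunction.exists_lipschitz`). Limits of translates along ultrafilters then satisfy a rigid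
difference equation, which forces f' → 0 (`IsLineFunction.tendsto_deriv_zero`). If f does not tend
to 0, sending one point to infinity gives a nonzero constant times the equation with one point less.
If f tends to 0 but its odd primitive F does not, integrating over one point has the same effect. If
both decay, which entails that f̂(0) = 2 lim F(T) is 0 and hence that n is even, integrating over
all points yields ∑ₖ ∏_{l ≠ k} F(yₖ − y_l) = 0. On a lattice εℤ this relation descends by two points
at a time (`DiffSolution.descend`), from the odd number n + 1 to three, where it says that 1/F is
additive. Hence F = −β/x and f = β/x².

Descent in the periodic case. Here f is replaced by a function φ that is even and periodic in a
strip, and points are moved into the strip, where period integrals converge. If ∫φ, which is a₀, is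
nonzero, integrating over one point removes it. If a₀ = 0, then n is even, and integrating over two
points with fixed difference v removes both as soon as K(v) = ∫φ(w + v)φ(w) dw is nonzero for some
v. If K vanishes identically, a computation of Fourier coefficients shows that φ is β/(4 sin²(z/2))
plus a trigonometric polynomial. The growth as Im z → ∞ excludes a nonzero polynomial, and what
remains is a trigonometric ℘ function up to a constant. -/

namespace PoincareFE

/-! ### The functional equation and the effect of adding points -/

section Basic

variable {𝕂 : Type*} [NontriviallyNormedField 𝕂] [NormedAlgebra 𝕂 ℂ]
  {ι : Type*} [Fintype ι] [DecidableEq ι]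

/-- The product `∏_{j ≠ i} p (t - x_j)`. -/
noncomputable def partialProd (p : 𝕂 → ℂ) (x : ι → 𝕂) (i : ι) (t : 𝕂) : ℂ :=
  ∏ j ∈ Finset.univ.erase i, p (t - x j)

/-- The product `∏_j p (t - x_j)`. -/
noncomputable def fullProd (p : 𝕂 → ℂ) (x : ι → 𝕂) (t : 𝕂) : ℂ := ∏ j, p (t - x j)

/-- The left hand side `∑_i ∂/∂x_i ∏_{j ≠ i} p (x_i - x_j)` of the functional equation. -/
noncomputable def divSum (p : 𝕂 → ℂ) (x : ι → 𝕂) : ℂ := ∑ i, deriv (partialProd p x i) (x i)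

/-- The functional equation for points indexed by `ι` whose differences avoid `S`. -/
def IsSolution (ι : Type*) [Fintype ι] [DecidableEq ι] (p : 𝕂 → ℂ) (S : Set 𝕂) : Prop :=
  ∀ x : ι → 𝕂, (∀ i j, i ≠ j → x i - x j ∉ S) → divSum p x = 0

/-- The configuration `x` with one further point `w`. -/
def addPoint (w : 𝕂) (x : ι → 𝕂) : Option ι → 𝕂 := fun o => o.elim w x

@[simp] lemma addPoint_none (w : 𝕂) (x : ι → 𝕂) : addPoint w x none = w := rfl

@[simp] lemma addPoint_some (w : 𝕂) (x : ι → 𝕂) (i : ι) : addPoint w x (some i) = x i := rfl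

lemma prod_erase_none {M : Type*} [CommMonoid M] (F : Option ι → M) :
    ∏ j ∈ Finset.univ.erase (none : Option ι), F j = ∏ i, F (some i) := by
  have : Finset.univ.erase (none : Option ι) = Finset.univ.map Function.Embedding.some := by
    ext o; cases o <;> simp
  rw [this, Finset.prod_map]; rfl

lemma prod_erase_some {M : Type*} [CommMonoid M] (F : Option ι → M) (i : ι) :
    ∏ j ∈ Finset.univ.erase (some i), F j
      = F none * ∏ j ∈ Finset.univ.erase i, F (some j) := by
  have : Finset.univ.erase (some i)
      = insert none ((Finset.univ.erase i).map Function.Embedding.some) := by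
    ext o; cases o <;> simp
  rw [this, Finset.prod_insert (by simp), Finset.prod_map]; rfl

lemma partialProd_addPoint_none (p : 𝕂 → ℂ) (w : 𝕂) (x : ι → 𝕂) :
    partialProd p (addPoint w x) none = fullProd p x := by
  ext t; simp [partialProd, fullProd, prod_erase_none]

lemma partialProd_addPoint_some (p : 𝕂 → ℂ) (w : 𝕂) (x : ι → 𝕂) (i : ι) :
    partialProd p (addPoint w x) (some i) = fun t => p (t - w) * partialProd p x i t := by
  ext t; simp [partialProd, prod_erase_some]

lemma fullProd_addPoint (p : 𝕂 → ℂ) (w : 𝕂) (x : ι → 𝕂) :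
    fullProd p (addPoint w x) = fun t => p (t - w) * fullProd p x t := by
  ext t; simp [fullProd, Fintype.prod_option]

lemma fullProd_eq_mul_partialProd (p : 𝕂 → ℂ) (x : ι → 𝕂) (i : ι) (t : 𝕂) :
    fullProd p x t = p (t - x i) * partialProd p x i t := by
  exact (Finset.mul_prod_erase _ (fun j => p (t - x j)) (Finset.mem_univ i)).symm

lemma addPoint_sub_notMem {S : Set 𝕂} (hS : ∀ u ∈ S, -u ∈ S) {w : 𝕂} {x : ι → 𝕂}
    (hw : ∀ i, w - x i ∉ S) (hx : ∀ i j, i ≠ j → x i - x j ∉ S) :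
    ∀ i j, i ≠ j → addPoint w x i - addPoint w x j ∉ S := by
  rintro (_ | i) (_ | j) h
  · exact absurd rfl h
  · exact hw j
  · intro h'
    exact hw i (by simpa using hS _ h')
  · exact hx i j (by simpa using h)

lemma differentiableAt_comp_sub {p : 𝕂 → ℂ} {t a : 𝕂} (h : DifferentiableAt 𝕂 p (t - a)) :
    DifferentiableAt 𝕂 (fun s => p (s - a)) t :=
  h.comp t (differentiableAt_id.sub_const a)

lemma deriv_fun_comp_sub (p : 𝕂 → ℂ) (t a : 𝕂) :
    deriv (fun s => p (s - a)) t = deriv p (t - a) := deriv_comp_sub_const p a t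

lemma differentiableAt_partialProd {p : 𝕂 → ℂ} {x : ι → 𝕂} {i : ι} {t : 𝕂}
    (h : ∀ j, j ≠ i → DifferentiableAt 𝕂 p (t - x j)) :
    DifferentiableAt 𝕂 (partialProd p x i) t := by
  unfold partialProd
  exact DifferentiableAt.fun_finsetProd fun j hj =>
    differentiableAt_comp_sub (h j (Finset.ne_of_mem_erase hj))

lemma differentiableAt_fullProd {p : 𝕂 → ℂ} {x : ι → 𝕂} {t : 𝕂}
    (h : ∀ j, DifferentiableAt 𝕂 p (t - x j)) : DifferentiableAt 𝕂 (fullProd p x) t := by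
  unfold fullProd
  exact DifferentiableAt.fun_finsetProd fun j _ => differentiableAt_comp_sub (h j)

lemma deriv_fullProd {p : 𝕂 → ℂ} {x : ι → 𝕂} {t : 𝕂}
    (h : ∀ j, DifferentiableAt 𝕂 p (t - x j)) :
    deriv (fullProd p x) t = ∑ i, deriv p (t - x i) * partialProd p x i t := by
  have := HasDerivAt.fun_finsetProd (u := Finset.univ) (f := fun j s => p (s - x j))
    (f' := fun j => deriv p (t - x j)) (x := t)
    (fun j _ => by
      have := (differentiableAt_comp_sub (h j)).hasDerivAt
      rwa [deriv_fun_comp_sub] at this)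
  unfold fullProd
  rw [this.deriv]
  exact Finset.sum_congr rfl fun i _ => by simp [partialProd, mul_comm]

/-- The left hand side of the functional equation after adding one point. -/
lemma divSum_addPoint {p : 𝕂 → ℂ} {w : 𝕂} {x : ι → 𝕂}
    (hw : ∀ i, DifferentiableAt 𝕂 p (x i - w))
    (hx : ∀ i j, i ≠ j → DifferentiableAt 𝕂 p (x i - x j)) :
    divSum p (addPoint w x) = deriv (fullProd p x) w +
      ∑ i, (deriv p (x i - w) * partialProd p x i (x i)
        + p (x i - w) * deriv (partialProd p x i) (x i)) := by
  rw [divSum, Fintype.sum_option, partialProd_addPoint_none]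
  congr 1
  refine Finset.sum_congr rfl fun i _ => ?_
  rw [partialProd_addPoint_some, addPoint_some]
  rw [deriv_fun_mul (differentiableAt_comp_sub (hw i))
    (differentiableAt_partialProd fun j hj => hx i j hj.symm), deriv_fun_comp_sub]

lemma deriv_neg_of_even {p : 𝕂 → ℂ} (he : ∀ u, p (-u) = p u) (u : 𝕂) :
    deriv p (-u) = -deriv p u := by
  have h := deriv_comp_neg p u
  simp only [he] at h
  rw [h, neg_neg]

/-- The left hand side of the functional equation after adding two points. -/
lemma divSum_addPoint_addPoint {p : 𝕂 → ℂ} (he : ∀ u, p (-u) = p u) {a b : 𝕂} {x : ι → 𝕂}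
    (hab : DifferentiableAt 𝕂 p (a - b))
    (ha : ∀ i, DifferentiableAt 𝕂 p (a - x i)) (hb : ∀ i, DifferentiableAt 𝕂 p (b - x i))
    (hx : ∀ i j, i ≠ j → DifferentiableAt 𝕂 p (x i - x j)) :
    divSum p (addPoint a (addPoint b x)) =
      deriv p (a - b) * (fullProd p x a - fullProd p x b) +
      p (a - b) * (deriv (fullProd p x) a + deriv (fullProd p x) b) +
      ∑ i, (p (a - x i) * p (b - x i) * deriv (partialProd p x i) (x i) -
        (deriv p (a - x i) * p (b - x i) + p (a - x i) * deriv p (b - x i))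
          * partialProd p x i (x i)) := by
  have hneg : ∀ u, DifferentiableAt 𝕂 p u → DifferentiableAt 𝕂 p (-u) := fun u hu => by
    have : DifferentiableAt 𝕂 (fun v => p (-v)) (-u) :=
      DifferentiableAt.comp (-u) (by simpa using hu) differentiableAt_id.neg
    simpa [he] using this
  have ha' : ∀ i, DifferentiableAt 𝕂 p (x i - a) := fun i => by simpa using hneg _ (ha i)
  have hb' : ∀ i, DifferentiableAt 𝕂 p (x i - b) := fun i => by simpa using hneg _ (hb i)
  have hba : DifferentiableAt 𝕂 p (b - a) := by simpa using hneg _ hab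
  rw [divSum_addPoint, Fintype.sum_option]
  · have e1 : deriv p (b - a) = - deriv p (a - b) := by
      rw [← deriv_neg_of_even he]; congr 1; ring
    have e2 : p (b - a) = p (a - b) := by rw [← he]; congr 1; ring
    rw [fullProd_addPoint, partialProd_addPoint_none,
      deriv_fun_mul (differentiableAt_comp_sub hab) (differentiableAt_fullProd ha),
      deriv_fun_comp_sub]
    simp only [addPoint_none, addPoint_some, e1, e2]
    have e3 : ∀ i, deriv p (x i - a) * partialProd p (addPoint b x) (some i) (x i) +
        p (x i - a) * deriv (partialProd p (addPoint b x) (some i)) (x i) =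
        p (a - x i) * p (b - x i) * deriv (partialProd p x i) (x i) -
        (deriv p (a - x i) * p (b - x i) + p (a - x i) * deriv p (b - x i))
          * partialProd p x i (x i) := by
      intro i
      rw [partialProd_addPoint_some, deriv_fun_mul (differentiableAt_comp_sub (hb' i))
        (differentiableAt_partialProd fun j hj => hx i j hj.symm), deriv_fun_comp_sub]
      have h1 : deriv p (x i - a) = - deriv p (a - x i) := by
        rw [← deriv_neg_of_even he]; congr 1; ring
      have h2 : p (x i - a) = p (a - x i) := by rw [← he]; congr 1; ring
      have h3 : deriv p (x i - b) = - deriv p (b - x i) := by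
        rw [← deriv_neg_of_even he]; congr 1; ring
      have h4 : p (x i - b) = p (b - x i) := by rw [← he]; congr 1; ring
      simp only [h1, h2, h3, h4]; ring
    rw [Finset.sum_congr rfl fun i _ => e3 i]
    ring
  · rintro (_ | i)
    · exact hba
    · exact ha' i
  · rintro (_ | i) (_ | j) h
    · exact absurd rfl h
    · exact hb j
    · exact hb' i
    · exact hx i j (by simpa using h)

lemma divSum_comp_equiv {κ : Type*} [Fintype κ] [DecidableEq κ] (e : ι ≃ κ) (p : 𝕂 → ℂ)
    (x : κ → 𝕂) : divSum p (x ∘ e) = divSum p x := by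
  unfold divSum
  refine Fintype.sum_equiv e _ _ fun i => ?_
  have : partialProd p (x ∘ e) i = partialProd p x (e i) := by
    ext t
    unfold partialProd
    refine Finset.prod_equiv e (by simp) (by simp)
  rw [this]; rfl

/-- Only the number of points matters. Index types can therefore be exchanged at will, with `Option`
serving whenever a point is to be singled out. -/
lemma IsSolution.of_card_eq {κ : Type*} [Fintype κ] [DecidableEq κ] {p : 𝕂 → ℂ} {S : Set 𝕂}
    (h : IsSolution ι p S) (hc : Fintype.card ι = Fintype.card κ) : IsSolution κ p S := by
  intro x hx
  obtain ⟨e⟩ := Fintype.card_eq.1 hc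
  rw [← divSum_comp_equiv e]
  exact h _ fun i j hij => hx _ _ (e.injective.ne hij)

end Basic

lemma solvesEquation_iff {n : ℕ} {f : ℂ → ℂ} : SolvesEquation n f ↔
    IsSolution (Fin (n + 1)) (fun x : ℝ => f x) {x : ℝ | ¬ AnalyticAt ℂ f x} := by
  simp only [SolvesEquation, IsSolution, Set.mem_ofPred_eq, not_not]
  rfl

/-! ### Coalescing points: cancellation of the poles -/

section Taylor

variable {𝕂 : Type*} [NontriviallyNormedField 𝕂] [NormedAlgebra 𝕂 ℂ]

/-- The difference quotient of an analytic function is analytic. The field is left general because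
coalescence is needed both over ℂ, for Liouville's theorem, and over ℝ, for the differential
equation. -/
lemma exists_eq_add_mul {R : 𝕂 → ℂ} {y : 𝕂} (hR : AnalyticAt 𝕂 R y) :
    ∃ K : 𝕂 → ℂ, AnalyticAt 𝕂 K 0 ∧
      ∀ u, R (y + u) = R y + algebraMap 𝕂 ℂ u * K u := by
  have hS : AnalyticAt 𝕂 (fun u => R (y + u)) 0 := by
    have : AnalyticAt 𝕂 (fun u : 𝕂 => y + u) 0 := by fun_prop
    exact AnalyticAt.fun_comp (by simpa using hR) this
  obtain ⟨q, hq⟩ := hS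
  refine ⟨dslope (fun u => R (y + u)) 0, ⟨_, hq.has_fpower_series_dslope_fslope⟩, fun u => ?_⟩
  have := sub_smul_dslope (fun u => R (y + u)) 0 u
  simp only [sub_zero, add_zero] at this
  rw [← Algebra.smul_def, this]; ring

lemma exists_cubic_taylor {R : 𝕂 → ℂ} {y : 𝕂} (hR : AnalyticAt 𝕂 R y) :
    ∃ (c₁ c₂ : ℂ) (K : 𝕂 → ℂ), AnalyticAt 𝕂 K 0 ∧ ∀ u, R (y + u) = R y + algebraMap 𝕂 ℂ u * c₁ +
      algebraMap 𝕂 ℂ u ^ 2 * c₂ + algebraMap 𝕂 ℂ u ^ 3 * K u := by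
  obtain ⟨K₁, h₁, e₁⟩ := exists_eq_add_mul hR
  obtain ⟨K₂, h₂, e₂⟩ := exists_eq_add_mul h₁
  obtain ⟨K₃, h₃, e₃⟩ := exists_eq_add_mul h₂
  refine ⟨K₁ 0, K₂ 0, K₃, h₃, fun u => ?_⟩
  have e₂' := e₂ u
  have e₃' := e₃ u
  rw [zero_add] at e₂' e₃'
  rw [e₁, e₂', e₃']; ring

lemma hasDerivAt_algebraMap (u : 𝕂) : HasDerivAt (fun v : 𝕂 => algebraMap 𝕂 ℂ v) 1 u := by
  have := (hasDerivAt_id u).smul_const (1 : ℂ)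
  simpa [Algebra.smul_def] using this

lemma HasDerivAt.taylor {c₀ c₁ c₂ : ℂ} {K : 𝕂 → ℂ} {K' : ℂ} {u : 𝕂} (h : HasDerivAt K K' u) :
    HasDerivAt (fun u => c₀ + algebraMap 𝕂 ℂ u * c₁ +
      algebraMap 𝕂 ℂ u ^ 2 * c₂ + algebraMap 𝕂 ℂ u ^ 3 * K u)
      (c₁ + 2 * algebraMap 𝕂 ℂ u * c₂ + 3 * algebraMap 𝕂 ℂ u ^ 2 * K u
        + algebraMap 𝕂 ℂ u ^ 3 * K') u := by
  have ha := hasDerivAt_algebraMap (𝕂 := 𝕂) u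
  refine ((((hasDerivAt_const u c₀).add (ha.mul_const c₁)).add ((ha.pow 2).mul_const c₂)).add
    ((ha.pow 3).mul h)).congr_deriv ?_
  simp only [Pi.pow_apply]
  push_cast
  ring

lemma deriv_comp_const_add' (R : 𝕂 → ℂ) (y : 𝕂) :
    deriv (fun u => R (y + u)) = fun u => deriv R (y + u) := by
  ext u; exact deriv_comp_const_add R y u

lemma tendsto_algebraMap_zero : Tendsto (algebraMap 𝕂 ℂ) (𝓝 0) (𝓝 0) := by
  have := (continuous_algebraMap 𝕂 ℂ).tendsto 0
  simpa using this

/-- The poles of two terms of the functional equation cancel when two points coalesce. -/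
lemma tendsto_coalescence [CompleteSpace 𝕂] {φ g : 𝕂 → ℂ} {β : ℂ} (hg : AnalyticAt 𝕂 g 0)
    (hφ : ∀ᶠ u in 𝓝[≠] (0 : 𝕂), φ u = β / algebraMap 𝕂 ℂ u ^ 2 + g u)
    {R : 𝕂 → ℂ} {y : 𝕂} (hR : AnalyticAt 𝕂 R y) :
    Tendsto (fun u => deriv φ u * (R (y + u) - R y) + φ u * (deriv R (y + u) + deriv R y))
      (𝓝[≠] 0) (𝓝 (β * (deriv (deriv (deriv R)) y / 6) + 2 * g 0 * deriv R y)) := by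
  -- Write R(y + u) = R(y) + c₁u + c₂u² + K(u)u³. The terms in c₁/u² and c₂/u cancel between −2β/u³
  -- · (R(y + u) − R(y)) and β/u² · (R'(y + u) + R'(y)), and the cubic terms leave (3 − 2)βK(0) =
  -- βR'''(y)/6.
  obtain ⟨c₁, c₂, K, hK, e⟩ := exists_cubic_taylor hR
  set A := algebraMap 𝕂 ℂ with hA
  have hKd : ∀ᶠ u in 𝓝 (0 : 𝕂), HasDerivAt K (deriv K u) u :=
    hK.eventually_analyticAt.mono fun u hu => hu.differentiableAt.hasDerivAt
  have d1 : ∀ᶠ u in 𝓝 (0 : 𝕂), deriv R (y + u)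
      = c₁ + 2 * A u * c₂ + 3 * A u ^ 2 * K u + A u ^ 3 * deriv K u := by
    filter_upwards [hKd] with u hu
    have h1 := (HasDerivAt.taylor (c₀ := R y) (c₁ := c₁) (c₂ := c₂) hu).deriv
    have h2 : (fun u => R (y + u)) = _ := funext e
    rw [← h2, deriv_comp_const_add'] at h1
    exact h1
  -- R' is brought into the form of a cubic expansion again, by splitting K(0) off K, so that
  -- `HasDerivAt.taylor` can be used a second time and R'''(y) is found to be 6K(0).
  have d1' : (fun u => deriv R (y + u)) =ᶠ[𝓝 0] fun u =>
      c₁ + A u * (2 * c₂) + A u ^ 2 * (3 * K 0) + A u ^ 3 *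
        (3 * dslope K 0 u + deriv K u) := by
    filter_upwards [d1] with u hu
    rw [hu]
    have := sub_smul_dslope K 0 u
    rw [sub_zero, Algebra.smul_def] at this
    have e : K u = K 0 + A u * dslope K 0 u := by rw [this]; ring
    rw [e]; ring
  have hD : AnalyticAt 𝕂 (fun u => 3 * dslope K 0 u + deriv K u) 0 := by
    obtain ⟨q, hq⟩ := id hK
    exact (analyticAt_const.mul ⟨_, hq.has_fpower_series_dslope_fslope⟩).add hK.deriv
  set D := fun u => 3 * dslope K 0 u + deriv K u with hDdef
  have d2 : (fun u => deriv (deriv R) (y + u)) =ᶠ[𝓝 0] fun u =>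
      2 * c₂ + A u * (2 * (3 * K 0)) + A u ^ 2 * (3 * D u) + A u ^ 3 * deriv D u := by
    have := d1'.deriv
    rw [deriv_comp_const_add'] at this
    refine this.trans ?_
    filter_upwards [hD.eventually_analyticAt] with u hu
    rw [(HasDerivAt.taylor hu.differentiableAt.hasDerivAt).deriv]; ring
  have d3 : deriv (deriv (deriv R)) y = 6 * K 0 := by
    have h := d2.deriv_eq
    rw [deriv_comp_const_add'] at h
    simp only [add_zero] at h
    rw [h]
    have ha := hasDerivAt_algebraMap (𝕂 := 𝕂) 0
    have h1 := hD.differentiableAt.hasDerivAt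
    have h2 := hD.deriv.differentiableAt.hasDerivAt
    refine HasDerivAt.deriv ?_
    refine ((((hasDerivAt_const (0 : 𝕂) (2 * c₂)).add (ha.mul_const _)).add
      ((ha.pow 2).mul (h1.const_mul 3))).add ((ha.pow 3).mul h2)).congr_deriv ?_
    simp only [Pi.pow_apply, map_zero]
    ring
  have d1y : deriv R y = c₁ := by
    have := d1.self_of_nhds
    simpa [hA] using this
  have hφ' : ∀ᶠ u in 𝓝[≠] (0 : 𝕂), deriv φ u = -2 * β / A u ^ 3 + deriv g u := by
    have h1 : ∀ᶠ u in 𝓝[≠] (0 : 𝕂), φ =ᶠ[𝓝 u] fun u => β / A u ^ 2 + g u := by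
      have := eventually_eventually_nhdsWithin.2 hφ
      filter_upwards [this, self_mem_nhdsWithin] with u hu hu0
      rwa [isOpen_compl_singleton.nhdsWithin_eq hu0] at hu
    have h2 : ∀ᶠ u in 𝓝[≠] (0 : 𝕂), AnalyticAt 𝕂 g u :=
      hg.eventually_analyticAt.filter_mono nhdsWithin_le_nhds
    filter_upwards [h1, h2, self_mem_nhdsWithin] with u hu hgu hu0
    have hu0' : A u ≠ 0 := by simpa [hA] using hu0
    rw [hu.deriv_eq]
    refine HasDerivAt.deriv ?_
    have ha : HasDerivAt A 1 u := hasDerivAt_algebraMap (𝕂 := 𝕂) u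
    refine (((hasDerivAt_const u β).div (ha.pow 2) (by simpa using hu0')).add
      hgu.differentiableAt.hasDerivAt).congr_deriv ?_
    simp only [Pi.pow_apply]
    field_simp
    ring
  have hev : ∀ᶠ u in 𝓝[≠] (0 : 𝕂), β * (K u + A u * deriv K u) + deriv g u * (R (y + u) - R y) +
      g u * (deriv R (y + u) + deriv R y) =
      deriv φ u * (R (y + u) - R y) + φ u * (deriv R (y + u) + deriv R y) := by
    filter_upwards [hφ', hφ, d1.filter_mono nhdsWithin_le_nhds, self_mem_nhdsWithin]
      with u h1 h2 h3 hu0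
    have hu0' : A u ≠ 0 := by simpa [hA] using hu0
    rw [h1, h2, h3, e u, d1y]
    field_simp
    ring
  refine Tendsto.congr' hev ?_
  rw [d3]
  have hA0 : Tendsto A (𝓝 0) (𝓝 0) := tendsto_algebraMap_zero
  have t1 : Tendsto (fun u => R (y + u)) (𝓝 0) (𝓝 (R y)) := by
    have : ContinuousAt (fun u => R (y + u)) 0 :=
      ContinuousAt.comp (g := R) (f := fun u => y + u)
        (by simpa using hR.continuousAt) (by fun_prop)
    simpa using this.tendsto
  have t2 : Tendsto (fun u => deriv R (y + u)) (𝓝 0) (𝓝 (deriv R y)) := by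
    have : ContinuousAt (fun u => deriv R (y + u)) 0 :=
      ContinuousAt.comp (g := deriv R) (f := fun u => y + u)
        (by simpa using hR.deriv.continuousAt) (by fun_prop)
    simpa using this.tendsto
  have t3 := hK.continuousAt.tendsto
  have t4 := hK.deriv.continuousAt.tendsto
  have t5 := hg.continuousAt.tendsto
  have t6 := hg.deriv.continuousAt.tendsto
  have t := (((t3.add (hA0.mul t4)).const_mul β).add (t6.mul (t1.sub_const (R y)))).add
    (t5.mul (t2.add_const (deriv R y)))
  convert t.mono_left nhdsWithin_le_nhds using 2
  ring

end Taylor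

/-! ### Sufficiency: periodic functions bounded away from their poles -/

/-- Liouville's theorem for functions with removable singularities. -/
lemma exists_const_of_bounded_of_isolated {G : Set ℂ} {T : ℂ → ℂ} {M : ℝ}
    (hG : ∀ d, ∀ᶠ t in 𝓝[≠] d, t ∈ G) (hd : ∀ t ∈ G, DifferentiableAt ℂ T t)
    (hM : ∀ t ∈ G, ‖T t‖ ≤ M) : ∃ c, ∀ t ∈ G, T t = c := by
  -- The limit fills the removable singularities; on G it is the value of T by continuity.
  set U : ℂ → ℂ := fun t => limUnder (𝓝[≠] t) T with hU
  have hUG : ∀ t ∈ G, U t = T t := fun t ht =>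
    ((hd t ht).continuousAt.tendsto.mono_left nhdsWithin_le_nhds).limUnder_eq
  have hlim : ∀ d, ∃ s ∈ 𝓝 d, s \ {d} ⊆ G := by
    intro d
    have := hG d
    rw [eventually_nhdsWithin_iff] at this
    exact ⟨_, this, fun t ht => ht.1 ht.2⟩
  have hdiff : Differentiable ℂ U := by
    intro d
    obtain ⟨s, hs, hsG⟩ := hlim d
    have h1 := Complex.differentiableOn_update_limUnder_of_bddAbove (f := T) hs
      (fun t ht => (hd t (hsG ht)).differentiableWithinAt)
      ⟨M, by rintro _ ⟨t, ht, rfl⟩; exact hM t (hsG ht)⟩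
    refine (h1.differentiableAt hs).congr_of_eventuallyEq ?_
    filter_upwards [hs] with t ht
    rcases eq_or_ne t d with rfl | hne
    · simp [hU]
    · rw [Function.update_of_ne hne, hUG t (hsG ⟨ht, hne⟩)]
  have hbd : ∀ t, ‖U t‖ ≤ M := by
    intro t
    have h2 : Tendsto U (𝓝[≠] t) (𝓝 (U t)) :=
      (hdiff t).continuousAt.tendsto.mono_left nhdsWithin_le_nhds
    refine le_of_tendsto h2.norm ?_
    filter_upwards [hG t] with s hs
    rw [hUG s hs]; exact hM s hs
  refine ⟨U 0, fun t ht => ?_⟩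
  rw [← hUG t ht]
  refine hdiff.apply_eq_apply_of_bounded ?_ t 0
  exact (Metric.isBounded_closedBall (x := (0 : ℂ)) (r := M)).subset (by
    rintro _ ⟨t, rfl⟩; simpa using hbd t)

/-- An even function with period group `Λ` and double poles without residue at the periods
only, bounded away from the periods. -/
structure IsDoublePeriodic (φ : ℂ → ℂ) (Λ : AddSubgroup ℂ) : Prop where
  even : ∀ z, φ (-z) = φ z
  periodic : ∀ l ∈ Λ, ∀ z, φ (z + l) = φ z
  analytic : ∀ z ∉ Λ, AnalyticAt ℂ φ z
  pole : ∃ (β : ℂ) (g : ℂ → ℂ), AnalyticAt ℂ g 0 ∧ ∀ᶠ u in 𝓝[≠] (0 : ℂ), φ u = β / u ^ 2 + g u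
  bounded : ∀ ε : ℝ, 0 < ε → ∃ C : ℝ, ∀ z, (∀ l ∈ Λ, ε ≤ ‖z - l‖) → ‖φ z‖ ≤ C
  closed : IsClosed (Λ : Set ℂ)
  countable : (Λ : Set ℂ).Countable
  discrete : ∀ᶠ z in 𝓝[≠] (0 : ℂ), z ∉ Λ

namespace IsDoublePeriodic

variable {φ : ℂ → ℂ} {Λ : AddSubgroup ℂ} (h : IsDoublePeriodic φ Λ)
include h

lemma deriv_periodic {l : ℂ} (hl : l ∈ Λ) (z : ℂ) : deriv φ (z + l) = deriv φ z := by
  have h1 : (fun z => φ (z + l)) = φ := funext (h.periodic l hl)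
  conv_rhs => rw [← h1]
  rw [deriv_comp_add_const]

lemma eventually_sub_notMem (a d : ℂ) : ∀ᶠ t in 𝓝[≠] d, t - a ∉ Λ := by
  by_cases hd : d - a ∈ Λ
  · have ht : Tendsto (fun t : ℂ => t - d) (𝓝[≠] d) (𝓝[≠] 0) := by
      refine tendsto_nhdsWithin_iff.2 ⟨?_, ?_⟩
      · have : ContinuousAt (fun t : ℂ => t - d) d := by fun_prop
        simpa using this.tendsto.mono_left nhdsWithin_le_nhds
      · filter_upwards [self_mem_nhdsWithin] with t ht
        simpa [sub_eq_zero] using ht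
    filter_upwards [ht.eventually h.discrete] with t ht hta
    exact ht (by simpa using Λ.sub_mem hta hd)
  · have : ∀ᶠ t in 𝓝 d, t - a ∈ (Λ : Set ℂ)ᶜ := by
      have hc : ContinuousAt (fun t : ℂ => t - a) d := by fun_prop
      exact hc.eventually (h.closed.isOpen_compl.mem_nhds hd)
    exact this.filter_mono nhdsWithin_le_nhds

/-- Cauchy's estimate on discs of radius ε/2, which stay at distance at least ε/2 from the periods.
-/
lemma bounded_deriv (ε : ℝ) (hε : 0 < ε) :
    ∃ C : ℝ, 0 ≤ C ∧ ∀ z, (∀ l ∈ Λ, ε ≤ ‖z - l‖) → ‖φ z‖ ≤ C ∧ ‖deriv φ z‖ ≤ C := by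
  obtain ⟨C₁, h₁⟩ := h.bounded (ε / 2) (by positivity)
  refine ⟨max (|C₁|) (|C₁| / (ε / 2)), by positivity, fun z hz => ?_⟩
  have hb : ∀ w ∈ Metric.closedBall z (ε / 2), (∀ l ∈ Λ, ε / 2 ≤ ‖w - l‖) := by
    intro w hw l hl
    have h2 := hz l hl
    have h3 : ‖w - z‖ ≤ ε / 2 := by simpa [dist_eq_norm] using hw
    have h4 : ‖z - l‖ ≤ ‖w - z‖ + ‖w - l‖ := by
      have := norm_sub_le (w - l) (w - z)
      rw [show (w - l) - (w - z) = z - l by ring] at this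
      linarith
    linarith
  have hw : ∀ w ∈ Metric.closedBall z (ε / 2), w ∉ Λ := by
    intro w hw hmem
    have := hb w hw w hmem
    simp at this
    linarith
  refine ⟨(h₁ z (hb z (by simp; positivity))).trans (le_max_of_le_left (le_abs_self _)), ?_⟩
  refine le_max_of_le_right ?_
  refine Complex.norm_deriv_le_of_forall_mem_sphere_norm_le (by positivity) ?_ fun w hw' => ?_
  · refine DifferentiableOn.diffContOnCl_ball (U := Metric.closedBall z (ε / 2)) ?_ subset_rfl
    exact fun w hw' => (h.analytic w (hw w hw')).differentiableAt.differentiableWithinAt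
  · exact (h₁ w (hb w (Metric.sphere_subset_closedBall hw'))).trans (le_abs_self _)

variable {ι : Type*} [Fintype ι] [DecidableEq ι]

lemma analyticAt_comp_sub {t a : ℂ} (ht : t - a ∉ Λ) : AnalyticAt ℂ (fun s => φ (s - a)) t :=
  AnalyticAt.fun_comp (h.analytic _ ht) (by fun_prop)

lemma analyticAt_partialProd {x : ι → ℂ} {i : ι} {t : ℂ} (ht : ∀ j, j ≠ i → t - x j ∉ Λ) :
    AnalyticAt ℂ (partialProd φ x i) t := by
  unfold partialProd
  exact Finset.analyticAt_fun_prod _ fun j hj => h.analyticAt_comp_sub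
    (ht j (Finset.ne_of_mem_erase hj))

lemma analyticAt_fullProd {x : ι → ℂ} {t : ℂ} (ht : ∀ j, t - x j ∉ Λ) :
    AnalyticAt ℂ (fullProd φ x) t := by
  unfold fullProd
  exact Finset.analyticAt_fun_prod _ fun j _ => h.analyticAt_comp_sub (ht j)

/-- In the new point t the sum is periodic. It is bounded at positive distance from all x i + Λ,
since φ and φ' are bounded away from Λ, and it is bounded near each x k, since the two terms
singular there cancel as in `tendsto_coalescence`. By periodicity the latter bound holds near all of
x k + Λ, and Liouville's theorem applies. No compact fundamental domain is needed, so the degenerate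
cases are covered too. -/
lemma exists_divSum_addPoint_eq_const (x : ι → ℂ) (hx : ∀ i j, i ≠ j → x i - x j ∉ Λ) :
    ∃ c, ∀ t, (∀ i, t - x i ∉ Λ) → divSum φ (addPoint t x) = c := by
  set P : ι → ℂ := fun i => partialProd φ x i (x i) with hP
  set P' : ι → ℂ := fun i => deriv (partialProd φ x i) (x i) with hP'
  set T : ℂ → ℂ := fun t => deriv (fullProd φ x) t +
    ∑ i, (deriv φ (x i - t) * P i + φ (x i - t) * P' i) with hT
  have hneg : ∀ {a b : ℂ}, a - b ∉ Λ → b - a ∉ Λ := fun {a b} hab hba =>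
    hab (by simpa using Λ.neg_mem hba)
  have hST : ∀ t, (∀ i, t - x i ∉ Λ) → divSum φ (addPoint t x) = T t := fun t ht =>
    divSum_addPoint (fun i => (h.analytic _ (hneg (ht i))).differentiableAt)
      (fun i j hij => (h.analytic _ (hx i j hij)).differentiableAt)
  have hG : ∀ d, ∀ᶠ t in 𝓝[≠] d, t ∈ {t : ℂ | ∀ i, t - x i ∉ Λ} := fun d =>
    eventually_all.2 fun i => h.eventually_sub_notMem (x i) d
  have hterm : ∀ i t, x i - t ∉ Λ →
      AnalyticAt ℂ (fun t => deriv φ (x i - t) * P i + φ (x i - t) * P' i) t := by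
    intro i t ht
    have e : AnalyticAt ℂ (fun t => x i - t) t := by fun_prop
    exact ((AnalyticAt.fun_comp (h.analytic _ ht).deriv e).mul analyticAt_const).add
      ((AnalyticAt.fun_comp (h.analytic _ ht) e).mul analyticAt_const)
  have hTd : ∀ t ∈ {t : ℂ | ∀ i, t - x i ∉ Λ}, DifferentiableAt ℂ T t := by
    intro t ht
    refine AnalyticAt.differentiableAt ?_
    refine (h.analyticAt_fullProd ht).deriv.add ?_
    exact Finset.analyticAt_fun_sum _ fun i _ => hterm i t (hneg (ht i))
  have hTp : ∀ l ∈ Λ, ∀ t, T (t + l) = T t := by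
    intro l hl t
    have hl' := Λ.neg_mem hl
    have e1 : (fun s => fullProd φ x (s + l)) = fullProd φ x := by
      ext s
      refine Finset.prod_congr rfl fun i _ => ?_
      rw [show s + l - x i = s - x i + l by ring, h.periodic l hl]
    have e2 : deriv (fullProd φ x) (t + l) = deriv (fullProd φ x) t := by
      conv_rhs => rw [← e1]
      rw [deriv_comp_add_const]
    simp only [hT, e2]
    congr 1
    refine Finset.sum_congr rfl fun i _ => ?_
    rw [show x i - (t + l) = x i - t + -l by ring, h.deriv_periodic hl', h.periodic _ hl']
  have hnear : ∀ k, ∃ ε > 0, ∃ C : ℝ, ∀ t, t ≠ x k → ‖t - x k‖ < ε → ‖T t‖ ≤ C := by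
    intro k
    obtain ⟨β, g, hg, hφ⟩ := h.pole
    have hR : AnalyticAt ℂ (partialProd φ x k) (x k) :=
      h.analyticAt_partialProd fun j hj => hx _ _ hj.symm
    have h1 := tendsto_coalescence (𝕂 := ℂ) (β := β) hg (by simpa using hφ) hR
    have h2 : Tendsto (fun u => ∑ i ∈ Finset.univ.erase k,
        (deriv φ (x i - (x k + u)) * P i + φ (x i - (x k + u)) * P' i)) (𝓝[≠] 0)
        (𝓝 (∑ i ∈ Finset.univ.erase k, (deriv φ (x i - x k) * P i + φ (x i - x k) * P' i))) := by
      refine (tendsto_finsetSum _ fun i hi => ?_)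
      have hc := (hterm i (x k) (hx _ _ (Finset.ne_of_mem_erase hi))).continuousAt
      have hc2 : ContinuousAt (fun u : ℂ => x k + u) 0 := by fun_prop
      have := ContinuousAt.comp (f := fun u : ℂ => x k + u) (x := 0) (by simpa using hc) hc2
      have := this.tendsto.mono_left (nhdsWithin_le_nhds (s := {0}ᶜ))
      simpa [Function.comp_def] using this
    have h3 := (h1.add h2).norm
    obtain ⟨C, hC⟩ := h3.isBoundedUnder_le
    have h4 : ∀ᶠ u in 𝓝[≠] (0 : ℂ), ∀ i, x k + u - x i ∉ Λ := by
      have ht : Tendsto (fun u : ℂ => x k + u) (𝓝[≠] 0) (𝓝[≠] (x k)) := by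
        refine tendsto_nhdsWithin_iff.2 ⟨?_, ?_⟩
        · have : ContinuousAt (fun u : ℂ => x k + u) 0 := by fun_prop
          simpa using this.tendsto.mono_left nhdsWithin_le_nhds
        · filter_upwards [self_mem_nhdsWithin] with t ht
          simpa using ht
      exact ht.eventually (hG (x k))
    have h5 : ∀ᶠ u in 𝓝[≠] (0 : ℂ), ‖T (x k + u)‖ ≤ C := by
      filter_upwards [hC, h4] with u hu hu4
      refine le_of_eq_of_le ?_ hu
      congr 1
      -- The factor singular at x k is split off the full product; its contribution to the
      -- derivative pairs with the summand i = k.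
      have e0 : fullProd φ x = fun t => φ (t - x k) * partialProd φ x k t :=
        funext (fullProd_eq_mul_partialProd φ x k)
      have e1 : deriv (fullProd φ x) (x k + u) = deriv φ u * partialProd φ x k (x k + u) +
          φ u * deriv (partialProd φ x k) (x k + u) := by
        rw [e0, deriv_fun_mul (h.analyticAt_comp_sub (hu4 k)).differentiableAt
          (h.analyticAt_partialProd fun j _ => hu4 j).differentiableAt, deriv_fun_comp_sub]
        simp
      simp only [hT]
      rw [← Finset.add_sum_erase _ _ (Finset.mem_univ k), e1,
        show x k - (x k + u) = -u by ring, deriv_neg_of_even h.even, h.even]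
      simp only [hP, hP']
      ring
    rw [eventually_nhdsWithin_iff, Metric.eventually_nhds_iff] at h5
    obtain ⟨ε, hε, h5⟩ := h5
    refine ⟨ε, hε, C, fun t ht htε => ?_⟩
    have := h5 (y := t - x k) (by simpa using htε) (by simpa [sub_eq_zero] using ht)
    simpa using this
  choose ε hε C hC using hnear
  obtain ⟨ε₀, hε₀, hle⟩ : ∃ ε₀ > 0, ∀ k, ε₀ ≤ ε k := by
    rcases isEmpty_or_nonempty ι with hι | hι
    · exact ⟨1, one_pos, fun k => (hι.false k).elim⟩
    · obtain ⟨k₀, hk₀⟩ := Finite.exists_min ε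
      exact ⟨ε k₀, hε k₀, hk₀⟩
  obtain ⟨B, hB0, hB⟩ := h.bounded_deriv ε₀ hε₀
  have hfar : ∃ M, ∀ t, (∀ i, ∀ l ∈ Λ, ε₀ ≤ ‖t - x i - l‖) → ‖T t‖ ≤ M := by
    refine ⟨∑ i : ι, B * B ^ (Finset.univ.erase i).card
      + ∑ i, (B * ‖P i‖ + B * ‖P' i‖), fun t ht => ?_⟩
    have hgood : ∀ i, t - x i ∉ Λ := by
      intro i hmem
      have := ht i _ hmem
      simp at this
      linarith
    refine (norm_add_le _ _).trans (add_le_add ?_ ?_)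
    · rw [deriv_fullProd fun j => (h.analytic _ (hgood j)).differentiableAt]
      refine (norm_sum_le _ _).trans (Finset.sum_le_sum fun i _ => ?_)
      rw [norm_mul]
      refine mul_le_mul (hB _ (ht i)).2 ?_ (norm_nonneg _) hB0
      unfold partialProd
      rw [norm_prod]
      refine (Finset.prod_le_prod (fun _ _ => norm_nonneg _)
        fun j _ => (hB _ (ht j)).1).trans ?_
      simp
    · refine (norm_sum_le _ _).trans (Finset.sum_le_sum fun i _ => ?_)
      have hi : ∀ l ∈ Λ, ε₀ ≤ ‖x i - t - l‖ := by
        intro l hl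
        have := ht i (-l) (Λ.neg_mem hl)
        rwa [← norm_neg, show -(t - x i - -l) = x i - t - l by ring] at this
      refine (norm_add_le _ _).trans ?_
      rw [norm_mul, norm_mul]
      gcongr
      · exact (hB _ hi).2
      · exact (hB _ hi).1
  obtain ⟨M, hM⟩ := hfar
  obtain ⟨c, hc⟩ := exists_const_of_bounded_of_isolated (M := |M| + ∑ k, |C k|) hG hTd (by
    intro t ht
    by_cases hcase : ∀ i, ∀ l ∈ Λ, ε₀ ≤ ‖t - x i - l‖
    · exact (hM t hcase).trans ((le_abs_self M).trans
        (le_add_of_nonneg_right (Finset.sum_nonneg fun _ _ => abs_nonneg _)))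
    · push Not at hcase
      obtain ⟨k, l, hl, hlt⟩ := hcase
      have h1 := hTp l hl (t - l)
      rw [sub_add_cancel] at h1
      rw [h1]
      refine (hC k (t - l) ?_ ?_).trans ((le_abs_self _).trans ?_)
      · intro he
        exact ht k (by rw [show t - x k = l by rw [← he]; ring]; exact hl)
      · rw [show t - l - x k = t - x k - l by ring]
        exact hlt.trans_le (hle k)
      · refine le_add_of_nonneg_of_le (abs_nonneg _) ?_
        exact Finset.single_le_sum (f := fun k => |C k|) (fun _ _ => abs_nonneg _)
          (Finset.mem_univ k))
  exact ⟨c, fun t ht => (hST t ht).trans (hc t ht)⟩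

lemma divSum_update (x : ι → ℂ) (hx : ∀ i j, i ≠ j → x i - x j ∉ Λ) (k : ι) (t : ℂ)
    (ht : ∀ j, j ≠ k → t - x j ∉ Λ) : divSum φ (Function.update x k t) = divSum φ x := by
  let e : Option {j // j ≠ k} ≃ ι := (Equiv.optionSubtypeNe k)
  have key : ∀ s, (Function.update x k s) ∘ e = addPoint s (fun j : {j // j ≠ k} => x j) := by
    intro s
    ext o
    rcases o with _ | j
    · simp [e]
    · simp [e, j.2]
  obtain ⟨c, hc⟩ := h.exists_divSum_addPoint_eq_const (fun j : {j // j ≠ k} => x j)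
    (fun i j hij => hx _ _ fun he => hij (Subtype.ext he))
  have h1 := hc t fun j => ht j j.2
  have h2 := hc (x k) fun j => hx _ _ j.2.symm
  rw [← key, divSum_comp_equiv] at h1 h2
  rw [h1, ← h2, Function.update_eq_self]

/-- The points are exchanged one at a time. Since the two configurations do not meet modulo Λ, all
the intermediate ones are regular. -/
lemma divSum_eq_of_sub_notMem (x y : ι → ℂ) (hx : ∀ i j, i ≠ j → x i - x j ∉ Λ)
    (hy : ∀ i j, i ≠ j → y i - y j ∉ Λ) (hxy : ∀ i j, y i - x j ∉ Λ) :
    divSum φ y = divSum φ x := by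
  have hyx : ∀ i j, x i - y j ∉ Λ := fun i j hm => hxy j i (by simpa using Λ.neg_mem hm)
  have key : ∀ s : Finset ι, divSum φ (s.piecewise y x) = divSum φ x := by
    intro s
    induction s using Finset.induction_on with
    | empty => simp
    | insert k s hk ih =>
      rw [Finset.piecewise_insert, ← ih]
      refine h.divSum_update _ ?_ k (y k) ?_
      · intro i j hij
        by_cases hi : i ∈ s <;> by_cases hj : j ∈ s <;> simp [hi, hj, hx, hy, hxy, hyx, hij]
      · intro j hj
        by_cases hjs : j ∈ s <;> simp [hjs, hxy, hy k j hj.symm]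
  simpa using key Finset.univ

/-- The reflection x ↦ v − x does not change the value of the sum, by the preceding lemma, and it
reverses its sign, because φ is even. -/
theorem divSum_eq_zero (x : ι → ℂ) (hx : ∀ i j, i ≠ j → x i - x j ∉ Λ) : divSum φ x = 0 := by
  -- The reflected points have to avoid the original ones modulo Λ, which excludes only countably
  -- many v.
  obtain ⟨v, hv⟩ : ∃ v : ℂ, ∀ i j, v - x i - x j ∉ Λ := by
    have hc : (⋃ i, ⋃ j, (fun l => l + x i + x j) '' (Λ : Set ℂ)).Countable :=
      Set.countable_iUnion fun i => Set.countable_iUnion fun j => h.countable.image _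
    obtain ⟨v, hv⟩ := hc.dense_compl ℝ |>.nonempty
    refine ⟨v, fun i j hm => hv ?_⟩
    simp only [Set.mem_iUnion]
    exact ⟨i, j, _, hm, by ring⟩
  have h1 := h.divSum_eq_of_sub_notMem x (fun i => v - x i) hx
    (fun i j hij => by
      rw [show v - x i - (v - x j) = x j - x i by ring]; exact hx _ _ hij.symm) hv
  have h2 : divSum φ (fun i => v - x i) = - divSum φ x := by
    unfold divSum
    rw [← Finset.sum_neg_distrib]
    refine Finset.sum_congr rfl fun i _ => ?_
    have : partialProd φ (fun i => v - x i) i = fun t => partialProd φ x i (v - t) := by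
      ext t
      refine Finset.prod_congr rfl fun j _ => ?_
      rw [← h.even]; congr 1; ring
    rw [this, deriv_comp_const_sub]
    congr 2; ring
  rw [h2] at h1
  have h3 : (2 : ℂ) * divSum φ x = 0 := by linear_combination -h1
  simpa using h3

end IsDoublePeriodic

/-! ### The Weierstrass functions: poles, periods, boundedness, differential equation -/

/-- An even h has no linear term, so that h/u² has no residue. Evenness is only required frequently
near 0, because for the given f it is known on the real axis alone; the identity theorem supplies
the rest. -/
lemma exists_div_sq_eq {h : ℂ → ℂ} (hh : AnalyticAt ℂ h 0)
    (he : ∃ᶠ u in 𝓝[≠] (0 : ℂ), h (-u) = h u) :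
    ∃ g : ℂ → ℂ, AnalyticAt ℂ g 0 ∧ ∀ u, u ≠ 0 → h u / u ^ 2 = h 0 / u ^ 2 + g u := by
  have hneg : AnalyticAt ℂ (fun u => h (-u)) 0 :=
    AnalyticAt.fun_comp (by simpa using hh) (by fun_prop)
  have heq : (fun u => h (-u)) =ᶠ[𝓝 0] h := (hneg.frequently_eq_iff_eventually_eq hh).1 he
  have hd : deriv h 0 = 0 := by
    have h1 := heq.deriv_eq
    rw [deriv_comp_neg, neg_zero] at h1
    have : (2 : ℂ) * deriv h 0 = 0 := by linear_combination -h1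
    simpa using this
  obtain ⟨K₁, hK₁, e₁⟩ := exists_eq_add_mul hh
  obtain ⟨K₂, hK₂, e₂⟩ := exists_eq_add_mul hK₁
  have hK0 : K₁ 0 = 0 := by
    have h1 : h = fun u => h 0 + u * K₁ u := by
      ext u; simpa using e₁ u
    have h2 : HasDerivAt (fun u => h 0 + u * K₁ u) (K₁ 0) 0 := by
      have := ((hasDerivAt_id (0 : ℂ)).mul hK₁.differentiableAt.hasDerivAt).const_add (h 0)
      simpa using this
    rw [← h1] at h2
    rw [← h2.deriv, hd]
  refine ⟨K₂, hK₂, fun u hu => ?_⟩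
  have h3 := e₁ u
  have h4 := e₂ u
  simp only [zero_add, hK0, Algebra.algebraMap_self, RingHom.id_apply] at h3 h4
  rw [h3, h4]
  field_simp

/-- A translation by a period takes z either into a fixed disc, where compactness gives the bound
away from the periods, or to a point where φ is bounded by C anyway. The second alternative is for
the degenerate cases, whose period group has rank less than two. -/
lemma isBounded_of_reduction {φ : ℂ → ℂ} {Λ : AddSubgroup ℂ}
    (hp : ∀ l ∈ Λ, ∀ z, φ (z + l) = φ z) (ha : ∀ z ∉ Λ, AnalyticAt ℂ φ z) {R C : ℝ}
    (hR : ∀ z, ∃ l ∈ Λ, ‖z - l‖ ≤ R ∨ ‖φ (z - l)‖ ≤ C) (ε : ℝ) (hε : 0 < ε) :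
    ∃ C : ℝ, ∀ z, (∀ l ∈ Λ, ε ≤ ‖z - l‖) → ‖φ z‖ ≤ C := by
  have hK : IsCompact (Metric.closedBall (0 : ℂ) R ∩ {z | ∀ l ∈ Λ, ε ≤ ‖z - l‖}) := by
    refine (isCompact_closedBall 0 R).inter_right ?_
    have : {z : ℂ | ∀ l ∈ Λ, ε ≤ ‖z - l‖} = ⋂ l ∈ Λ, {z | ε ≤ ‖z - l‖} := by
      ext z; simp
    rw [this]
    exact isClosed_biInter fun l _ => isClosed_le continuous_const (by fun_prop)
  obtain ⟨D, hD⟩ := hK.exists_bound_of_continuousOn (f := φ) fun z hz => by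
    refine (ha z fun hm => ?_).continuousAt.continuousWithinAt
    have := hz.2 z hm
    simp at this
    linarith
  refine ⟨max C D, fun z hz => ?_⟩
  obtain ⟨l, hl, h⟩ := hR z
  have hpz : φ (z - l) = φ z := by
    rw [sub_eq_add_neg, hp _ (Λ.neg_mem hl)]
  rcases h with h | h
  · rw [← hpz]
    refine (hD _ ⟨by simpa using h, fun m hm => ?_⟩).trans (le_max_right _ _)
    rw [sub_sub]
    exact hz _ (Λ.add_mem hl hm)
  · rw [← hpz]; exact h.trans (le_max_left _ _)

lemma IsDoublePeriodic.affine {φ : ℂ → ℂ} {Λ : AddSubgroup ℂ} (h : IsDoublePeriodic φ Λ)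
    (a b : ℂ) : IsDoublePeriodic (fun z => a + b * φ z) Λ where
  even z := by simp only [h.even]
  periodic l hl z := by simp only [h.periodic l hl]
  analytic z hz := analyticAt_const.add (analyticAt_const.mul (h.analytic z hz))
  pole := by
    obtain ⟨β, g, hg, he⟩ := h.pole
    refine ⟨b * β, fun u => a + b * g u, analyticAt_const.add (analyticAt_const.mul hg), ?_⟩
    filter_upwards [he] with u hu
    rw [hu]; ring
  bounded ε hε := by
    obtain ⟨C, hC⟩ := h.bounded ε hε
    refine ⟨‖a‖ + ‖b‖ * C, fun z hz => (norm_add_le _ _).trans ?_⟩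
    rw [norm_mul]
    gcongr
    exact hC z hz
  closed := h.closed
  countable := h.countable
  discrete := h.discrete

/-- The properties of the Weierstrass functions that are used. -/
structure IsWeierstrassLike (g₂ g₃ : ℂ) (P : ℂ → ℂ) (Λ : AddSubgroup ℂ) : Prop where
  doublePeriodic : IsDoublePeriodic P Λ
  pole : ∃ g : ℂ → ℂ, AnalyticAt ℂ g 0 ∧ ∀ᶠ u in 𝓝[≠] (0 : ℂ), P u = 1 / u ^ 2 + g u
  ode : ∀ z ∉ Λ, deriv P z ^ 2 = 4 * P z ^ 3 - g₂ * P z - g₃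

lemma isWeierstrassLike_rational : IsWeierstrassLike 0 0 (fun z => 1 / z ^ 2) ⊥ := by
  have hp : ∃ g : ℂ → ℂ, AnalyticAt ℂ g 0 ∧
      ∀ᶠ u in 𝓝[≠] (0 : ℂ), 1 / u ^ 2 = 1 / u ^ 2 + g u :=
    ⟨fun _ => 0, analyticAt_const, by simp⟩
  have hper : ∀ l ∈ (⊥ : AddSubgroup ℂ), ∀ z : ℂ, 1 / (z + l) ^ 2 = 1 / z ^ 2 := by simp
  have han : ∀ z ∉ (⊥ : AddSubgroup ℂ), AnalyticAt ℂ (fun z : ℂ => 1 / z ^ 2) z := by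
    intro z hz
    have hz : z ≠ 0 := by simpa using hz
    exact analyticAt_const.div (by fun_prop) (by positivity)
  refine ⟨⟨fun z => by simp, hper, han, ⟨1, hp⟩, ?_, by simp, by simp, ?_⟩, hp, ?_⟩
  · refine isBounded_of_reduction (R := 1) (C := 1) hper han fun z => ⟨0, by simp, ?_⟩
    rcases le_total ‖z‖ 1 with h | h
    · left; simpa using h
    · right
      simp only [sub_zero, norm_div, norm_one, norm_pow]
      exact div_le_one_of_le₀ (one_le_pow₀ h) (by positivity)
  · filter_upwards [self_mem_nhdsWithin] with z hz
    simpa using hz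
  · intro z hz
    have hz : z ≠ 0 := by simpa using hz
    have : HasDerivAt (fun z : ℂ => 1 / z ^ 2) (-2 / z ^ 3) z := by
      refine ((hasDerivAt_const z (1 : ℂ)).div ((hasDerivAt_id z).pow 2)
        (by simpa using hz)).congr_deriv ?_
      simp
      field_simp
    rw [this.deriv]
    field_simp
    ring

lemma isWeierstrassLike_elliptic (L : PeriodPair) :
    IsWeierstrassLike L.g₂ L.g₃ L.weierstrassP L.lattice.toAddSubgroup := by
  have hper : ∀ l ∈ L.lattice.toAddSubgroup, ∀ z : ℂ,
      L.weierstrassP (z + l) = L.weierstrassP z := fun l hl z =>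
    L.weierstrassP_add_coe z ⟨l, hl⟩
  have hp : ∃ g : ℂ → ℂ, AnalyticAt ℂ g 0 ∧
      ∀ᶠ u in 𝓝[≠] (0 : ℂ), L.weierstrassP u = 1 / u ^ 2 + g u := by
    refine ⟨L.weierstrassPExcept 0, L.analyticAt_weierstrassPExcept 0, Eventually.of_forall ?_⟩
    intro u
    have := L.weierstrassPExcept_add 0 u
    simp only [ZeroMemClass.coe_zero] at this
    rw [← this]; simp; ring
  refine ⟨⟨L.weierstrassP_neg, hper, L.analyticOnNhd_weierstrassP, ⟨1, hp⟩, ?_,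
    L.isClosed_lattice, ?_, ?_⟩, hp, ?_⟩
  · refine isBounded_of_reduction (R := ∑ i, ‖L.basis i‖) (C := 0) hper
      L.analyticOnNhd_weierstrassP fun z => ?_
    refine ⟨ZSpan.floor L.basis z, ?_, Or.inl ?_⟩
    · exact (SetLike.ext_iff.1 L.lattice_eq_span_range_basis _).2 (ZSpan.floor L.basis z).2
    · exact ZSpan.norm_fract_le L.basis z
  · have : Countable L.lattice := L.latticeEquivProd.toEquiv.countable_iff.2 inferInstance
    exact Set.to_countable _
  · have := L.compl_lattice_sdiff_singleton_mem_nhds 0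
    rw [eventually_nhdsWithin_iff]
    filter_upwards [this] with z hz hz0 hm
    exact hz ⟨hm, hz0⟩
  · intro z hz
    rw [L.deriv_weierstrassP]
    exact L.derivWeierstrassP_sq z hz

lemma sinh_eq_zero_iff_mem {c : ℂ} (hc : c ≠ 0) (z : ℂ) : Complex.sinh (c * z) = 0 ↔
    z ∈ AddSubgroup.zmultiples ((Real.pi : ℂ) * Complex.I / c) := by
  have h1 : Complex.sinh (c * z) = 0 ↔ Complex.sin (c * z * Complex.I) = 0 := by
    rw [Complex.sin_mul_I]; simp
  rw [h1, Complex.sin_eq_zero_iff, AddSubgroup.mem_zmultiples_iff]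
  have hI := Complex.I_sq
  constructor
  · rintro ⟨k, hk⟩
    refine ⟨-k, ?_⟩
    rw [zsmul_eq_mul]
    field_simp
    push_cast
    linear_combination Complex.I * hk + (-c * z) * hI
  · rintro ⟨k, rfl⟩
    refine ⟨-k, ?_⟩
    rw [zsmul_eq_mul]
    field_simp
    rw [hI]; push_cast; ring

lemma abs_sinh_re_le_norm_sinh (w : ℂ) : |Real.sinh w.re| ≤ ‖Complex.sinh w‖ := by
  have h1 : Complex.sinh w = (Complex.exp w - Complex.exp (-w)) / 2 := rfl
  have h2 := abs_norm_sub_norm_le (Complex.exp w) (Complex.exp (-w))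
  rw [Complex.norm_exp, Complex.norm_exp, Complex.neg_re] at h2
  rw [h1, norm_div, Real.sinh_eq, abs_div]
  simp only [Complex.norm_ofNat, Nat.abs_ofNat]
  linarith

lemma isWeierstrassLike_trigonometric {c : ℂ} (hc : c ≠ 0) :
    IsWeierstrassLike (4 * c ^ 4 / 3) (-8 * c ^ 6 / 27)
      (fun z => c ^ 2 / Complex.sinh (c * z) ^ 2 + c ^ 2 / 3)
      (AddSubgroup.zmultiples ((Real.pi : ℂ) * Complex.I / c)) := by
  set Λ := AddSubgroup.zmultiples ((Real.pi : ℂ) * Complex.I / c) with hΛ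
  have hz0 : ∀ z, Complex.sinh (c * z) = 0 ↔ z ∈ Λ := sinh_eq_zero_iff_mem hc
  have hsq : ∀ l ∈ Λ, ∀ z : ℂ, Complex.sinh (c * (z + l)) ^ 2 = Complex.sinh (c * z) ^ 2 := by
    intro l hl z
    have hl0 := (hz0 l).2 hl
    have hc1 : Complex.cosh (c * l) ^ 2 = 1 := by
      rw [Complex.cosh_sq, hl0]; ring
    rw [mul_add, Complex.sinh_add, hl0, mul_zero, add_zero, mul_pow, hc1, mul_one]
  have hper : ∀ l ∈ Λ, ∀ z : ℂ, c ^ 2 / Complex.sinh (c * (z + l)) ^ 2 + c ^ 2 / 3 =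
      c ^ 2 / Complex.sinh (c * z) ^ 2 + c ^ 2 / 3 := fun l hl z => by rw [hsq l hl z]
  have hsd : Differentiable ℂ (fun z => Complex.sinh (c * z)) :=
    Complex.differentiable_sinh.comp (differentiable_id.const_mul c)
  have hsa : ∀ z, AnalyticAt ℂ (fun z => Complex.sinh (c * z)) z := fun z =>
    hsd.analyticAt z
  have han : ∀ z ∉ Λ, AnalyticAt ℂ
      (fun z => c ^ 2 / Complex.sinh (c * z) ^ 2 + c ^ 2 / 3) z := by
    intro z hz
    have : Complex.sinh (c * z) ≠ 0 := fun h => hz ((hz0 z).1 h)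
    exact (analyticAt_const.div ((hsa z).pow 2) (pow_ne_zero 2 this)).add analyticAt_const
  have hp : ∃ g : ℂ → ℂ, AnalyticAt ℂ g 0 ∧ ∀ᶠ u in 𝓝[≠] (0 : ℂ),
      c ^ 2 / Complex.sinh (c * u) ^ 2 + c ^ 2 / 3 = 1 / u ^ 2 + g u := by
    -- sinh(cu) = uK(u) with K(0) = c and K even off 0. Hence c²/sinh²(cu) is 1/u² times the even
    -- function c²/K², which takes the value 1 at 0.
    obtain ⟨K, hK, e⟩ := exists_eq_add_mul (hsa 0)
    simp only [zero_add, mul_zero, Complex.sinh_zero, Algebra.algebraMap_self,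
      RingHom.id_apply] at e
    have hK0 : K 0 = c := by
      have h1 : HasDerivAt (fun u => Complex.sinh (c * u)) (Complex.cosh (c * 0) * c) 0 := by
        have := (Complex.hasDerivAt_sinh (c * 0)).comp 0 ((hasDerivAt_id (0 : ℂ)).const_mul c)
        simpa [Function.comp_def] using this
      have h2 : HasDerivAt (fun u => u * K u) (K 0) 0 := by
        have := (hasDerivAt_id (0 : ℂ)).fun_mul hK.differentiableAt.hasDerivAt
        simpa using this
      have h3 : (fun u => Complex.sinh (c * u)) = fun u => u * K u := funext e
      rw [h3] at h1
      have := h1.unique h2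
      simpa using this.symm
    have hh : AnalyticAt ℂ (fun u => c ^ 2 / K u ^ 2) 0 :=
      analyticAt_const.div (hK.pow 2) (by rw [hK0]; exact pow_ne_zero 2 hc)
    have hev : ∀ u, u ≠ 0 → K (-u) = K u := by
      intro u hu
      have h1 := e u
      have h2 := e (-u)
      rw [mul_neg, Complex.sinh_neg, h1] at h2
      have : u * (K (-u) - K u) = 0 := by linear_combination h2
      rcases mul_eq_zero.1 this with h | h
      · exact absurd h hu
      · linear_combination h
    obtain ⟨g, hg, eg⟩ := exists_div_sq_eq hh (Eventually.frequently (by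
      filter_upwards [self_mem_nhdsWithin] with u hu
      rw [hev u hu]))
    refine ⟨fun u => g u + c ^ 2 / 3, hg.add analyticAt_const, ?_⟩
    filter_upwards [self_mem_nhdsWithin] with u hu
    have h1 := eg u hu
    simp only [hK0] at h1
    rw [div_self (pow_ne_zero 2 hc)] at h1
    rw [← add_assoc, ← h1, e u, mul_pow, div_div, mul_comm (u ^ 2)]
  refine ⟨⟨fun z => by simp, hper, han, ⟨1, hp⟩, ?_, ?_, ?_, ?_⟩, hp, ?_⟩
  · refine isBounded_of_reduction (R := (1 + Real.pi / 2) / ‖c‖)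
      (C := ‖c‖ ^ 2 / Real.sinh 1 ^ 2 + ‖c ^ 2 / 3‖) hper han fun z => ?_
    -- Subtracting k periods brings the imaginary part of cz into [−π/2, π/2]. Then either the real
    -- part is at most 1 in modulus and the point lies in a fixed disc, or |sinh| is at least sinh
    -- 1.
    set k : ℤ := round ((c * z).im / Real.pi) with hk
    refine ⟨k • ((Real.pi : ℂ) * Complex.I / c), AddSubgroup.zsmul_mem_zmultiples _ _, ?_⟩
    set y := z - k • ((Real.pi : ℂ) * Complex.I / c) with hy
    have hcy : c * y = c * z - (k * Real.pi : ℝ) * Complex.I := by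
      rw [hy, zsmul_eq_mul]; field_simp; push_cast; ring
    have him : |(c * y).im| ≤ Real.pi / 2 := by
      have h1 := abs_sub_round ((c * z).im / Real.pi)
      rw [← hk] at h1
      have h2 : (c * y).im = ((c * z).im / Real.pi - k) * Real.pi := by
        rw [hcy, Complex.sub_im, Complex.im_ofReal_mul, Complex.I_im]
        field_simp
      rw [h2, abs_mul, abs_of_pos Real.pi_pos]
      nlinarith [Real.pi_pos]
    rcases le_total |(c * y).re| 1 with h | h
    · left
      have h3 : ‖c * y‖ ≤ 1 + Real.pi / 2 := (Complex.norm_le_abs_re_add_abs_im _).trans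
        (add_le_add h him)
      rw [norm_mul] at h3
      rw [le_div_iff₀ (norm_pos_iff.2 hc)]
      linarith
    · right
      refine (norm_add_le _ _).trans ?_
      rw [norm_div, norm_pow, norm_pow]
      have h4 : Real.sinh 1 ≤ ‖Complex.sinh (c * y)‖ := by
        refine le_trans ?_ (abs_sinh_re_le_norm_sinh _)
        rw [Real.abs_sinh]
        exact Real.sinh_le_sinh.2 h
      have h5 : 0 < Real.sinh 1 := Real.sinh_pos_iff.2 one_pos
      gcongr
  · have : (Λ : Set ℂ) = (fun z => Complex.sinh (c * z)) ⁻¹' {0} := by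
      ext z; simp [hz0]
    rw [this]
    exact isClosed_singleton.preimage hsd.continuous
  · exact Set.countable_range _
  · have h1 := (hsa 0).eventually_eq_zero_or_eventually_ne_zero
    rcases h1 with h1 | h1
    · exfalso
      have h2 := EventuallyEq.deriv_eq (f := fun _ : ℂ => (0 : ℂ)) h1
      have h3 : HasDerivAt (fun u => Complex.sinh (c * u)) (Complex.cosh (c * 0) * c) 0 := by
        have := (Complex.hasDerivAt_sinh (c * 0)).comp 0 ((hasDerivAt_id (0 : ℂ)).const_mul c)
        simpa [Function.comp_def] using this
      rw [h3.deriv] at h2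
      simp [hc] at h2
    · filter_upwards [h1] with z hz
      rwa [← hz0]
  · intro z hz
    have hs : Complex.sinh (c * z) ≠ 0 := fun h => hz ((hz0 z).1 h)
    have h1 : HasDerivAt (fun u => Complex.sinh (c * u)) (Complex.cosh (c * z) * c) z := by
      have := (Complex.hasDerivAt_sinh (c * z)).comp z ((hasDerivAt_id z).const_mul c)
      simpa [Function.comp_def] using this
    have h2 : HasDerivAt (fun z => c ^ 2 / Complex.sinh (c * z) ^ 2 + c ^ 2 / 3)
        (-2 * c ^ 3 * Complex.cosh (c * z) / Complex.sinh (c * z) ^ 3) z := by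
      refine (((hasDerivAt_const z (c ^ 2)).div (h1.pow 2) (pow_ne_zero 2 hs)).add_const
        _).congr_deriv ?_
      simp only [Pi.pow_apply]
      field_simp
      ring
    rw [h2.deriv]
    have h3 := Complex.cosh_sq (c * z)
    field_simp
    rw [h3]
    ring

lemma IsWeierstrassP.exists_isWeierstrassLike {g₂ g₃ : ℂ} {P : ℂ → ℂ}
    (h : IsWeierstrassP g₂ g₃ P) : ∃ Λ, IsWeierstrassLike g₂ g₃ P Λ := by
  cases h with
  | elliptic L => exact ⟨_, isWeierstrassLike_elliptic L⟩
  | trigonometric c hc => exact ⟨_, isWeierstrassLike_trigonometric hc⟩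
  | rational => exact ⟨_, isWeierstrassLike_rational⟩

/-! ### Passage between the real axis and the complex plane -/

lemma tendsto_ofReal_punctured (x : ℝ) :
    Tendsto (fun t : ℝ => (t : ℂ)) (𝓝[≠] x) (𝓝[≠] (x : ℂ)) := by
  refine tendsto_nhdsWithin_iff.2 ⟨?_, ?_⟩
  · exact (Complex.continuous_ofReal.tendsto x).mono_left nhdsWithin_le_nhds
  · filter_upwards [self_mem_nhdsWithin] with t ht
    simpa using ht

/-- Order −2 means f = h/u² with h(0) ≠ 0, and evenness on the real axis removes the residue. -/
lemma exists_pole_form {f : ℂ → ℂ} (ho : meromorphicOrderAt f 0 = ((-2 : ℤ) : WithTop ℤ))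
    (he : ∀ x : ℝ, f (-(x : ℂ)) = f x) :
    ∃ β : ℂ, β ≠ 0 ∧ ∃ g : ℂ → ℂ, AnalyticAt ℂ g 0 ∧
      ∀ᶠ u in 𝓝[≠] (0 : ℂ), f u = β / u ^ 2 + g u := by
  have hm : MeromorphicAt f 0 := meromorphicAt_of_meromorphicOrderAt_ne_zero (by
    rw [ho]; exact (by decide : ((-2 : ℤ) : WithTop ℤ) ≠ ((0 : ℤ) : WithTop ℤ)))
  obtain ⟨h, hh, h0, hf⟩ := (meromorphicOrderAt_eq_int_iff hm).1 ho
  have hf' : ∀ᶠ u in 𝓝[≠] (0 : ℂ), f u = h u / u ^ 2 := by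
    filter_upwards [hf] with u hu
    rw [hu]
    simp only [sub_zero, smul_eq_mul, zpow_neg, div_eq_mul_inv]
    rw [mul_comm]; norm_cast
  have hev : ∃ᶠ u in 𝓝[≠] (0 : ℂ), h (-u) = h u := by
    have ht := tendsto_ofReal_punctured 0
    rw [Complex.ofReal_zero] at ht
    refine ht.frequently (Eventually.frequently ?_)
    have hneg : Tendsto (fun t : ℝ => -t) (𝓝[≠] 0) (𝓝[≠] 0) := by
      refine tendsto_nhdsWithin_iff.2 ⟨?_, ?_⟩
      · have : Tendsto (fun t : ℝ => -t) (𝓝 0) (𝓝 0) := by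
          simpa using (continuous_neg (G := ℝ)).tendsto 0
        exact this.mono_left nhdsWithin_le_nhds
      · filter_upwards [self_mem_nhdsWithin] with t ht
        simpa using ht
    filter_upwards [ht.eventually hf', (ht.comp hneg).eventually hf', self_mem_nhdsWithin]
      with t h1 h2 h3
    have h3' : (t : ℂ) ≠ 0 := by simpa using h3
    have h4 := he t
    simp only [Function.comp_apply, Complex.ofReal_neg] at h2
    rw [h1, h2, neg_sq] at h4
    field_simp at h4
    exact h4
  obtain ⟨g, hg, eg⟩ := exists_div_sq_eq hh hev
  refine ⟨h 0, h0, g, hg, ?_⟩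
  filter_upwards [hf', self_mem_nhdsWithin] with u h1 h2
  rw [h1, eg u h2]

section Bridge

variable {ι : Type*} [Fintype ι] [DecidableEq ι]

lemma deriv_comp_ofReal {f : ℂ → ℂ} {x : ℝ} (h : DifferentiableAt ℂ f x) :
    deriv (fun t : ℝ => f t) x = deriv f x := h.hasDerivAt.comp_ofReal.deriv

lemma divSum_ofReal {f : ℂ → ℂ} {x : ι → ℝ}
    (h : ∀ i j, i ≠ j → DifferentiableAt ℂ f ((x i - x j : ℝ) : ℂ)) :
    divSum (fun t : ℝ => f t) x = divSum f (fun i => (x i : ℂ)) := by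
  refine Finset.sum_congr rfl fun i _ => ?_
  have e : partialProd (fun t : ℝ => f t) x i =
      fun t : ℝ => partialProd f (fun i => (x i : ℂ)) i t := by
    ext t; simp [partialProd]
  rw [e]
  exact deriv_comp_ofReal (differentiableAt_partialProd fun j hj => by
    simpa using h i j hj.symm)

lemma divSum_congr {𝕂 : Type*} [NontriviallyNormedField 𝕂] [NormedAlgebra 𝕂 ℂ] {f φ : 𝕂 → ℂ}
    {z : ι → 𝕂}
    (h : ∀ i j, i ≠ j → f =ᶠ[𝓝 (z i - z j)] φ) : divSum f z = divSum φ z := by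
  refine Finset.sum_congr rfl fun i _ => EventuallyEq.deriv_eq ?_
  have : ∀ᶠ t in 𝓝 (z i), ∀ j, j ≠ i → f (t - z j) = φ (t - z j) := by
    refine eventually_all.2 fun j => ?_
    by_cases hj : j = i
    · simp [hj]
    · have hc : ContinuousAt (fun t => t - z j) (z i) := by fun_prop
      filter_upwards [hc.eventually (h i j (Ne.symm hj))] with t ht _ using ht
  filter_upwards [this] with t ht
  exact Finset.prod_congr rfl fun j hj => ht j (Finset.ne_of_mem_erase hj)

end Bridge

lemma tendsto_sq_mul_pole {β : ℂ} {g f : ℂ → ℂ} (hg : AnalyticAt ℂ g 0) {d : ℂ}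
    (hf : ∀ᶠ z in 𝓝[≠] d, f z = β / (z - d) ^ 2 + g (z - d)) :
    Tendsto (fun z => (z - d) ^ 2 * f z) (𝓝[≠] d) (𝓝 β) := by
  have hc : ContinuousAt (fun z => β + (z - d) ^ 2 * g (z - d)) d := by
    have : ContinuousAt (fun z => g (z - d)) d :=
      ContinuousAt.comp (g := g) (f := fun z => z - d) (by simpa using hg.continuousAt)
        (by fun_prop)
    exact continuousAt_const.add
      ((by fun_prop : ContinuousAt (fun z => (z - d) ^ 2) d).mul this)
  have := hc.tendsto.mono_left (nhdsWithin_le_nhds (s := {d}ᶜ))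
  simp only [sub_self, ne_eq, OfNat.ofNat_ne_zero, not_false_eq_true, zero_pow, zero_mul,
    add_zero] at this
  refine this.congr' ?_
  filter_upwards [hf, self_mem_nhdsWithin] with z h1 h2
  have : z - d ≠ 0 := sub_ne_zero.2 h2
  rw [h1]; field_simp

lemma tendsto_sq_mul_of_continuousAt {f φ : ℂ → ℂ} {d : ℂ} (hφ : ContinuousAt φ d)
    (hf : ∀ᶠ z in 𝓝[≠] d, f z = φ z) :
    Tendsto (fun z => (z - d) ^ 2 * f z) (𝓝[≠] d) (𝓝 0) := by
  have hc : ContinuousAt (fun z => (z - d) ^ 2 * φ z) d := by fun_prop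
  have := hc.tendsto.mono_left (nhdsWithin_le_nhds (s := {d}ᶜ))
  simp only [sub_self, ne_eq, OfNat.ofNat_ne_zero, not_false_eq_true, zero_pow,
    zero_mul] at this
  refine this.congr' ?_
  filter_upwards [hf] with z h1
  rw [h1]

/-- Functions of Weierstrass form satisfy the functional equation. -/
theorem solvesEquation_of_isWeierstrassForm {f : ℂ → ℂ} {n : ℕ}
    (ho : meromorphicOrderAt f 0 = ((-2 : ℤ) : WithTop ℤ))
    (he : ∀ x : ℝ, f (-(x : ℂ)) = f x) (h : IsWeierstrassForm f) : SolvesEquation n f := by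
  obtain ⟨β, hβ, g, hg, hf0⟩ := exists_pole_form ho he
  obtain ⟨a, b, g₂, g₃, P, hP, hfP⟩ := h
  obtain ⟨Λ, hW⟩ := hP.exists_isWeierstrassLike
  obtain ⟨q, hq, hPq⟩ := hW.pole
  have hφ0 : ∀ d ∈ Λ, ∀ᶠ z in 𝓝[≠] d, a + b * P z = b / (z - d) ^ 2 + (a + b * q (z - d)) := by
    intro d hd
    have ht : Tendsto (fun z : ℂ => z - d) (𝓝[≠] d) (𝓝[≠] 0) := by
      refine tendsto_nhdsWithin_iff.2 ⟨?_, ?_⟩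
      · have : ContinuousAt (fun t : ℂ => t - d) d := by fun_prop
        simpa using this.tendsto.mono_left nhdsWithin_le_nhds
      · filter_upwards [self_mem_nhdsWithin] with t ht
        simpa [sub_eq_zero] using ht
    filter_upwards [ht.eventually hPq] with z hz
    have := hW.doublePeriodic.periodic d hd (z - d)
    rw [sub_add_cancel] at this
    rw [this, hz]; ring
  have hqa : AnalyticAt ℂ (fun z => a + b * q z) 0 :=
    analyticAt_const.add (analyticAt_const.mul hq)
  -- If b were 0, f would be constant near 0 apart from the point itself, and u²f(u) would tend to 0
  -- and not to β.
  have hb : b ≠ 0 := by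
    rintro rfl
    have h1 := tendsto_sq_mul_pole (d := 0) hg (by simpa using hf0)
    have h2 := tendsto_sq_mul_of_continuousAt (f := f) (φ := fun _ => a) (d := 0)
      continuousAt_const (by simpa using hfP 0)
    exact hβ (tendsto_nhds_unique h1 h2)
  -- f agrees with a + b℘ only on punctured neighbourhoods, so regularity of f has to be converted
  -- into regularity of ℘: at a period (z − x)²f(z) tends to b ≠ 0, whereas at a regular point of f
  -- it tends to 0.
  have key : ∀ x : ℝ, AnalyticAt ℂ f x → (x : ℂ) ∉ Λ := by
    intro x hx hm
    have h1 := tendsto_sq_mul_of_continuousAt (f := f) hx.continuousAt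
      (Eventually.of_forall fun _ => rfl)
    have h2 := tendsto_sq_mul_pole (f := f) (d := (x : ℂ)) hqa (by
      filter_upwards [hφ0 x hm, hfP x] with z e1 e2
      rw [e2, e1])
    exact hb (tendsto_nhds_unique h2 h1)
  have hφ := hW.doublePeriodic.affine a b
  intro x hx
  have hx' := fun i j hij => hx i j hij
  have h1 := divSum_ofReal (f := f) (x := x) fun i j hij => (hx i j hij).differentiableAt
  have h2 : divSum f (fun i => (x i : ℂ)) = divSum (fun z => a + b * P z) (fun i => (x i : ℂ)) := by
    refine divSum_congr fun i j hij => ?_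
    have h3 := hx i j hij
    have h4 := hφ.analytic _ (key _ h3)
    have h5 := (h3.frequently_eq_iff_eventually_eq h4).1 (hfP _).frequently
    rwa [Complex.ofReal_sub] at h5
  have h3 := hφ.divSum_eq_zero (fun i => (x i : ℂ)) fun i j hij => by
    rw [← Complex.ofReal_sub]; exact key _ (hx i j hij)
  rw [← h2, ← h1] at h3
  exact h3

/-! ### Three points: the Weierstrass differential equation -/

lemma analyticAt_comp_ofReal {f : ℂ → ℂ} {x : ℝ} (h : AnalyticAt ℂ f x) :
    AnalyticAt ℝ (fun t : ℝ => f t) x :=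
  AnalyticAt.fun_comp (g := f) (f := fun t : ℝ => (t : ℂ)) h.restrictScalars
    (Complex.ofRealCLM.analyticAt x)

/-- The Weierstrass differential equation determines the solution with a given double pole. -/
lemma eventuallyEq_of_weierstrass_ode {g₂ g₃ : ℂ} {P₁ P₂ q₁ q₂ : ℂ → ℂ}
    (hq₁ : AnalyticAt ℂ q₁ 0) (hq₂ : AnalyticAt ℂ q₂ 0)
    (h₁ : ∀ᶠ u in 𝓝[≠] (0 : ℂ), P₁ u = 1 / u ^ 2 + q₁ u)
    (h₂ : ∀ᶠ u in 𝓝[≠] (0 : ℂ), P₂ u = 1 / u ^ 2 + q₂ u)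
    (e₁ : ∀ᶠ u in 𝓝[≠] (0 : ℂ), deriv P₁ u ^ 2 = 4 * P₁ u ^ 3 - g₂ * P₁ u - g₃)
    (e₂ : ∀ᶠ u in 𝓝[≠] (0 : ℂ), deriv P₂ u ^ 2 = 4 * P₂ u ^ 3 - g₂ * P₂ u - g₃) :
    ∀ᶠ u in 𝓝[≠] (0 : ℂ), P₁ u = P₂ u := by
  have hder : ∀ {P q : ℂ → ℂ}, AnalyticAt ℂ q 0 →
      (∀ᶠ u in 𝓝[≠] (0 : ℂ), P u = 1 / u ^ 2 + q u) →
      ∀ᶠ u in 𝓝[≠] (0 : ℂ), deriv P u = -2 / u ^ 3 + deriv q u := by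
    intro P q hq hP
    have h1 : ∀ᶠ u in 𝓝[≠] (0 : ℂ), P =ᶠ[𝓝 u] fun u => 1 / u ^ 2 + q u := by
      have := eventually_eventually_nhdsWithin.2 hP
      filter_upwards [this, self_mem_nhdsWithin] with u hu hu0
      rwa [isOpen_compl_singleton.nhdsWithin_eq hu0] at hu
    filter_upwards [h1, hq.eventually_analyticAt.filter_mono nhdsWithin_le_nhds,
      self_mem_nhdsWithin] with u hu hqu hu0
    have hu0 : u ≠ 0 := hu0
    rw [hu.deriv_eq]
    refine HasDerivAt.deriv ?_
    refine (((hasDerivAt_const u (1 : ℂ)).div ((hasDerivAt_id u).pow 2) (by simpa using hu0)).add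
      hqu.differentiableAt.hasDerivAt).congr_deriv ?_
    simp only [Pi.pow_apply, id]
    field_simp
    ring
  by_cases hz : ∀ᶠ u in 𝓝 (0 : ℂ), q₁ u - q₂ u = 0
  · filter_upwards [hz.filter_mono nhdsWithin_le_nhds, h₁, h₂] with u hu a1 a2
    rw [a1, a2]; linear_combination hu
  · exfalso
    -- Otherwise P₁ − P₂ = uᵐe(u) off 0, with e(0) ≠ 0. The difference of the two equations, (P₁' −
    -- P₂')(P₁' + P₂') = (P₁ − P₂)(4(P₁² + P₁P₂ + P₂²) − g₂), is multiplied by u⁴ and divided by uᵐ.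
    -- As u → 0 it becomes −4m e(0) = 12 e(0), which is impossible for m ≥ 0.
    obtain ⟨m, e, he, he0, hd⟩ :=
      (hq₁.sub hq₂).exists_eventuallyEq_pow_smul_nonzero_iff.2 hz
    have hd' : ∀ᶠ u in 𝓝[≠] (0 : ℂ),
        u * (deriv q₁ u - deriv q₂ u) = u ^ m * (m * e u + u * deriv e u) := by
      filter_upwards [hd.eventually_nhds.filter_mono nhdsWithin_le_nhds,
        he.eventually_analyticAt.filter_mono nhdsWithin_le_nhds,
        hq₁.eventually_analyticAt.filter_mono nhdsWithin_le_nhds,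
        hq₂.eventually_analyticAt.filter_mono nhdsWithin_le_nhds] with u hu heu hu1 hu2
      have h3 : deriv (q₁ - q₂) u = deriv q₁ u - deriv q₂ u :=
        deriv_sub hu1.differentiableAt hu2.differentiableAt
      have h4 : (q₁ - q₂) =ᶠ[𝓝 u] fun z => z ^ m * e z := by
        filter_upwards [hu] with z hz
        simpa using hz
      rw [← h3, h4.deriv_eq, deriv_fun_mul (by fun_prop) heu.differentiableAt, deriv_pow_field]
      rcases m with _ | m
      · simp
      · simp only [Nat.add_sub_cancel]; push_cast; ring
    have hfin : ∀ᶠ u in 𝓝[≠] (0 : ℂ),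
        (m * e u + u * deriv e u) * (-4 + u ^ 3 * (deriv q₁ u + deriv q₂ u)) =
        e u * (4 * ((1 + u ^ 2 * q₁ u) ^ 2 + (1 + u ^ 2 * q₁ u) * (1 + u ^ 2 * q₂ u) +
          (1 + u ^ 2 * q₂ u) ^ 2) - g₂ * u ^ 4) := by
      filter_upwards [hd', hd.filter_mono nhdsWithin_le_nhds, h₁, h₂, hder hq₁ h₁, hder hq₂ h₂,
        e₁, e₂, self_mem_nhdsWithin] with u a1 a2 a3 a4 a5 a6 a7 a8 a9
      have hu : u ≠ 0 := a9
      have hum : u ^ m ≠ 0 := pow_ne_zero m hu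
      simp only [Pi.sub_apply, sub_zero, smul_eq_mul] at a2
      have b1 : P₁ u - P₂ u = u ^ m * e u := by rw [a3, a4]; linear_combination a2
      have b2 : u * (deriv P₁ u - deriv P₂ u) = u ^ m * (m * e u + u * deriv e u) := by
        rw [a5, a6]; linear_combination a1
      have b3 : (deriv P₁ u - deriv P₂ u) * (deriv P₁ u + deriv P₂ u) =
          (P₁ u - P₂ u) * (4 * (P₁ u ^ 2 + P₁ u * P₂ u + P₂ u ^ 2) - g₂) := by
        linear_combination a7 - a8
      have b4 : u ^ 3 * (deriv P₁ u + deriv P₂ u) = -4 + u ^ 3 * (deriv q₁ u + deriv q₂ u) := by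
        rw [a5, a6]; field_simp; ring
      have b5 : u ^ 2 * P₁ u = 1 + u ^ 2 * q₁ u := by rw [a3]; field_simp
      have b6 : u ^ 2 * P₂ u = 1 + u ^ 2 * q₂ u := by rw [a4]; field_simp
      rw [← b4, ← b5, ← b6]
      apply mul_left_cancel₀ hum
      linear_combination (-u ^ 3 * (deriv P₁ u + deriv P₂ u)) * b2 + u ^ 4 * b3 +
        u ^ 4 * (4 * (P₁ u ^ 2 + P₁ u * P₂ u + P₂ u ^ 2) - g₂) * b1
    have c1 := he.continuousAt
    have c2 := he.deriv.continuousAt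
    have c3 := hq₁.continuousAt
    have c4 := hq₂.continuousAt
    have c5 := hq₁.deriv.continuousAt
    have c6 := hq₂.deriv.continuousAt
    have cL : ContinuousAt (fun u => (m * e u + u * deriv e u) *
        (-4 + u ^ 3 * (deriv q₁ u + deriv q₂ u))) 0 := by
      have i : ContinuousAt (fun u : ℂ => u) 0 := continuousAt_id
      exact ((continuousAt_const.mul c1).add (i.mul c2)).mul
        (continuousAt_const.add ((i.pow 3).mul (c5.add c6)))
    have cR : ContinuousAt (fun u => e u * (4 * ((1 + u ^ 2 * q₁ u) ^ 2 +
        (1 + u ^ 2 * q₁ u) * (1 + u ^ 2 * q₂ u) + (1 + u ^ 2 * q₂ u) ^ 2) - g₂ * u ^ 4)) 0 := by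
      have i : ContinuousAt (fun u : ℂ => u) 0 := continuousAt_id
      have k1 : ContinuousAt (fun u => 1 + u ^ 2 * q₁ u) 0 :=
        continuousAt_const.add ((i.pow 2).mul c3)
      have k2 : ContinuousAt (fun u => 1 + u ^ 2 * q₂ u) 0 :=
        continuousAt_const.add ((i.pow 2).mul c4)
      exact c1.mul ((continuousAt_const.mul (((k1.pow 2).add (k1.mul k2)).add (k2.pow 2))).sub
        (continuousAt_const.mul (i.pow 4)))
    have hlim := tendsto_nhds_unique ((cL.tendsto.mono_left nhdsWithin_le_nhds).congr' hfin)
      (cR.tendsto.mono_left nhdsWithin_le_nhds)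
    norm_num at hlim
    have hm : ((m : ℂ) + 3) * e 0 = 0 := by linear_combination (-1 / 4 : ℂ) * hlim
    rcases mul_eq_zero.1 hm with h | h
    · have : ((m + 3 : ℕ) : ℂ) = 0 := by push_cast; exact h
      exact absurd (Nat.cast_eq_zero.1 this) (by omega)
    · exact he0 h

/-- On a connected set a meromorphic function has infinite order everywhere or nowhere. Along the
real axis this carries the agreement near 0 across the poles. -/
lemma eventuallyEq_real_of_eventuallyEq {f φ : ℂ → ℂ} (hf : ∀ x : ℝ, MeromorphicAt f x)
    (hφ : ∀ x : ℝ, MeromorphicAt φ x) (h0 : ∀ᶠ u in 𝓝[≠] (0 : ℂ), f u = φ u) (x : ℝ) :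
    ∀ᶠ z in 𝓝[≠] (x : ℂ), f z = φ z := by
  have hm : MeromorphicOn (fun z => f z - φ z) (Set.range ((↑) : ℝ → ℂ)) := by
    rintro _ ⟨x, rfl⟩; exact (hf x).sub (hφ x)
  have hpc : IsPreconnected (Set.range ((↑) : ℝ → ℂ)) :=
    isPreconnected_range Complex.continuous_ofReal
  have htop : meromorphicOrderAt (fun z => f z - φ z) (0 : ℂ) = ⊤ := by
    rw [meromorphicOrderAt_eq_top_iff]
    filter_upwards [h0] with u hu; rw [hu, sub_self]
  by_contra hx
  have hne : meromorphicOrderAt (fun z => f z - φ z) (x : ℂ) ≠ ⊤ := by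
    intro h
    rw [meromorphicOrderAt_eq_top_iff] at h
    exact hx (by filter_upwards [h] with u hu; linear_combination hu)
  exact (hm.meromorphicOrderAt_ne_top_of_isPreconnected hpc (y := 0) ⟨x, rfl⟩
    ⟨0, by simp⟩ hne) htop

/-- For three points the functional equation implies the Weierstrass differential equation. -/
lemma exists_weierstrass_ode {f g : ℂ → ℂ} {β : ℂ} (hβ : β ≠ 0) (hg : AnalyticAt ℂ g 0)
    (hf : ∀ᶠ u in 𝓝[≠] (0 : ℂ), f u = β / u ^ 2 + g u)
    (he : ∀ x : ℝ, f (-(x : ℂ)) = f x)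
    (hsol : IsSolution (Option (Option Unit)) (fun x : ℝ => f x)
      {x : ℝ | ¬ AnalyticAt ℂ f x}) :
    ∃ g₂ g₃ : ℂ, ∀ᶠ u in 𝓝[≠] (0 : ℂ),
      (deriv (fun z => (f z - g 0) / β) u) ^ 2
        = 4 * ((f u - g 0) / β) ^ 3 - g₂ * ((f u - g 0) / β) - g₃ := by
  set p : ℝ → ℂ := fun x => f x with hp
  have hev : ∀ x : ℝ, p (-x) = p x := fun x => by simp [hp, he]
  have hmer : MeromorphicAt f 0 := by
    have h1 : MeromorphicAt (fun u => β / u ^ 2 + g u) 0 :=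
      ((MeromorphicAt.const β 0).div ((MeromorphicAt.id 0).pow 2)).add hg.meromorphicAt
    exact h1.congr (by filter_upwards [hf] with u hu using hu.symm)
  have han : ∀ᶠ u in 𝓝[≠] (0 : ℂ), AnalyticAt ℂ f u := hmer.eventually_analyticAt
  have hanR : ∀ᶠ u : ℝ in 𝓝[≠] 0, AnalyticAt ℂ f (u : ℂ) := by
    have ht := tendsto_ofReal_punctured 0
    rw [Complex.ofReal_zero] at ht
    exact ht.eventually han
  obtain ⟨ε, hε, hball⟩ : ∃ ε > 0, ∀ u : ℝ, u ≠ 0 → |u| < ε → AnalyticAt ℂ f (u : ℂ) := by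
    rw [eventually_nhdsWithin_iff, Metric.eventually_nhds_iff] at hanR
    obtain ⟨ε, hε, h⟩ := hanR
    exact ⟨ε, hε, fun u hu hlt => h (by simpa using hlt) hu⟩
  have hpa : ∀ u : ℝ, u ≠ 0 → |u| < ε → AnalyticAt ℝ p u := fun u hu hlt =>
    analyticAt_comp_ofReal (hball u hu hlt)
  have hgR : AnalyticAt ℝ (fun t : ℝ => g t) 0 := analyticAt_comp_ofReal (by simpa using hg)
  have hpR : ∀ᶠ u in 𝓝[≠] (0 : ℝ), p u = β / algebraMap ℝ ℂ u ^ 2 + g u := by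
    have ht := tendsto_ofReal_punctured 0
    rw [Complex.ofReal_zero] at ht
    exact ht.eventually hf
  -- The points are y + u, y and 0 with u → 0. The terms containing p(u) and p'(u) converge by
  -- `tendsto_coalescence`; the term of the point 0 tends to −2p(y)p'(y).
  have hthird : ∀ y ∈ Set.Ioo 0 ε, β * (deriv (deriv (deriv p)) y / 6) + 2 * g 0 * deriv p y =
      2 * p y * deriv p y := by
    intro y hy
    have hy0 : y ≠ 0 := hy.1.ne'
    have hya : |y| < ε := by rw [abs_of_pos hy.1]; exact hy.2
    have hpy := hpa y hy0 hya
    have h1 := tendsto_coalescence (𝕂 := ℝ) (y := y) hgR hpR hpy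
    have hc : ContinuousAt (fun u : ℝ => y + u) 0 := by fun_prop
    have h2 : ∀ᶠ u in 𝓝[≠] (0 : ℝ), deriv p u * (p (y + u) - p y) +
        p u * (deriv p (y + u) + deriv p y) =
        deriv p (y + u) * p y + p (y + u) * deriv p y := by
      have e1 : ∀ᶠ u in 𝓝[≠] (0 : ℝ), y + u ∈ Set.Ioo 0 ε :=
        (hc.eventually (isOpen_Ioo.mem_nhds (by simpa using hy))).filter_mono nhdsWithin_le_nhds
      have e2 : ∀ᶠ u in 𝓝[≠] (0 : ℝ), |u| < ε := by
        have : ContinuousAt (fun u : ℝ => |u|) 0 := by fun_prop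
        exact (this.eventually (gt_mem_nhds (by simpa using hε))).filter_mono nhdsWithin_le_nhds
      filter_upwards [e1, e2, self_mem_nhdsWithin] with u hu1 hu2 hu0
      have hu0 : u ≠ 0 := hu0
      have hyu : |y + u| < ε := by rw [abs_of_pos hu1.1]; exact hu1.2
      have hyu0 : y + u ≠ 0 := hu1.1.ne'
      set x : Unit → ℝ := fun _ => 0
      have key := hsol (addPoint (y + u) (addPoint y x)) (by
        rintro (_ | _ | i) (_ | _ | j) h
        · exact absurd rfl h
        · simpa [addPoint] using hball u hu0 hu2
        · simpa [addPoint, x] using hball _ hyu0 hyu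
        · have := hball (-u) (neg_ne_zero.2 hu0) (by rwa [abs_neg])
          simpa [addPoint] using this
        · exact absurd rfl h
        · simpa [addPoint, x] using hball y hy0 hya
        · have := hball (-(y + u)) (neg_ne_zero.2 hyu0) (by rwa [abs_neg])
          simpa [addPoint, x] using this
        · have := hball (-y) (neg_ne_zero.2 hy0) (by rwa [abs_neg])
          simpa [addPoint, x] using this
        · exact absurd rfl h)
      rw [divSum_addPoint_addPoint hev (by simpa using (hpa u hu0 hu2).differentiableAt)
        (fun _ => by simpa [x] using (hpa _ hyu0 hyu).differentiableAt)
        (fun _ => by simpa [x] using hpy.differentiableAt)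
        (fun i j hij => absurd (Subsingleton.elim i j) hij)] at key
      have f1 : fullProd p x = p := by ext t; simp [fullProd, x]
      have f2 : partialProd p x () = fun _ => 1 := by
        ext t
        simp [partialProd]
      simp only [f1, Finset.univ_unique, Finset.sum_singleton, PUnit.default_eq_unit, f2,
        deriv_const, x, sub_zero, add_sub_cancel_left] at key
      linear_combination key
    have h3 : Tendsto (fun u => deriv p (y + u) * p y + p (y + u) * deriv p y) (𝓝[≠] 0)
        (𝓝 (deriv p y * p y + p y * deriv p y)) := by
      have t1 : ContinuousAt (fun u => deriv p (y + u)) 0 :=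
        ContinuousAt.comp (g := deriv p) (by simpa using hpy.deriv.continuousAt) hc
      have t2 : ContinuousAt (fun u => p (y + u)) 0 :=
        ContinuousAt.comp (g := p) (by simpa using hpy.continuousAt) hc
      have := ((t1.tendsto.mul_const (p y)).add (t2.tendsto.mul_const (deriv p y))).mono_left
        (nhdsWithin_le_nhds (s := {0}ᶜ))
      simpa using this
    have := tendsto_nhds_unique (h1.congr' h2) h3
    rw [Complex.ofReal_zero] at this
    rw [this]; ring
  have hD : ∀ y ∈ Set.Ioo 0 ε, HasDerivAt p (deriv p y) y ∧
      HasDerivAt (deriv p) (deriv (deriv p) y) y ∧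
      HasDerivAt (deriv (deriv p)) (deriv (deriv (deriv p)) y) y := by
    intro y hy
    have h := hpa y hy.1.ne' (by rw [abs_of_pos hy.1]; exact hy.2)
    exact ⟨h.differentiableAt.hasDerivAt, h.deriv.differentiableAt.hasDerivAt,
      h.deriv.deriv.differentiableAt.hasDerivAt⟩
  -- First integral of the third order equation. Multiplied by 12p' it can be integrated once more.
  obtain ⟨c, hc⟩ : ∃ c, ∀ y ∈ Set.Ioo 0 ε,
      β * (deriv (deriv p) y / 6) + 2 * g 0 * p y - p y ^ 2 = c := by
    have hd : ∀ y ∈ Set.Ioo 0 ε, HasDerivAt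
        (fun y => β * (deriv (deriv p) y / 6) + 2 * g 0 * p y - p y ^ 2) 0 y := by
      intro y hy
      obtain ⟨h1, h2, h3⟩ := hD y hy
      refine ((((h3.div_const 6).const_mul β).add (h1.const_mul (2 * g 0))).sub
        (h1.pow 2)).congr_deriv ?_
      rw [hthird y hy]; push_cast; ring
    exact isOpen_Ioo.exists_is_const_of_deriv_eq_zero isPreconnected_Ioo
      (fun y hy => (hd y hy).differentiableAt.differentiableWithinAt) fun y hy => (hd y hy).deriv
  obtain ⟨d, hd⟩ : ∃ d, ∀ y ∈ Set.Ioo 0 ε,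
      β * deriv p y ^ 2 - (4 * p y ^ 3 - 12 * g 0 * p y ^ 2 + 12 * c * p y) = d := by
    have hd : ∀ y ∈ Set.Ioo 0 ε, HasDerivAt (fun y => β * deriv p y ^ 2 -
        (4 * p y ^ 3 - 12 * g 0 * p y ^ 2 + 12 * c * p y)) 0 y := by
      intro y hy
      obtain ⟨h1, h2, h3⟩ := hD y hy
      refine (((h2.pow 2).const_mul β).sub ((((h1.pow 3).const_mul 4).sub
        ((h1.pow 2).const_mul (12 * g 0))).add (h1.const_mul (12 * c)))).congr_deriv ?_
      push_cast
      linear_combination 12 * deriv p y * hc y hy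
    exact isOpen_Ioo.exists_is_const_of_deriv_eq_zero isPreconnected_Ioo
      (fun y hy => (hd y hy).differentiableAt.differentiableWithinAt) fun y hy => (hd y hy).deriv
  -- The substitution p = βP + g(0) in βp'² = 4p³ − 12g(0)p² + 12cp + d removes the quadratic term
  -- and leaves 4P³ as the leading one; the invariants are read off from the rest.
  refine ⟨(12 * g 0 ^ 2 - 12 * c) / β ^ 2, (8 * g 0 ^ 3 - 12 * c * g 0 - d) / β ^ 3, ?_⟩
  have hP : MeromorphicAt (fun z => (f z - g 0) / β) 0 :=
    (hmer.sub (MeromorphicAt.const _ _)).div (MeromorphicAt.const _ _)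
  -- The equation holds at the real points of (0, ε). For meromorphic functions frequent equality
  -- near 0 is equality on a punctured neighbourhood.
  have hfr : ∃ᶠ u in 𝓝[≠] (0 : ℂ), (deriv (fun z => (f z - g 0) / β) u) ^ 2
        = 4 * ((f u - g 0) / β) ^ 3 - (12 * g 0 ^ 2 - 12 * c) / β ^ 2 * ((f u - g 0) / β)
          - (8 * g 0 ^ 3 - 12 * c * g 0 - d) / β ^ 3 := by
    have ht := tendsto_ofReal_punctured 0
    rw [Complex.ofReal_zero] at ht
    refine ht.frequently ?_
    have hpos : ∀ᶠ t in 𝓝[>] (0 : ℝ), t ∈ Set.Ioo 0 ε := Ioo_mem_nhdsGT hε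
    refine Frequently.filter_mono (Eventually.frequently ?_)
      (nhdsWithin_mono _ (fun t (ht : 0 < t) => ht.ne') : 𝓝[>] (0 : ℝ) ≤ 𝓝[≠] 0)
    filter_upwards [hpos] with y hy
    have ha := hball y hy.1.ne' (by rw [abs_of_pos hy.1]; exact hy.2)
    have h1 : deriv (fun z => (f z - g 0) / β) y = deriv p y / β := by
      rw [hp, deriv_comp_ofReal ha.differentiableAt]
      exact ((ha.differentiableAt.hasDerivAt.sub_const _).div_const _).deriv
    rw [h1]
    have h2 := hd y hy
    change _ = 4 * ((p y - g 0) / β) ^ 3 - _ * ((p y - g 0) / β) - _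
    field_simp
    linear_combination h2
  refine (MeromorphicAt.frequently_eq_iff_eventuallyEq (f := fun u =>
    (deriv (fun z => (f z - g 0) / β) u) ^ 2) (g := fun u => 4 * ((f u - g 0) / β) ^ 3 -
      (12 * g 0 ^ 2 - 12 * c) / β ^ 2 * ((f u - g 0) / β)
          - (8 * g 0 ^ 3 - 12 * c * g 0 - d) / β ^ 3) (hP.deriv.pow 2) ?_).1 hfr
  exact (((MeromorphicAt.const 4 0).mul (hP.pow 3)).sub
    ((MeromorphicAt.const _ 0).mul hP)).sub (MeromorphicAt.const _ 0)

/-! ### Realising all invariants g₂, g₃ -/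

section Uniformization

open UpperHalfPlane ModularForm ModularFormClass MatrixGroups EisensteinSeries

lemma tendsto_atImInfty_E {k : ℕ} (hk : 3 ≤ k) (hk2 : Even k) :
    Tendsto (E hk) atImInfty (𝓝 1) := by
  have h := exp_decay_sub_atImInfty' (E hk)
  obtain ⟨c, hc, hO⟩ := h
  have hv : valueAtInfty (E hk) = 1 := by
    rw [← UpperHalfPlane.qExpansion_coeff_zero one_pos
      (ModularFormClass.analyticAt_cuspFunction_zero (E hk) one_pos one_mem_strictPeriods_SL)
      (SlashInvariantFormClass.periodic_comp_ofComplex (E hk) one_mem_strictPeriods_SL)]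
    exact E_qExpansion_coeff_zero hk hk2
  rw [hv] at hO
  have hz : Tendsto (fun τ : ℍ => Real.exp (-c * τ.im)) atImInfty (𝓝 0) := by
    refine Real.tendsto_exp_atBot.comp ?_
    exact tendsto_comap.const_mul_atTop_of_neg (by linarith)
  have := hO.trans_tendsto hz
  simpa using this.add_const 1

/-- If AE₄³ − BE₆² had no zero, its reciprocal would be a modular form of weight −12: it is bounded
at the cusp because the form tends to A − B ≠ 0 there. A form of negative weight vanishes, a
contradiction. This plays the role of the surjectivity of the j-invariant. -/
lemma exists_eisenstein_relation {A B : ℂ} (hAB : A ≠ B) :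
    ∃ τ : ℍ, A * E₄ τ ^ 3 - B * E₆ τ ^ 2 = 0 := by
  by_contra! hne
  set F : ModularForm 𝒮ℒ 12 :=
    A • ModularForm.mcast (by decide) (E₄.pow 3) - B • ModularForm.mcast (by decide) (E₆.pow 2)
    with hF
  have hFa : ∀ τ, F τ = A * E₄ τ ^ 3 - B * E₆ τ ^ 2 := by
    intro τ
    have e4 : (E₄.pow 3) τ = E₄ τ ^ 3 := by rw [coe_pow, Pi.pow_apply]
    have e6 : (E₆.pow 2) τ = E₆ τ ^ 2 := by rw [coe_pow, Pi.pow_apply]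
    rw [← e4, ← e6]
    rfl
  have hF0 : ∀ τ, F τ ≠ 0 := fun τ => by rw [hFa]; exact hne τ
  have hlim : Tendsto F atImInfty (𝓝 (A - B)) := by
    have h4 := tendsto_atImInfty_E (k := 4) (by norm_num) (by decide)
    have h6 := tendsto_atImInfty_E (k := 6) (by norm_num) (by decide)
    have := ((h4.pow 3).const_mul A).sub ((h6.pow 2).const_mul B)
    simp only [one_pow, mul_one] at this
    exact this.congr fun τ => (hFa τ).symm
  have hslash : ∀ γ : SL(2, ℤ), (fun z => (1 : ModularForm 𝒮ℒ 0) z / F z) ∣[(0 - 12 : ℤ)] γ =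
      fun z => (1 : ModularForm 𝒮ℒ 0) z / F z := by
    intro γ
    have hγ : (γ : GL (Fin 2) ℝ) ∈ 𝒮ℒ := ⟨γ, rfl⟩
    change (⇑(1 : ModularForm 𝒮ℒ 0) / ⇑F) ∣[(0 - 12 : ℤ)] γ = ⇑(1 : ModularForm 𝒮ℒ 0) / ⇑F
    simp_rw [div_slash_SL2, SL_slash, SlashInvariantForm.slash_action_eqn _ _ hγ]
  let G : ModularForm 𝒮ℒ (0 - 12) :=
    { toFun z := (1 : ModularForm 𝒮ℒ 0) z / F z
      slash_action_eq' := fun _ ⟨γ, hγ⟩ => hγ ▸ hslash γ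
      holo' := (1 : ModularForm 𝒮ℒ 0).holo'.div F.holo' hF0
      bdd_at_cusps' {c} hc := by
        rw [Subgroup.IsArithmetic.isCusp_iff_isCusp_SL2Z] at hc
        rw [OnePoint.isBoundedAt_iff_forall_SL2Z hc]
        intro γ _
        rw [hslash γ, IsBoundedAtImInfty, BoundedAtFilter]
        have h1 : Tendsto (fun z => (1 : ModularForm 𝒮ℒ 0) z / F z) atImInfty
            (𝓝 (1 / (A - B))) := by
          refine Tendsto.div ?_ hlim (sub_ne_zero.2 hAB)
          exact tendsto_const_nhds.congr fun z => by simp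
        exact h1.isBigO_one ℝ }
  have hG := levelOne_neg_weight_eq_zero (by norm_num) G
  have h1 := congrFun hG UpperHalfPlane.I
  have h2 : (1 : ModularForm 𝒮ℒ 0) UpperHalfPlane.I / F UpperHalfPlane.I = 0 := h1
  rw [div_eq_zero_iff] at h2
  rcases h2 with h2 | h2
  · simp at h2
  · exact hF0 _ h2

/-- The lattice `ℤ λτ + ℤ λ`. -/
def scaledPeriodPair (τ : ℍ) (c : ℂ) (hc : c ≠ 0) : PeriodPair where
  ω₁ := c * τ
  ω₂ := c
  indep := by
    rw [LinearIndependent.pair_iff]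
    intro s t hst
    have h1 : c * ((s : ℂ) * τ + t) = 0 := by
      simp only [Complex.real_smul] at hst; linear_combination hst
    have h2 := (mul_eq_zero.1 h1).resolve_left hc
    have h3 := congrArg Complex.im h2
    simp only [Complex.add_im, Complex.mul_im, Complex.ofReal_re, Complex.ofReal_im, zero_mul,
      add_zero, Complex.zero_im] at h3
    have hs : s = 0 := (mul_eq_zero.1 h3).resolve_right τ.im_ne_zero
    subst hs
    simpa using h2

/-- Expresses the lattice sums by normalised Eisenstein series. In particular g₂ and g₃ of the
lattice scaled by c are constant multiples of c⁻⁴E₄(τ) and c⁻⁶E₆(τ). -/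
lemma scaledPeriodPair_G (τ : ℍ) (c : ℂ) (hc : c ≠ 0) {k : ℕ} (hk : 3 ≤ k) :
    (scaledPeriodPair τ c hc).G k = (c ^ k)⁻¹ * (2 * riemannZeta k * E hk τ) := by
  have h1 := tsum_eisSummand_eq_riemannZeta_mul_eisensteinSeries hk τ
  have h2 : E hk τ = (1 / 2 : ℂ) * eisensteinSeries (N := 1) 0 k τ := by
    rw [show E hk τ = (1 / 2 : ℂ) • eisensteinSeriesSIF (N := 1) 0 k τ from rfl,
      eisensteinSeriesSIF_apply 0 k τ, smul_eq_mul]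
  have h3 : 2 * riemannZeta k * E hk τ = ∑' v : Fin 2 → ℤ, eisSummand k v τ := by
    rw [h1, h2]; ring
  rw [h3, PeriodPair.G, ← tsum_mul_left]
  set L := scaledPeriodPair τ c hc
  rw [← L.latticeEquivProd.symm.toEquiv.tsum_eq, ← (finTwoArrowEquiv ℤ).tsum_eq]
  refine tsum_congr fun v => ?_
  have h4 : ((L.latticeEquivProd.symm (finTwoArrowEquiv ℤ v) : L.lattice) : ℂ) =
      c * (v 0 * τ + v 1) := by
    rw [L.latticeEquiv_symm_apply]
    change ((v 0 : ℤ) : ℂ) * (c * τ) + (v 1 : ℤ) * c = _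
    ring
  change (((L.latticeEquivProd.symm (finTwoArrowEquiv ℤ v) : L.lattice) : ℂ) ^ k)⁻¹ = _
  rw [h4, eisSummand, mul_pow, mul_inv, zpow_neg, zpow_natCast]

lemma riemannZeta_six : riemannZeta 6 = Real.pi ^ 6 / 945 := by
  have h := riemannZeta_two_mul_nat (k := 3) (by norm_num)
  have hb : bernoulli 6 = 1 / 42 := by decide +kernel
  norm_num [hb, Nat.factorial] at h
  rw [h]; ring

lemma scaledPeriodPair_g₂ (τ : ℍ) (c : ℂ) (hc : c ≠ 0) :
    (scaledPeriodPair τ c hc).g₂ = (c ^ 4)⁻¹ * (4 * Real.pi ^ 4 / 3 * E₄ τ) := by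
  have h := scaledPeriodPair_G τ c hc (k := 4) (by norm_num)
  rw [PeriodPair.g₂, h, Nat.cast_ofNat, riemannZeta_four]; ring

lemma scaledPeriodPair_g₃ (τ : ℍ) (c : ℂ) (hc : c ≠ 0) :
    (scaledPeriodPair τ c hc).g₃ = (c ^ 6)⁻¹ * (8 * Real.pi ^ 6 / 27 * E₆ τ) := by
  have h := scaledPeriodPair_G τ c hc (k := 6) (by norm_num)
  rw [PeriodPair.g₃, h, Nat.cast_ofNat, riemannZeta_six]; ring

/-- Every pair of invariants is realised by a Weierstrass function, possibly degenerate. -/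
lemma exists_isWeierstrassP (g₂ g₃ : ℂ) : ∃ P, IsWeierstrassP g₂ g₃ P := by
  by_cases hdisc : g₂ ^ 3 = 27 * g₃ ^ 2
  · by_cases h0 : g₂ = 0
    · have h3 : g₃ = 0 := by
        rw [h0] at hdisc
        have : g₃ ^ 2 = 0 := by linear_combination (-1 / 27 : ℂ) * hdisc
        exact pow_eq_zero_iff (two_ne_zero) |>.1 this
      subst h0; subst h3
      exact ⟨_, .rational⟩
    -- In the trigonometric case g₂ = 4c⁴/3 and g₃ = −8c⁶/27, hence g₃/g₂ = −2c²/9; this determines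
    -- c².
    · obtain ⟨c, hc⟩ := IsAlgClosed.exists_pow_nat_eq (-9 * g₃ / (2 * g₂)) (n := 2) (by norm_num)
      have h4 : 4 * c ^ 4 / 3 = g₂ := by
        have : c ^ 4 = (c ^ 2) ^ 2 := by ring
        rw [this, hc]; field_simp; linear_combination (-12 : ℂ) * hdisc
      have h6 : -8 * c ^ 6 / 27 = g₃ := by
        have : c ^ 6 = (c ^ 2) ^ 3 := by ring
        rw [this, hc]; field_simp; linear_combination (-216 * g₃ : ℂ) * hdisc
      have hc0 : c ≠ 0 := by
        rintro rfl
        apply h0; rw [← h4]; norm_num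
      have := IsWeierstrassP.trigonometric c hc0
      rw [h4, h6] at this
      exact ⟨_, this⟩
  · have hpi : (Real.pi : ℂ) ≠ 0 := by exact_mod_cast Real.pi_ne_zero
    obtain ⟨τ, hτ⟩ := exists_eisenstein_relation (A := 27 * g₃ ^ 2) (B := g₂ ^ 3) (Ne.symm hdisc)
    set a : ℂ := 4 * Real.pi ^ 4 / 3 * E₄ τ with ha
    set b : ℂ := 8 * Real.pi ^ 6 / 27 * E₆ τ with hb
    have hab : g₃ ^ 2 * a ^ 3 = g₂ ^ 3 * b ^ 2 := by
      rw [ha, hb]; linear_combination (64 * (Real.pi : ℂ) ^ 12 / 729) * hτ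
    have hne : ¬ (a = 0 ∧ b = 0) := by
      rintro ⟨h1, h2⟩
      have h4 : E₄ τ = 0 := (mul_eq_zero.1 h1).resolve_left (by simp [hpi])
      have h6 : E₆ τ = 0 := (mul_eq_zero.1 h2).resolve_left (by simp [hpi])
      apply discriminant_ne_zero τ
      rw [discriminant_eq_E₄_cube_sub_E₆_sq, h4, h6]; norm_num
    -- The choice of τ only matches the ratio of g₂³ to g₃². What is left is the homothety of the
    -- lattice, with factor m⁻¹. If neither invariant is 0, the two conditions determine m²; if one
    -- of them is 0, the other condition determines m⁴ or m⁶.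
    suffices h : ∃ m : ℂ, m ≠ 0 ∧ m ^ 4 * a = g₂ ∧ m ^ 6 * b = g₃ by
      obtain ⟨m, hm, h2, h3⟩ := h
      have h := IsWeierstrassP.elliptic (scaledPeriodPair τ m⁻¹ (inv_ne_zero hm))
      rw [scaledPeriodPair_g₂, scaledPeriodPair_g₃, ← ha, ← hb] at h
      simp only [inv_pow, inv_inv, h2, h3] at h
      exact ⟨_, h⟩
    by_cases h2 : g₂ = 0
    · have h3 : g₃ ≠ 0 := fun h => hdisc (by rw [h2, h]; norm_num)
      have ha0 : a = 0 := by
        rw [h2] at hab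
        have : g₃ ^ 2 * a ^ 3 = 0 := by rw [hab]; ring
        simpa [h3] using this
      have hb0 : b ≠ 0 := fun h => hne ⟨ha0, h⟩
      obtain ⟨m, hm⟩ := IsAlgClosed.exists_pow_nat_eq (g₃ / b) (n := 6) (by norm_num)
      refine ⟨m, ?_, by rw [ha0, h2, mul_zero], by rw [hm]; field_simp⟩
      rintro rfl
      exact div_ne_zero h3 hb0 (by rw [← hm]; norm_num)
    · by_cases h3 : g₃ = 0
      · have hb0 : b = 0 := by
          rw [h3] at hab
          have : g₂ ^ 3 * b ^ 2 = 0 := by rw [← hab]; ring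
          simpa [h2] using this
        have ha0 : a ≠ 0 := fun h => hne ⟨h, hb0⟩
        obtain ⟨m, hm⟩ := IsAlgClosed.exists_pow_nat_eq (g₂ / a) (n := 4) (by norm_num)
        refine ⟨m, ?_, by rw [hm]; field_simp, by rw [hb0, h3, mul_zero]⟩
        rintro rfl
        exact div_ne_zero h2 ha0 (by rw [← hm]; norm_num)
      · have ha0 : a ≠ 0 := by
          intro h
          refine hne ⟨h, ?_⟩
          have : g₂ ^ 3 * b ^ 2 = 0 := by rw [← hab, h]; ring
          simpa [h2] using this
        have hb0 : b ≠ 0 := by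
          intro h
          refine ha0 ?_
          have : g₃ ^ 2 * a ^ 3 = 0 := by rw [hab, h]; ring
          simpa [h3] using this
        obtain ⟨m, hm⟩ := IsAlgClosed.exists_pow_nat_eq (g₃ * a / (b * g₂)) (n := 2) (by norm_num)
        refine ⟨m, ?_, ?_, ?_⟩
        · rintro rfl
          exact div_ne_zero (mul_ne_zero h3 ha0) (mul_ne_zero hb0 h2) (by rw [← hm]; norm_num)
        · have : m ^ 4 = (m ^ 2) ^ 2 := by ring
          rw [this, hm]; field_simp; linear_combination hab
        · have : m ^ 6 = (m ^ 2) ^ 3 := by ring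
          rw [this, hm]; field_simp; linear_combination hab

end Uniformization

/-- For three points the functional equation forces the Weierstrass form. -/
lemma isWeierstrassForm_of_isSolution {f : ℂ → ℂ} (hm : ∀ x : ℝ, MeromorphicAt f x)
    (ho : meromorphicOrderAt f 0 = ((-2 : ℤ) : WithTop ℤ))
    (he : ∀ x : ℝ, f (-(x : ℂ)) = f x)
    (hsol : IsSolution (Option (Option Unit)) (fun x : ℝ => f x)
      {x : ℝ | ¬ AnalyticAt ℂ f x}) : IsWeierstrassForm f := by
  obtain ⟨β, hβ, g, hg, hf⟩ := exists_pole_form ho he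
  obtain ⟨g₂, g₃, hode⟩ := exists_weierstrass_ode hβ hg hf he hsol
  obtain ⟨P, hP⟩ := exists_isWeierstrassP g₂ g₃
  refine ⟨g 0, β, g₂, g₃, P, hP, ?_⟩
  obtain ⟨Λ, hW⟩ := hP.exists_isWeierstrassLike
  obtain ⟨q, hq, hPq⟩ := hW.pole
  have hloc : ∀ᶠ u in 𝓝[≠] (0 : ℂ), (f u - g 0) / β = P u := by
    refine eventuallyEq_of_weierstrass_ode (P₁ := fun z => (f z - g 0) / β)
      (q₁ := fun z => (g z - g 0) / β) ((hg.sub analyticAt_const).div analyticAt_const hβ) hq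
      ?_ hPq hode ?_
    · filter_upwards [hf, self_mem_nhdsWithin] with u hu hu0
      have hu0 : u ≠ 0 := hu0
      rw [hu]; field_simp; ring
    · filter_upwards [hW.doublePeriodic.discrete] with u hu using hW.ode u hu
  have hP0 : MeromorphicAt P 0 := by
    have h1 : MeromorphicAt (fun u => 1 / u ^ 2 + q u) 0 :=
      ((MeromorphicAt.const 1 0).div ((MeromorphicAt.id 0).pow 2)).add hq.meromorphicAt
    exact h1.congr (by filter_upwards [hPq] with u hu using hu.symm)
  have hPm : ∀ z : ℂ, MeromorphicAt P z := by
    intro z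
    by_cases hz : z ∈ Λ
    · have h1 : P = fun w => P (w - z) := by
        funext w
        rw [← hW.doublePeriodic.periodic z hz (w - z), sub_add_cancel]
      rw [h1]
      have h2 : MeromorphicAt P (z - z) := by rwa [sub_self]
      exact h2.comp_analyticAt (f := P) (g := fun w => w - z) (by fun_prop)
    · exact (hW.doublePeriodic.analytic z hz).meromorphicAt
  intro x
  have := eventuallyEq_real_of_eventuallyEq (φ := fun z => g 0 + β * P z) hm
    (fun x => (MeromorphicAt.const _ _).add ((MeromorphicAt.const _ _).mul (hPm x))) (by
      filter_upwards [hloc] with u hu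
      rw [← hu]; field_simp; ring) x
  exact this

/-! ### Bounded solutions on the line: Lipschitz estimates -/

/-- An even function on the real line, analytic and bounded away from a double pole at `0`. -/
structure IsLineFunction (p : ℝ → ℂ) (β : ℂ) : Prop where
  even : ∀ x, p (-x) = p x
  ne_zero : β ≠ 0
  analytic : ∀ x, x ≠ 0 → AnalyticAt ℝ p x
  pole : ∃ g : ℝ → ℂ, AnalyticAt ℝ g 0 ∧ ∀ᶠ u in 𝓝[≠] (0 : ℝ), p u = β / (u : ℂ) ^ 2 + g u
  bounded : ∀ δ : ℝ, 0 < δ → ∃ C : ℝ, ∀ x : ℝ, δ ≤ |x| → ‖p x‖ ≤ C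

namespace IsLineFunction

variable {p : ℝ → ℂ} {β : ℂ}

lemma differentiableAt (hp : IsLineFunction p β) {x : ℝ} (hx : x ≠ 0) : DifferentiableAt ℝ p x :=
  (hp.analytic x hx).differentiableAt

lemma tendsto_sq_mul (hp : IsLineFunction p β) :
    Tendsto (fun u : ℝ => (u : ℂ) ^ 2 * p u) (𝓝[≠] 0) (𝓝 β) := by
  obtain ⟨g, hg, h⟩ := hp.pole
  have h1 : Tendsto (fun u : ℝ => β + (u : ℂ) ^ 2 * g u) (𝓝 0) (𝓝 (β + ((0 : ℝ) : ℂ) ^ 2 * g 0)) := by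
    refine tendsto_const_nhds.add (Tendsto.mul ?_ hg.continuousAt.tendsto)
    exact (Complex.continuous_ofReal.pow 2).tendsto 0
  simp only [Complex.ofReal_zero, ne_eq, OfNat.ofNat_ne_zero, not_false_eq_true, zero_pow, zero_mul,
    add_zero] at h1
  refine (h1.mono_left nhdsWithin_le_nhds).congr' ?_
  filter_upwards [h, self_mem_nhdsWithin] with u hu hu0
  have : (u : ℂ) ≠ 0 := Complex.ofReal_ne_zero.2 hu0
  rw [hu]; field_simp

lemma eventually_ne_zero (hp : IsLineFunction p β) : ∀ᶠ u in 𝓝[≠] (0 : ℝ), p u ≠ 0 := by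
  filter_upwards [hp.tendsto_sq_mul.eventually_ne hp.ne_zero] with u hu h
  exact hu (by rw [h, mul_zero])

end IsLineFunction

lemma norm_prod_sub_prod_le {ι : Type*} (s : Finset ι) {a b : ι → ℂ} {C : ℝ} (hC : 1 ≤ C)
    (ha : ∀ i ∈ s, ‖a i‖ ≤ C) (hb : ∀ i ∈ s, ‖b i‖ ≤ C) :
    ‖∏ i ∈ s, a i - ∏ i ∈ s, b i‖ ≤ C ^ s.card * ∑ i ∈ s, ‖a i - b i‖ := by
  classical
  induction s using Finset.induction_on with
  | empty => simp
  | insert i s hi ih =>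
    rw [Finset.prod_insert hi, Finset.prod_insert hi, Finset.sum_insert hi,
      Finset.card_insert_of_notMem hi]
    have ih := ih (fun j hj => ha j (Finset.mem_insert_of_mem hj))
      (fun j hj => hb j (Finset.mem_insert_of_mem hj))
    have hbs : ‖∏ j ∈ s, b j‖ ≤ C ^ s.card := by
      rw [norm_prod]
      exact (Finset.prod_le_prod (fun _ _ => norm_nonneg _)
        fun j hj => hb j (Finset.mem_insert_of_mem hj)).trans (by simp)
    have hai := ha i (Finset.mem_insert_self i s)
    have hC0 : 0 ≤ C := by linarith
    have hCp : 0 ≤ C ^ s.card := by positivity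
    have hS : 0 ≤ ∑ j ∈ s, ‖a j - b j‖ := Finset.sum_nonneg fun j _ => norm_nonneg _
    have e : a i * ∏ j ∈ s, a j - b i * ∏ j ∈ s, b j =
        a i * (∏ j ∈ s, a j - ∏ j ∈ s, b j) + (a i - b i) * ∏ j ∈ s, b j := by ring
    rw [e]
    calc _ ≤ C * (C ^ s.card * ∑ j ∈ s, ‖a j - b j‖) + ‖a i - b i‖ * C ^ s.card := by
          refine (norm_add_le _ _).trans (add_le_add ?_ ?_)
          · rw [norm_mul]
            exact mul_le_mul hai ih (norm_nonneg _) hC0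
          · rw [norm_mul]
            exact mul_le_mul_of_nonneg_left hbs (norm_nonneg _)
      _ ≤ _ := by
          have h1 : C ^ s.card * ‖a i - b i‖ ≤ C * (C ^ s.card * ‖a i - b i‖) :=
            le_mul_of_one_le_left (by positivity) hC
          rw [pow_succ]
          nlinarith

/-- Contraction of the increments at the shifted arguments gives a Lipschitz bound. -/
lemma exists_lipschitz_of_contraction {ι : Type*} [Fintype ι] {u : ℝ → ℂ} {c x : ι → ℝ}
    {B L M θ : ℝ} (hb : ∀ w, 1 ≤ w → ‖u w‖ ≤ B)
    (hloc : ∀ w s, 1 ≤ w → w ≤ 2 → 0 ≤ s → s ≤ 1 → ‖u (w + s) - u w‖ ≤ L * s)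
    (hc : ∀ i, 0 ≤ c i) (hθ : ∑ i, c i ≤ θ) (hθ1 : θ < 1) (hx : ∀ i, |x i| ≤ 1)
    (h : ∀ w s, 2 ≤ w → 0 ≤ s → s ≤ 1 →
      ‖u (w + s) - u w‖ ≤ ∑ i, c i * ‖u (w + s - x i) - u (w - x i)‖ + M * s) :
    ∃ L', ∀ w s, 1 ≤ w → 0 ≤ s → s ≤ 1 → ‖u (w + s) - u w‖ ≤ L' * s := by
  refine ⟨max L (M / (1 - θ)), fun w s hw hs hs1 => ?_⟩
  set Δ : Set.Ici (1 : ℝ) → ℝ := fun w => ‖u (w + s) - u w‖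
  have hbd : BddAbove (Set.range Δ) := by
    refine ⟨B + B, ?_⟩
    rintro _ ⟨w, rfl⟩
    have hw1 : (1 : ℝ) ≤ w := w.2
    exact (norm_sub_le _ _).trans (add_le_add (hb _ (by linarith)) (hb _ hw1))
  -- The supremum of the increments with step s is finite since u is bounded. It satisfies ω ≤
  -- max(Ls, θω + Ms): on [1, 2] the local bound applies, and for w ≥ 2 all the arguments w − x i
  -- are still at least 1. As θ < 1, ω is at most a multiple of s.
  set ω := ⨆ w, Δ w
  have hle : ∀ w (hw : 1 ≤ w), ‖u (w + s) - u w‖ ≤ ω := fun w hw =>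
    le_ciSup hbd (⟨w, hw⟩ : Set.Ici (1 : ℝ))
  have hω0 : 0 ≤ ω := (norm_nonneg _).trans (hle 1 le_rfl)
  have : Nonempty (Set.Ici (1 : ℝ)) := ⟨⟨1, Set.self_mem_Ici⟩⟩
  have key : ω ≤ max (L * s) (θ * ω + M * s) := by
    refine ciSup_le fun w => ?_
    have hw1 : (1 : ℝ) ≤ w := w.2
    rcases le_total (w : ℝ) 2 with h2 | h2
    · exact (hloc _ _ hw1 h2 hs hs1).trans (le_max_left _ _)
    · refine (h _ _ h2 hs hs1).trans (le_trans ?_ (le_max_right _ _))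
      gcongr
      calc _ ≤ ∑ i, c i * ω := by
            refine Finset.sum_le_sum fun i _ => mul_le_mul_of_nonneg_left ?_ (hc i)
            have := hle (w - x i) (by have := (abs_le.1 (hx i)).2; linarith)
            rwa [show (w : ℝ) - x i + s = w + s - x i by ring] at this
        _ = (∑ i, c i) * ω := by rw [Finset.sum_mul]
        _ ≤ θ * ω := mul_le_mul_of_nonneg_right hθ hω0
  refine (hle w hw).trans ?_
  rw [max_mul_of_nonneg _ _ hs]
  rcases le_max_iff.1 key with h1 | h1
  · exact h1.trans (le_max_left _ _)
  · refine le_trans ?_ (le_max_right _ _)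
    rw [div_mul_eq_mul_div, le_div_iff₀ (by linarith)]
    nlinarith

section Dominant

variable {p : ℝ → ℂ} {β : ℂ} {r : ℕ}

/-- There are configurations for which one of the coefficients of the functional equation
dominates all others. -/
lemma IsLineFunction.exists_dominant (hp : IsLineFunction p β) (K : ℝ) :
    ∃ x : Option (Option (Option (Fin r))) → ℝ, (∀ i j, i ≠ j → x i - x j ≠ 0) ∧ x none = 0 ∧
      (∀ i, |x i| ≤ 1) ∧
      ∑ i, ‖partialProd p x (some i) (x (some i))‖ + K < ‖partialProd p x none (x none)‖ := by
  obtain ⟨ε, hε, hne⟩ : ∃ ε > 0, ∀ u : ℝ, 0 < u → u < ε → p u ≠ 0 := by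
    have := hp.eventually_ne_zero
    rw [eventually_nhdsWithin_iff, Metric.eventually_nhds_iff] at this
    obtain ⟨ε, hε, h⟩ := this
    exact ⟨ε, hε, fun u hu hlt => h (by simpa [abs_of_pos hu] using hlt) (Set.mem_compl_singleton_iff.2 hu.ne')⟩
  set η := min ε 1 with hη
  have hη0 : 0 < η := by positivity
  -- The configuration consists of 0, t, −t and fixed points d k in (0, η), where p has no zero.
  -- With D = ∏ p(d k), as t → 0 the coefficient at 0 behaves like β²D/t⁴, those at t and −t behave
  -- like β²D/(4t⁴), and those at the d k stay bounded. Since 1/4 + 1/4 < 1, the first one finally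
  -- exceeds the sum of the others by more than any K.
  set d : Fin r → ℝ := fun k => η * ((k : ℝ) + 1) / (r + 1) with hd
  have hd0 : ∀ k, 0 < d k := fun k => by positivity
  have hdη : ∀ k, d k < η := by
    intro k
    rw [hd]; simp only
    rw [div_lt_iff₀ (by positivity)]
    have : (k : ℝ) < r := by exact_mod_cast k.2
    nlinarith
  have hdinj : ∀ i j, i ≠ j → d i - d j ≠ 0 := by
    intro i j hij h
    apply hij
    have h1 : d i = d j := by linarith
    simp only [hd] at h1
    have h2 : η * ((i : ℝ) + 1) = η * ((j : ℝ) + 1) := by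
      have : (r : ℝ) + 1 ≠ 0 := by positivity
      field_simp at h1
      nlinarith
    have h3 := mul_left_cancel₀ hη0.ne' h2
    exact Fin.ext (by exact_mod_cast (by linarith : (i : ℝ) = j))
  have hD : fullProd p d 0 ≠ 0 := by
    rw [fullProd, Finset.prod_ne_zero_iff]
    intro k _
    rw [zero_sub, hp.even]
    exact hne _ (hd0 k) ((hdη k).trans_le (min_le_left _ _))
  set x : ℝ → Option (Option (Option (Fin r))) → ℝ := fun t =>
    addPoint 0 (addPoint t (addPoint (-t) d)) with hx
  have hca : ∀ k, ContinuousAt p (0 - d k) := fun k =>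
    (hp.differentiableAt (by linarith [hd0 k])).continuousAt
  have hcF : ContinuousAt (fullProd p d) 0 :=
    (differentiableAt_fullProd fun j => hp.differentiableAt (by linarith [hd0 j])).continuousAt
  have hcF' : ContinuousAt (fun t => fullProd p d (-t)) 0 :=
    ContinuousAt.comp (g := fullProd p d) (by simpa using hcF) continuousAt_neg
  have hle : 𝓝[>] (0 : ℝ) ≤ 𝓝[≠] 0 := nhdsWithin_mono _ fun t (ht : 0 < t) => ht.ne'
  have ha : Tendsto (fun u : ℝ => (u : ℂ) ^ 2 * p u) (𝓝[>] 0) (𝓝 β) := hp.tendsto_sq_mul.mono_left hle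
  have ha2 : Tendsto (fun u : ℝ => ((2 * u : ℝ) : ℂ) ^ 2 * p (2 * u)) (𝓝[>] 0) (𝓝 β) := by
    refine ha.comp (tendsto_nhdsWithin_iff.2 ⟨?_, ?_⟩)
    · have : Continuous fun u : ℝ => 2 * u := by fun_prop
      simpa using (this.tendsto 0).mono_left nhdsWithin_le_nhds
    · filter_upwards [self_mem_nhdsWithin] with u hu
      have : 0 < u := hu
      simpa using this
  have hn : 𝓝[>] (0 : ℝ) ≤ 𝓝 0 := nhdsWithin_le_nhds
  have h0 : Tendsto (fun t : ℝ => (t : ℂ) ^ 4 * partialProd p (x t) none (x t none)) (𝓝[>] 0)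
      (𝓝 (β * (β * fullProd p d 0))) := by
    refine (ha.mul (ha.mul_const (fullProd p d 0))).congr fun t => ?_
    rw [hx]; simp only [partialProd_addPoint_none, fullProd_addPoint, addPoint_none]
    rw [zero_sub, hp.even, zero_sub, neg_neg]; ring
  have h1 : Tendsto (fun t : ℝ => (t : ℂ) ^ 4 *
      partialProd p (x t) (some none) (x t (some none))) (𝓝[>] 0)
      (𝓝 (β * (β / 4 * fullProd p d 0))) := by
    refine (ha.mul ((ha2.div_const 4).mul (hcF.tendsto.mono_left hn))).congr fun t => ?_
    rw [hx]; simp only [partialProd_addPoint_none, partialProd_addPoint_some, fullProd_addPoint,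
      addPoint_none, addPoint_some]
    rw [sub_zero, show t - -t = 2 * t by ring]; push_cast; ring
  have h2 : Tendsto (fun t : ℝ => (t : ℂ) ^ 4 *
      partialProd p (x t) (some (some none)) (x t (some (some none)))) (𝓝[>] 0)
      (𝓝 (β * (β / 4 * fullProd p d 0))) := by
    have : Tendsto (fun t => fullProd p d (-t)) (𝓝[>] 0) (𝓝 (fullProd p d 0)) := by
      have := hcF'.tendsto.mono_left hn
      rwa [neg_zero] at this
    refine (ha.mul ((ha2.div_const 4).mul this)).congr fun t => ?_
    rw [hx]; simp only [partialProd_addPoint_none, partialProd_addPoint_some,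
      addPoint_none, addPoint_some]
    rw [sub_zero, hp.even, show -t - t = -(2 * t) by ring, hp.even]; push_cast; ring
  have h3 : ∀ k, Tendsto (fun t : ℝ => (t : ℂ) ^ 4 *
      partialProd p (x t) (some (some (some k))) (x t (some (some (some k))))) (𝓝[>] 0)
      (𝓝 0) := by
    intro k
    have hk : ContinuousAt p (d k) := (hp.differentiableAt (hd0 k).ne').continuousAt
    have t1 : ContinuousAt (fun t : ℝ => p (d k - t)) 0 :=
      ContinuousAt.comp (g := p) (by simpa using hk) (by fun_prop)
    have t2 : ContinuousAt (fun t : ℝ => p (d k - -t)) 0 :=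
      ContinuousAt.comp (g := p) (by simpa using hk) (by fun_prop)
    have t3 : ContinuousAt (fun t : ℝ => (t : ℂ) ^ 4) 0 :=
      (Complex.continuous_ofReal.pow 4).continuousAt
    have := (t3.tendsto.mul ((tendsto_const_nhds (x := p (d k - 0))).mul (t1.tendsto.mul
      (t2.tendsto.mul (tendsto_const_nhds (x := partialProd p d k (d k))))))).mono_left hn
    simp only [Complex.ofReal_zero, ne_eq, OfNat.ofNat_ne_zero, not_false_eq_true, zero_pow,
      zero_mul] at this
    refine this.congr fun t => ?_
    rw [hx]; simp only [partialProd_addPoint_some, addPoint_some]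
  have hlim : Tendsto (fun t : ℝ => ∑ i, ‖(t : ℂ) ^ 4 * partialProd p (x t) (some i) (x t (some i))‖
      + t ^ 4 * K) (𝓝[>] 0) (𝓝 (‖β * (β / 4 * fullProd p d 0)‖ +
        (‖β * (β / 4 * fullProd p d 0)‖ + ∑ k : Fin r, ‖(0 : ℂ)‖) + 0 ^ 4 * K)) := by
    simp only [Fintype.sum_option]
    refine (h1.norm.add (h2.norm.add (tendsto_finsetSum _ fun k _ => (h3 k).norm))).add ?_
    have : Continuous fun t : ℝ => t ^ 4 * K := by fun_prop
    exact (this.tendsto 0).mono_left hn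
  have hlt : ‖β * (β / 4 * fullProd p d 0)‖ + (‖β * (β / 4 * fullProd p d 0)‖ +
      ∑ k : Fin r, ‖(0 : ℂ)‖) + 0 ^ 4 * K < ‖β * (β * fullProd p d 0)‖ := by
    have hpos : 0 < ‖β * (β * fullProd p d 0)‖ :=
      norm_pos_iff.2 (mul_ne_zero hp.ne_zero (mul_ne_zero hp.ne_zero hD))
    have e : ‖β * (β / 4 * fullProd p d 0)‖ = ‖β * (β * fullProd p d 0)‖ / 4 := by
      rw [show β * (β / 4 * fullProd p d 0) = β * (β * fullProd p d 0) / 4 by ring, norm_div]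
      norm_num
    rw [e]; simp only [norm_zero, Finset.sum_const_zero]; linarith
  have hsmall : ∀ᶠ t in 𝓝[>] (0 : ℝ), (∀ k, t < d k) ∧ t < 1 := by
    refine Eventually.and (eventually_all.2 fun k => ?_) ?_
    · exact hn (gt_mem_nhds (hd0 k))
    · exact hn (gt_mem_nhds one_pos)
  obtain ⟨t, htlt, ⟨htd, ht1⟩, ht0⟩ :=
    ((hlim.eventually_lt h0.norm hlt).and (hsmall.and self_mem_nhdsWithin)).exists
  have ht0 : 0 < t := ht0
  refine ⟨x t, ?_, rfl, ?_, ?_⟩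
  · refine addPoint_sub_notMem (S := {0}) (by simp) ?_ (addPoint_sub_notMem (by simp) ?_
      (addPoint_sub_notMem (by simp) ?_ hdinj))
    · rintro (_ | _ | k)
      · simpa using ht0.ne'
      · simpa using ht0.ne'
      · simpa using (hd0 k).ne'
    · rintro (_ | k)
      · simp only [addPoint_none, Set.mem_singleton_iff]; linarith
      · simp only [addPoint_some, Set.mem_singleton_iff]; linarith [htd k]
    · intro k
      simp only [Set.mem_singleton_iff]; linarith [hd0 k]
  · have hd1 : ∀ k, d k < 1 := fun k => (hdη k).trans_le (min_le_right _ _)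
    rintro (_ | _ | _ | k)
    · simp [hx]
    · simp only [hx, addPoint_some, addPoint_none, abs_of_pos ht0]; exact ht1.le
    · simp only [hx, addPoint_some, addPoint_none, abs_neg, abs_of_pos ht0]; exact ht1.le
    · simp only [hx, addPoint_some, abs_of_pos (hd0 k)]; exact (hd1 k).le
  · have hn4 : ∀ z : ℂ, ‖(t : ℂ) ^ 4 * z‖ = t ^ 4 * ‖z‖ := by
      intro z
      rw [norm_mul, norm_pow, Complex.norm_real, Real.norm_of_nonneg ht0.le]
    simp only [hn4, ← Finset.mul_sum, ← mul_add] at htlt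
    exact lt_of_mul_lt_mul_left htlt (by positivity)

end Dominant

section Lipschitz

variable {p : ℝ → ℂ} {β : ℂ} {ι : Type*} [Fintype ι] [DecidableEq ι]

lemma IsLineFunction.lipschitz_local {u : ℝ → ℂ} (hu : ∀ x : ℝ, x ≠ 0 → AnalyticAt ℝ u x) :
    ∃ L, ∀ w s, 1 ≤ w → w ≤ 2 → 0 ≤ s → s ≤ 1 → ‖u (w + s) - u w‖ ≤ L * s := by
  have hc : ContinuousOn (deriv u) (Set.Icc 1 3) := fun x hx =>
    (hu x (by linarith [hx.1])).deriv.continuousAt.continuousWithinAt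
  obtain ⟨L, hL⟩ := isCompact_Icc.exists_bound_of_continuousOn hc
  refine ⟨L, fun w s h1 h2 h3 h4 => ?_⟩
  have := (convex_Icc (1 : ℝ) 3).norm_image_sub_le_of_norm_deriv_le (f := u)
    (fun x hx => (hu x (by linarith [hx.1])).differentiableAt) hL
    (x := w) (y := w + s) ⟨h1, by linarith⟩ ⟨by linarith, by linarith⟩
  simpa [abs_of_nonneg h3] using this

/-- The functional equation after adding one point, solved for the derivatives at that point. -/
lemma IsLineFunction.sum_deriv_mul (hp : IsLineFunction p β) {x : ι → ℝ}
    (hsol : IsSolution (Option ι) p {0}) (hx : ∀ i j, i ≠ j → x i - x j ≠ 0) {w : ℝ}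
    (hw : ∀ i, w - x i ≠ 0) :
    ∑ i, deriv p (w - x i) * (partialProd p x i w - partialProd p x i (x i)) =
      - ∑ i, p (w - x i) * deriv (partialProd p x i) (x i) := by
  have h := hsol (addPoint w x) (addPoint_sub_notMem (by simp) hw hx)
  rw [divSum_addPoint (fun i => hp.differentiableAt (sub_ne_zero.2 (sub_ne_zero.1 (hw i)).symm))
    (fun i j hij => hp.differentiableAt (hx i j hij)),
    deriv_fullProd (fun i => hp.differentiableAt (hw i)), ← Finset.sum_add_distrib] at h
  have e1 : ∀ i, p (x i - w) = p (w - x i) := fun i => by rw [← hp.even]; congr 1; ring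
  have e2 : ∀ i, deriv p (x i - w) = - deriv p (w - x i) := fun i => by
    rw [← deriv_neg_of_even hp.even]; congr 1; ring
  simp only [e1, e2] at h
  rw [eq_neg_iff_add_eq_zero, ← Finset.sum_add_distrib, ← h]
  exact Finset.sum_congr rfl fun i _ => by ring

end Lipschitz

namespace IsLineFunction

variable {p : ℝ → ℂ} {β : ℂ}

section

variable {ι : Type*} [Fintype ι] [DecidableEq ι]

lemma norm_prod_le_pow_card (s : Finset ι) {a : ι → ℂ} {C : ℝ} (hC : 1 ≤ C)
    (ha : ∀ i ∈ s, ‖a i‖ ≤ C) : ‖∏ i ∈ s, a i‖ ≤ C ^ Fintype.card ι := by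
  rw [norm_prod]
  calc _ ≤ ∏ i ∈ s, C := Finset.prod_le_prod (fun _ _ => norm_nonneg _) ha
    _ = C ^ s.card := by simp
    _ ≤ _ := pow_le_pow_right₀ hC (Finset.card_le_univ s)

lemma norm_prod_sub_prod_le' (s : Finset ι) {a b : ι → ℂ} {C : ℝ} (hC : 1 ≤ C)
    (ha : ∀ i ∈ s, ‖a i‖ ≤ C) (hb : ∀ i ∈ s, ‖b i‖ ≤ C) :
    ‖∏ i ∈ s, a i - ∏ i ∈ s, b i‖ ≤ C ^ Fintype.card ι * ∑ i, ‖a i - b i‖ := by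
  have hC0 : 0 ≤ C := by linarith
  refine (norm_prod_sub_prod_le s hC ha hb).trans (mul_le_mul (pow_le_pow_right₀ hC
    (Finset.card_le_univ s)) (Finset.sum_le_univ_sum_of_nonneg fun _ => norm_nonneg _)
    (Finset.sum_nonneg fun _ _ => norm_nonneg _) (by positivity))

end

/-- A solution for at least four points is Lipschitz away from the pole. -/
lemma exists_lipschitz (hp : IsLineFunction p β) {r : ℕ}
    (hsol : IsSolution (Option (Option (Option (Option (Fin r))))) p {0}) :
    (∃ L, ∀ w, 1 ≤ w → ‖deriv p w‖ ≤ L) ∧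
    ∃ L, ∀ w s, 1 ≤ w → 0 ≤ s → s ≤ 1 → ‖deriv p (w + s) - deriv p w‖ ≤ L * s := by
  obtain ⟨C₀, hC₀⟩ := hp.bounded 1 one_pos
  set C := max C₀ 1
  have hC1 : 1 ≤ C := le_max_right _ _
  have hC0 : 0 < C := by linarith
  have hC : ∀ w, 1 ≤ w → ‖p w‖ ≤ C := fun w hw =>
    (hC₀ w (hw.trans (le_abs_self w))).trans (le_max_left _ _)
  set ι := Option (Option (Option (Fin r)))
  set N := Fintype.card ι
  set K := C ^ N
  have hK : 0 < K := by positivity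
  obtain ⟨x, hx, hx0, hx1, hdom⟩ := hp.exists_dominant (r := r) (N * K)
  set V : ι → ℂ := fun i => partialProd p x i (x i) with hV
  set M := C * ∑ i, ‖deriv (partialProd p x i) (x i)‖ with hM
  have hM0 : 0 ≤ M := mul_nonneg hC0.le (Finset.sum_nonneg fun _ _ => norm_nonneg _)
  have hV0 : 0 < ‖V none‖ := lt_of_le_of_lt (add_nonneg
    (Finset.sum_nonneg fun _ _ => norm_nonneg _) (by positivity)) hdom
  have hw1 : ∀ w, 2 ≤ w → ∀ i, 1 ≤ w - x i := fun w hw i => by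
    have := (abs_le.1 (hx1 i)).2; linarith
  have hw0 : ∀ w, 2 ≤ w → ∀ i, w - x i ≠ 0 := fun w hw i => by
    have := hw1 w hw i; linarith
  have hid : ∀ w, 2 ≤ w → ∑ i, deriv p (w - x i) * (partialProd p x i w - V i) =
      - ∑ i, p (w - x i) * deriv (partialProd p x i) (x i) := fun w hw =>
    hp.sum_deriv_mul hsol hx (hw0 w hw)
  have hsumM : ∀ w, 2 ≤ w → ‖∑ i, p (w - x i) * deriv (partialProd p x i) (x i)‖ ≤ M := by
    intro w hw
    rw [hM, Finset.mul_sum]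
    refine norm_sum_le_of_le _ fun i _ => ?_
    rw [norm_mul]
    exact mul_le_mul_of_nonneg_right (hC _ (hw1 w hw i)) (norm_nonneg _)
  -- Weights of the shifted increments once the equation is solved for the increment at x none = 0.
  -- The V i come from the terms linear in p, and K bounds the partial products of p(w − x j).
  -- Dominance with margin N · K makes the sum of the weights less than 1.
  set c : ι → ℝ := fun i => (K + if i = none then 0 else ‖V i‖) / ‖V none‖ with hc
  have hc0 : ∀ i, 0 ≤ c i := by
    intro i
    simp only [hc]
    split_ifs <;> positivity
  have hθ : ∑ i, c i < 1 := by
    rw [hc, ← Finset.sum_div, div_lt_one hV0, Finset.sum_add_distrib]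
    rw [Finset.sum_const, Finset.card_univ, nsmul_eq_mul]
    have : ∑ i : ι, (if i = none then 0 else ‖V i‖) = ∑ i, ‖V (some i)‖ := by
      rw [Fintype.sum_option]; simp
    rw [this]
    have := hdom
    simp only [hV, N, ι] at this ⊢
    linarith
  -- the abstract form of both estimates
  have hstep : ∀ (u : ℝ → ℂ) (M' : ℝ), (∀ w s, 2 ≤ w → 0 ≤ s → s ≤ 1 →
      ‖∑ i, V i * (u (w + s - x i) - u (w - x i))‖ ≤
        K * ∑ i, ‖u (w + s - x i) - u (w - x i)‖ + M' * s) →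
      ∀ w s, 2 ≤ w → 0 ≤ s → s ≤ 1 → ‖u (w + s) - u w‖ ≤
        ∑ i, c i * ‖u (w + s - x i) - u (w - x i)‖ + M' / ‖V none‖ * s := by
    intro u M' h w s hw hs hs1
    have h1 := h w s hw hs hs1
    set D : ι → ℂ := fun i => u (w + s - x i) - u (w - x i) with hD
    have hDn : D none = u (w + s) - u w := by simp [hD, hx0]
    have h2 : ‖V none‖ * ‖D none‖ ≤ ‖∑ i, V i * D i‖ + ∑ i, ‖V (some i)‖ * ‖D (some i)‖ := by
      rw [← norm_mul]
      have : V none * D none = ∑ i, V i * D i - ∑ i, V (some i) * D (some i) := by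
        rw [Fintype.sum_option]; ring
      rw [this]
      refine (norm_sub_le _ _).trans (add_le_add le_rfl ?_)
      exact norm_sum_le_of_le _ fun i _ => (norm_mul _ _).le
    have h3 : ∑ i, c i * ‖D i‖ = (K * ∑ i, ‖D i‖ + ∑ i, ‖V (some i)‖ * ‖D (some i)‖) / ‖V none‖ := by
      rw [Finset.mul_sum, Fintype.sum_option (f := fun i => c i * ‖D i‖),
        Fintype.sum_option (f := fun i => K * ‖D i‖), add_assoc,
        ← Finset.sum_add_distrib, add_div, Finset.sum_div]
      congr 1
      · simp only [hc, if_true]; ring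
      · refine Finset.sum_congr rfl fun i _ => ?_
        simp only [hc, reduceCtorEq, if_false]; ring
    rw [← hDn, h3, div_mul_eq_mul_div, ← add_div, le_div_iff₀ hV0]
    linarith
  have hpLip : ∃ L, ∀ w s, 1 ≤ w → 0 ≤ s → s ≤ 1 → ‖p (w + s) - p w‖ ≤ L * s := by
    obtain ⟨L₀, hL₀⟩ := lipschitz_local hp.analytic
    refine exists_lipschitz_of_contraction (u := p) (c := c) (x := x) hC hL₀ hc0 le_rfl hθ hx1
      (hstep p M ?_)
    intro w s hw hs hs1
    -- By the functional equation ψ' is a combination of values of p, hence bounded. So the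
    -- increments of ∑ V i p(w − x i) are those of the product up to O(s), and no bound on p' is
    -- needed beforehand.
    set ψ : ℝ → ℂ := fun w => fullProd p x w - ∑ i, V i * p (w - x i) with hψ
    have hψd : ∀ w, 2 ≤ w → HasDerivAt ψ (- ∑ i, p (w - x i) * deriv (partialProd p x i) (x i)) w := by
      intro w hw
      have h1 := (differentiableAt_fullProd (p := p) (x := x)
        fun j => hp.differentiableAt (hw0 w hw j)).hasDerivAt
      rw [deriv_fullProd fun j => hp.differentiableAt (hw0 w hw j)] at h1
      have h2 : HasDerivAt (fun w => ∑ i, V i * p (w - x i)) (∑ i, V i * deriv p (w - x i)) w := by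
        refine HasDerivAt.fun_sum fun i _ => ?_
        have := (hp.differentiableAt (hw0 w hw i)).hasDerivAt.comp_sub_const w (x i)
        exact this.const_mul (V i)
      refine (h1.sub h2).congr_deriv ?_
      rw [← hid w hw, ← Finset.sum_sub_distrib]
      exact Finset.sum_congr rfl fun i _ => by ring
    have hψb : ‖ψ (w + s) - ψ w‖ ≤ M * s := by
      have := (convex_Ici (2 : ℝ)).norm_image_sub_le_of_norm_hasDerivWithin_le (f := ψ)
        (fun x hx => (hψd x (Set.mem_Ici.1 hx)).hasDerivWithinAt) (C := M)
        (fun x hx => by rw [norm_neg]; exact hsumM x (Set.mem_Ici.1 hx)) (x := w) (y := w + s)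
        (Set.mem_Ici.2 hw) (Set.mem_Ici.2 (by linarith))
      simpa [abs_of_nonneg hs] using this
    have hws : 2 ≤ w + s := by linarith
    have hg : ‖fullProd p x (w + s) - fullProd p x w‖ ≤
        K * ∑ i, ‖p (w + s - x i) - p (w - x i)‖ :=
      norm_prod_sub_prod_le' Finset.univ hC1 (fun i _ => hC _ (hw1 _ hws i))
        (fun i _ => hC _ (hw1 _ hw i))
    have e : ∑ i, V i * (p (w + s - x i) - p (w - x i)) =
        (fullProd p x (w + s) - fullProd p x w) - (ψ (w + s) - ψ w) := by
      simp only [hψ, mul_sub, Finset.sum_sub_distrib]; ring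
    rw [e]
    exact (norm_sub_le _ _).trans (add_le_add hg hψb)
  obtain ⟨L, hL⟩ := hpLip
  have hL0 : 0 ≤ L := by
    have := (norm_nonneg _).trans (hL 1 1 le_rfl zero_le_one le_rfl); simpa using this
  have hq : ∀ w, 1 ≤ w → ‖deriv p w‖ ≤ L := by
    intro w hw
    have hd := (hp.differentiableAt (by linarith : w ≠ 0)).hasDerivAt
    have ht := (hasDerivAt_iff_tendsto_slope.1 hd).mono_left
      (nhdsWithin_mono (s := Set.Ioi w) w fun t (ht : w < t) => ht.ne')
    refine le_of_tendsto ht.norm ?_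
    filter_upwards [Ioo_mem_nhdsGT (show w < w + 1 by linarith)] with t htt
    have := hL w (t - w) hw (by linarith [htt.1]) (by linarith [htt.2])
    rw [add_sub_cancel] at this
    rw [slope_def_module, norm_smul, norm_inv, Real.norm_of_nonneg (by linarith [htt.1]),
      inv_mul_le_iff₀ (by linarith [htt.1])]
    linarith
  refine ⟨⟨L, hq⟩, ?_⟩
  -- The same contraction for p': the equation at w is subtracted from that at w + s, and the
  -- increments of p and of the products are now O(s) by the first part.
  obtain ⟨L₀, hL₀⟩ := lipschitz_local (u := deriv p) fun x hx => (hp.analytic x hx).deriv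
  refine exists_lipschitz_of_contraction (u := deriv p) (c := c) (x := x) hq hL₀ hc0 le_rfl hθ hx1
      (hstep (deriv p) (N * (L * (K * (N * L))) + L * ∑ i, ‖deriv (partialProd p x i) (x i)‖) ?_)
  intro w s hw hs hs1
  have hws : 2 ≤ w + s := by linarith
  have hpd : ∀ i, ‖p (w + s - x i) - p (w - x i)‖ ≤ L * s := fun i => by
    have := hL (w - x i) s (hw1 w hw i) hs hs1
    rwa [show w - x i + s = w + s - x i by ring] at this
  have e : ∑ i, V i * (deriv p (w + s - x i) - deriv p (w - x i)) =
      ∑ i, ((deriv p (w + s - x i) - deriv p (w - x i)) * partialProd p x i (w + s)) +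
      ∑ i, (deriv p (w - x i) * (partialProd p x i (w + s) - partialProd p x i w)) +
      ∑ i, (p (w + s - x i) - p (w - x i)) * deriv (partialProd p x i) (x i) := by
    have h1 := hid w hw
    have h2 := hid (w + s) hws
    rw [← sub_eq_zero] at h1 h2
    have h3 := h1.trans h2.symm
    simp only [sub_neg_eq_add, ← Finset.sum_add_distrib] at h3 ⊢
    rw [← sub_eq_zero, ← Finset.sum_sub_distrib] at h3 ⊢
    rw [← h3]
    exact Finset.sum_congr rfl fun i _ => by ring
  rw [e]
  have hP : ∀ i, ‖partialProd p x i (w + s)‖ ≤ K := fun i =>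
    norm_prod_le_pow_card _ hC1 fun j _ => hC _ (hw1 _ hws j)
  have hPd : ∀ i, ‖partialProd p x i (w + s) - partialProd p x i w‖ ≤ K * (N * (L * s)) := by
    intro i
    refine (norm_prod_sub_prod_le' _ hC1 (fun j _ => hC _ (hw1 _ hws j))
        (fun j _ => hC _ (hw1 _ hw j))).trans (mul_le_mul_of_nonneg_left ?_ hK.le)
    refine (Finset.sum_le_sum fun j _ => hpd j).trans ?_
    rw [Finset.sum_const, Finset.card_univ, nsmul_eq_mul]
  have b1 : ‖∑ i, ((deriv p (w + s - x i) - deriv p (w - x i)) * partialProd p x i (w + s))‖ ≤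
      K * ∑ i, ‖deriv p (w + s - x i) - deriv p (w - x i)‖ := by
    rw [Finset.mul_sum]
    refine norm_sum_le_of_le _ fun i _ => ?_
    rw [norm_mul, mul_comm]
    exact mul_le_mul_of_nonneg_right (hP i) (norm_nonneg _)
  have b2 : ‖∑ i, (deriv p (w - x i) * (partialProd p x i (w + s) - partialProd p x i w))‖ ≤
      N * (L * (K * (N * (L * s)))) := by
    refine (norm_sum_le_of_le (f := fun i => deriv p (w - x i) *
      (partialProd p x i (w + s) - partialProd p x i w)) _
      (n := fun _ => L * (K * (N * (L * s)))) fun i _ => ?_).trans ?_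
    · rw [norm_mul]
      exact mul_le_mul (hq _ (hw1 w hw i)) (hPd i) (norm_nonneg _) hL0
    · rw [Finset.sum_const, Finset.card_univ, nsmul_eq_mul]
  have b3 : ‖∑ i, (p (w + s - x i) - p (w - x i)) * deriv (partialProd p x i) (x i)‖ ≤
      (L * s) * ∑ i, ‖deriv (partialProd p x i) (x i)‖ := by
    rw [Finset.mul_sum]
    refine norm_sum_le_of_le _ fun i _ => ?_
    rw [norm_mul]
    exact mul_le_mul_of_nonneg_right (hpd i) (norm_nonneg _)
  refine (norm_add_le _ _).trans ((add_le_add ((norm_add_le _ _).trans (add_le_add b1 b2)) b3).trans ?_)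
  apply le_of_eq; ring

/-- The bounds for the Taylor remainder of first order. -/
lemma exists_taylor_bound (hp : IsLineFunction p β) {r : ℕ}
    (hsol : IsSolution (Option (Option (Option (Option (Fin r))))) p {0}) :
    ∃ L, (∀ w, 1 ≤ w → ‖deriv p w‖ ≤ L) ∧
      (∀ w s, 1 ≤ w → 1 ≤ w + s → |s| ≤ 1 → ‖p (w + s) - p w - s * deriv p w‖ ≤ L * s ^ 2) := by
  obtain ⟨⟨L₁, h₁⟩, L₂, h₂⟩ := hp.exists_lipschitz hsol
  refine ⟨max L₁ L₂, fun w hw => (h₁ w hw).trans (le_max_left _ _), fun w s hw hws hs => ?_⟩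
  have hL₂ : 0 ≤ L₂ := by
    have := (norm_nonneg _).trans (h₂ 1 1 le_rfl zero_le_one le_rfl); simpa using this
  have hsym : ∀ t, 1 ≤ w + t → |t| ≤ 1 → ‖deriv p (w + t) - deriv p w‖ ≤ L₂ * |t| := by
    intro t hwt ht
    rcases le_total 0 t with h0 | h0
    · rw [abs_of_nonneg h0] at ht ⊢
      exact h₂ w t hw h0 ht
    · rw [abs_of_nonpos h0] at ht ⊢
      have := h₂ (w + t) (-t) hwt (by linarith) ht
      rwa [add_neg_cancel_right, norm_sub_rev] at this
  have hmem : ∀ t ∈ Set.uIcc 0 s, 1 ≤ w + t ∧ |t| ≤ |s| := by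
    intro t ht
    rcases le_total 0 s with h0 | h0
    · rw [Set.uIcc_of_le h0] at ht
      rw [abs_of_nonneg h0, abs_of_nonneg ht.1]
      exact ⟨by linarith [ht.1], ht.2⟩
    · rw [Set.uIcc_of_ge h0] at ht
      rw [abs_of_nonpos h0, abs_of_nonpos ht.2]
      exact ⟨by linarith [ht.1], by linarith [ht.1]⟩
  have hd : ∀ t ∈ Set.uIcc 0 s, HasDerivWithinAt (fun t : ℝ => p (w + t) - t * deriv p w)
      (deriv p (w + t) - deriv p w) (Set.uIcc 0 s) t := by
    intro t ht
    have hne : w + t ≠ 0 := by linarith [(hmem t ht).1]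
    have h1 := (hp.differentiableAt hne).hasDerivAt.comp_const_add w t
    have h2 : HasDerivAt (fun t : ℝ => (t : ℂ) * deriv p w) (1 * deriv p w) t :=
      (Complex.ofRealCLM.hasDerivAt (x := t)).mul_const _
    rw [one_mul] at h2
    exact (h1.sub h2).hasDerivWithinAt
  have := (convex_uIcc (0 : ℝ) s).norm_image_sub_le_of_norm_hasDerivWithin_le hd (C := L₂ * |s|)
    (fun t ht => (hsym t (hmem t ht).1 ((hmem t ht).2.trans hs)).trans
      (mul_le_mul_of_nonneg_left (hmem t ht).2 hL₂)) Set.left_mem_uIcc Set.right_mem_uIcc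
  simp only [add_zero, Complex.ofReal_zero, zero_mul, sub_zero, Real.norm_eq_abs] at this
  rw [show p (w + s) - p w - s * deriv p w = p (w + s) - s * deriv p w - p w by ring]
  refine this.trans ?_
  rw [mul_assoc, ← sq, sq_abs]
  exact mul_le_mul_of_nonneg_right (le_max_right _ _) (sq_nonneg s)

end IsLineFunction

/-! ### Rigidity of bounded solutions of a difference equation -/

section Rigidity

/-- A bounded solution of a second order recurrence starting at `0` cannot stay away from `0`. -/
lemma not_bounded_below_of_recurrence {s : ℕ → ℂ} {γ : ℂ} {B c : ℝ} (h0 : s 0 = 0)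
    (hrec : ∀ j, s (j + 2) = γ * s (j + 1) - s j) (hB : ∀ j, ‖s j‖ ≤ B) (hc : 0 < c)
    (hlow : ∀ j, 1 ≤ j → c ≤ ‖s j‖) : False := by
  -- A Casoratian of two solutions of the recurrence does not depend on i; at i = 0 it is −s(1)s(d).
  -- Along a subsequence on which the pairs (s i, s (i + 1)) converge it becomes small, whereas
  -- |s(1)s(d)| ≥ c² for d ≥ 1.
  have hW : ∀ d i, s i * s (i + d + 1) - s (i + 1) * s (i + d) = - (s 1 * s d) := by
    intro d i
    induction i with
    | zero => simp [h0]
    | succ i ih =>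
      rw [← ih, show i + 1 + d + 1 = (i + d) + 2 by ring, show i + 1 + d = i + d + 1 by ring,
        show i + 1 + 1 = i + 2 by ring, hrec, hrec]
      ring
  obtain ⟨⟨l₁, l₂⟩, _, e, he, hlim⟩ := tendsto_subseq_of_bounded (x := fun i => (s i, s (i + 1)))
    (Metric.isBounded_closedBall (x := (0 : ℂ × ℂ)) (r := B)) (fun i => by
      rw [mem_closedBall_zero_iff, Prod.norm_def]
      exact max_le (hB _) (hB _))
  have h1 : Tendsto (fun n => s (e n)) atTop (𝓝 l₁) := (continuous_fst.tendsto _).comp hlim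
  have h2 : Tendsto (fun n => s (e n + 1)) atTop (𝓝 l₂) := (continuous_snd.tendsto _).comp hlim
  have h1' := h1.comp (tendsto_add_atTop_nat 1)
  have h2' := h2.comp (tendsto_add_atTop_nat 1)
  have hz : Tendsto (fun n => s (e n) * s (e (n + 1) + 1) - s (e n + 1) * s (e (n + 1))) atTop
      (𝓝 (l₁ * l₂ - l₂ * l₁)) := (h1.mul h2').sub (h2.mul h1')
  rw [mul_comm l₂, sub_self] at hz
  have hlt := hz.norm.eventually (gt_mem_nhds (show ‖(0 : ℂ)‖ < c * c by
    rw [norm_zero]; positivity))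
  obtain ⟨n, hn⟩ := hlt.exists
  have hen : e n < e (n + 1) := he (Nat.lt_succ_self n)
  obtain ⟨d, hd⟩ := Nat.exists_eq_add_of_lt hen
  have := hW (d + 1) (e n)
  rw [← add_assoc, ← hd] at this
  rw [this, norm_neg, norm_mul] at hn
  have := mul_le_mul (hlow 1 le_rfl) (hlow (d + 1) (by omega)) hc.le (norm_nonneg _)
  linarith

variable {φ φ' : ℝ → ℂ} {β : ℂ}

/-- The equation says that φ(2v)E(v)² has derivative 0. The constant is found as v → 0, where φ(2v)
behaves like β/(4v²) and E(v) like ev. -/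
lemma sq_mul_eq_of_ode (hφ : ∀ v, 0 < v → HasDerivAt φ (φ' v) v)
    (hpole : Tendsto (fun v : ℝ => (v : ℂ) ^ 2 * φ v) (𝓝[>] 0) (𝓝 β)) {E E' : ℝ → ℂ} {e : ℂ}
    (hE : ∀ v, 0 < v → HasDerivAt E (E' v) v)
    (hode : ∀ v, 0 < v → φ' (2 * v) * E v + φ (2 * v) * E' v = 0)
    (he : Tendsto (fun v : ℝ => E v / v) (𝓝[>] 0) (𝓝 e)) {v : ℝ} (hv : 0 < v) :
    φ (2 * v) * E v ^ 2 = β * e ^ 2 / 4 := by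
  have hd : ∀ v, 0 < v → HasDerivAt (fun v => φ (2 * v) * E v ^ 2) 0 v := by
    intro v hv
    have h1 : HasDerivAt (fun v => φ (2 * v)) ((2 : ℝ) • φ' (2 * v)) v := by
      have := (hφ (2 * v) (by linarith)).scomp v ((hasDerivAt_id v).const_mul 2)
      simpa [Function.comp_def] using this
    refine (h1.mul ((hE v hv).pow 2)).congr_deriv ?_
    simp only [Complex.real_smul, Pi.pow_apply]
    push_cast
    linear_combination (2 * E v) * hode v hv
  have hconst : ∀ w, 0 < w → φ (2 * w) * E w ^ 2 = φ (2 * v) * E v ^ 2 := fun w hw =>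
    isOpen_Ioi.is_const_of_deriv_eq_zero isPreconnected_Ioi
      (fun y hy => (hd y hy).differentiableAt.differentiableWithinAt)
      (fun y hy => (hd y hy).deriv) hw hv
  have ht2 : Tendsto (fun v : ℝ => 2 * v) (𝓝[>] 0) (𝓝[>] 0) := by
    refine tendsto_nhdsWithin_iff.2 ⟨?_, ?_⟩
    · have : Continuous fun u : ℝ => 2 * u := by fun_prop
      simpa using (this.tendsto 0).mono_left nhdsWithin_le_nhds
    · filter_upwards [self_mem_nhdsWithin] with u hu
      have : 0 < u := hu
      simpa using this
  have hlim := ((hpole.comp ht2).mul (he.pow 2)).div_const 4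
  refine tendsto_nhds_unique (tendsto_const_nhds.congr' ?_) hlim
  filter_upwards [self_mem_nhdsWithin] with w hw
  have hw : 0 < w := hw
  have hw0 : (w : ℂ) ≠ 0 := Complex.ofReal_ne_zero.2 hw.ne'
  rw [← hconst w hw]
  simp only [Function.comp]
  push_cast
  field_simp
  ring

/-- Put D m v = G(m + v) − G(m − v). With v half the distance of the points, the equation gives
φ(2v)(D m v)² = βG'(m)². If G'(m) ≠ 0, then φ(2v) ≠ 0; the same formula for D y v · G'(m) − D m v ·
G'(y), whose slope at v = 0 is zero, shows that D y is proportional to D m for every y. The identity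
D (m + 1) (j + 1) + D (m − 1) (j + 1) = D m (j + 2) + D m j then becomes a second order recurrence
for the sequence D m j. It starts at 0, is bounded because G is, and is bounded below for j ≥ 1
because φ is bounded; there is no such sequence. -/
lemma eq_zero_of_difference_equation (hβ : β ≠ 0) (hφ : ∀ v, 0 < v → HasDerivAt φ (φ' v) v)
    (hpole : Tendsto (fun v : ℝ => (v : ℂ) ^ 2 * φ v) (𝓝[>] 0) (𝓝 β)) {C : ℝ}
    (hφC : ∀ v, 1 ≤ v → ‖φ v‖ ≤ C) {G G' : ℝ → ℂ} (hG : ∀ x, HasDerivAt G (G' x) x)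
    (hGC : ∀ x, ‖G x‖ ≤ C)
    (h : ∀ a b, b < a → φ' (a - b) * (G a - G b) + φ (a - b) * (G' a + G' b) = 0) (m : ℝ) :
    G' m = 0 := by
  by_contra hm
  set D : ℝ → ℝ → ℂ := fun m v => G (m + v) - G (m - v) with hD
  have hDd : ∀ m v, HasDerivAt (D m) (G' (m + v) + G' (m - v)) v := by
    intro m v
    have h1 := (hG (m + v)).comp_const_add m v
    have h2 := (hG (m - v)).comp_const_sub m v
    exact (h1.sub h2).congr_deriv (by ring)
  have hD0 : ∀ m, D m 0 = 0 := fun m => by simp [hD]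
  have hDlim : ∀ m, Tendsto (fun v : ℝ => D m v / v) (𝓝[>] 0) (𝓝 (2 * G' m)) := by
    intro m
    have h1 := hDd m 0
    rw [hasDerivAt_iff_tendsto_slope] at h1
    simp only [add_zero, sub_zero] at h1
    rw [← two_mul] at h1
    refine (h1.mono_left (nhdsWithin_mono (s := Set.Ioi 0) 0 fun t (ht : 0 < t) => ht.ne')).congr
      fun v => ?_
    rw [slope_def_module, hD0, sub_zero, sub_zero, Complex.real_smul]; push_cast; ring
  have hode : ∀ m v, 0 < v → φ' (2 * v) * D m v + φ (2 * v) * (G' (m + v) + G' (m - v)) = 0 := by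
    intro m v hv
    have := h (m + v) (m - v) (by linarith)
    rwa [show m + v - (m - v) = 2 * v by ring] at this
  have hsq : ∀ v, 0 < v → φ (2 * v) * D m v ^ 2 = β * G' m ^ 2 := fun v hv => by
    rw [sq_mul_eq_of_ode hφ hpole (fun v _ => hDd m v) (hode m) (hDlim m) hv]; ring
  have hφ0 : ∀ v, 0 < v → φ (2 * v) ≠ 0 := fun v hv h0 => by
    have := hsq v hv
    rw [h0, zero_mul] at this
    exact mul_ne_zero hβ (pow_ne_zero 2 hm) this.symm
  have hprop : ∀ y v, 0 < v → D y v * G' m = D m v * G' y := by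
    intro y v hv
    have h1 := sq_mul_eq_of_ode hφ hpole (E := fun v => D y v * G' m - D m v * G' y)
      (E' := fun v => (G' (y + v) + G' (y - v)) * G' m - (G' (m + v) + G' (m - v)) * G' y)
      (e := 2 * G' y * G' m - 2 * G' m * G' y)
      (fun v _ => ((hDd y v).mul_const _).sub ((hDd m v).mul_const _))
      (fun v hv => by linear_combination G' m * hode y v hv - G' y * hode m v hv)
      ((((hDlim y).mul_const (G' m)).sub ((hDlim m).mul_const (G' y))).congr fun v => by ring) hv
    have h2 : φ (2 * v) * (D y v * G' m - D m v * G' y) ^ 2 = 0 := by rw [h1]; ring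
    have h3 := (mul_eq_zero.1 h2).resolve_left (hφ0 v hv)
    exact sub_eq_zero.1 (pow_eq_zero_iff two_ne_zero |>.1 h3)
  set γ := (G' (m + 1) + G' (m - 1)) / G' m with hγ
  have hrec : ∀ j : ℕ, D m ((j + 2 : ℕ) : ℝ) = γ * D m ((j + 1 : ℕ) : ℝ) - D m (j : ℝ) := by
    intro j
    have hj : (0 : ℝ) < ((j + 1 : ℕ) : ℝ) := by positivity
    have h1 := hprop (m + 1) _ hj
    have h2 := hprop (m - 1) _ hj
    have h3 : D (m + 1) ((j + 1 : ℕ) : ℝ) + D (m - 1) ((j + 1 : ℕ) : ℝ) =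
        D m ((j + 2 : ℕ) : ℝ) + D m (j : ℝ) := by
      simp only [hD]
      push_cast
      ring_nf
    have h4 : γ * G' m = G' (m + 1) + G' (m - 1) := div_mul_cancel₀ _ hm
    apply mul_right_cancel₀ hm
    linear_combination h1 + h2 - G' m * h3 - D m ((j + 1 : ℕ) : ℝ) * h4
  have hC1 : 0 < C := by
    have h1 := hsq 1 one_pos
    have h2 := hφC (2 * 1) (by norm_num)
    exact (norm_pos_iff.2 (hφ0 1 one_pos)).trans_le h2
  have hpos : 0 < ‖β * G' m ^ 2‖ := norm_pos_iff.2 (mul_ne_zero hβ (pow_ne_zero 2 hm))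
  refine not_bounded_below_of_recurrence (s := fun j : ℕ => D m j) (γ := γ) (B := C + C)
    (c := √(‖β * G' m ^ 2‖ / C)) (by simp [hD0]) hrec
    (fun j => (norm_sub_le _ _).trans (add_le_add (hGC _) (hGC _))) (by positivity) ?_
  intro j hj
  have hj1 : (1 : ℝ) ≤ j := by exact_mod_cast hj
  rw [Real.sqrt_le_left (norm_nonneg _), div_le_iff₀ hC1, ← hsq j (by linarith), norm_mul, norm_pow,
    mul_comm]
  exact mul_le_mul_of_nonneg_left (hφC _ (by linarith)) (by positivity)

end Rigidity

/-! ### Limits of translates along ultrafilters -/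

section Limits

lemma hasDerivAt_of_quadratic {h : ℝ → ℂ} {k : ℂ} {a L : ℝ}
    (H : ∀ s : ℝ, |s| ≤ 1 → ‖h (a + s) - h a - s * k‖ ≤ L * s ^ 2) : HasDerivAt h k a := by
  rw [hasDerivAt_iff_isLittleO_nhds_zero]
  have h1 : (fun s : ℝ => h (a + s) - h a - s • k) =O[𝓝 0] fun s : ℝ => s ^ 2 := by
    refine Asymptotics.IsBigO.of_bound L ?_
    have : ∀ᶠ s : ℝ in 𝓝 0, |s| ≤ 1 := by
      filter_upwards [Metric.closedBall_mem_nhds (0 : ℝ) one_pos] with s hs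
      simpa using hs
    filter_upwards [this] with s hs
    rw [Complex.real_smul, norm_pow, Real.norm_eq_abs, sq_abs]
    exact H s hs
  refine h1.trans_isLittleO ?_
  have := Asymptotics.isLittleO_pow_pow (𝕜 := ℝ) (m := 1) (n := 2) (by norm_num)
  simpa using this

lemma exists_tendsto_of_norm_le {α : Type*} {U : Ultrafilter α} {u : α → ℂ} {C : ℝ}
    (h : ∀ᶠ t in (U : Filter α), ‖u t‖ ≤ C) : ∃ z, Tendsto u U (𝓝 z) ∧ ‖z‖ ≤ C := by
  have hc := isCompact_closedBall (0 : ℂ) C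
  obtain ⟨z, hz, hle⟩ := hc.ultrafilter_le_nhds (U.map u) (by
    rw [le_principal_iff, Ultrafilter.mem_coe, Ultrafilter.mem_map]
    filter_upwards [h] with t ht
    simpa using ht)
  exact ⟨z, hle, by simpa using hz⟩

/-- The translates of a function with bounded Taylor remainders have limits of the same kind. -/
lemma exists_translation_limit {α : Type*} {U : Ultrafilter α} {u u' : ℝ → ℂ} {τ : α → ℝ → ℝ}
    {C L : ℝ} (hτ : ∀ t a s, τ t (a + s) = τ t a + s) {D : Set ℝ}
    (hD : ∀ a, ∀ᶠ t in (U : Filter α), τ t a ∈ D)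
    (hu : ∀ x ∈ D, ‖u x‖ ≤ C) (hu' : ∀ x ∈ D, ‖u' x‖ ≤ L)
    (hL : ∀ x s, x ∈ D → x + s ∈ D → |s| ≤ 1 → ‖u (x + s) - u x - s * u' x‖ ≤ L * s ^ 2) :
    ∃ h h' : ℝ → ℂ, (∀ a, Tendsto (fun t => u (τ t a)) U (𝓝 (h a))) ∧
      (∀ a, Tendsto (fun t => u' (τ t a)) U (𝓝 (h' a))) ∧ (∀ a, ‖h a‖ ≤ C) ∧ (∀ a, ‖h' a‖ ≤ L) ∧
      (∀ a s : ℝ, |s| ≤ 1 → ‖h (a + s) - h a - s * h' a‖ ≤ L * s ^ 2) ∧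
      ∀ a, HasDerivAt h (h' a) a := by
  have h1 : ∀ a, ∃ z, Tendsto (fun t => u (τ t a)) U (𝓝 z) ∧ ‖z‖ ≤ C := fun a =>
    exists_tendsto_of_norm_le (by filter_upwards [hD a] with t ht using hu _ ht)
  have h2 : ∀ a, ∃ z, Tendsto (fun t => u' (τ t a)) U (𝓝 z) ∧ ‖z‖ ≤ L := fun a =>
    exists_tendsto_of_norm_le (by filter_upwards [hD a] with t ht using hu' _ ht)
  choose h hh hhC using h1
  choose h' hh' hhL using h2
  -- The bound on the Taylor remainder survives pointwise limits and makes h' the derivative of h.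
  -- The ultrafilter provides the limits at all points simultaneously, with no choice of
  -- subsequences.
  have hq : ∀ a s : ℝ, |s| ≤ 1 → ‖h (a + s) - h a - s * h' a‖ ≤ L * s ^ 2 := by
    intro a s hs
    refine le_of_tendsto (((hh (a + s)).sub (hh a)).sub ((hh' a).const_mul (s : ℂ))).norm ?_
    filter_upwards [hD a, hD (a + s)] with t ht hts
    rw [hτ] at hts ⊢
    exact hL _ _ ht hts hs
  exact ⟨h, h', hh, hh', hhC, hhL, hq, fun a => hasDerivAt_of_quadratic (hq a)⟩

end Limits

section PairEquation

variable {ι : Type*} [Fintype ι] [DecidableEq ι]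

/-- The functional equation after adding two points, in terms of the values of the function and
of its derivative at the differences. -/
noncomputable def pairSum (V V' : ι → ℂ) (c c' : ℂ) (a a' b b' : ι → ℂ) : ℂ :=
  c' * (∏ i, a i - ∏ i, b i) +
    c * (∑ i, a' i * ∏ j ∈ Finset.univ.erase i, a j + ∑ i, b' i * ∏ j ∈ Finset.univ.erase i, b j) +
    ∑ i, (a i * b i * V' i - (a' i * b i + a i * b' i) * V i)

lemma tendsto_pairSum {α : Type*} {l : Filter α} {V V' : ι → ℂ} {c c' : α → ℂ}
    {a a' b b' : α → ι → ℂ} {c₀ c₀' : ℂ} {a₀ a₀' b₀ b₀' : ι → ℂ}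
    (hc : Tendsto c l (𝓝 c₀)) (hc' : Tendsto c' l (𝓝 c₀'))
    (ha : ∀ i, Tendsto (fun t => a t i) l (𝓝 (a₀ i)))
    (ha' : ∀ i, Tendsto (fun t => a' t i) l (𝓝 (a₀' i)))
    (hb : ∀ i, Tendsto (fun t => b t i) l (𝓝 (b₀ i)))
    (hb' : ∀ i, Tendsto (fun t => b' t i) l (𝓝 (b₀' i))) :
    Tendsto (fun t => pairSum V V' (c t) (c' t) (a t) (a' t) (b t) (b' t)) l
      (𝓝 (pairSum V V' c₀ c₀' a₀ a₀' b₀ b₀')) := by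
  unfold pairSum
  refine ((hc'.mul ((tendsto_finsetProd _ fun i _ => ha i).sub
    (tendsto_finsetProd _ fun i _ => hb i))).add (hc.mul ?_)).add ?_
  · exact (tendsto_finsetSum _ fun i _ => (ha' i).mul (tendsto_finsetProd _ fun j _ => ha j)).add
      (tendsto_finsetSum _ fun i _ => (hb' i).mul (tendsto_finsetProd _ fun j _ => hb j))
  · exact tendsto_finsetSum _ fun i _ => (((ha i).mul (hb i)).mul_const _).sub
      ((((ha' i).mul (hb i)).add ((ha i).mul (hb' i))).mul_const _)

lemma IsLineFunction.pairSum_eq_zero {p : ℝ → ℂ} {β : ℂ} (hp : IsLineFunction p β) {x : ι → ℝ}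
    (hsol : IsSolution (Option (Option ι)) p {0}) (hx : ∀ i j, i ≠ j → x i - x j ≠ 0) {a b : ℝ}
    (hab : a - b ≠ 0) (ha : ∀ i, a - x i ≠ 0) (hb : ∀ i, b - x i ≠ 0) :
    pairSum (fun i => partialProd p x i (x i)) (fun i => deriv (partialProd p x i) (x i))
      (p (a - b)) (deriv p (a - b)) (fun i => p (a - x i)) (fun i => deriv p (a - x i))
      (fun i => p (b - x i)) (fun i => deriv p (b - x i)) = 0 := by
  have h := hsol (addPoint a (addPoint b x)) (addPoint_sub_notMem (by simp) (by
    rintro (_ | i)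
    · exact hab
    · exact ha i) (addPoint_sub_notMem (by simp) hb hx))
  rw [divSum_addPoint_addPoint hp.even (hp.differentiableAt hab)
    (fun i => hp.differentiableAt (ha i)) (fun i => hp.differentiableAt (hb i))
    (fun i j hij => hp.differentiableAt (hx i j hij)),
    deriv_fullProd fun i => hp.differentiableAt (ha i),
    deriv_fullProd fun i => hp.differentiableAt (hb i)] at h
  exact h

end PairEquation

/-! ### Decay of the derivative, and removal of a point at infinity -/

namespace IsLineFunction

variable {p : ℝ → ℂ} {β : ℂ}

/-- All products of translates of a limit of translates are constant. -/
lemma deriv_limit_prod_eq_zero (hp : IsLineFunction p β) {ι : Type*} [Fintype ι] [DecidableEq ι]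
    (hsol : IsSolution (Option (Option ι)) p {0}) {C L : ℝ}
    (hC : ∀ x ∈ Set.Ici (1 : ℝ), ‖p x‖ ≤ C) {U : Ultrafilter ℝ} (hU : (U : Filter ℝ) ≤ atTop)
    {h h' : ℝ → ℂ} (hh : ∀ a, Tendsto (fun t => p (t + a)) U (𝓝 (h a)))
    (hh' : ∀ a, Tendsto (fun t => deriv p (t + a)) U (𝓝 (h' a))) (hhC : ∀ a, ‖h a‖ ≤ C)
    (hhL : ∀ a, ‖h' a‖ ≤ L)
    (hq : ∀ a s : ℝ, |s| ≤ 1 → ‖h (a + s) - h a - s * h' a‖ ≤ L * s ^ 2)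
    (hd : ∀ a, HasDerivAt h (h' a) a) {x : ι → ℝ} (hx : ∀ i j, i ≠ j → x i - x j ≠ 0) (m : ℝ) :
    HasDerivAt (fullProd h x) 0 m := by
  -- H is the limit of h(a − t). It is what p(a − b) turns into if the two additional points escape
  -- to infinity and also from each other.
  obtain ⟨H, H', hH, hH', hHC, -, -, hHd⟩ := exists_translation_limit (U := U)
    (τ := fun t a => a - t) (fun t a s => by ring) (D := Set.univ) (fun a => by simp)
    (fun a _ => hhC a) (fun a _ => hhL a) (fun a s _ _ hs => hq a s hs)
  have hlarge : ∀ a b : ℝ, ∀ᶠ t in (U : Filter ℝ), t + a - b ≠ 0 := by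
    intro a b
    filter_upwards [hU (eventually_gt_atTop (b - a))] with t ht
    linarith
  set V : ι → ℂ := fun i => partialProd p x i (x i)
  set V' : ι → ℂ := fun i => deriv (partialProd p x i) (x i)
  have e : ∀ t a y : ℝ, t + a - y = t + (a - y) := fun t a y => by ring
  -- Both points go to infinity with their difference a − b kept fixed.
  have hI : ∀ a b : ℝ, b < a → pairSum V V' (p (a - b)) (deriv p (a - b)) (fun i => h (a - x i))
      (fun i => h' (a - x i)) (fun i => h (b - x i)) (fun i => h' (b - x i)) = 0 := by
    intro a b hab
    have hlim := tendsto_pairSum (l := (U : Filter ℝ)) (V := V) (V' := V')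
      (tendsto_const_nhds (x := p (a - b))) (tendsto_const_nhds (x := deriv p (a - b)))
      (fun i => hh (a - x i)) (fun i => hh' (a - x i)) (fun i => hh (b - x i))
      (fun i => hh' (b - x i))
    refine tendsto_nhds_unique (hlim.congr' ?_) tendsto_const_nhds
    filter_upwards [eventually_all.2 fun i => hlarge a (x i),
      eventually_all.2 fun i => hlarge b (x i)] with t h1 h2
    have hab' : (t + a) - (t + b) ≠ 0 := by linarith
    have := hp.pairSum_eq_zero hsol hx hab' h1 h2
    rwa [show (t + a) - (t + b) = a - b by ring, funext fun i => congrArg p (e t a (x i)),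
      funext fun i => congrArg (deriv p) (e t a (x i)), funext fun i => congrArg p (e t b (x i)),
      funext fun i => congrArg (deriv p) (e t b (x i))] at this
  -- Now the first point escapes before the second, so that H(a − b) takes the place of p(a − b)
  -- while everything else is the same as before. Subtraction leaves the difference equation for φ =
  -- p − H and G = ∏ h(y − x i); φ keeps the double pole because H is continuous at 0.
  have hII : ∀ a b : ℝ, pairSum V V' (H (a - b)) (H' (a - b)) (fun i => h (a - x i))
      (fun i => h' (a - x i)) (fun i => h (b - x i)) (fun i => h' (b - x i)) = 0 := by
    intro a b
    have hlim := tendsto_pairSum (l := (U : Filter ℝ)) (V := V) (V' := V')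
      (hH (a - b)) (hH' (a - b))
      (fun i => tendsto_const_nhds (x := h (a - x i)))
      (fun i => tendsto_const_nhds (x := h' (a - x i))) (fun i => hh (b - x i))
      (fun i => hh' (b - x i))
    refine tendsto_nhds_unique (hlim.congr' ?_) tendsto_const_nhds
    filter_upwards [eventually_all.2 fun i => hlarge b (x i)] with s hs
    have hlim' := tendsto_pairSum (l := (U : Filter ℝ)) (V := V) (V' := V')
      (hh (a - b - s)) (hh' (a - b - s)) (fun i => hh (a - x i)) (fun i => hh' (a - x i))
      (fun i => tendsto_const_nhds (x := p (s + b - x i)))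
      (fun i => tendsto_const_nhds (x := deriv p (s + b - x i)))
    simp only [e] at hlim' ⊢
    refine tendsto_nhds_unique (hlim'.congr' ?_) tendsto_const_nhds
    filter_upwards [hlarge a (s + b), eventually_all.2 fun i => hlarge a (x i)] with t h1 h2
    have := hp.pairSum_eq_zero hsol hx h1 h2 hs
    simp only [e] at this
    rwa [show t + (a - (s + b)) = t + (a - b - s) by ring] at this
  have hG : ∀ y, HasDerivAt (fullProd h x) (∑ i, h' (y - x i) * partialProd h x i y) y := by
    intro y
    have h1 := (differentiableAt_fullProd (p := h) (x := x) (t := y)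
      fun j => (hd _).differentiableAt).hasDerivAt
    rw [deriv_fullProd fun j => (hd _).differentiableAt] at h1
    simpa only [(hd _).deriv] using h1
  have hC0 : 0 ≤ C := (norm_nonneg _).trans (hhC 0)
  have hGC : ∀ y, ‖fullProd h x y‖ ≤ C ^ Fintype.card ι := by
    intro y
    rw [fullProd, norm_prod]
    exact (Finset.prod_le_prod (fun _ _ => norm_nonneg _) fun i _ => hhC _).trans (by simp)
  have key := eq_zero_of_difference_equation (φ := fun v => p v - H v)
    (φ' := fun v => deriv p v - H' v) (β := β) (C := max (C + C) (C ^ Fintype.card ι)) hp.ne_zero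
    (fun v hv => (hp.differentiableAt hv.ne').hasDerivAt.sub (hHd v)) ?_ ?_ hG
    (fun y => (hGC y).trans (le_max_right _ _)) ?_ m
  · have := hG m
    rwa [key] at this
  · have h1 := hp.tendsto_sq_mul.mono_left
      (nhdsWithin_mono (s := Set.Ioi (0 : ℝ)) 0 fun t (ht : 0 < t) => ht.ne')
    have h2 : Tendsto (fun v : ℝ => (v : ℂ) ^ 2 * H v) (𝓝[>] 0) (𝓝 (((0 : ℝ) : ℂ) ^ 2 * H 0)) :=
      (((Complex.continuous_ofReal.pow 2).tendsto 0).mul (hHd 0).continuousAt.tendsto).mono_left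
        nhdsWithin_le_nhds
    have h3 := h1.sub h2
    simp only [Complex.ofReal_zero, ne_eq, OfNat.ofNat_ne_zero, not_false_eq_true, zero_pow,
      zero_mul, sub_zero] at h3
    exact h3.congr fun v => by ring
  · intro v hv
    exact ((norm_sub_le _ _).trans (add_le_add (hC v hv) (hHC v))).trans (le_max_left _ _)
  · intro a b hab
    have h1 := hI a b hab
    have h2 := hII a b
    simp only [pairSum] at h1 h2
    simp only [fullProd, partialProd]
    linear_combination h1 - h2

/-- The derivative of a bounded solution for at least four points tends to zero. -/
lemma tendsto_deriv_zero (hp : IsLineFunction p β) {r : ℕ}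
    (hsol : IsSolution (Option (Option (Option (Option (Fin r))))) p {0}) :
    Tendsto (deriv p) atTop (𝓝 0) := by
  by_contra hnot
  obtain ⟨ε, hε, hfr⟩ : ∃ ε > 0, ∃ᶠ t in atTop, ε ≤ ‖deriv p t‖ := by
    rw [Metric.tendsto_nhds] at hnot
    push Not at hnot
    obtain ⟨ε, hε, h⟩ := hnot
    refine ⟨ε, hε, ?_⟩
    simpa using h
  have hne : NeBot (atTop ⊓ 𝓟 {t : ℝ | ε ≤ ‖deriv p t‖}) := frequently_iff_neBot.1 hfr
  set U := Ultrafilter.of (atTop ⊓ 𝓟 {t : ℝ | ε ≤ ‖deriv p t‖}) with hUdef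
  have hU' := Ultrafilter.of_le (atTop ⊓ 𝓟 {t : ℝ | ε ≤ ‖deriv p t‖})
  have hU : (U : Filter ℝ) ≤ atTop := hU'.trans inf_le_left
  have hUε : ∀ᶠ t in (U : Filter ℝ), ε ≤ ‖deriv p t‖ := by
    have := hU'.trans inf_le_right
    exact this (mem_principal_self _)
  obtain ⟨L, hL1, hL2⟩ := hp.exists_taylor_bound hsol
  obtain ⟨C, hC⟩ := hp.bounded 1 one_pos
  have hC' : ∀ x ∈ Set.Ici (1 : ℝ), ‖p x‖ ≤ C := fun x hx =>
    hC x (le_trans (Set.mem_Ici.1 hx) (le_abs_self x))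
  obtain ⟨h, h', hh, hh', hhC, hhL, hq, hd⟩ := exists_translation_limit (U := U) (u := p)
    (u' := deriv p) (τ := fun t a => t + a) (fun t a s => by ring) (D := Set.Ici 1)
    (fun a => hU (by filter_upwards [eventually_ge_atTop (1 - a)] with t ht
                     simp only [Set.mem_Ici]; linarith))
    hC' (fun x hx => hL1 x hx) (fun x s hx hxs hs => hL2 x s hx hxs hs)
  have hsol' : IsSolution (Option (Option (Fin (r + 2)))) p {0} := hsol.of_card_eq (by simp)
  -- Two of the r + 4 points have gone to infinity, and the products of r + 2 translates of h are
  -- constant. With equally spaced translates and spacing δ → 0 the power of h itself is constant,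
  -- hence h'(0) = 0. But |h'(0)| ≥ ε by the choice of the ultrafilter.
  have hconst : ∀ m, h m ^ (r + 2) = h 0 ^ (r + 2) := by
    intro m
    have hprod : ∀ δ : ℝ, δ ≠ 0 → ∏ i : Fin (r + 2), h (m - δ * (i : ℕ)) =
        ∏ i : Fin (r + 2), h (0 - δ * (i : ℕ)) := by
      intro δ hδ
      have hx : ∀ i j : Fin (r + 2), i ≠ j → δ * ((i : ℕ) : ℝ) - δ * ((j : ℕ) : ℝ) ≠ 0 := by
        intro i j hij h0
        apply hij
        rw [← mul_sub] at h0
        have := (mul_eq_zero.1 h0).resolve_left hδ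
        exact Fin.ext (by exact_mod_cast sub_eq_zero.1 this)
      have hz := fun y => hp.deriv_limit_prod_eq_zero hsol' hC' hU hh hh' hhC hhL hq hd hx y
      exact is_const_of_deriv_eq_zero (fun y => (hz y).differentiableAt) (fun y => (hz y).deriv) m 0
    have hlim : ∀ y, Tendsto (fun δ : ℝ => ∏ i : Fin (r + 2), h (y - δ * (i : ℕ))) (𝓝[≠] 0)
        (𝓝 (h y ^ (r + 2))) := by
      intro y
      have h1 : ∀ i : Fin (r + 2), Tendsto (fun δ : ℝ => h (y - δ * (i : ℕ))) (𝓝[≠] 0) (𝓝 (h y)) := by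
        intro i
        have hc : ContinuousAt (fun δ : ℝ => y - δ * (i : ℕ)) 0 := by fun_prop
        have := ContinuousAt.comp (g := h) (f := fun δ : ℝ => y - δ * (i : ℕ)) (x := 0)
          (hd _).continuousAt hc
        have h2 := this.tendsto
        simp only [Function.comp_def, zero_mul, sub_zero] at h2
        exact h2.mono_left nhdsWithin_le_nhds
      have := tendsto_finsetProd (Finset.univ : Finset (Fin (r + 2))) fun i _ => h1 i
      simpa using this
    refine tendsto_nhds_unique ((hlim m).congr' ?_) (hlim 0)
    filter_upwards [self_mem_nhdsWithin] with δ hδ using hprod δ hδ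
  have hz : h' 0 = 0 := by
    by_cases h0 : h 0 = 0
    · have : h = fun _ => 0 := by
        funext m
        have := hconst m
        rw [h0, zero_pow (by omega)] at this
        exact pow_eq_zero_iff (by omega) |>.1 this
      have h1 := hd 0
      rw [this] at h1
      exact h1.unique (hasDerivAt_const _ _)
    · have h1 := (hd 0).pow (r + 2)
      have h2 : h ^ (r + 2) = fun _ => h 0 ^ (r + 2) := funext hconst
      rw [h2] at h1
      have h3 := h1.unique (hasDerivAt_const _ _)
      have h4 : ((r + 2 : ℕ) : ℂ) * h 0 ^ (r + 2 - 1) ≠ 0 :=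
        mul_ne_zero (by exact_mod_cast (by omega : r + 2 ≠ 0)) (pow_ne_zero _ h0)
      exact (mul_eq_zero.1 h3).resolve_left h4
  have h0 := hh' 0
  rw [hz] at h0
  simp only [add_zero] at h0
  have := ge_of_tendsto h0.norm hUε
  rw [norm_zero] at this
  linarith

/-- A solution not tending to zero also solves the equation with one point less. -/
lemma isSolution_of_not_tendsto_zero (hp : IsLineFunction p β)
    (hder : Tendsto (deriv p) atTop (𝓝 0)) (hnot : ¬ Tendsto p atTop (𝓝 0))
    {ι : Type*} [Fintype ι] [DecidableEq ι] (hsol : IsSolution (Option ι) p {0}) :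
    IsSolution ι p {0} := by
  intro x hx
  replace hx : ∀ i j, i ≠ j → x i - x j ≠ 0 := hx
  obtain ⟨ε, hε, hfr⟩ : ∃ ε > 0, ∃ᶠ t in atTop, ε ≤ ‖p t‖ := by
    rw [Metric.tendsto_nhds] at hnot
    push Not at hnot
    obtain ⟨ε, hε, h⟩ := hnot
    refine ⟨ε, hε, ?_⟩
    simpa using h
  have hne : NeBot (atTop ⊓ 𝓟 {t : ℝ | ε ≤ ‖p t‖}) := frequently_iff_neBot.1 hfr
  set U := Ultrafilter.of (atTop ⊓ 𝓟 {t : ℝ | ε ≤ ‖p t‖})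
  have hU' := Ultrafilter.of_le (atTop ⊓ 𝓟 {t : ℝ | ε ≤ ‖p t‖})
  have hU : (U : Filter ℝ) ≤ atTop := hU'.trans inf_le_left
  have hUε : ∀ᶠ t in (U : Filter ℝ), ε ≤ ‖p t‖ := (hU'.trans inf_le_right) (mem_principal_self _)
  obtain ⟨C, hC⟩ := hp.bounded 1 one_pos
  have hC' : ∀ t, 1 ≤ t → ‖p t‖ ≤ C := fun t ht => hC t (ht.trans (le_abs_self t))
  obtain ⟨c, hc, -⟩ := exists_tendsto_of_norm_le (U := U) (u := p) (C := C)
    (hU (by filter_upwards [eventually_ge_atTop 1] with t ht using hC' t ht))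
  have hc0 : c ≠ 0 := by
    rintro rfl
    have := ge_of_tendsto hc.norm hUε
    rw [norm_zero] at this
    linarith
  have hder' : ∀ y, Tendsto (fun t => deriv p (t - y)) U (𝓝 0) := fun y =>
    (hder.comp (tendsto_atTop_add_const_right atTop (-y) tendsto_id)).mono_left hU
  -- Since p' → 0, all the translates share the limit c ≠ 0. In the equation with one additional
  -- point at t the terms containing p' disappear in the limit, and c times the equation for x
  -- remains.
  have hshift : ∀ y, Tendsto (fun t => p (t - y)) U (𝓝 c) := by
    intro y
    have hz : Tendsto (fun t => p (t - y) - p t) atTop (𝓝 0) := by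
      rw [Metric.tendsto_atTop]
      intro η hη
      have hy : 0 < η / (|y| + 1) := by positivity
      obtain ⟨T, hT⟩ := eventually_atTop.1 ((tendsto_zero_iff_norm_tendsto_zero.1 hder).eventually
        (gt_mem_nhds hy))
      refine ⟨max T 1 + |y|, fun t ht => ?_⟩
      have hty : max T 1 ≤ t - y ∧ max T 1 ≤ t := by
        constructor <;> linarith [le_abs_self y, abs_nonneg y]
      have := (convex_Ici (max T 1)).norm_image_sub_le_of_norm_deriv_le (f := p)
        (C := η / (|y| + 1)) (fun s hs => hp.differentiableAt (by
          have := (le_max_right T 1).trans (Set.mem_Ici.1 hs); linarith))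
        (fun s hs => (hT s ((le_max_left T 1).trans (Set.mem_Ici.1 hs))).le)
        (Set.mem_Ici.2 hty.2) (Set.mem_Ici.2 hty.1)
      rw [dist_zero_right]
      refine this.trans_lt ?_
      rw [sub_sub_cancel_left, norm_neg, Real.norm_eq_abs, div_mul_eq_mul_div,
        div_lt_iff₀ (by positivity)]
      nlinarith [abs_nonneg y]
    have := (hz.mono_left hU).add hc
    simpa using this
  have hlim : Tendsto (fun t => ∑ i, deriv p (t - x i) *
      (partialProd p x i t - partialProd p x i (x i)) +
      ∑ i, p (t - x i) * deriv (partialProd p x i) (x i)) U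
      (𝓝 (∑ i, 0 * (∏ j ∈ Finset.univ.erase i, c - partialProd p x i (x i)) +
        ∑ i, c * deriv (partialProd p x i) (x i))) :=
    (tendsto_finsetSum _ fun i _ => (hder' (x i)).mul
      ((tendsto_finsetProd _ fun j _ => hshift (x j)).sub tendsto_const_nhds)).add
      (tendsto_finsetSum _ fun i _ => (hshift (x i)).mul_const _)
  have hz : ∑ i, 0 * (∏ j ∈ Finset.univ.erase i, c - partialProd p x i (x i)) +
        ∑ i, c * deriv (partialProd p x i) (x i) = 0 := by
    refine tendsto_nhds_unique (hlim.congr' ?_) tendsto_const_nhds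
    refine hU (?_ : ∀ᶠ t in atTop, _)
    filter_upwards [eventually_all.2 fun i => eventually_gt_atTop (x i)] with t ht
    rw [hp.sum_deriv_mul hsol hx fun i => (sub_pos.2 (ht i)).ne', neg_add_cancel]
  simp only [zero_mul, Finset.sum_const_zero, zero_add, ← Finset.mul_sum] at hz
  exact (mul_eq_zero.1 hz).resolve_left hc0

end IsLineFunction

/-! ### Integration over the points -/

/-- `F` is the odd primitive of the even function `p` with a double pole at the origin. -/
structure IsOddPrimitive (p F : ℝ → ℂ) (β : ℂ) : Prop where
  odd : ∀ x, F (-x) = -F x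
  hasDerivAt : ∀ x, x ≠ 0 → HasDerivAt F (p x) x
  meromorphic : ∀ x, MeromorphicAt F x
  pole : Tendsto (fun u : ℝ => (u : ℂ) * F u) (𝓝[≠] 0) (𝓝 (-β))

lemma IsLineFunction.meromorphicAt {p : ℝ → ℂ} {β : ℂ} (hp : IsLineFunction p β) (x : ℝ) :
    MeromorphicAt p x := by
  by_cases hx : x = 0
  · obtain ⟨g, hg, h⟩ := hp.pole
    subst hx
    have hid : MeromorphicAt (fun u : ℝ => (u : ℂ)) 0 :=
      (Complex.ofRealCLM.analyticAt 0).meromorphicAt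
    have h1 : MeromorphicAt (fun u : ℝ => β / (u : ℂ) ^ 2 + g u) 0 :=
      ((MeromorphicAt.const β 0).div (hid.pow 2)).add hg.meromorphicAt
    exact h1.congr (by filter_upwards [h] with u hu using hu.symm)
  · exact (hp.analytic x hx).meromorphicAt

/-- A meromorphic function on the real line with zero derivative off a closed discrete set is
constant off this set. -/
lemma eq_of_meromorphic_of_hasDerivAt_zero {E : ℝ → ℂ} (hE : ∀ x, MeromorphicAt E x) {S : Set ℝ}
    (hS : S.Finite) (hd : ∀ x ∉ S, HasDerivAt E 0 x) {w w' : ℝ} (hw : w ∉ S) (hw' : w' ∉ S) :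
    E w = E w' := by
  have hloc : ∀ᶠ x in 𝓝[≠] w, E x = E w := by
    obtain ⟨ε, hε, hball⟩ := Metric.isOpen_iff.1 hS.isClosed.isOpen_compl w hw
    refine Filter.Eventually.filter_mono nhdsWithin_le_nhds ?_
    filter_upwards [Metric.ball_mem_nhds w hε] with x hx
    exact Metric.isOpen_ball.is_const_of_deriv_eq_zero (convex_ball w ε).isPreconnected
      (fun y hy => (hd y (hball hy)).differentiableAt.differentiableWithinAt)
      (fun y hy => (hd y (hball hy)).deriv) hx (Metric.mem_ball_self hε)
  -- A zero derivative makes E constant between consecutive points of S only. Meromorphy excludes a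
  -- jump at a point of S: vanishing of E − E(w) near w means infinite order there, hence
  -- everywhere.
  have hm : MeromorphicOn (fun x => E x - E w) Set.univ := fun x _ =>
    (hE x).sub (MeromorphicAt.const _ _)
  have htop : meromorphicOrderAt (fun x => E x - E w) w = ⊤ := by
    rw [meromorphicOrderAt_eq_top_iff]
    filter_upwards [hloc] with u hu; rw [hu, sub_self]
  have htop' : meromorphicOrderAt (fun x => E x - E w) w' = ⊤ := by
    by_contra hne
    exact (hm.meromorphicOrderAt_ne_top_of_isPreconnected isPreconnected_univ (x := w') (y := w)
      (Set.mem_univ _) (Set.mem_univ _) hne) htop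
  rw [meromorphicOrderAt_eq_top_iff] at htop'
  have h1 : Tendsto E (𝓝[≠] w') (𝓝 (E w')) :=
    (hd w' hw').continuousAt.tendsto.mono_left nhdsWithin_le_nhds
  refine (tendsto_nhds_unique h1 (tendsto_const_nhds.congr' ?_)).symm
  filter_upwards [htop'] with x hx
  exact (sub_eq_zero.1 hx).symm

section Mixed

variable {ι κ : Type*} [Fintype ι] [DecidableEq ι] [Fintype κ] [DecidableEq κ]

/-- The expression obtained from the left hand side of the functional equation by integrating over
the points `y`. -/
noncomputable def mixedSum (p F : ℝ → ℂ) (x : ι → ℝ) (y : κ → ℝ) : ℂ :=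
  ∑ i, deriv (fun t => partialProd p x i t * fullProd F y t) (x i) -
    ∑ k, fullProd p x (y k) * partialProd F y k (y k)

/-- The dependence of `mixedSum` on one of the points over which we integrated. -/
noncomputable def mixedSumOne (p F : ℝ → ℂ) (x : ι → ℝ) (y : κ → ℝ) (w : ℝ) : ℂ :=
  ∑ i, (F (x i - w) * deriv (fun t => partialProd p x i t * fullProd F y t) (x i) +
      p (x i - w) * (partialProd p x i (x i) * fullProd F y (x i))) -
    fullProd p x w * fullProd F y w -
    ∑ k, F (y k - w) * (fullProd p x (y k) * partialProd F y k (y k))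

/-- All the points of two configurations are distinct. -/
structure AreDistinct (x : ι → ℝ) (y : κ → ℝ) : Prop where
  left : ∀ i j, i ≠ j → x i - x j ≠ 0
  right : ∀ k l, k ≠ l → y k - y l ≠ 0
  mixed : ∀ i k, x i - y k ≠ 0

/-- The equation after the points indexed by κ have been integrated over; factors involving these
points contain F in place of p. -/
def MixedSolution (ι κ : Type*) [Fintype ι] [DecidableEq ι] [Fintype κ] [DecidableEq κ]
    (p F : ℝ → ℂ) : Prop :=
  ∀ (x : ι → ℝ) (y : κ → ℝ), AreDistinct x y → mixedSum p F x y = 0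

variable {p F : ℝ → ℂ} {β : ℂ} {x : ι → ℝ} {y : κ → ℝ} {w : ℝ}

lemma sub_ne_zero_comm {a b : ℝ} (h : a - b ≠ 0) : b - a ≠ 0 := by
  rw [← neg_sub]; exact neg_ne_zero.2 h

lemma mixedSum_addPoint_right (hp : IsLineFunction p β) (hF : IsOddPrimitive p F β)
    (h : AreDistinct x y) (hwx : ∀ i, w - x i ≠ 0) :
    mixedSum p F x (addPoint w y) = mixedSumOne p F x y w := by
  unfold mixedSum mixedSumOne
  rw [Fintype.sum_option]
  simp only [addPoint_none, addPoint_some, partialProd_addPoint_none, partialProd_addPoint_some,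
    fullProd_addPoint]
  have e1 : ∀ i, deriv (fun t => partialProd p x i t * (F (t - w) * fullProd F y t)) (x i) =
      F (x i - w) * deriv (fun t => partialProd p x i t * fullProd F y t) (x i) +
      p (x i - w) * (partialProd p x i (x i) * fullProd F y (x i)) := by
    intro i
    have h1 : DifferentiableAt ℝ (fun t => partialProd p x i t * fullProd F y t) (x i) :=
      (differentiableAt_partialProd fun j hj => hp.differentiableAt (h.left i j hj.symm)).mul
        (differentiableAt_fullProd fun k => (hF.hasDerivAt _ (h.mixed i k)).differentiableAt)
    have h2 := (hF.hasDerivAt _ (sub_ne_zero_comm (hwx i))).comp_sub_const (x i) w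
    have h3 := (h2.mul h1.hasDerivAt).deriv
    rw [show (fun t => partialProd p x i t * (F (t - w) * fullProd F y t)) =
      (fun t => F (t - w)) * fun t => partialProd p x i t * fullProd F y t by
        ext t; simp only [Pi.mul_apply]; ring, h3]
    ring
  simp only [e1]
  have e2 : ∀ k, fullProd p x (y k) * (F (y k - w) * partialProd F y k (y k)) =
      F (y k - w) * (fullProd p x (y k) * partialProd F y k (y k)) := fun k => by ring
  simp only [e2]
  ring

/-- Together with `mixedSum_addPoint_right`: up to sign, transferring the point w from x to y is
integration with respect to w. -/
lemma hasDerivAt_mixedSumOne (hp : IsLineFunction p β) (hF : IsOddPrimitive p F β)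
    (h : AreDistinct x y) (hwx : ∀ i, w - x i ≠ 0) (hwy : ∀ k, w - y k ≠ 0) :
    HasDerivAt (mixedSumOne p F x y) (-mixedSum p F (addPoint w x) y) w := by
  have hA : ∀ i, DifferentiableAt ℝ (fun t => partialProd p x i t * fullProd F y t) (x i) :=
    fun i => (differentiableAt_partialProd fun j hj => hp.differentiableAt (h.left i j hj.symm)).mul
      (differentiableAt_fullProd fun k => (hF.hasDerivAt _ (h.mixed i k)).differentiableAt)
  have hxw : ∀ i, x i - w ≠ 0 := fun i => sub_ne_zero_comm (hwx i)
  have hyw : ∀ k, y k - w ≠ 0 := fun k => sub_ne_zero_comm (hwy k)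
  have e1 : ∀ i, deriv (fun t => partialProd p (addPoint w x) (some i) t * fullProd F y t) (x i) =
      p (x i - w) * deriv (fun t => partialProd p x i t * fullProd F y t) (x i) +
      deriv p (x i - w) * (partialProd p x i (x i) * fullProd F y (x i)) := by
    intro i
    have h2 := (hp.differentiableAt (hxw i)).hasDerivAt.comp_sub_const (x i) w
    have h3 := (h2.mul (hA i).hasDerivAt).deriv
    rw [partialProd_addPoint_some, show (fun t => p (t - w) * partialProd p x i t * fullProd F y t) =
      (fun t => p (t - w)) * fun t => partialProd p x i t * fullProd F y t by
        ext t; simp only [Pi.mul_apply]; ring, h3]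
    ring
  have d1 : HasDerivAt (fun w => ∑ i, (F (x i - w) * deriv (fun t => partialProd p x i t *
      fullProd F y t) (x i) + p (x i - w) * (partialProd p x i (x i) * fullProd F y (x i))))
      (-∑ i, deriv (fun t => partialProd p (addPoint w x) (some i) t * fullProd F y t) (x i)) w := by
    rw [← Finset.sum_neg_distrib]
    refine HasDerivAt.fun_sum fun i _ => ?_
    have h2 := (hF.hasDerivAt _ (hxw i)).comp_const_sub (x i) w
    have h3 := (hp.differentiableAt (hxw i)).hasDerivAt.comp_const_sub (x i) w
    refine ((h2.mul_const _).add (h3.mul_const _)).congr_deriv ?_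
    rw [e1]; ring
  have hf1 : DifferentiableAt ℝ (fun t => fullProd p x t * fullProd F y t) w :=
    (differentiableAt_fullProd fun i => hp.differentiableAt (hwx i)).mul
      (differentiableAt_fullProd fun k => (hF.hasDerivAt _ (hwy k)).differentiableAt)
  have d3 : HasDerivAt (fun w => ∑ k, F (y k - w) * (fullProd p x (y k) * partialProd F y k (y k)))
      (-∑ k, fullProd p (addPoint w x) (y k) * partialProd F y k (y k)) w := by
    rw [← Finset.sum_neg_distrib]
    refine HasDerivAt.fun_sum fun k _ => ?_
    have h2 := (hF.hasDerivAt _ (hyw k)).comp_const_sub (y k) w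
    refine (h2.mul_const _).congr_deriv ?_
    rw [fullProd_addPoint]; ring
  refine ((d1.sub hf1.hasDerivAt).sub d3).congr_deriv ?_
  unfold mixedSum
  rw [Fintype.sum_option, partialProd_addPoint_none]
  simp only [addPoint_none, addPoint_some]
  ring

lemma meromorphicAt_mixedSumOne (hp : IsLineFunction p β) (hF : IsOddPrimitive p F β) (w : ℝ) :
    MeromorphicAt (mixedSumOne p F x y) w := by
  have h1 : ∀ {q : ℝ → ℂ}, (∀ t, MeromorphicAt q t) → ∀ a, MeromorphicAt (fun t => q (a - t)) w :=
    fun {q} hq a => (hq (a - w)).comp_analyticAt (f := q) (g := fun t => a - t) (by fun_prop)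
  have h2 : ∀ {q : ℝ → ℂ}, (∀ t, MeromorphicAt q t) → ∀ a, MeromorphicAt (fun t => q (t - a)) w :=
    fun {q} hq a => (hq (w - a)).comp_analyticAt (f := q) (g := fun t => t - a) (by fun_prop)
  unfold mixedSumOne
  refine ((MeromorphicAt.fun_sum fun i _ => ((h1 hF.meromorphic (x i)).mul
    (MeromorphicAt.const _ _)).add ((h1 hp.meromorphicAt (x i)).mul (MeromorphicAt.const _ _))).sub
    (MeromorphicAt.mul ?_ ?_)).sub
    (MeromorphicAt.fun_sum fun k _ => (h1 hF.meromorphic (y k)).mul (MeromorphicAt.const _ _))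
  · exact MeromorphicAt.fun_prod fun i _ => h2 hp.meromorphicAt (x i)
  · exact MeromorphicAt.fun_prod fun i _ => h2 hF.meromorphic (y i)

lemma mixedSumOne_eq (hp : IsLineFunction p β) (hF : IsOddPrimitive p F β)
    (hsol : MixedSolution (Option ι) κ p F) (h : AreDistinct x y) {w w' : ℝ}
    (hwx : ∀ i, w - x i ≠ 0) (hwy : ∀ k, w - y k ≠ 0) (hwx' : ∀ i, w' - x i ≠ 0)
    (hwy' : ∀ k, w' - y k ≠ 0) : mixedSumOne p F x y w = mixedSumOne p F x y w' := by
  refine eq_of_meromorphic_of_hasDerivAt_zero (meromorphicAt_mixedSumOne hp hF)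
    ((Set.finite_range x).union (Set.finite_range y)) ?_ ?_ ?_
  · intro t ht
    have htx : ∀ i, t - x i ≠ 0 := fun i h0 => ht (Or.inl ⟨i, (sub_eq_zero.1 h0).symm⟩)
    have hty : ∀ k, t - y k ≠ 0 := fun k h0 => ht (Or.inr ⟨k, (sub_eq_zero.1 h0).symm⟩)
    have hd := hasDerivAt_mixedSumOne hp hF h htx hty
    rw [hsol (addPoint t x) y ⟨addPoint_sub_notMem (S := {0}) (by simp) htx h.left, h.right, by
      rintro (_ | i) k
      · exact hty k
      · exact h.mixed i k⟩, neg_zero] at hd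
    exact hd
  · rintro (⟨i, hi⟩ | ⟨k, hk⟩)
    · exact hwx i (by rw [hi, sub_self])
    · exact hwy k (by rw [hk, sub_self])
  · rintro (⟨i, hi⟩ | ⟨k, hk⟩)
    · exact hwx' i (by rw [hi, sub_self])
    · exact hwy' k (by rw [hk, sub_self])

lemma tendsto_const_sub_of_even {q : ℝ → ℂ} (hq : Tendsto q atTop (𝓝 0)) (he : ∀ u, ‖q (-u)‖ = ‖q u‖)
    (a : ℝ) : Tendsto (fun t => q (a - t)) atTop (𝓝 0) := by
  have h1 : Tendsto (fun t => q (t - a)) atTop (𝓝 0) :=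
    hq.comp (tendsto_atTop_add_const_right atTop (-a) tendsto_id)
  rw [tendsto_zero_iff_norm_tendsto_zero] at h1 ⊢
  refine h1.congr fun t => ?_
  rw [← he, neg_sub]

/-- One more point may be integrated over if the function and its primitive decay. -/
lemma MixedSolution.integrate (hp : IsLineFunction p β) (hF : IsOddPrimitive p F β)
    (hp0 : Tendsto p atTop (𝓝 0)) (hF0 : Tendsto F atTop (𝓝 0)) [Nonempty (ι ⊕ κ)]
    (hsol : MixedSolution (Option ι) κ p F) : MixedSolution ι (Option κ) p F := by
  intro x y' hd
  set y : κ → ℝ := fun k => y' (some k)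
  set w := y' none
  have hy' : y' = addPoint w y := by ext (_ | k) <;> rfl
  have h : AreDistinct x y := ⟨hd.left, fun k l hkl => hd.right _ _ (by simpa using hkl),
    fun i k => hd.mixed i _⟩
  have hwx : ∀ i, w - x i ≠ 0 := fun i => sub_ne_zero_comm (hd.mixed i none)
  have hwy : ∀ k, w - y k ≠ 0 := fun k => hd.right none (some k) (by simp)
  rw [hy', mixedSum_addPoint_right hp hF h hwx]
  have hpe : ∀ u, ‖p (-u)‖ = ‖p u‖ := fun u => by rw [hp.even]
  have hFe : ∀ u, ‖F (-u)‖ = ‖F u‖ := fun u => by rw [hF.odd, norm_neg]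
  have hpm : ∀ a, Tendsto (fun t => p (t - a)) atTop (𝓝 0) := fun a =>
    hp0.comp (tendsto_atTop_add_const_right atTop (-a) tendsto_id)
  have hFm : ∀ a, Tendsto (fun t => F (t - a)) atTop (𝓝 0) := fun a =>
    hF0.comp (tendsto_atTop_add_const_right atTop (-a) tendsto_id)
  -- An empty product would be 1 and not decay, so at least one point besides w is needed. All other
  -- terms of the expression contain a decaying factor too; being constant in w off the other
  -- points, it is 0.
  have hprod : Tendsto (fun t => fullProd p x t * fullProd F y t) atTop (𝓝 0) := by
    have h1 := (tendsto_finsetProd Finset.univ fun i _ => hpm (x i)).mul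
      (tendsto_finsetProd Finset.univ fun k _ => hFm (y k))
    have h2 : (∏ _i : ι, (0 : ℂ)) * ∏ _k : κ, (0 : ℂ) = 0 := by
      obtain ⟨i | k⟩ := ‹Nonempty (ι ⊕ κ)›
      · rw [Finset.prod_eq_zero (Finset.mem_univ i) rfl, zero_mul]
      · rw [Finset.prod_eq_zero (Finset.mem_univ k) rfl, mul_zero]
    rwa [h2] at h1
  have hlim : Tendsto (mixedSumOne p F x y) atTop (𝓝 (∑ i : ι, (0 * deriv (fun t =>
      partialProd p x i t * fullProd F y t) (x i) +
      0 * (partialProd p x i (x i) * fullProd F y (x i))) - 0 -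
      ∑ k, 0 * (fullProd p x (y k) * partialProd F y k (y k)))) := by
    unfold mixedSumOne
    exact ((tendsto_finsetSum _ fun i _ =>
      ((tendsto_const_sub_of_even hF0 hFe _).mul_const _).add
      ((tendsto_const_sub_of_even hp0 hpe _).mul_const _)).sub hprod).sub
      (tendsto_finsetSum _ fun k _ => (tendsto_const_sub_of_even hF0 hFe _).mul_const _)
  simp only [zero_mul, add_zero, Finset.sum_const_zero, sub_zero] at hlim
  refine tendsto_nhds_unique (tendsto_const_nhds.congr' ?_) hlim
  filter_upwards [eventually_all.2 fun i => eventually_gt_atTop (x i),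
    eventually_all.2 fun k => eventually_gt_atTop (y k)] with t h1 h2
  exact mixedSumOne_eq hp hF hsol h hwx hwy (fun i => (sub_pos.2 (h1 i)).ne')
    (fun k => (sub_pos.2 (h2 k)).ne')

lemma mixedSum_of_isEmpty [IsEmpty κ] : mixedSum p F x y = divSum p x := by
  unfold mixedSum divSum
  have : ∀ i, (fun t => partialProd p x i t * fullProd F y t) = partialProd p x i := fun i => by
    ext t; simp [fullProd]
  simp [this]

lemma IsSolution.mixedSolution [IsEmpty κ] (h : IsSolution ι p {0}) : MixedSolution ι κ p F :=
  fun x _ hd => by rw [mixedSum_of_isEmpty]; exact h x hd.left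

lemma partialProd_comp_equiv {ι' : Type*} [Fintype ι'] [DecidableEq ι'] (e : ι ≃ ι') (q : ℝ → ℂ)
    (z : ι' → ℝ) (i : ι) : partialProd q (z ∘ e) i = partialProd q z (e i) := by
  ext t
  exact Finset.prod_equiv e (by simp) (by simp)

lemma mixedSum_comp_equiv {ι' κ' : Type*} [Fintype ι'] [DecidableEq ι'] [Fintype κ']
    [DecidableEq κ'] (e : ι ≃ ι') (e' : κ ≃ κ') (x : ι' → ℝ) (y : κ' → ℝ) :
    mixedSum p F (x ∘ e) (y ∘ e') = mixedSum p F x y := by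
  have h2 : fullProd p (x ∘ e) = fullProd p x := by
    ext t; exact Fintype.prod_equiv e _ _ fun _ => rfl
  have h3 : fullProd F (y ∘ e') = fullProd F y := by
    ext t; exact Fintype.prod_equiv e' _ _ fun _ => rfl
  unfold mixedSum
  simp only [partialProd_comp_equiv, h2, h3]
  congr 1
  · exact Fintype.sum_equiv e _ _ fun _ => rfl
  · exact Fintype.sum_equiv e' _ _ fun _ => rfl

lemma MixedSolution.of_equiv {ι' κ' : Type*} [Fintype ι'] [DecidableEq ι'] [Fintype κ']
    [DecidableEq κ'] (e : ι ≃ ι') (e' : κ ≃ κ') (h : MixedSolution ι κ p F) :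
    MixedSolution ι' κ' p F := by
  intro x y hd
  rw [← mixedSum_comp_equiv e e']
  exact h _ _ ⟨fun i j hij => hd.left _ _ (e.injective.ne hij),
    fun i j hij => hd.right _ _ (e'.injective.ne hij), fun i k => hd.mixed _ _⟩

/-- For a decaying solution with decaying primitive, the primitive satisfies an addition formula. -/
lemma sum_partialProd_eq_zero (hp : IsLineFunction p β) (hF : IsOddPrimitive p F β)
    (hp0 : Tendsto p atTop (𝓝 0)) (hF0 : Tendsto F atTop (𝓝 0)) {n : ℕ} (hn : 1 ≤ n)
    (hsol : IsSolution (Fin (n + 1)) p {0}) {y : Fin (n + 1) → ℝ}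
    (hy : ∀ i j, i ≠ j → y i - y j ≠ 0) : ∑ k, partialProd F y k (y k) = 0 := by
  -- The points are integrated over one after another. When all of them have been transferred, the
  -- first sum is empty and a relation for F alone is left.
  have key : ∀ m ≤ n + 1, MixedSolution (Fin (n + 1 - m)) (Fin m) p F := by
    intro m hm
    induction m with
    | zero => exact IsSolution.mixedSolution hsol
    | succ m ih =>
      have h1 := ih (by omega)
      have e : Fin (n + 1 - m) ≃ Option (Fin (n + 1 - (m + 1))) :=
        (finCongr (by omega)).trans finSuccEquivLast
      have h2 := h1.of_equiv e (Equiv.refl _)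
      have : Nonempty (Fin (n + 1 - (m + 1)) ⊕ Fin m) := by
        rcases Nat.eq_zero_or_pos m with rfl | h0
        · exact ⟨Sum.inl ⟨0, by omega⟩⟩
        · exact ⟨Sum.inr ⟨0, h0⟩⟩
      exact (h2.integrate hp hF hp0 hF0).of_equiv (Equiv.refl _) finSuccEquivLast.symm
  have h1 := key (n + 1) le_rfl
  have e : Fin (n + 1 - (n + 1)) ≃ Fin 0 := finCongr (by omega)
  have h2 := h1.of_equiv e (Equiv.refl _) (fun i => i.elim0) y
    ⟨fun i => i.elim0, hy, fun i => i.elim0⟩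
  simpa [mixedSum, fullProd] using h2

/-- A decaying solution with a primitive that does not decay solves the equation with one point
less. -/
lemma isSolution_of_primitive_not_tendsto_zero (hp : IsLineFunction p β)
    (hF : IsOddPrimitive p F β) (hp0 : Tendsto p atTop (𝓝 0)) (hF0 : ¬ Tendsto F atTop (𝓝 0))
    (hsol : IsSolution (Option ι) p {0}) : IsSolution ι p {0} := by
  intro x hx
  replace hx : ∀ i j, i ≠ j → x i - x j ≠ 0 := hx
  by_contra hne
  apply hF0
  have h : AreDistinct x (fun k : Fin 0 => k.elim0) := ⟨hx, fun i => i.elim0, fun _ k => k.elim0⟩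
  set y : Fin 0 → ℝ := fun k => k.elim0
  have hsol' : MixedSolution (Option ι) (Fin 0) p F := IsSolution.mixedSolution hsol
  have hpm : ∀ a, Tendsto (fun t => p (t - a)) atTop (𝓝 0) := fun a =>
    hp0.comp (tendsto_atTop_add_const_right atTop (-a) tendsto_id)
  have hpe : ∀ u, ‖p (-u)‖ = ‖p u‖ := fun u => by rw [hp.even]
  have hFshift : ∀ a, Tendsto (fun t => F (t - a) - F t) atTop (𝓝 0) := by
    intro a
    rw [Metric.tendsto_atTop]
    intro η hη
    obtain ⟨T, hT⟩ := eventually_atTop.1 ((tendsto_zero_iff_norm_tendsto_zero.1 hp0).eventually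
      (gt_mem_nhds (show 0 < η / (|a| + 1) by positivity)))
    refine ⟨max T 1 + |a|, fun t ht => ?_⟩
    have hta : max T 1 ≤ t - a ∧ max T 1 ≤ t := by
      constructor <;> linarith [le_abs_self a, abs_nonneg a]
    have := (convex_Ici (max T 1)).norm_image_sub_le_of_norm_hasDerivWithin_le (f := F) (f' := p)
      (C := η / (|a| + 1)) (fun s hs => (hF.hasDerivAt s (by
        have := (le_max_right T 1).trans (Set.mem_Ici.1 hs); linarith)).hasDerivWithinAt)
      (fun s hs => (hT s ((le_max_left T 1).trans (Set.mem_Ici.1 hs))).le)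
      (Set.mem_Ici.2 hta.2) (Set.mem_Ici.2 hta.1)
    rw [dist_zero_right]
    refine this.trans_lt ?_
    rw [sub_sub_cancel_left, norm_neg, Real.norm_eq_abs, div_mul_eq_mul_div,
      div_lt_iff₀ (by positivity)]
    nlinarith [abs_nonneg a]
  set V' : ι → ℂ := fun i => deriv (partialProd p x i) (x i)
  set V : ι → ℂ := fun i => partialProd p x i (x i)
  have hform : ∀ w, mixedSumOne p F x y w =
      ∑ i, (F (x i - w) * V' i + p (x i - w) * V i) - fullProd p x w := by
    intro w
    have : ∀ i, (fun t => partialProd p x i t * fullProd F y t) = partialProd p x i := fun i => by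
      ext t; simp [fullProd]
    simp only [mixedSumOne, this]
    simp [fullProd, V', V]
  -- The expression is constant in w off the points, so its values at w and −w agree for large w. As
  -- F is odd and its translates differ by o(1), the comparison gives (2∑ V' i)F(w) → 0. If ∑ V' i,
  -- the left hand side of the equation for x, were not zero, F would decay.
  have hdiff : ∀ᶠ w in atTop, mixedSumOne p F x y (-w) - mixedSumOne p F x y w = 0 := by
    filter_upwards [eventually_all.2 fun i => eventually_gt_atTop (x i),
      eventually_all.2 fun i => eventually_gt_atTop (-x i)] with w h1 h2
    rw [sub_eq_zero]
    exact mixedSumOne_eq hp hF hsol' h (fun i => by have := h2 i; intro h0; linarith)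
      (fun k => k.elim0) (fun i => (sub_pos.2 (h1 i)).ne') (fun k => k.elim0)
  have hprod : Tendsto (fun w => fullProd p x (-w) - fullProd p x w) atTop (𝓝 0) := by
    have h1 : Tendsto (fun w => fullProd p x w) atTop (𝓝 (∏ _i : ι, 0)) :=
      tendsto_finsetProd Finset.univ fun i _ => hpm (x i)
    have h2 : Tendsto (fun w => fullProd p x (-w)) atTop (𝓝 (∏ _i : ι, 0)) := by
      refine tendsto_finsetProd Finset.univ fun i _ => ?_
      exact (tendsto_const_sub_of_even hp0 hpe (-x i)).congr fun t => by congr 1; ring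
    simpa using h2.sub h1
  have hrest : Tendsto (fun w => ∑ i, ((F (w - -x i) - F w) * V' i + (F (w - x i) - F w) * V' i +
      (p (w - -x i) - p (w - x i)) * V i) - (fullProd p x (-w) - fullProd p x w)) atTop
      (𝓝 (∑ i, (0 * V' i + 0 * V' i + (0 - 0) * V i) - 0)) :=
    (tendsto_finsetSum _ fun i _ => (((hFshift (-x i)).mul_const _).add
      ((hFshift (x i)).mul_const _)).add (((hpm (-x i)).sub (hpm (x i))).mul_const _)).sub hprod
  simp only [zero_mul, add_zero, sub_zero, Finset.sum_const_zero] at hrest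
  have hmain : Tendsto (fun w => -(2 * ∑ i, V' i) * F w) atTop (𝓝 0) := by
    refine hrest.congr' ?_
    filter_upwards [hdiff] with w hw
    rw [hform, hform] at hw
    have e1 : ∀ i, F (x i - -w) = F (w - -x i) := fun i => by congr 1; ring
    have e2 : ∀ i, F (x i - w) = -F (w - x i) := fun i => by rw [← hF.odd]; congr 1; ring
    have e3 : ∀ i, p (x i - -w) = p (w - -x i) := fun i => by congr 1; ring
    have e4 : ∀ i, p (x i - w) = p (w - x i) := fun i => by rw [← hp.even]; congr 1; ring
    simp only [e1, e2, e3, e4] at hw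
    simp only [Finset.sum_add_distrib, sub_mul, Finset.sum_sub_distrib, ← Finset.mul_sum,
      neg_mul, Finset.sum_neg_distrib] at hw ⊢
    linear_combination hw
  have hc : -(2 * ∑ i, V' i) ≠ 0 := by
    refine neg_ne_zero.2 (mul_ne_zero two_ne_zero hne)
  have := hmain.const_mul (-(2 * ∑ i, V' i))⁻¹
  rw [mul_zero] at this
  exact this.congr fun w => by rw [← mul_assoc, inv_mul_cancel₀ hc, one_mul]

end Mixed

/-! ### Linear recurrences and exponential sequences -/

section Recurrence

/-- The space spanned by the translates of a nonzero solution of a linear recurrence contains an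
exponential sequence. -/
lemma exists_exponential_mem_span {M : ℕ} {Q : Fin (M + 1) → ℂ} (hQ0 : Q 0 ≠ 0)
    (hQM : Q (Fin.last M) ≠ 0) {h : ℤ → ℂ} (hne : h ≠ 0)
    (hrec : ∀ s : ℤ, ∑ k, Q k * h (s - (k : ℕ)) = 0) :
    ∃ z : ℂ, z ≠ 0 ∧ (fun s : ℤ => z ^ s) ∈
      Submodule.span ℂ (Set.range fun (a : ℤ) (s : ℤ) => h (a + s)) := by
  set W := Submodule.span ℂ (Set.range fun (a : ℤ) (s : ℤ) => h (a + s)) with hW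
  have hWrec : ∀ f ∈ W, ∀ s : ℤ, ∑ k, Q k * f (s - (k : ℕ)) = 0 := by
    intro f hf
    induction hf using Submodule.span_induction with
    | mem f hf =>
      obtain ⟨a, rfl⟩ := hf
      intro s
      rw [← hrec (a + s)]
      exact Finset.sum_congr rfl fun k _ => by rw [add_sub_assoc]
    | zero => simp
    | add f g _ _ h1 h2 =>
      intro s
      simp only [Pi.add_apply, mul_add, Finset.sum_add_distrib, h1, h2, add_zero]
    | smul c f _ h1 =>
      intro s
      have : ∀ k : Fin (M + 1), Q k * (c • f) (s - (k : ℕ)) = c * (Q k * f (s - (k : ℕ))) :=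
        fun k => by simp only [Pi.smul_apply, smul_eq_mul]; ring
      simp only [this, ← Finset.mul_sum, h1, mul_zero]
  -- The outer coefficients are nonzero, so the recurrence runs in both directions and M + 1
  -- consecutive values determine a solution. Hence W is finite dimensional. It is invariant under
  -- the shift, which has an eigenvector in it, and an eigenvector of the shift is an exponential
  -- sequence.
  have hdet : ∀ f ∈ W, (∀ k : Fin (M + 1), f (k : ℕ) = 0) → f = 0 := by
    intro f hf h0
    have hclaim : ∀ j : ℕ, ∀ i : ℤ, -(j : ℤ) ≤ i → i < M + 1 + j → f i = 0 := by
      intro j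
      induction j with
      | zero =>
        intro i h1 h2
        lift i to ℕ using by simpa using h1
        exact h0 ⟨i, by omega⟩
      | succ j ih =>
        intro i h1 h2
        push_cast at h1 h2
        rcases lt_or_ge i (-(j : ℤ)) with h3 | h3
        · have hr := hWrec f hf (i + M)
          rw [Finset.sum_eq_single (Fin.last M)] at hr
          · have := (mul_eq_zero.1 hr).resolve_left hQM
            simpa using this
          · intro k _ hk
            have hkM : (k : ℕ) < M := lt_of_le_of_ne (Nat.lt_succ_iff.1 k.2)
              fun h => hk (Fin.ext h)
            rw [ih _ (by omega) (by omega), mul_zero]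
          · simp
        · rcases lt_or_ge i (M + 1 + j) with h4 | h4
          · exact ih i h3 h4
          · have hr := hWrec f hf i
            rw [Finset.sum_eq_single 0] at hr
            · have := (mul_eq_zero.1 hr).resolve_left hQ0
              simpa using this
            · intro k _ hk
              have hk0 : 0 < (k : ℕ) := Nat.pos_of_ne_zero fun h => hk (Fin.ext h)
              have := k.2
              rw [ih _ (by omega) (by omega), mul_zero]
            · simp
    funext i
    exact hclaim i.natAbs i (by omega) (by omega)
  set ρ : (ℤ → ℂ) →ₗ[ℂ] (Fin (M + 1) → ℂ) :=
    LinearMap.funLeft ℂ ℂ fun k : Fin (M + 1) => ((k : ℕ) : ℤ) with hρ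
  have hinj : Function.Injective (ρ.domRestrict W) := by
    rw [← LinearMap.ker_eq_bot, LinearMap.ker_eq_bot']
    intro f hf
    exact Subtype.ext (hdet f f.2 fun k => congrFun hf k)
  have hfin : FiniteDimensional ℂ W := FiniteDimensional.of_injective _ hinj
  have hhW : h ∈ W := Submodule.subset_span ⟨0, by funext s; simp⟩
  have hnt : Nontrivial W := ⟨⟨⟨h, hhW⟩, 0, fun h0 => hne (congrArg Subtype.val h0)⟩⟩
  set S : (ℤ → ℂ) →ₗ[ℂ] (ℤ → ℂ) := LinearMap.funLeft ℂ ℂ fun s : ℤ => s + 1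
  have hSW : ∀ f ∈ W, S f ∈ W := by
    intro f hf
    induction hf using Submodule.span_induction with
    | mem f hf =>
      obtain ⟨a, rfl⟩ := hf
      refine Submodule.subset_span ⟨a + 1, ?_⟩
      funext s
      simp only [S, LinearMap.funLeft_apply]
      congr 1; ring
    | zero => rw [map_zero]; exact W.zero_mem
    | add f g _ _ h1 h2 => rw [map_add]; exact W.add_mem h1 h2
    | smul c f _ h1 => rw [map_smul]; exact W.smul_mem c h1
  obtain ⟨z, hz⟩ := Module.End.exists_eigenvalue (S.restrict hSW)
  obtain ⟨⟨e, heW⟩, he⟩ := hz.exists_hasEigenvector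
  have he0 : e ≠ 0 := fun h0 => he.2 (Subtype.ext h0)
  have hshift : ∀ s, e (s + 1) = z * e s := fun s => by
    have := congrArg Subtype.val he.apply_eq_smul
    exact congrFun this s
  have hz0 : z ≠ 0 := by
    rintro rfl
    apply he0
    funext s
    have := hshift (s - 1)
    simpa using this
  have hpow : ∀ s : ℤ, e s = z ^ s * e 0 := by
    intro s
    induction s with
    | zero => simp
    | succ n ih => rw [hshift, ih, zpow_add_one₀ hz0]; ring
    | pred n ih =>
      have := hshift (-(n : ℤ) - 1)
      rw [sub_add_cancel, ih] at this
      rw [zpow_sub_one₀ hz0]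
      field_simp
      linear_combination -this
  have he00 : e 0 ≠ 0 := fun h0 => he0 (funext fun s => by rw [hpow, h0, mul_zero]; rfl)
  refine ⟨z, hz0, ?_⟩
  have : (fun s : ℤ => z ^ s) = (e 0)⁻¹ • e := by
    funext s
    rw [Pi.smul_apply, hpow s, smul_eq_mul]; field_simp
  rw [this]
  exact W.smul_mem _ heW

/-- The rescaled translates of a decaying solution of a perturbed linear recurrence converge along
an ultrafilter to a nonzero solution of the linear recurrence. -/
lemma exists_rescaled_limit {M : ℕ} (hM : 1 ≤ M) {Q : Fin (M + 1) → ℂ} (hQ0 : Q 0 ≠ 0)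
    (hQM : Q (Fin.last M) ≠ 0) {u : ℤ → ℂ} (hu : Tendsto u atTop (𝓝 0))
    (hfr : ∃ᶠ m in atTop, u m ≠ 0)
    (hrec : ∀ᶠ m : ℤ in atTop, ∑ k, Q k * u (m - (k : ℕ)) = ∏ k : Fin (M + 1), u (m - (k : ℕ))) :
    ∃ (U : Ultrafilter ℤ) (σ : ℤ → ℝ) (h : ℤ → ℂ), (U : Filter ℤ) ≤ atTop ∧
      (∀ᶠ m in (U : Filter ℤ), 0 < σ m) ∧
      (∀ s, Tendsto (fun m => u (m + s) / σ m) U (𝓝 (h s))) ∧ h ≠ 0 ∧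
      ∀ s : ℤ, ∑ k, Q k * h (s - (k : ℕ)) = 0 := by
  have hsh : ∀ s : ℤ, Tendsto (fun m : ℤ => m + s) atTop atTop := fun s =>
    tendsto_atTop_add_const_right atTop s tendsto_id
  have hus : ∀ s : ℤ, Tendsto (fun m : ℤ => u (m + s)) atTop (𝓝 0) := fun s => hu.comp (hsh s)
  -- The scale is the sum of M consecutive moduli, as single values may vanish. The product on the
  -- right of the recurrence is negligible against its first and against its last linear term. So
  -- u(m) and u(m − M) are bounded by neighbouring values of σ, a step in either direction changes σ
  -- by a factor of at most 1 + A, and the quotients u(m + s)/σ(m) stay bounded.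
  set σ : ℤ → ℝ := fun m => ∑ k ∈ Finset.range M, ‖u (m - (k : ℕ))‖ with hσ
  have hσF : ∀ m, σ m = ∑ k : Fin M, ‖u (m - (k : ℕ))‖ := fun m => Finset.sum_range _
  have hσ0 : ∀ m, 0 ≤ σ m := fun m => Finset.sum_nonneg fun _ _ => norm_nonneg _
  have huσ : ∀ m, ‖u m‖ ≤ σ m := fun m => by
    have := Finset.single_le_sum (f := fun k : ℕ => ‖u (m - (k : ℕ))‖) (fun k _ => norm_nonneg _)
      (Finset.mem_range.2 (by omega : 0 < M))
    simpa using this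
  have hσid : ∀ m, σ m + ‖u (m - M)‖ = ‖u m‖ + σ (m - 1) := by
    intro m
    have h1 := Finset.sum_range_succ (fun k : ℕ => ‖u (m - (k : ℕ))‖) M
    have h2 := Finset.sum_range_succ' (fun k : ℕ => ‖u (m - (k : ℕ))‖) M
    rw [h1] at h2
    rw [hσ]
    simp only
    rw [h2, add_comm]
    congr 1
    · simp
    · refine Finset.sum_congr rfl fun k _ => ?_
      congr 2; push_cast; ring
  have hK : ∃ K : ℝ, 0 ≤ K ∧ ∀ k, ‖Q k‖ ≤ K := ⟨∑ k, ‖Q k‖,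
    Finset.sum_nonneg fun _ _ => norm_nonneg _, fun k =>
      Finset.single_le_sum (f := fun k => ‖Q k‖) (fun k _ => norm_nonneg _) (Finset.mem_univ k)⟩
  obtain ⟨K, hK0, hK⟩ := hK
  -- a generic estimate isolating one term of the recurrence
  have hiso : ∀ (q ε v r : ℂ) (R : ℝ), q * v + r = v * ε → ‖ε‖ ≤ ‖q‖ / 2 → q ≠ 0 → ‖r‖ ≤ R →
      ‖v‖ ≤ 2 / ‖q‖ * R := by
    intro q ε v r R h1 h2 h3 h4
    have hq : 0 < ‖q‖ := norm_pos_iff.2 h3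
    have h5 : ‖q * v‖ ≤ ‖v‖ * ‖ε‖ + R := by
      have : q * v = v * ε - r := by linear_combination h1
      rw [this]
      exact (norm_sub_le _ _).trans (add_le_add (norm_mul _ _).le h4)
    rw [norm_mul] at h5
    have h6 : ‖v‖ * ‖ε‖ ≤ ‖v‖ * (‖q‖ / 2) := mul_le_mul_of_nonneg_left h2 (norm_nonneg _)
    rw [div_mul_eq_mul_div, le_div_iff₀ hq]
    nlinarith
  have hpr1 : Tendsto (fun m : ℤ => ∏ k : Fin M, u (m - (k.succ : ℕ))) atTop (𝓝 0) := by
    have := tendsto_finsetProd (Finset.univ : Finset (Fin M)) fun k _ => hus (-((k.succ : ℕ) : ℤ))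
    simpa [Finset.prod_const, sub_eq_add_neg, zero_pow (by omega : M ≠ 0)] using this
  have hpr2 : Tendsto (fun m : ℤ => ∏ k : Fin M, u (m - (k : ℕ))) atTop (𝓝 0) := by
    have := tendsto_finsetProd (Finset.univ : Finset (Fin M)) fun k _ => hus (-((k : ℕ) : ℤ))
    simpa [Finset.prod_const, sub_eq_add_neg, zero_pow (by omega : M ≠ 0)] using this
  have hA : ∃ A : ℝ, 0 ≤ A ∧ ∀ᶠ m : ℤ in atTop, ‖u m‖ ≤ A * σ (m - 1) ∧ ‖u (m - M)‖ ≤ A * σ m := by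
    have q0 : 0 < ‖Q 0‖ := norm_pos_iff.2 hQ0
    have qM : 0 < ‖Q (Fin.last M)‖ := norm_pos_iff.2 hQM
    refine ⟨max (2 / ‖Q 0‖ * K) (2 / ‖Q (Fin.last M)‖ * K),
      le_max_of_le_left (by positivity), ?_⟩
    filter_upwards [hrec, hpr1.norm.eventually (ge_mem_nhds (show ‖(0 : ℂ)‖ < ‖Q 0‖ / 2 by
        rw [norm_zero]; positivity)), hpr2.norm.eventually (ge_mem_nhds
        (show ‖(0 : ℂ)‖ < ‖Q (Fin.last M)‖ / 2 by rw [norm_zero]; positivity))] with m h1 h2 h3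
    constructor
    · rw [Fin.sum_univ_succ, Fin.prod_univ_succ] at h1
      have h4 := hiso (Q 0) (∏ k : Fin M, u (m - (k.succ : ℕ))) (u m)
        (∑ k : Fin M, Q k.succ * u (m - (k.succ : ℕ))) (K * σ (m - 1)) (by simpa using h1) h2 hQ0 (by
          rw [hσF, Finset.mul_sum]
          refine norm_sum_le_of_le _ fun k _ => ?_
          rw [norm_mul, show m - ((k.succ : ℕ) : ℤ) = m - 1 - (k : ℕ) by
            rw [Fin.val_succ]; push_cast; ring]
          exact mul_le_mul_of_nonneg_right (hK _) (norm_nonneg _))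
      rw [← mul_assoc] at h4
      exact h4.trans (mul_le_mul_of_nonneg_right (le_max_left _ _) (hσ0 _))
    · rw [Fin.sum_univ_castSucc, Fin.prod_univ_castSucc] at h1
      have h4 := hiso (Q (Fin.last M)) (∏ k : Fin M, u (m - (k : ℕ))) (u (m - M))
        (∑ k : Fin M, Q k.castSucc * u (m - (k : ℕ))) (K * σ m) (by
          simp only [Fin.val_castSucc, Fin.val_last] at h1
          linear_combination h1) h3 hQM (by
          rw [hσF, Finset.mul_sum]
          refine norm_sum_le_of_le _ fun k _ => ?_
          rw [norm_mul]
          exact mul_le_mul_of_nonneg_right (hK _) (norm_nonneg _))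
      rw [← mul_assoc] at h4
      exact h4.trans (mul_le_mul_of_nonneg_right (le_max_right _ _) (hσ0 _))
  obtain ⟨A, hA0, hA⟩ := hA
  obtain ⟨m₀, hm₀⟩ := eventually_atTop.1 hA
  have hup : ∀ j : ℕ, ∀ m ≥ m₀, σ (m + j) ≤ (1 + A) ^ j * σ m := by
    intro j m hm
    induction j with
    | zero => simp
    | succ j ih =>
      have h1 := (hm₀ (m + (j + 1)) (by omega)).1
      have h2 := hσid (m + (j + 1))
      rw [show m + ((j : ℤ) + 1) - 1 = m + j by ring] at h1 h2
      have h3 : σ (m + (j + 1)) ≤ (1 + A) * σ (m + j) := by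
        linarith [norm_nonneg (u (m + (j + 1) - M))]
      push_cast
      refine h3.trans ?_
      rw [pow_succ', mul_assoc]
      exact mul_le_mul_of_nonneg_left ih (by linarith)
  have hdown : ∀ j : ℕ, ∀ m ≥ m₀, σ m ≤ (1 + A) ^ j * σ (m + j) := by
    intro j m hm
    induction j with
    | zero => simp
    | succ j ih =>
      have h1 := (hm₀ (m + (j + 1)) (by omega)).2
      have h2 := hσid (m + (j + 1))
      rw [show m + ((j : ℤ) + 1) - 1 = m + j by ring] at h2
      have h3 : σ (m + j) ≤ (1 + A) * σ (m + (j + 1)) := by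
        linarith [norm_nonneg (u (m + (j + 1)))]
      push_cast
      refine ih.trans ?_
      rw [pow_succ, mul_assoc]
      exact mul_le_mul_of_nonneg_left h3 (by positivity)
  have hpos : ∀ m ≥ m₀, 0 < σ m := by
    intro m hm
    refine lt_of_le_of_ne (hσ0 m) fun h0 => ?_
    refine hfr ?_
    filter_upwards [eventually_ge_atTop m] with i hi
    obtain ⟨j, rfl⟩ := Int.le.dest hi
    have h1 := hup j m hm
    rw [← h0, mul_zero] at h1
    rw [not_not]
    exact norm_le_zero_iff.1 ((huσ _).trans h1)
  have hbound : ∀ s : ℤ, ∀ᶠ m : ℤ in atTop, ‖u (m + s) / σ m‖ ≤ (1 + A) ^ s.natAbs := by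
    intro s
    filter_upwards [eventually_ge_atTop m₀, eventually_ge_atTop (m₀ - s)] with m h1 h2
    have hσm := hpos m h1
    rw [norm_div, Complex.norm_real, Real.norm_of_nonneg hσm.le, div_le_iff₀ hσm]
    refine (huσ _).trans ?_
    rcases le_total 0 s with h3 | h3
    · have := hup s.natAbs m h1
      rwa [Int.natAbs_of_nonneg h3] at this
    · have := hdown s.natAbs (m + s) (by omega)
      rwa [Int.ofNat_natAbs_of_nonpos h3, add_neg_cancel_right] at this
  set U : Ultrafilter ℤ := Ultrafilter.of atTop
  have hU : (U : Filter ℤ) ≤ atTop := Ultrafilter.of_le _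
  have hex : ∀ s : ℤ, ∃ z, Tendsto (fun m => u (m + s) / σ m) U (𝓝 z) := fun s =>
    (exists_tendsto_of_norm_le (hU (hbound s))).imp fun z hz => hz.1
  choose h hh using hex
  have hUpos : ∀ᶠ m in (U : Filter ℤ), 0 < σ m := hU (by
    filter_upwards [eventually_ge_atTop m₀] with m hm using hpos m hm)
  refine ⟨U, σ, h, hU, hUpos, hh, ?_, ?_⟩
  -- For each m the moduli of the M rescaled values in the window add up to 1, so the limit cannot
  -- vanish.
  · rintro rfl
    have h1 : Tendsto (fun m => ∑ k ∈ Finset.range M, ‖u (m + -((k : ℕ) : ℤ)) / σ m‖) U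
        (𝓝 (∑ k ∈ Finset.range M, ‖(0 : ℤ → ℂ) (-((k : ℕ) : ℤ))‖)) :=
      tendsto_finsetSum _ fun k _ => (hh _).norm
    simp only [Pi.zero_apply, norm_zero, Finset.sum_const_zero] at h1
    have h2 : (1 : ℝ) = 0 := by
      refine tendsto_nhds_unique (tendsto_const_nhds.congr' ?_) h1
      filter_upwards [hUpos] with m hm
      simp only [norm_div, Complex.norm_real, Real.norm_of_nonneg hm.le, ← Finset.sum_div,
        ← sub_eq_add_neg]
      exact (div_self hm.ne').symm
    exact one_ne_zero h2
  · intro s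
    have h1 : Tendsto (fun m => ∑ k : Fin (M + 1), Q k * (u (m + (s - (k : ℕ))) / σ m)) U
        (𝓝 (∑ k, Q k * h (s - (k : ℕ)))) :=
      tendsto_finsetSum _ fun k _ => (hh _).const_mul _
    have h2 : Tendsto (fun m => (u (m + s) / σ m) * ∏ k : Fin M, u (m + s - (k.succ : ℕ))) U
        (𝓝 (h s * 0)) := (hh s).mul ((hpr1.comp (hsh s)).mono_left hU)
    rw [mul_zero] at h2
    refine tendsto_nhds_unique (h1.congr' ?_) h2
    filter_upwards [hU ((hsh s).eventually hrec)] with m hm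
    rw [Fin.prod_univ_succ] at hm
    simp only [Fin.val_zero, Nat.cast_zero, sub_zero] at hm
    rw [div_mul_eq_mul_div, ← hm, Finset.sum_div]
    refine Finset.sum_congr rfl fun k _ => ?_
    rw [add_sub_assoc]; ring

end Recurrence

/-! ### The addition formula on a lattice and its descent -/

section Discrete

variable {ι : Type*} [Fintype ι] [DecidableEq ι]

/-- The sum `∑_k ∏_{l ≠ k} u (y_k - y_l)` for a sequence `u` and integers `y`. -/
def diffSum (u : ℤ → ℂ) (y : ι → ℤ) : ℂ := ∑ k, ∏ l ∈ Finset.univ.erase k, u (y k - y l)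

def DiffSolution (ι : Type*) [Fintype ι] [DecidableEq ι] (u : ℤ → ℂ) : Prop :=
  ∀ y : ι → ℤ, Function.Injective y → diffSum u y = 0

lemma DiffSolution.of_card_eq {κ : Type*} [Fintype κ] [DecidableEq κ] {u : ℤ → ℂ}
    (h : DiffSolution ι u) (hc : Fintype.card ι = Fintype.card κ) : DiffSolution κ u := by
  intro y hy
  obtain ⟨e⟩ := Fintype.card_eq.1 hc
  rw [← h (y ∘ e) (hy.comp e.injective)]
  refine (Fintype.sum_equiv e _ _ fun i => ?_).symm
  exact Finset.prod_equiv e (by simp) (by simp)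

lemma diffSum_option (u : ℤ → ℂ) (a : ℤ) (y : ι → ℤ) :
    diffSum u (fun o : Option ι => o.elim a y) = ∏ l, u (a - y l) +
      ∑ k, u (y k - a) * ∏ l ∈ Finset.univ.erase k, u (y k - y l) := by
  rw [diffSum, Fintype.sum_option, prod_erase_none]
  congr 1
  exact Finset.sum_congr rfl fun k _ => by rw [prod_erase_some]; rfl

lemma injective_option_elim {α : Type*} {a : α} {y : ι → α} (hy : Function.Injective y)
    (ha : ∀ i, a ≠ y i) : Function.Injective (fun o : Option ι => o.elim a y) := by
  rintro (_ | i) (_ | j) h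
  · rfl
  · exact absurd h (ha j)
  · exact absurd h.symm (ha i)
  · exact congrArg some (hy h)

variable {u : ℤ → ℂ}

/-- The formula for the points 0, …, M and m. The summand of the point m is the product on the
right; those of the fixed points are linear in u(m − k), with coefficients independent of m. -/
lemma diffSolution_recurrence (hodd : ∀ m, u (-m) = -u m) {M : ℕ}
    (hsol : DiffSolution (Option (Fin (M + 1))) u) {m : ℤ} (hm : M < m) :
    ∑ k : Fin (M + 1), (∏ l ∈ Finset.univ.erase k, u (((k : ℕ) : ℤ) - ((l : ℕ) : ℤ))) *
      u (m - (k : ℕ)) = ∏ k : Fin (M + 1), u (m - (k : ℕ)) := by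
  have h := hsol (fun o => o.elim m fun k : Fin (M + 1) => ((k : ℕ) : ℤ))
    (injective_option_elim (fun i j h => Fin.ext (by exact_mod_cast h)) fun i => by
      have := i.2; omega)
  rw [diffSum_option] at h
  have e : ∀ k : Fin (M + 1), u (((k : ℕ) : ℤ) - m) = -u (m - (k : ℕ)) := fun k => by
    rw [← hodd, neg_sub]
  simp only [e, neg_mul, Finset.sum_neg_distrib] at h
  rw [← sub_eq_zero, ← neg_eq_zero, neg_sub, sub_eq_add_neg, ← h]
  congr 2
  exact Finset.sum_congr rfl fun k _ => mul_comm _ _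

/-- The addition formula for a decaying odd sequence descends to two points less. -/
lemma DiffSolution.descend (hodd : ∀ m, u (-m) = -u m) (hu : Tendsto u atTop (𝓝 0))
    (hcard : 2 ≤ Fintype.card ι) (hne : ∀ j : ℤ, 1 ≤ j → j ≤ Fintype.card ι → u j ≠ 0)
    (hsol : DiffSolution (Option (Option ι)) u) : DiffSolution ι u := by
  set M := Fintype.card ι with hM
  have hsol' : DiffSolution (Option (Fin (M + 1))) u := hsol.of_card_eq (by simp [hM])
  set Q : Fin (M + 1) → ℂ := fun k => ∏ l ∈ Finset.univ.erase k, u (((k : ℕ) : ℤ) - ((l : ℕ) : ℤ))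
  have hne' : ∀ j : ℤ, j ≠ 0 → |j| ≤ M → u j ≠ 0 := by
    intro j hj hjM
    rcases lt_or_gt_of_ne hj with h | h
    · rw [abs_of_neg h] at hjM
      have := hne (-j) (by omega) hjM
      rw [hodd] at this
      exact neg_ne_zero.1 this
    · rw [abs_of_pos h] at hjM
      exact hne j (by omega) hjM
  have hQ : ∀ k, Q k ≠ 0 := by
    intro k
    rw [Finset.prod_ne_zero_iff]
    intro l hl
    have hkl : l ≠ k := Finset.ne_of_mem_erase hl
    refine hne' _ (fun h0 => hkl (Fin.ext (by omega))) ?_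
    have h1 := k.2
    have h2 := l.2
    rw [abs_le]; omega
  have hrec : ∀ m : ℤ, M < m → ∑ k, Q k * u (m - (k : ℕ)) = ∏ k : Fin (M + 1), u (m - (k : ℕ)) :=
    fun m hm => diffSolution_recurrence hodd hsol' hm
  -- If u vanished from some index on, the recurrence run backwards would give u(1) = 0.
  have hfr : ∃ᶠ m in atTop, u m ≠ 0 := by
    intro hev
    simp only [not_not] at hev
    obtain ⟨T, hT⟩ := eventually_atTop.1 hev
    have hclaim : ∀ j : ℕ, ∀ m : ℤ, 1 ≤ m → T - j ≤ m → u m = 0 := by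
      intro j
      induction j with
      | zero => intro m _ hm; exact hT m (by simpa using hm)
      | succ j ih =>
        intro m h1 hm
        push_cast at hm
        have hr := hrec (m + M) (by omega)
        rw [Finset.sum_eq_single (Fin.last M), Finset.prod_eq_zero (Finset.mem_univ 0)] at hr
        · have := (mul_eq_zero.1 hr).resolve_left (hQ _)
          simpa using this
        · exact ih _ (by simp; omega) (by simp; omega)
        · intro k _ hk
          have hkM : (k : ℕ) < M := lt_of_le_of_ne (Nat.lt_succ_iff.1 k.2)
            fun h => hk (Fin.ext h)
          rw [ih _ (by omega) (by omega), mul_zero]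
        · simp
    exact hne 1 le_rfl (by omega) (hclaim (T - 1).natAbs 1 le_rfl (by omega))
  obtain ⟨U, σ, h, hU, hσ, hh, hh0, hhrec⟩ := exists_rescaled_limit (by omega : 1 ≤ M) (hQ 0)
    (hQ (Fin.last M)) hu hfr (by
      filter_upwards [eventually_gt_atTop (M : ℤ)] with m hm using hrec m hm)
  obtain ⟨z, hz0, hz⟩ := exists_exponential_mem_span (hQ 0) (hQ (Fin.last M)) hh0 hhrec
  intro y hy
  set R : ι → ℂ := fun k => ∏ l ∈ Finset.univ.erase k, u (y k - y l)
  have hsh : ∀ s : ℤ, Tendsto (fun m : ℤ => m + s) atTop atTop := fun s =>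
    tendsto_atTop_add_const_right atTop s tendsto_id
  have hdouble : ∀ s : ℤ, Tendsto (fun m : ℤ => u (m + m + s)) atTop (𝓝 0) := fun s =>
    hu.comp ((hsh s).comp (tendsto_id.atTop_add_atTop tendsto_id))
  have hus : ∀ s : ℤ, Tendsto (fun m : ℤ => u (m + s)) atTop (𝓝 0) := fun s => hu.comp (hsh s)
  obtain ⟨i₁, i₂, hi⟩ := Fintype.exists_pair_of_one_lt_card (by omega : 1 < Fintype.card ι)
  -- quotients of products of at least two factors by the square of the scale are bounded
  have hprod : ∀ s : ι → ℤ, ∃ c, Tendsto (fun m => (∏ l, u (m + s l)) / (σ m : ℂ) ^ 2) U (𝓝 c) := by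
    intro s
    refine ⟨h (s i₁) * (h (s i₂) * ∏ l ∈ (Finset.univ.erase i₁).erase i₂, 0), ?_⟩
    have h1 := (hh (s i₁)).mul ((hh (s i₂)).mul (tendsto_finsetProd
      ((Finset.univ.erase i₁).erase i₂) fun l _ => (hus (s l)).mono_left hU))
    refine h1.congr fun m => ?_
    rw [← Finset.mul_prod_erase Finset.univ _ (Finset.mem_univ i₁),
      ← Finset.mul_prod_erase (Finset.univ.erase i₁) _
        (Finset.mem_erase.2 ⟨hi.symm, Finset.mem_univ i₂⟩)]
    ring
  -- The points m + a and −(m + b) are added to y, and the formula is divided by the square of the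
  -- scale. The summands of the points y k converge, up to sign, to those of the claim. The two
  -- others contain u(2m + a + b) → 0 beside a product of at least two small factors, which is
  -- bounded relative to that square.
  have hbil : ∀ a b : ℤ, ∑ k, R k * (h (a + -y k) * h (b + y k)) = 0 := by
    intro a b
    obtain ⟨c₁, hc₁⟩ := hprod fun l => a + -y l
    obtain ⟨c₂, hc₂⟩ := hprod fun l => b + y l
    have h1 : Tendsto (fun m => ∑ k, R k * ((u (m + (a + -y k)) / σ m) * (u (m + (b + y k)) / σ m)))
        U (𝓝 (∑ k, R k * (h (a + -y k) * h (b + y k)))) :=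
      tendsto_finsetSum _ fun k _ => ((hh _).mul (hh _)).const_mul _
    have h2 : Tendsto (fun m => u (m + m + (a + b)) *
        ((∏ l, u (m + (a + -y l))) / (σ m : ℂ) ^ 2) - u (m + m + (a + b)) *
        ((-1) ^ M * ((∏ l, u (m + (b + y l))) / (σ m : ℂ) ^ 2))) U
        (𝓝 (0 * c₁ - 0 * ((-1) ^ M * c₂))) :=
      (((hdouble (a + b)).mono_left hU).mul hc₁).sub
        (((hdouble (a + b)).mono_left hU).mul (hc₂.const_mul _))
    simp only [zero_mul, sub_zero] at h2
    refine tendsto_nhds_unique (h1.congr' ?_) h2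
    have hlarge : ∀ c : ℤ, ∀ᶠ m : ℤ in (U : Filter ℤ), c < m := fun c =>
      hU (eventually_gt_atTop c)
    filter_upwards [hσ, eventually_all.2 fun k => hlarge (y k - a),
      eventually_all.2 fun k => hlarge (-y k - b), hlarge (-(a + b)), hlarge 0] with m hm h3 h4 h5 h6
    have hσ0 : (σ m : ℂ) ≠ 0 := Complex.ofReal_ne_zero.2 hm.ne'
    have hs := hsol (fun o => o.elim (m + a) fun o => o.elim (-(m + b)) y)
      (injective_option_elim (injective_option_elim hy fun k => by have := h4 k; omega) (by
        rintro (_ | k)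
        · simp only [Option.elim]; omega
        · simp only [Option.elim]; have := h3 k; omega))
    rw [diffSum_option, Fintype.prod_option, Fintype.sum_option, prod_erase_none] at hs
    simp only [Option.elim, prod_erase_some] at hs
    have e1 : u (m + a - -(m + b)) = u (m + m + (a + b)) := by congr 1; ring
    have e2 : u (-(m + b) - (m + a)) = -u (m + m + (a + b)) := by rw [← hodd]; congr 1; ring
    have e3 : ∀ k, u (m + a - y k) = u (m + (a + -y k)) := fun k => by congr 1; ring
    have e4 : ∀ k, u (-(m + b) - y k) = -1 * u (m + (b + y k)) := fun k => by
      rw [neg_one_mul, ← hodd]; congr 1; ring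
    have e5 : ∀ k, u (y k - (m + a)) = -u (m + (a + -y k)) := fun k => by
      rw [← hodd]; congr 1; ring
    have e6 : ∀ k, u (y k - -(m + b)) = u (m + (b + y k)) := fun k => by congr 1; ring
    simp only [e1, e2, e3, e4, e5, e6, Finset.prod_mul_distrib, Finset.prod_const,
      Finset.card_univ] at hs
    rw [← hM] at hs
    have e7 : ∑ k, R k * ((u (m + (a + -y k)) / σ m) * (u (m + (b + y k)) / σ m)) =
        (∑ k, u (m + (a + -y k)) * (u (m + (b + y k)) * R k)) / (σ m : ℂ) ^ 2 := by
      rw [Finset.sum_div]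
      exact Finset.sum_congr rfl fun k _ => by field_simp
    have hR' : ∀ k, ∏ l ∈ Finset.univ.erase k, u (y k - y l) = R k := fun _ => rfl
    simp only [neg_mul, Finset.sum_neg_distrib, hR'] at hs
    have key : ∑ k, u (m + (a + -y k)) * (u (m + (b + y k)) * R k) =
        u (m + m + (a + b)) * (∏ l, u (m + (a + -y l))) -
        u (m + m + (a + b)) * ((-1) ^ M * ∏ l, u (m + (b + y l))) := by
      linear_combination -hs
    rw [e7, key]
    ring
  have hspan : ∀ f ∈ Submodule.span ℂ (Set.range fun (a : ℤ) (s : ℤ) => h (a + s)),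
      ∀ g ∈ Submodule.span ℂ (Set.range fun (a : ℤ) (s : ℤ) => h (a + s)),
      ∑ k, R k * (f (-y k) * g (y k)) = 0 := by
    intro f hf
    induction hf using Submodule.span_induction with
    | mem f hf =>
      obtain ⟨a, rfl⟩ := hf
      intro g hg
      induction hg using Submodule.span_induction with
      | mem g hg =>
        obtain ⟨b, rfl⟩ := hg
        exact hbil a b
      | zero => simp
      | add g₁ g₂ _ _ h1 h2 =>
        simp only [Pi.add_apply, mul_add, Finset.sum_add_distrib, h1, h2, add_zero]
      | smul c g _ h1 =>
        rw [← mul_zero c, ← h1, Finset.mul_sum]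
        exact Finset.sum_congr rfl fun k _ => by simp only [Pi.smul_apply, smul_eq_mul]; ring
    | zero => simp
    | add f₁ f₂ _ _ h1 h2 =>
      intro g hg
      simp only [Pi.add_apply, add_mul, mul_add, Finset.sum_add_distrib, h1 g hg, h2 g hg, add_zero]
    | smul c f _ h1 =>
      intro g hg
      rw [← mul_zero c, ← h1 g hg, Finset.mul_sum]
      exact Finset.sum_congr rfl fun k _ => by simp only [Pi.smul_apply, smul_eq_mul]; ring
  -- With the same exponential sequence in both slots the factors z^(−y k) and z^(y k) cancel, and ∑
  -- R k = 0 is the formula for y alone.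
  have := hspan _ hz _ hz
  simp only [zpow_neg, inv_mul_cancel₀ (zpow_ne_zero _ hz0), mul_one] at this
  exact this

/-- For three points the addition formula determines the sequence. -/
lemma DiffSolution.eq_div (hodd : ∀ m, u (-m) = -u m) (h1 : u 1 ≠ 0)
    (hsol : DiffSolution (Fin 3) u) (m : ℕ) : u (m + 1 : ℕ) = u 1 / (m + 1 : ℕ) := by
  induction m with
  | zero => simp
  | succ m ih =>
    -- The points m + 2, 1, 0 give u(m+1)u(m+2) − u(m+1)u(1) + u(m+2)u(1) = 0, that is 1/u(m+2) =
    -- 1/u(m+1) + 1/u(1).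
    have hs := (hsol.of_card_eq (κ := Option (Option Unit)) (by simp))
      (fun o => o.elim ((m + 2 : ℕ) : ℤ) fun o => o.elim (1 : ℤ) fun _ => 0)
      (injective_option_elim (injective_option_elim (fun _ _ _ => rfl) (by simp)) (by
        rintro (_ | k)
        · simp only [Option.elim]; omega
        · simp only [Option.elim]; omega))
    rw [diffSum_option, Fintype.prod_option, Fintype.sum_option, prod_erase_none] at hs
    simp only [Option.elim, prod_erase_some, Finset.univ_unique, Finset.prod_singleton,
      Finset.sum_singleton, Finset.erase_singleton, Finset.prod_empty, sub_zero, zero_sub, hodd] at hs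
    have e1 : u (((m + 2 : ℕ) : ℤ) - 1) = u ((m + 1 : ℕ) : ℤ) := by congr 1; push_cast; ring
    have e2 : u (1 - ((m + 2 : ℕ) : ℤ)) = -u ((m + 1 : ℕ) : ℤ) := by
      rw [← hodd]; congr 1
    rw [e1, e2, ih] at hs
    have hm1 : ((m + 1 : ℕ) : ℂ) ≠ 0 := by exact_mod_cast (by omega : m + 1 ≠ 0)
    have hm2 : ((m + 1 + 1 : ℕ) : ℂ) ≠ 0 := by exact_mod_cast (by omega : m + 1 + 1 ≠ 0)
    rw [eq_div_iff hm2]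
    change u ((m + 2 : ℕ) : ℤ) * _ = _
    field_simp at hs
    apply mul_left_cancel₀ h1
    push_cast at hs ⊢
    linear_combination hs

end Discrete

/-- A decaying solution with decaying primitive for an odd number of points is rational. -/
lemma eq_div_sq_of_tendsto_zero {p F : ℝ → ℂ} {β : ℂ} (hp : IsLineFunction p β)
    (hF : IsOddPrimitive p F β) (hp0 : Tendsto p atTop (𝓝 0)) (hF0 : Tendsto F atTop (𝓝 0)) {r : ℕ}
    (hsol : IsSolution (Fin (2 * r + 2 + 1)) p {0}) {x : ℝ} (hx : 0 < x) :
    p x = β / (x : ℂ) ^ 2 := by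
  -- F is nonzero near its pole. For small ε this covers all the lattice values whose nonvanishing
  -- is used in the descent.
  have hFne : ∀ᶠ ε in 𝓝[>] (0 : ℝ), ∀ j : ℕ, j < 2 * r + 3 → F (((j + 1 : ℕ) : ℝ) * ε) ≠ 0 := by
    have h0 : ∀ᶠ t in 𝓝[>] (0 : ℝ), F t ≠ 0 := by
      have := (hF.pole.mono_left (nhdsWithin_mono (s := Set.Ioi (0 : ℝ)) 0
        fun t (ht : 0 < t) => ht.ne')).eventually_ne (neg_ne_zero.2 hp.ne_zero)
      filter_upwards [this] with t ht h
      exact ht (by rw [h, mul_zero])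
    have h1 : ∀ j : Fin (2 * r + 3), ∀ᶠ ε in 𝓝[>] (0 : ℝ), F ((((j : ℕ) + 1 : ℕ) : ℝ) * ε) ≠ 0 := by
      intro j
      have ht : Tendsto (fun ε : ℝ => (((j : ℕ) + 1 : ℕ) : ℝ) * ε) (𝓝[>] 0) (𝓝[>] 0) := by
        refine tendsto_nhdsWithin_iff.2 ⟨?_, ?_⟩
        · have : Continuous fun ε : ℝ => (((j : ℕ) + 1 : ℕ) : ℝ) * ε := by fun_prop
          simpa using (this.tendsto 0).mono_left nhdsWithin_le_nhds
        · filter_upwards [self_mem_nhdsWithin] with ε hε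
          have : 0 < ε := hε
          exact Set.mem_Ioi.2 (by positivity)
      exact ht.eventually h0
    filter_upwards [eventually_all.2 h1] with ε hε j hj using hε ⟨j, hj⟩
  have hdiv : ∀ᶠ ε in 𝓝[>] (0 : ℝ), ∀ m : ℕ, F (((m + 1 : ℕ) : ℝ) * ε) = F ε / (m + 1 : ℕ) := by
    filter_upwards [hFne, self_mem_nhdsWithin] with ε hne hε m
    have hε : 0 < ε := hε
    set u : ℤ → ℂ := fun m => F (m * ε) with hu
    have hodd : ∀ m, u (-m) = -u m := fun m => by simp only [hu]; rw [← hF.odd]; congr 1; push_cast; ring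
    have hu0 : Tendsto u atTop (𝓝 0) :=
      hF0.comp (tendsto_intCast_atTop_atTop.atTop_mul_const hε)
    have hune : ∀ j : ℤ, 1 ≤ j → j ≤ 2 * r + 3 → u j ≠ 0 := by
      intro j h1 h2
      obtain ⟨i, rfl⟩ := Int.le.dest h1
      have := hne i (by omega)
      simp only [hu]
      push_cast at this ⊢
      rwa [add_comm] at this
    -- The descent takes away two points at a time; it ends at three because their number is odd.
    have hstep : ∀ j ≤ r, DiffSolution (Fin (2 * (r - j) + 3)) u := by
      intro j hj
      induction j with
      | zero =>
        intro y hy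
        have := sum_partialProd_eq_zero hp hF hp0 hF0 (n := 2 * r + 2) (by omega) hsol
          (y := fun k => y k * ε) (fun i k hik h0 => by
            rw [← sub_mul] at h0
            have h1 := (mul_eq_zero.1 h0).resolve_right hε.ne'
            exact hik (hy (by exact_mod_cast sub_eq_zero.1 h1)))
        rw [← this]
        refine Finset.sum_congr rfl fun k _ => Finset.prod_congr rfl fun l _ => ?_
        simp only [hu]
        congr 1; push_cast; ring
      | succ j ih =>
        have h1 := (ih (by omega)).of_card_eq (κ := Option (Option (Fin (2 * (r - (j + 1)) + 3))))
          (by simp; omega)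
        refine h1.descend hodd hu0 (by simp) fun i hi1 hi2 => hune i hi1 ?_
        simp only [Fintype.card_fin] at hi2
        omega
    have h3 : DiffSolution (Fin 3) u := by
      have := hstep r le_rfl
      rwa [Nat.sub_self] at this
    have h4 := h3.eq_div hodd (hune 1 le_rfl (by omega)) m
    simp only [hu] at h4
    simpa using h4
  -- For ε = y/(m + 1) the relation on the lattice reads yF(y) = εF(ε), and the right hand side
  -- tends to −β as m → ∞.
  have hFx : ∀ y : ℝ, 0 < y → F y = -β / y := by
    intro y hy
    have ht : Tendsto (fun m : ℕ => y / ((m : ℝ) + 1)) atTop (𝓝[>] 0) := by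
      refine tendsto_nhdsWithin_iff.2 ⟨?_, Eventually.of_forall fun m => ?_⟩
      · have h1 := tendsto_one_div_add_atTop_nhds_zero_nat (𝕜 := ℝ)
        have := h1.const_mul y
        rw [mul_zero] at this
        exact this.congr fun m => by ring
      · exact Set.mem_Ioi.2 (by positivity)
    have hlim := (hF.pole.mono_left (nhdsWithin_mono (s := Set.Ioi (0 : ℝ)) 0
        fun t (ht : 0 < t) => ht.ne')).comp ht
    have hconst : ∀ᶠ m : ℕ in atTop, (y : ℂ) * F y =
        ((fun u : ℝ => (u : ℂ) * F u) ∘ fun m : ℕ => y / ((m : ℝ) + 1)) m := by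
      filter_upwards [ht.eventually hdiv] with m hm
      have h1 := hm m
      have hm0 : ((m + 1 : ℕ) : ℝ) ≠ 0 := by positivity
      have e : ((m + 1 : ℕ) : ℝ) * (y / ((m : ℝ) + 1)) = y := by
        push_cast at hm0 ⊢; field_simp
      rw [e] at h1
      simp only [Function.comp]
      rw [h1]
      push_cast
      ring
    have h2 := tendsto_nhds_unique (tendsto_const_nhds.congr' hconst) hlim
    have hy0 : (y : ℂ) ≠ 0 := Complex.ofReal_ne_zero.2 hy.ne'
    rw [eq_div_iff hy0, mul_comm]
    exact h2
  have h1 := hF.hasDerivAt x hx.ne'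
  have h2 : HasDerivAt (fun y : ℝ => -β / (y : ℂ)) (β / (x : ℂ) ^ 2) x := by
    have hx0 : (x : ℂ) ≠ 0 := Complex.ofReal_ne_zero.2 hx.ne'
    have := ((hasDerivAt_inv hx0).const_mul (-β)).comp_ofReal
    refine this.congr_deriv ?_
    field_simp
  have h3 : F =ᶠ[𝓝 x] fun y : ℝ => -β / (y : ℂ) := by
    filter_upwards [lt_mem_nhds hx] with y hy using hFx y hy
  exact h1.unique (h2.congr_of_eventuallyEq h3)

/-! ### Primitives and the indented integrals -/

lemma exists_analyticAt_primitive {G : ℂ → ℂ} {z : ℂ} (hG : AnalyticAt ℂ G z) :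
    ∃ Φ : ℂ → ℂ, AnalyticAt ℂ Φ z ∧ ∀ᶠ w in 𝓝 z, HasDerivAt Φ (G w) w := by
  obtain ⟨ε, hε, h⟩ := Metric.eventually_nhds_iff_ball.1 hG.eventually_analyticAt
  obtain ⟨Φ, hΦ⟩ := DifferentiableOn.isExactOn_ball (f := G) (c := z) (r := ε)
    fun w hw => (h w hw).differentiableAt.differentiableWithinAt
  refine ⟨Φ, ?_, ?_⟩
  · exact DifferentiableOn.analyticAt (s := Metric.ball z ε)
      (fun w hw => (hΦ w hw).differentiableAt.differentiableWithinAt) (Metric.ball_mem_nhds z hε)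
  · filter_upwards [Metric.ball_mem_nhds z hε] with w hw using hΦ w hw

/-- A primitive on the real line of an analytic function extends locally. -/
lemma exists_analyticAt_extension {A : ℝ → ℂ} {G : ℂ → ℂ} {x : ℝ} (hG : AnalyticAt ℂ G x)
    (hA : ∀ t : ℝ, HasDerivAt A (G t) t) :
    ∃ Φ : ℂ → ℂ, AnalyticAt ℂ Φ x ∧ (∀ᶠ w in 𝓝 (x : ℂ), HasDerivAt Φ (G w) w) ∧
      ∀ᶠ t in 𝓝 x, A t = Φ t := by
  obtain ⟨Φ, h1, h2⟩ := exists_analyticAt_primitive hG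
  refine ⟨fun z => Φ z + (A x - Φ x), h1.add analyticAt_const,
    h2.mono fun w hw => hw.add_const _, ?_⟩
  obtain ⟨ε, hε, hball⟩ := Metric.eventually_nhds_iff_ball.1
    (Complex.continuous_ofReal.continuousAt.eventually h2)
  have hd : ∀ t ∈ Metric.ball x ε, HasDerivAt (fun t : ℝ => A t - Φ t) 0 t := by
    intro t ht
    have := (hA t).sub (hball t ht).comp_ofReal
    rwa [sub_self] at this
  filter_upwards [Metric.ball_mem_nhds x hε] with t ht
  have := Metric.isOpen_ball.is_const_of_deriv_eq_zero (convex_ball x ε).isPreconnected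
      (fun y hy => (hd y hy).differentiableAt.differentiableWithinAt)
      (fun y hy => (hd y hy).deriv) ht (Metric.mem_ball_self hε)
  linear_combination this

/-- The mean of the indented integrals of an even function is given by its odd primitive. -/
lemma meanIntegral_eq_two_mul {f Φ : ℂ → ℂ} {F : ℝ → ℂ} (he : ∀ x : ℝ, f (-(x : ℂ)) = f x)
    (hF : ∀ x, F (-x) = -F x)
    (hΦ : ∀ᶠ w in 𝓝[≠] (0 : ℂ), HasDerivAt Φ (f w) w ∧ ContinuousAt f w)
    (hΦF : ∀ᶠ t in 𝓝[≠] (0 : ℝ), F t = Φ t) :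
    ∀ᶠ r in 𝓝[>] (0 : ℝ), ∀ T : ℝ, r ≤ T →
      (∀ x : ℝ, x ∈ Set.Ioc 0 T → HasDerivAt F (f x) x) →
      (∀ x : ℝ, x ∈ Set.Ioc 0 T → ContinuousAt f x) → meanIntegral f r T 0 = 2 * F T := by
  obtain ⟨ε, hε, hball⟩ := Metric.eventually_nhds_iff_ball.1 (eventually_nhdsWithin_iff.1 hΦ)
  obtain ⟨ε', hε', hball'⟩ := Metric.eventually_nhds_iff_ball.1 (eventually_nhdsWithin_iff.1 hΦF)
  have hmem : Set.Ioo 0 (min ε ε') ∈ 𝓝[>] (0 : ℝ) := Ioo_mem_nhdsGT (lt_min hε hε')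
  filter_upwards [hmem] with r hr T hT hd hc
  have hr0 : 0 < r := hr.1
  have hrΦ : ∀ t : ℝ, |t| = r → F t = Φ t := fun t ht => hball' t (by
    rw [Metric.mem_ball, dist_zero_right, Real.norm_eq_abs, ht]
    exact hr.2.trans_le (min_le_right _ _)) (by rintro rfl; simp at ht; exact hr0.ne ht)
  have hI : ∫ x in r..T, f x = F T - F r := by
    refine intervalIntegral.integral_eq_sub_of_hasDerivAt (fun x hx => ?_) ?_
    · rw [Set.uIcc_of_le hT] at hx
      exact hd x ⟨hr0.trans_le hx.1, hx.2⟩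
    · refine ContinuousOn.intervalIntegrable fun x hx => ?_
      rw [Set.uIcc_of_le hT] at hx
      exact ((hc x ⟨hr0.trans_le hx.1, hx.2⟩).comp
        Complex.continuous_ofReal.continuousAt).continuousWithinAt
  have hI' : ∫ x in (-T)..(-r), f x = F T - F r := by
    rw [← hI, ← intervalIntegral.integral_comp_neg]
    simp only [Complex.ofReal_neg, he]
  -- Near 0 there is a single-valued primitive Φ of f, so both semicircles contribute Φ(r) − Φ(−r) =
  -- 2F(r), whichever side they lie on.
  have harc : ∀ σ : ℝ, |σ| = 1 → ∫ θ in (0 : ℝ)..Real.pi,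
      f (-r * Complex.exp (-Complex.I * σ * θ)) *
      (Complex.I * σ * r * Complex.exp (-Complex.I * σ * θ)) = 2 * F r := by
    intro σ hσ
    have hγ : ∀ θ : ℝ, HasDerivAt (fun θ : ℝ => -(r : ℂ) * Complex.exp (-Complex.I * σ * θ))
        (Complex.I * σ * r * Complex.exp (-Complex.I * σ * θ)) θ := by
      intro θ
      have h1 : HasDerivAt (fun z : ℂ => -(r : ℂ) * Complex.exp (-Complex.I * σ * z))
          (-(r : ℂ) * (Complex.exp (-Complex.I * σ * θ) * (-Complex.I * σ * 1))) (θ : ℂ) :=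
        (((hasDerivAt_id (θ : ℂ)).const_mul (-Complex.I * σ)).cexp).const_mul _
      exact h1.comp_ofReal.congr_deriv (by ring)
    have hn : ∀ θ : ℝ, ‖-(r : ℂ) * Complex.exp (-Complex.I * σ * θ)‖ = r := by
      intro θ
      have e : -Complex.I * σ * θ = ((-σ * θ : ℝ) : ℂ) * Complex.I := by push_cast; ring
      rw [norm_mul, e, Complex.norm_exp_ofReal_mul_I, norm_neg, Complex.norm_real,
        Real.norm_of_nonneg hr0.le, mul_one]
    have hγ' : ∀ θ : ℝ, HasDerivAt Φ (f (-(r : ℂ) * Complex.exp (-Complex.I * σ * θ)))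
        (-(r : ℂ) * Complex.exp (-Complex.I * σ * θ)) ∧
        ContinuousAt f (-(r : ℂ) * Complex.exp (-Complex.I * σ * θ)) := fun θ =>
      hball _ (by
        rw [Metric.mem_ball, dist_zero_right, hn]; exact hr.2.trans_le (min_le_left _ _))
        (fun h => by
          have := hn θ
          rw [h, norm_zero] at this
          exact hr0.ne this)
    have h1 : ∫ θ in (0 : ℝ)..Real.pi, f (-r * Complex.exp (-Complex.I * σ * θ)) *
        (Complex.I * σ * r * Complex.exp (-Complex.I * σ * θ)) =
        Φ (-(r : ℂ) * Complex.exp (-Complex.I * σ * (Real.pi : ℝ))) -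
        Φ (-(r : ℂ) * Complex.exp (-Complex.I * σ * ((0 : ℝ) : ℂ))) := by
      refine intervalIntegral.integral_eq_sub_of_hasDerivAt
        (f := fun θ : ℝ => Φ (-(r : ℂ) * Complex.exp (-Complex.I * σ * θ)))
        (fun θ _ => ?_) ?_
      · exact (hγ' θ).1.comp θ (hγ θ)
      · refine Continuous.intervalIntegrable ?_ _ _
        refine Continuous.mul ?_ (by fun_prop)
        rw [continuous_iff_continuousAt]
        intro θ
        exact ContinuousAt.comp (f := fun θ : ℝ => -(r : ℂ) * Complex.exp (-Complex.I * σ * θ))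
          (hγ' θ).2 (hγ θ).continuousAt
    have e0 : -(r : ℂ) * Complex.exp (-Complex.I * σ * ((0 : ℝ) : ℂ)) = ((-r : ℝ) : ℂ) := by simp
    have e1 : -(r : ℂ) * Complex.exp (-Complex.I * σ * (Real.pi : ℝ)) = ((r : ℝ) : ℂ) := by
      have : Complex.exp (-Complex.I * σ * (Real.pi : ℝ)) = -1 := by
        rcases (abs_eq one_pos.le).1 hσ with h | h
        · rw [h]
          have : -Complex.I * ((1 : ℝ) : ℂ) * (Real.pi : ℝ) = -(Real.pi * Complex.I) := by
            push_cast; ring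
          rw [this, Complex.exp_neg, Complex.exp_pi_mul_I]; norm_num
        · rw [h]
          have : -Complex.I * ((-1 : ℝ) : ℂ) * (Real.pi : ℝ) = (Real.pi * Complex.I) := by
            push_cast; ring
          rw [this, Complex.exp_pi_mul_I]
      rw [this]; ring
    rw [h1, e0, e1, ← hrΦ r (abs_of_pos hr0), ← hrΦ (-r) (by rw [abs_neg, abs_of_pos hr0]), hF]
    ring
  have hind : ∀ σ : ℝ, |σ| = 1 → indentedIntegral f σ r T 0 = 2 * F T := by
    intro σ hσ
    unfold indentedIntegral
    simp only [Complex.ofReal_zero, mul_zero, zero_mul, Complex.exp_zero, mul_one]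
    rw [hI, hI', harc σ hσ]; ring
  unfold meanIntegral
  have h1 := hind 1 (by simp)
  have h2 := hind (-1) (by simp)
  rw [h1, h2]; ring

/-- The regular part of `f` at the origin. -/
lemma exists_regularPart {f : ℂ → ℂ} (ho : meromorphicOrderAt f 0 = ((-2 : ℤ) : WithTop ℤ))
    (he : ∀ x : ℝ, f (-(x : ℂ)) = f x) :
    ∃ β : ℂ, β ≠ 0 ∧ ∃ G : ℂ → ℂ, AnalyticAt ℂ G 0 ∧ ∀ u ≠ 0, f u = β / u ^ 2 + G u := by
  obtain ⟨β, hβ, g, hg, hf⟩ := exists_pole_form ho he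
  refine ⟨β, hβ, fun u => if u = 0 then g 0 else f u - β / u ^ 2, ?_, fun u hu => ?_⟩
  · refine hg.congr ?_
    filter_upwards [eventually_nhdsWithin_iff.1 hf] with u hu
    by_cases h : u = 0
    · simp [h]
    · simp only [h, if_false]; rw [hu h]; ring
  · simp only [hu, if_false]; ring

lemma not_analyticAt_of_double_pole {f : ℂ → ℂ} {z : ℂ}
    (ho : meromorphicOrderAt f z = ((-2 : ℤ) : WithTop ℤ)) : ¬ AnalyticAt ℂ f z := fun h => by
  have := h.meromorphicOrderAt_nonneg
  rw [ho] at this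
  exact absurd this (by decide)

lemma meromorphicAt_of_double_pole {f : ℂ → ℂ} {z : ℂ}
    (ho : meromorphicOrderAt f z = ((-2 : ℤ) : WithTop ℤ)) : MeromorphicAt f z :=
  meromorphicAt_of_meromorphicOrderAt_ne_zero (by
    rw [ho]; exact (by decide : ((-2 : ℤ) : WithTop ℤ) ≠ ((0 : ℤ) : WithTop ℤ)))

lemma IsSolution.fin_three {p : ℝ → ℂ} {S : Set ℝ}
    (hstep : ∀ m : ℕ, IsSolution (Option (Fin (m + 3))) p S → IsSolution (Fin (m + 3)) p S) {m : ℕ}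
    (hsol : IsSolution (Fin (m + 3)) p S) : IsSolution (Fin 3) p S := by
  induction m with
  | zero => exact hsol
  | succ m ih => exact ih (hstep m (hsol.of_card_eq (by simp)))

/-! ### Conclusion for the bounded class -/

namespace ClassB

variable {f : ℂ → ℂ}

lemma singularSet_eq (hf : ClassB f) : {x : ℝ | ¬ AnalyticAt ℂ f x} = {0} := by
  ext x
  simp only [Set.mem_ofPred_eq, Set.mem_singleton_iff]
  constructor
  · intro h; by_contra hx; exact h (hf.analytic x hx)
  · rintro rfl
    exact not_analyticAt_of_double_pole (by simpa using hf.pole)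

lemma meromorphicAt (hf : ClassB f) (x : ℝ) : MeromorphicAt f x := by
  by_cases hx : x = 0
  · subst hx; simpa using meromorphicAt_of_double_pole hf.pole
  · exact (hf.analytic x hx).meromorphicAt

lemma isLineFunction (hf : ClassB f) (he : ∀ x : ℝ, f (-(x : ℂ)) = f x) {β : ℂ} (hβ : β ≠ 0)
    {G : ℂ → ℂ} (hG : AnalyticAt ℂ G 0) (hfG : ∀ u ≠ 0, f u = β / u ^ 2 + G u) :
    IsLineFunction (fun x : ℝ => f x) β where
  even x := by simpa using he x
  ne_zero := hβ
  analytic x hx := analyticAt_comp_ofReal (hf.analytic x hx)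
  pole := ⟨fun x => G x, analyticAt_comp_ofReal (by simpa using hG), by
    filter_upwards [self_mem_nhdsWithin] with u hu
    exact hfG _ (Complex.ofReal_ne_zero.2 hu)⟩
  bounded := hf.bounded

/-- F(x) = −β/x + ∫₀ˣ G. The mean of the indented integrals from −T to T is 2F(T), so decay of F
means f̂(0) = 0; this is how the hypothesis for odd n enters. -/
lemma exists_isOddPrimitive (hf : ClassB f) (he : ∀ x : ℝ, f (-(x : ℂ)) = f x) {β : ℂ}
    {G : ℂ → ℂ} (hG : AnalyticAt ℂ G 0) (hfG : ∀ u ≠ 0, f u = β / u ^ 2 + G u) :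
    ∃ F, IsOddPrimitive (fun x : ℝ => f x) F β ∧
      (Tendsto F atTop (𝓝 0) → HasTransformValue f 0 0) := by
  have hGa : ∀ x : ℝ, AnalyticAt ℂ G x := by
    intro x
    by_cases hx : x = 0
    · subst hx; simpa using hG
    · have hx' : (x : ℂ) ≠ 0 := Complex.ofReal_ne_zero.2 hx
      have h1 : AnalyticAt ℂ (fun z => f z - β / z ^ 2) x :=
        (hf.analytic x hx).sub (analyticAt_const.div (analyticAt_id.pow 2) (pow_ne_zero 2 hx'))
      refine h1.congr ?_
      filter_upwards [isOpen_ne.mem_nhds hx'] with z hz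
      rw [hfG z hz]; ring
  have hGe : ∀ x : ℝ, G ((-x : ℝ) : ℂ) = G x := by
    intro x
    by_cases hx : x = 0
    · simp [hx]
    · have h1 := hfG x (Complex.ofReal_ne_zero.2 hx)
      have h2 := hfG (-x) (neg_ne_zero.2 (Complex.ofReal_ne_zero.2 hx))
      rw [he, h1, neg_sq] at h2
      push_cast
      linear_combination -h2
  have hGc : Continuous fun x : ℝ => G x := by
    rw [continuous_iff_continuousAt]
    exact fun x => (hGa x).continuousAt.comp Complex.continuous_ofReal.continuousAt
  set A : ℝ → ℂ := fun x => ∫ t in (0 : ℝ)..x, G t with hA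
  have hAd : ∀ x : ℝ, HasDerivAt A (G x) x := fun x =>
    intervalIntegral.integral_hasDerivAt_right (hGc.intervalIntegrable _ _)
      (hGc.stronglyMeasurableAtFilter _ _) hGc.continuousAt
  have hAodd : ∀ x, A (-x) = -A x := by
    intro x
    have h1 := intervalIntegral.integral_comp_neg (a := 0) (b := x) (fun t : ℝ => G t)
    simp only [hGe, neg_zero] at h1
    simp only [hA]
    rw [h1, intervalIntegral.integral_symm]
  set F : ℝ → ℂ := fun x => -β / x + A x with hFdef
  have hinv : ∀ z : ℂ, z ≠ 0 → HasDerivAt (fun z => -β / z) (β / z ^ 2) z := fun z hz =>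
    ((hasDerivAt_inv hz).const_mul (-β)).congr_deriv (by field_simp)
  have hodd : ∀ x, F (-x) = -F x := fun x => by
    simp only [hFdef, hAodd]; push_cast; rw [div_neg]; ring
  have hFd : ∀ x : ℝ, x ≠ 0 → HasDerivAt F (f x) x := fun x hx => by
    have hx' : (x : ℂ) ≠ 0 := Complex.ofReal_ne_zero.2 hx
    exact ((hinv x hx').comp_ofReal.add (hAd x)).congr_deriv (hfG _ hx').symm
  have hF : IsOddPrimitive (fun x : ℝ => f x) F β := by
    refine ⟨hodd, hFd, fun x => ?_, ?_⟩
    · obtain ⟨Φ, h1, -, h2⟩ := exists_analyticAt_extension (hGa x) hAd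
      have h3 : AnalyticAt ℝ A x := (analyticAt_comp_ofReal h1).congr (by
        filter_upwards [h2] with t ht using ht.symm)
      have hid : MeromorphicAt (fun u : ℝ => (u : ℂ)) x :=
        (Complex.ofRealCLM.analyticAt x).meromorphicAt
      exact ((MeromorphicAt.const (-β) x).div hid).add h3.meromorphicAt
    · have h1 : Tendsto (fun u : ℝ => -β + u * A u) (𝓝 0) (𝓝 (-β + (0 : ℝ) * A 0)) :=
        tendsto_const_nhds.add (Tendsto.mul (Complex.continuous_ofReal.tendsto 0)
          (hAd 0).continuousAt.tendsto)
      simp only [Complex.ofReal_zero, zero_mul, add_zero] at h1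
      refine (h1.mono_left nhdsWithin_le_nhds).congr' ?_
      filter_upwards [self_mem_nhdsWithin] with u hu
      have : (u : ℂ) ≠ 0 := Complex.ofReal_ne_zero.2 hu
      simp only [hFdef]; field_simp
  refine ⟨F, hF, fun hF0 => ?_⟩
  obtain ⟨Ψ, -, h2, h3⟩ := exists_analyticAt_extension (hGa 0) hAd
  rw [Complex.ofReal_zero] at h2
  have hm := meanIntegral_eq_two_mul (f := f) (F := F) (Φ := fun z => -β / z + Ψ z) he hodd (by
      filter_upwards [h2.filter_mono nhdsWithin_le_nhds,
        hG.eventually_analyticAt.filter_mono nhdsWithin_le_nhds, self_mem_nhdsWithin]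
        with w hw hGw hw0
      have hw0 : w ≠ 0 := hw0
      refine ⟨((hinv w hw0).add hw).congr_deriv (hfG w hw0).symm, ?_⟩
      have h4 : ContinuousAt (fun z => β / z ^ 2 + G z) w :=
        (continuousAt_const.div (continuousAt_id.pow 2) (pow_ne_zero 2 hw0)).add hGw.continuousAt
      refine h4.congr ?_
      filter_upwards [isOpen_ne.mem_nhds hw0] with z hz using (hfG z hz).symm) (by
      filter_upwards [h3.filter_mono nhdsWithin_le_nhds] with t ht
      simp only [hFdef]; rw [ht])
  filter_upwards [hm] with r hr
  have h4 := hF0.const_mul 2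
  rw [mul_zero] at h4
  refine h4.congr' ?_
  filter_upwards [eventually_ge_atTop r] with T hT
  exact (hr T hT (fun x hx => hFd x hx.1.ne')
    (fun x hx => (hf.analytic x hx.1.ne').continuousAt)).symm

lemma isWeierstrassForm_of_eq_div_sq (hf : ClassB f) {β : ℂ} {G : ℂ → ℂ} (hG : AnalyticAt ℂ G 0)
    (hfG : ∀ u ≠ 0, f u = β / u ^ 2 + G u) (h : ∀ x : ℝ, 0 < x → f x = β / (x : ℂ) ^ 2) :
    IsWeierstrassForm f := by
  have hG0 : ∀ᶠ z in 𝓝 (0 : ℂ), G z = 0 := by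
    refine (hG.frequently_zero_iff_eventually_zero).1 ?_
    have ht := tendsto_ofReal_punctured 0
    rw [Complex.ofReal_zero] at ht
    refine (ht.mono_left (nhdsWithin_mono (s := Set.Ioi (0 : ℝ)) 0
      fun t (ht : 0 < t) => ht.ne')).frequently (Eventually.frequently ?_)
    filter_upwards [self_mem_nhdsWithin] with t ht
    have ht : 0 < t := ht
    have h1 := hfG t (Complex.ofReal_ne_zero.2 ht.ne')
    rw [h t ht] at h1
    linear_combination -h1
  refine ⟨0, β, 0, 0, _, IsWeierstrassP.rational, fun x => ?_⟩
  refine eventuallyEq_real_of_eventuallyEq (φ := fun z => 0 + β * (1 / z ^ 2)) hf.meromorphicAt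
    (fun x => by fun_prop) ?_ x
  filter_upwards [hG0.filter_mono nhdsWithin_le_nhds, self_mem_nhdsWithin] with z hz hz0
  rw [hfG z hz0, hz]; ring

/-- For n = 2 there are three points already. For larger n, if f does not decay, or if f decays and
F does not, points are removed one at a time until three are left. If both decay, then f̂(0) = 0, so
n is even, the number of points is odd and f is rational. -/
theorem isWeierstrassForm (hf : ClassB f) (he : ∀ x : ℝ, f (-(x : ℂ)) = f x) {n : ℕ} (hn : 2 ≤ n)
    (hsol : SolvesEquation n f) (hc : Even n ∨ ¬ HasTransformValue f 0 0) :
    IsWeierstrassForm f := by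
  rw [solvesEquation_iff] at hsol
  have hfin : IsSolution (Fin 3) (fun x : ℝ => f x) {x : ℝ | ¬ AnalyticAt ℂ f x} →
      IsWeierstrassForm f := fun h =>
    isWeierstrassForm_of_isSolution hf.meromorphicAt hf.pole he (h.of_card_eq (by simp))
  rw [hf.singularSet_eq] at hsol hfin
  rcases hn.eq_or_lt with rfl | hn
  · exact hfin hsol
  obtain ⟨β, hβ, G, hG, hfG⟩ := exists_regularPart hf.pole he
  have hp := hf.isLineFunction he hβ hG hfG
  obtain ⟨F, hF, hFT⟩ := hf.exists_isOddPrimitive he hG hfG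
  obtain ⟨r, rfl⟩ := Nat.exists_eq_add_of_le hn
  have hder : Tendsto (deriv fun x : ℝ => f x) atTop (𝓝 0) :=
    hp.tendsto_deriv_zero (r := r) (hsol.of_card_eq (by simp; omega))
  have hsol' : IsSolution (Fin (r + 1 + 3)) (fun x : ℝ => f x) {0} :=
    hsol.of_card_eq (by simp; omega)
  by_cases hp0 : Tendsto (fun x : ℝ => f x) atTop (𝓝 0)
  · by_cases hF0 : Tendsto F atTop (𝓝 0)
    · have heven := hc.resolve_right fun h => h (hFT hF0)
      obtain ⟨k, hk⟩ := heven
      obtain ⟨j, rfl⟩ := Nat.exists_eq_add_of_le (show 1 ≤ k by omega)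
      exact hf.isWeierstrassForm_of_eq_div_sq hG hfG fun x hx =>
        eq_div_sq_of_tendsto_zero hp hF hp0 hF0 (r := j) (hsol.of_card_eq (by simp; omega)) hx
    · exact hfin (hsol'.fin_three fun m h =>
        isSolution_of_primitive_not_tendsto_zero hp hF hp0 hF0 h)
  · exact hfin (hsol'.fin_three fun m h => hp.isSolution_of_not_tendsto_zero hder hp0 h)

end ClassB

/-! ### The periodic class: extension to a strip -/

/-- An even function with period `2π` that is analytic in the strip `|Im z| < δ` apart from double
poles at the points `2πm`. -/
structure IsStripFunction (φ : ℂ → ℂ) (β : ℂ) (δ : ℝ) : Prop where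
  even : ∀ z, φ (-z) = φ z
  periodic : ∀ z, φ (z + 2 * Real.pi) = φ z
  ne_zero : β ≠ 0
  pos : 0 < δ
  analytic : ∀ z : ℂ, |z.im| < δ → Complex.sin (z / 2) ≠ 0 → AnalyticAt ℂ φ z
  pole : ∃ G : ℂ → ℂ, AnalyticAt ℂ G 0 ∧ ∀ᶠ u in 𝓝[≠] (0 : ℂ), φ u = β / u ^ 2 + G u

lemma sin_half_eq_zero_iff {z : ℂ} :
    Complex.sin (z / 2) = 0 ↔ ∃ k : ℤ, z = 2 * Real.pi * k := by
  rw [Complex.sin_eq_zero_iff]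
  refine exists_congr fun k => ?_
  constructor
  · intro h; linear_combination 2 * h
  · intro h; rw [h]; ring

lemma sin_half_ne_zero_of_im_ne_zero {z : ℂ} (h : z.im ≠ 0) : Complex.sin (z / 2) ≠ 0 := by
  rw [Ne, sin_half_eq_zero_iff]
  rintro ⟨k, rfl⟩
  apply h
  have : (2 * Real.pi * k : ℂ) = ((2 * Real.pi * k : ℝ) : ℂ) := by push_cast; ring
  rw [this, Complex.ofReal_im]

/-- The representative of `z` modulo `2π` with real part in `[-π, π)`. -/
noncomputable def reduceReal (z : ℂ) : ℂ := z - 2 * Real.pi * (⌊z.re / (2 * Real.pi) + 1 / 2⌋ : ℤ)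

lemma reduceReal_add (z : ℂ) : reduceReal (z + 2 * Real.pi) = reduceReal z := by
  have hpi := Real.pi_pos
  have h : (z + 2 * Real.pi).re / (2 * Real.pi) + 1 / 2 =
      z.re / (2 * Real.pi) + 1 / 2 + (1 : ℤ) := by
    have : (z + 2 * Real.pi).re = z.re + 2 * Real.pi := by simp
    rw [this]; push_cast; field_simp; ring
  unfold reduceReal
  rw [h, Int.floor_add_intCast]; push_cast; ring

lemma reduceReal_eq {z : ℂ} {k : ℤ} (h₁ : -Real.pi ≤ z.re - 2 * Real.pi * k)
    (h₂ : z.re - 2 * Real.pi * k < Real.pi) : reduceReal z = z - 2 * Real.pi * k := by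
  have hpi := Real.pi_pos
  have : ⌊z.re / (2 * Real.pi) + 1 / 2⌋ = k := by
    rw [Int.floor_eq_iff]
    have e : z.re / (2 * Real.pi) + 1 / 2 = (z.re - 2 * Real.pi * k + Real.pi) / (2 * Real.pi) + k := by
      field_simp; ring
    rw [e]
    constructor
    · have : 0 ≤ (z.re - 2 * Real.pi * k + Real.pi) / (2 * Real.pi) :=
        div_nonneg (by linarith) (by positivity)
      linarith
    · have : (z.re - 2 * Real.pi * k + Real.pi) / (2 * Real.pi) < 1 := by
        rw [div_lt_one (by positivity)]; linarith
      linarith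
  rw [reduceReal, this]

lemma exists_reduceReal_eq (z : ℂ) : ∃ k : ℤ, -Real.pi ≤ z.re - 2 * Real.pi * k ∧
    z.re - 2 * Real.pi * k < Real.pi := by
  have hpi := Real.pi_pos
  refine ⟨⌊z.re / (2 * Real.pi) + 1 / 2⌋, ?_, ?_⟩
  · have h := Int.floor_le (z.re / (2 * Real.pi) + 1 / 2)
    have h' := mul_le_mul_of_nonneg_left h (by positivity : 0 ≤ 2 * Real.pi)
    have e : 2 * Real.pi * (z.re / (2 * Real.pi) + 1 / 2) = z.re + Real.pi := by field_simp
    linarith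
  · have h := Int.lt_floor_add_one (z.re / (2 * Real.pi) + 1 / 2)
    have h' := mul_lt_mul_of_pos_left h (by positivity : 0 < 2 * Real.pi)
    have e : 2 * Real.pi * (z.re / (2 * Real.pi) + 1 / 2) = z.re + Real.pi := by field_simp
    linarith

/-- The periodic extension from the strip around `[-π, π]` is analytic. -/
lemma analyticAt_comp_reduceReal {f : ℂ → ℂ} {δ : ℝ}
    (han : ∀ z : ℂ, |z.re| ≤ Real.pi → |z.im| < δ → z ≠ 0 → AnalyticAt ℂ f z)
    (hper : ∀ u : ℂ, ‖u + Real.pi‖ < δ → f (u + 2 * Real.pi) = f u) {z : ℂ} (hz : |z.im| < δ)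
    (hs : Complex.sin (z / 2) ≠ 0) : AnalyticAt ℂ (fun z => f (reduceReal z)) z := by
  have hpi := Real.pi_pos
  obtain ⟨k, h1, h2⟩ := exists_reduceReal_eq z
  have hre : ∀ w : ℂ, (w - 2 * Real.pi * k).re = w.re - 2 * Real.pi * k := by intro w; simp
  have him : ∀ w : ℂ, (w - 2 * Real.pi * k).im = w.im := by intro w; simp
  have hy : AnalyticAt ℂ f (z - 2 * Real.pi * k) := han _ (by
      rw [hre]; exact abs_le.2 ⟨h1, h2.le⟩) (by rwa [him]) (by
      intro h; apply hs
      rw [sin_half_eq_zero_iff]; exact ⟨k, by linear_combination h⟩)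
  have h3 : AnalyticAt ℂ (fun w => f (w - 2 * Real.pi * k)) z :=
    AnalyticAt.fun_comp (f := fun w : ℂ => w - 2 * Real.pi * k) (x := z) hy (by fun_prop)
  refine h3.congr ?_
  have hcont : Continuous fun w : ℂ => w.re - 2 * Real.pi * k := by fun_prop
  have hlt := (hcont.continuousAt (x := z)).eventually_lt_const h2
  rcases h1.lt_or_eq with h1 | h1
  · filter_upwards [hlt, (hcont.continuousAt (x := z)).eventually_const_lt h1] with w h4 h5
    rw [reduceReal_eq h5.le h4]
  -- On the seam Re z = −π modulo 2π the representatives on the two sides differ by a period, and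
  -- the assumed periodicity near −π matches the values.
  · have h6 : ∀ᶠ w : ℂ in 𝓝 z, ‖w - 2 * Real.pi * k + Real.pi‖ < δ := by
      have hc : ContinuousAt (fun w : ℂ => ‖w - 2 * Real.pi * k + Real.pi‖) z := by fun_prop
      refine hc.eventually_lt_const ?_
      have : z - 2 * Real.pi * k + Real.pi = z.im * Complex.I := by
        apply Complex.ext
        · simp; linarith
        · simp
      beta_reduce
      rw [this]
      simpa using hz
    have h7 : -(2 * Real.pi) < z.re - 2 * Real.pi * k := by linarith
    filter_upwards [hlt, h6, (hcont.continuousAt (x := z)).eventually_const_lt h7] with w h4 h5 h8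
    by_cases h9 : -Real.pi ≤ w.re - 2 * Real.pi * k
    · rw [reduceReal_eq h9 h4]
    · rw [reduceReal_eq (k := k - 1) (by push_cast; linarith) (by push_cast; linarith),
        ← hper _ h5]
      congr 1; push_cast; ring

namespace ClassBTwoPi

variable {f : ℂ → ℂ}

lemma analyticAt_iff (hf : ClassBTwoPi f) {x : ℝ} :
    AnalyticAt ℂ f x ↔ Complex.sin ((x : ℂ) / 2) ≠ 0 := by
  rw [Ne, sin_half_eq_zero_iff]
  constructor
  · rintro h ⟨k, hk⟩
    refine not_analyticAt_of_double_pole (hf.pole k) ?_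
    have : x = 2 * Real.pi * k := by exact_mod_cast hk
    rwa [this] at h
  · intro h
    exact hf.analytic x fun m hm => h ⟨m, by rw [hm]; push_cast; ring⟩

lemma pole_zero (hf : ClassBTwoPi f) : meromorphicOrderAt f 0 = ((-2 : ℤ) : WithTop ℤ) := by
  simpa using hf.pole 0

lemma meromorphicAt (hf : ClassBTwoPi f) (x : ℝ) : MeromorphicAt f x := by
  by_cases hx : ∃ m : ℤ, x = 2 * Real.pi * m
  · obtain ⟨m, rfl⟩ := hx
    exact meromorphicAt_of_double_pole (hf.pole m)
  · exact (hf.analytic x fun m hm => hx ⟨m, hm⟩).meromorphicAt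

/-- An even function of the periodic class agrees on the real axis with one that is even and
periodic in a strip. -/
lemma exists_isStripFunction (hf : ClassBTwoPi f) (he : ∀ x : ℝ, f (-(x : ℂ)) = f x) :
    ∃ (φ : ℂ → ℂ) (β : ℂ) (δ : ℝ), IsStripFunction φ β δ ∧ ∀ x : ℝ, φ x = f x := by
  have hpi := Real.pi_pos
  have hm0 : MeromorphicAt f 0 := by simpa using hf.meromorphicAt 0
  -- a strip around the period on which `f` is analytic
  obtain ⟨δ₁, hδ₁, hthick⟩ : ∃ δ₁ > 0,
      Metric.thickening δ₁ (((↑) : ℝ → ℂ) '' Set.Icc (-Real.pi) Real.pi) ⊆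
        {z | AnalyticAt ℂ f z} ∪ {0} := by
    refine (isCompact_Icc.image Complex.continuous_ofReal).exists_thickening_subset_open ?_ ?_
    · rw [isOpen_iff_mem_nhds]
      rintro z (hz | rfl)
      · exact mem_of_superset hz.eventually_analyticAt Set.subset_union_left
      · have := hm0.eventually_analyticAt
        filter_upwards [eventually_nhdsWithin_iff.1 this] with z hz
        by_cases h : z = 0
        · exact Or.inr h
        · exact Or.inl (hz h)
    · rintro _ ⟨x, hx, rfl⟩
      by_cases h : x = 0
      · right; simp [h]
      · left
        refine hf.analytic x fun m hm => ?_
        rcases lt_trichotomy m 0 with h0 | rfl | h0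
        · have : (m : ℝ) ≤ -1 := by exact_mod_cast Int.le_sub_one_of_lt h0
          nlinarith [hx.1]
        · exact h (by simpa using hm)
        · have : (1 : ℝ) ≤ m := by exact_mod_cast h0
          nlinarith [hx.2]
  -- a disc on which `f` is periodic
  obtain ⟨δ₂, hδ₂, hball⟩ : ∃ δ₂ > 0, ∀ u ∈ Metric.ball (-(Real.pi : ℂ)) δ₂,
      f (u + 2 * Real.pi) = f u := by
    have hne : ∀ y : ℝ, |y| = Real.pi → AnalyticAt ℂ f y := by
      intro y hy
      refine hf.analytic y fun m hm => ?_
      rcases lt_trichotomy m 0 with h0 | rfl | h0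
      · have : (m : ℝ) ≤ -1 := by exact_mod_cast Int.le_sub_one_of_lt h0
        have := neg_abs_le y
        nlinarith
      · rw [hm] at hy; simp at hy; exact hpi.ne hy
      · have : (1 : ℝ) ≤ m := by exact_mod_cast h0
        have := le_abs_self y
        nlinarith
    have h1 : AnalyticAt ℂ (fun u => f (u + 2 * Real.pi)) ((-Real.pi : ℝ) : ℂ) := by
      refine AnalyticAt.fun_comp (f := fun u : ℂ => u + 2 * Real.pi) ?_ (by fun_prop)
      have := hne Real.pi (abs_of_pos hpi)
      have e : ((-Real.pi : ℝ) : ℂ) + 2 * Real.pi = (Real.pi : ℂ) := by push_cast; ring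
      rwa [e]
    have h2 := hne (-Real.pi) (by rw [abs_neg, abs_of_pos hpi])
    have h3 : ∃ᶠ u in 𝓝[≠] ((-Real.pi : ℝ) : ℂ), f (u + 2 * Real.pi) = f u := by
      refine (tendsto_ofReal_punctured (-Real.pi)).frequently (Eventually.of_forall fun t => ?_).frequently
      have := hf.periodic t
      push_cast at this
      exact this
    obtain ⟨δ₂, hδ₂, h4⟩ := Metric.eventually_nhds_iff_ball.1
      ((h1.frequently_eq_iff_eventually_eq h2).1 h3)
    exact ⟨δ₂, hδ₂, by simpa using h4⟩
  obtain ⟨β, hβ, G, hG, hfG⟩ := exists_regularPart hf.pole_zero he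
  set δ := min δ₁ δ₂ with hδ
  have han := fun z => analyticAt_comp_reduceReal (f := f) (δ := δ) (fun z hz1 hz2 hz3 => by
    have : z ∈ Metric.thickening δ₁ (((↑) : ℝ → ℂ) '' Set.Icc (-Real.pi) Real.pi) := by
      rw [Metric.mem_thickening_iff]
      refine ⟨z.re, ⟨z.re, abs_le.1 hz1, rfl⟩, ?_⟩
      rw [Complex.dist_of_re_eq (by simp)]
      simpa [Real.dist_eq] using hz2.trans_le (min_le_left _ _)
    rcases hthick this with h | h
    · exact h
    · exact absurd h hz3) (fun u hu => hball u (by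
    rw [Metric.mem_ball, dist_eq_norm, sub_neg_eq_add]
    exact hu.trans_le (min_le_right _ _))) (z := z)
  have hreal : ∀ x : ℝ, f (reduceReal x) = f x := by
    intro x
    obtain ⟨k, h1, h2⟩ := exists_reduceReal_eq x
    rw [reduceReal_eq h1 h2]
    have hp : Function.Periodic (fun x : ℝ => f x) (2 * Real.pi) := hf.periodic
    have := hp.sub_int_mul_eq (x := x) k
    rw [← this]; congr 1; push_cast; ring
  -- f is known to be even and periodic on the real axis only. Reduction modulo 2π and
  -- symmetrisation build both properties in, throughout the plane, without changing a value on the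
  -- real axis.
  refine ⟨fun z => (f (reduceReal z) + f (reduceReal (-z))) / 2, β, δ, ⟨fun z => ?_, fun z => ?_, hβ,
    lt_min hδ₁ hδ₂, fun z h1 h2 => ?_, ?_⟩, fun x => ?_⟩
  · rw [neg_neg, add_comm]
  · have := reduceReal_add (-(z + 2 * Real.pi))
    rw [show -(z + 2 * Real.pi) + 2 * (Real.pi : ℂ) = -z by ring] at this
    rw [reduceReal_add, this]
  · have h3 : AnalyticAt ℂ (fun z => f (reduceReal (-z))) z := by
      refine AnalyticAt.fun_comp (f := fun z : ℂ => -z) (g := fun z => f (reduceReal z))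
        (han (-z) (by simpa using h1) ?_) (by fun_prop)
      rw [neg_div, Complex.sin_neg]; exact neg_ne_zero.2 h2
    exact ((han z h1 h2).add h3).div_const
  · have hGn : AnalyticAt ℂ (fun z => G (-z)) 0 :=
      AnalyticAt.fun_comp (f := fun z : ℂ => -z) (by simpa using hG) (by fun_prop)
    refine ⟨fun u => (G u + G (-u)) / 2, (hG.add hGn).div_const, ?_⟩
    have hc : Continuous fun u : ℂ => |u.re| := by fun_prop
    have h1 : ∀ᶠ u : ℂ in 𝓝 0, |u.re| < Real.pi :=
      (hc.continuousAt (x := 0)).eventually_lt_const (by simpa using hpi)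
    filter_upwards [h1.filter_mono nhdsWithin_le_nhds, self_mem_nhdsWithin] with u hu hu0
    have hu0 : u ≠ 0 := hu0
    have h2 := abs_lt.1 hu
    have e1 : reduceReal u = u := by
      rw [reduceReal_eq (k := 0) (by push_cast; linarith) (by push_cast; linarith)]; simp
    have e2 : reduceReal (-u) = -u := by
      rw [reduceReal_eq (k := 0) (by rw [Complex.neg_re]; push_cast; linarith)
        (by rw [Complex.neg_re]; push_cast; linarith)]; simp
    rw [e1, e2, hfG u hu0, hfG (-u) (neg_ne_zero.2 hu0), neg_sq]; ring
  · have h1 := hreal (-x)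
    push_cast at h1
    beta_reduce
    rw [hreal, h1, he]; ring

end ClassBTwoPi

/-- A function that is analytic in a strip above the real axis and vanishes on a real interval near
which it is analytic vanishes identically. -/
lemma eq_zero_of_eventually_real {Θ : ℂ → ℂ} {δ : ℝ} {w₀ : ℝ}
    (ha : ∀ w : ℂ, 0 < w.im → w.im < δ → AnalyticAt ℂ Θ w) (h₀ : AnalyticAt ℂ Θ w₀)
    (hz : ∀ᶠ t : ℝ in 𝓝 w₀, Θ t = 0) {w : ℂ} (hw : 0 < w.im) (hw' : w.im < δ) : Θ w = 0 := by
  obtain ⟨ε, hε, hball⟩ := Metric.eventually_nhds_iff_ball.1 h₀.eventually_analyticAt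
  have hδ : 0 < δ := hw.trans hw'
  set A : Set ℂ := {w : ℂ | 0 < w.im ∧ w.im < δ}
  have hA : Convex ℝ A :=
    (convex_halfSpace_im_gt 0).inter (convex_halfSpace_im_lt δ)
  set y : ℂ := w₀ + (min ε δ / 2 : ℝ) * Complex.I with hy
  have hm : 0 < min ε δ := lt_min hε hδ
  have hyim : y.im = min ε δ / 2 := by simp [hy]
  have hyA : y ∈ A := by
    refine ⟨by rw [hyim]; positivity, ?_⟩
    rw [hyim]; linarith [min_le_right ε δ]
  have hyB : y ∈ Metric.ball (w₀ : ℂ) ε := by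
    rw [Metric.mem_ball, dist_eq_norm]
    have : y - w₀ = (min ε δ / 2 : ℝ) * Complex.I := by rw [hy]; ring
    rw [this, norm_mul, Complex.norm_I, mul_one, Complex.norm_real, Real.norm_of_nonneg (by positivity)]
    linarith [min_le_left ε δ]
  have hU : IsPreconnected (A ∪ Metric.ball (w₀ : ℂ) ε) :=
    IsPreconnected.union y hyA hyB hA.isPreconnected (convex_ball _ _).isPreconnected
  have han : AnalyticOnNhd ℂ Θ (A ∪ Metric.ball (w₀ : ℂ) ε) := by
    rintro z (hz | hz)
    · exact ha z hz.1 hz.2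
    · exact hball z hz
  have hfr : ∃ᶠ z in 𝓝[≠] (w₀ : ℂ), Θ z = 0 :=
    (tendsto_ofReal_punctured w₀).frequently (hz.filter_mono nhdsWithin_le_nhds).frequently
  exact han.eqOn_zero_of_preconnected_of_frequently_eq_zero hU
    (Or.inr (Metric.mem_ball_self hε)) hfr (Or.inl ⟨hw, hw'⟩)

/-! ### The functional equation with points in the strip -/

section DivSum

variable {κ : Type*} [Fintype κ] [DecidableEq κ]

/-- The product rule exhibits the sum as a polynomial in values of φ and φ' at analytic arguments.
-/
lemma analyticAt_divSum {φ : ℂ → ℂ} {z : κ → ℂ → ℂ} {w : ℂ} (hz : ∀ k, AnalyticAt ℂ (z k) w)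
    (hφ : ∀ i j, i ≠ j → AnalyticAt ℂ φ (z i w - z j w)) :
    AnalyticAt ℂ (fun w => divSum φ fun k => z k w) w := by
  have hc : ∀ i j, i ≠ j → ∀ᶠ w' in 𝓝 w, AnalyticAt ℂ φ (z i w' - z j w') := fun i j hij =>
    ((hz i).continuousAt.sub (hz j).continuousAt).eventually (hφ i j hij).eventually_analyticAt
  have hc' : ∀ᶠ w' in 𝓝 w, ∀ i j, i ≠ j → AnalyticAt ℂ φ (z i w' - z j w') := by
    refine eventually_all.2 fun i => eventually_all.2 fun j => ?_
    by_cases hij : i = j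
    · simp [hij]
    · filter_upwards [hc i j hij] with w' h _ using h
  have ha : AnalyticAt ℂ (fun w => ∑ i, ∑ j ∈ Finset.univ.erase i,
      (∏ k ∈ (Finset.univ.erase i).erase j, φ (z i w - z k w)) * deriv φ (z i w - z j w)) w := by
    refine Finset.analyticAt_fun_sum _ fun i _ => Finset.analyticAt_fun_sum _ fun j hj => ?_
    have hji : j ≠ i := Finset.ne_of_mem_erase hj
    refine AnalyticAt.mul (Finset.analyticAt_fun_prod _ fun k hk => ?_) ?_
    · exact AnalyticAt.fun_comp (f := fun w => z i w - z k w) (x := w)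
        (hφ i k (Finset.ne_of_mem_erase (Finset.mem_of_mem_erase hk)).symm) ((hz i).sub (hz k))
    · exact AnalyticAt.fun_comp (f := fun w => z i w - z j w) (x := w) (hφ i j hji.symm).deriv
        ((hz i).sub (hz j))
  refine ha.congr ?_
  filter_upwards [hc'] with w' h
  refine Finset.sum_congr rfl fun i _ => ?_
  have := HasDerivAt.fun_finsetProd (u := Finset.univ.erase i) (f := fun j s => φ (s - z j w'))
    (f' := fun j => deriv φ (z i w' - z j w')) (x := z i w')
    (fun j hj => by
      have := (differentiableAt_comp_sub (p := φ) (t := z i w') (a := z j w')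
        (h i j (Finset.ne_of_mem_erase hj).symm).differentiableAt).hasDerivAt
      rwa [deriv_fun_comp_sub] at this)
  unfold partialProd
  rw [this.deriv]
  rfl

lemma exists_forall_sin_half_ne_zero (a : κ → ℝ) :
    ∃ w : ℝ, ∀ k, Complex.sin (((w - a k : ℝ) : ℂ) / 2) ≠ 0 := by
  have hc : (⋃ k, ⋃ m : ℤ, {a k + 2 * Real.pi * m} : Set ℝ).Countable :=
    Set.countable_iUnion fun k => Set.countable_iUnion fun m => Set.countable_singleton _
  obtain ⟨w, hw⟩ := (hc.dense_compl ℝ).nonempty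
  refine ⟨w, fun k hk => hw ?_⟩
  obtain ⟨m, hm⟩ := sin_half_eq_zero_iff.1 hk
  refine Set.mem_iUnion.2 ⟨k, Set.mem_iUnion.2 ⟨m, ?_⟩⟩
  have : w - a k = 2 * Real.pi * m := by exact_mod_cast hm
  simp only [Set.mem_singleton_iff]; linarith

end DivSum

namespace IsStripFunction

variable {φ : ℂ → ℂ} {β : ℂ} {δ : ℝ} {ι κ : Type*} [Fintype ι] [DecidableEq ι] [Fintype κ]
  [DecidableEq κ]

/-- The functional equation extends to points some of which are shifted into the strip. -/
lemma divSum_eq_zero (h : IsStripFunction φ β δ)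
    (hsol : IsSolution κ (fun t : ℝ => φ t) {t : ℝ | Complex.sin ((t : ℂ) / 2) = 0}) {x : κ → ℝ}
    {e : κ → Bool} (hx : ∀ i j, i ≠ j → e i = e j → Complex.sin (((x i - x j : ℝ) : ℂ) / 2) ≠ 0)
    {w : ℂ} (hw : 0 < w.im) (hw' : w.im < δ) :
    divSum φ (fun k => (x k : ℂ) + if e k then w else 0) = 0 := by
  have hz : ∀ k (w : ℂ), AnalyticAt ℂ (fun w : ℂ => (x k : ℂ) + if e k then w else 0) w := by
    intro k w
    by_cases hk : e k
    · simp only [hk, if_true]; fun_prop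
    · simp [hk]; exact (analyticAt_const : AnalyticAt ℂ (fun _ : ℂ => (x k : ℂ)) w)
  have hneg : ∀ {u : ℂ}, AnalyticAt ℂ φ (-u) → AnalyticAt ℂ φ u := by
    intro u hu
    have : AnalyticAt ℂ (fun z => φ (-z)) u :=
      AnalyticAt.fun_comp (f := fun z : ℂ => -z) (x := u) hu (by fun_prop)
    simpa only [h.even] using this
  have hgen : ∀ w : ℂ, |w.im| < δ →
      (∀ i j, Complex.sin ((w - (x j - x i : ℝ)) / 2) ≠ 0) → ∀ i j, i ≠ j →
      AnalyticAt ℂ φ (((x i : ℂ) + if e i then w else 0) - ((x j : ℂ) + if e j then w else 0)) := by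
    intro w h1 h2 i j hij
    by_cases hi : e i <;> by_cases hj : e j
    · refine h.analytic _ (by simpa [hi, hj] using h.pos) ?_
      have := hx i j hij (by simp [hi, hj])
      simpa [hi, hj] using this
    · refine h.analytic _ (by simpa [hi, hj] using h1) ?_
      have := h2 i j
      simp only [hi, hj, if_true]
      convert this using 3
      push_cast; simp; ring
    · refine hneg (h.analytic _ (by simpa [hi, hj] using h1) ?_)
      have := h2 j i
      simp only [hi, hj, if_true]
      convert this using 3
      push_cast; simp; ring
    · refine h.analytic _ (by simpa [hi, hj] using h.pos) ?_
      have := hx i j hij (by simp [hi, hj])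
      simpa [hi, hj] using this
  -- For a generic real shift w₀ the configuration is regular. The equation holds for the real w
  -- near w₀ and extends to the strip by the identity theorem. For Im w > 0 shifted and unshifted
  -- points have nonreal differences, so no condition relating them is needed.
  obtain ⟨w₀, hw₀⟩ := exists_forall_sin_half_ne_zero fun k : κ × κ => x k.2 - x k.1
  have hw₀' : ∀ i j, Complex.sin (((w₀ : ℂ) - (x j - x i : ℝ)) / 2) ≠ 0 := fun i j => by
    have := hw₀ (i, j)
    push_cast at this ⊢
    exact this
  refine eq_zero_of_eventually_real (Θ := fun w => divSum φ fun k => (x k : ℂ) + if e k then w else 0)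
    (δ := δ) (w₀ := w₀) (fun w h1 h2 => ?_) ?_ ?_ hw hw'
  · refine analyticAt_divSum (fun k => hz k w) (hgen w (by rwa [abs_of_pos h1]) fun i j => ?_)
    refine sin_half_ne_zero_of_im_ne_zero ?_
    simpa using h1.ne'
  · exact analyticAt_divSum (fun k => hz k w₀) (hgen w₀ (by simpa using h.pos) hw₀')
  · have hev : ∀ᶠ t : ℝ in 𝓝 w₀, ∀ i j, Complex.sin (((t : ℂ) - (x j - x i : ℝ)) / 2) ≠ 0 := by
      refine eventually_all.2 fun i => eventually_all.2 fun j => ?_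
      have hc : Continuous fun t : ℝ => Complex.sin (((t : ℂ) - (x j - x i : ℝ)) / 2) := by fun_prop
      exact hc.continuousAt.eventually_ne (hw₀' i j)
    filter_upwards [hev] with t ht
    have hd := hgen t (by simpa using h.pos) ht
    have e1 : ∀ k, (((x k + if e k then t else 0 : ℝ) : ℝ) : ℂ) = (x k : ℂ) + if e k then (t : ℂ) else 0 := by
      intro k; by_cases hk : e k <;> simp [hk]
    have hs := hsol (fun k => x k + if e k then t else 0) (fun i j hij hmem => by
      have h1 : Complex.sin ((((x i + if e i then t else 0) - (x j + if e j then t else 0) : ℝ) : ℂ) / 2)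
        = 0 := hmem
      rw [Complex.ofReal_sub, e1, e1] at h1
      by_cases hi : e i <;> by_cases hj : e j <;> simp only [hi, hj, if_true] at h1
      · have := hx i j hij (by simp [hi, hj])
        apply this
        convert h1 using 3
        push_cast; ring
      · apply ht i j
        convert h1 using 3
        push_cast; simp; ring
      · apply ht j i
        rw [← neg_eq_zero, ← Complex.sin_neg]
        convert h1 using 2
        push_cast; simp; ring
      · have := hx i j hij (by simp [hi, hj])
        apply this
        convert h1 using 3
        push_cast; simp)
    rw [divSum_ofReal (fun i j hij => by
      rw [Complex.ofReal_sub, e1, e1]; exact (hd i j hij).differentiableAt)] at hs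
    simpa only [e1] using hs

lemma analyticAt_line (h : IsStripFunction φ β δ) {w : ℂ} (hw : 0 < w.im) (hw' : w.im < δ) (a : ℝ) :
    AnalyticAt ℂ φ (w - a) :=
  h.analytic _ (by simpa [abs_of_pos hw] using hw')
    (sin_half_ne_zero_of_im_ne_zero (by simpa using hw.ne'))

lemma periodic_sub (h : IsStripFunction φ β δ) (w : ℂ) (a : ℝ) :
    φ (w + 2 * Real.pi - a) = φ (w - a) := by
  rw [← h.periodic (w - a)]; congr 1; ring

end IsStripFunction

/-! ### Period integrals and the removal of points -/

/-- The integral of `f` over a period at height `η`. -/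
noncomputable def lineIntegral (f : ℂ → ℂ) (η : ℝ) : ℂ :=
  ∫ u in (0 : ℝ)..(2 * Real.pi), f (u + η * Complex.I)

lemma lineIntegral_comp_sub {f : ℂ → ℂ} (hf : ∀ z, f (z + 2 * Real.pi) = f z) (η a : ℝ) :
    lineIntegral (fun w => f (w - a)) η = lineIntegral f η := by
  unfold lineIntegral
  have hp : Function.Periodic (fun u : ℝ => f (u + η * Complex.I)) (2 * Real.pi) := fun u => by
    beta_reduce
    rw [← hf (u + η * Complex.I)]; congr 1; push_cast; ring
  have h1 := hp.intervalIntegral_add_eq 0 (-a)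
  rw [zero_add] at h1
  rw [h1]
  have h2 := intervalIntegral.integral_comp_sub_right (a := 0) (b := 2 * Real.pi)
    (fun u : ℝ => f (u + η * Complex.I)) a
  rw [zero_sub, show 2 * Real.pi - a = -a + 2 * Real.pi by ring] at h2
  rw [← h2]
  refine intervalIntegral.integral_congr fun u _ => ?_
  beta_reduce
  congr 1; push_cast; ring

lemma continuous_line {f : ℂ → ℂ} {η : ℝ} (hf : ∀ w : ℂ, w.im = η → AnalyticAt ℂ f w) :
    Continuous fun u : ℝ => f (u + η * Complex.I) := by
  rw [continuous_iff_continuousAt]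
  intro u
  have h1 : ContinuousAt (fun u : ℝ => (u : ℂ) + η * Complex.I) u := by fun_prop
  exact ContinuousAt.comp (f := fun u : ℝ => (u : ℂ) + η * Complex.I)
    (hf _ (by simp)).continuousAt h1

/-- The derivative of a periodic function has integral zero over a period. -/
lemma lineIntegral_eq_zero_of_hasDerivAt {P f : ℂ → ℂ} {η : ℝ}
    (hP : ∀ z, P (z + 2 * Real.pi) = P z) (hd : ∀ w : ℂ, w.im = η → HasDerivAt P (f w) w)
    (hf : ∀ w : ℂ, w.im = η → AnalyticAt ℂ f w) : lineIntegral f η = 0 := by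
  unfold lineIntegral
  rw [intervalIntegral.integral_eq_sub_of_hasDerivAt (f := fun u : ℝ => P (u + η * Complex.I))
    (fun u _ => ((hd _ (by simp)).comp_add_const (u : ℂ) (η * Complex.I)).comp_ofReal)
    ((continuous_line hf).intervalIntegrable _ _)]
  have := hP (0 + η * Complex.I)
  rw [sub_eq_zero]
  push_cast
  rw [← this]; congr 1; ring

lemma lineIntegral_add {f g : ℂ → ℂ} {η : ℝ} (hf : ∀ w : ℂ, w.im = η → AnalyticAt ℂ f w)
    (hg : ∀ w : ℂ, w.im = η → AnalyticAt ℂ g w) :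
    lineIntegral (fun w => f w + g w) η = lineIntegral f η + lineIntegral g η :=
  intervalIntegral.integral_add ((continuous_line hf).intervalIntegrable _ _)
    ((continuous_line hg).intervalIntegrable _ _)

lemma lineIntegral_sub {f g : ℂ → ℂ} {η : ℝ} (hf : ∀ w : ℂ, w.im = η → AnalyticAt ℂ f w)
    (hg : ∀ w : ℂ, w.im = η → AnalyticAt ℂ g w) :
    lineIntegral (fun w => f w - g w) η = lineIntegral f η - lineIntegral g η :=
  intervalIntegral.integral_sub ((continuous_line hf).intervalIntegrable _ _)
    ((continuous_line hg).intervalIntegrable _ _)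

lemma lineIntegral_const_mul (c : ℂ) (f : ℂ → ℂ) (η : ℝ) :
    lineIntegral (fun w => c * f w) η = c * lineIntegral f η :=
  intervalIntegral.integral_const_mul _ _

lemma lineIntegral_mul_const (c : ℂ) (f : ℂ → ℂ) (η : ℝ) :
    lineIntegral (fun w => f w * c) η = lineIntegral f η * c :=
  intervalIntegral.integral_mul_const _ _

lemma lineIntegral_sum {ι : Type*} (s : Finset ι) {f : ι → ℂ → ℂ} {η : ℝ}
    (hf : ∀ i ∈ s, ∀ w : ℂ, w.im = η → AnalyticAt ℂ (f i) w) :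
    lineIntegral (fun w => ∑ i ∈ s, f i w) η = ∑ i ∈ s, lineIntegral (f i) η :=
  intervalIntegral.integral_finsetSum fun i hi =>
    (continuous_line (hf i hi)).intervalIntegrable _ _

lemma lineIntegral_congr {f g : ℂ → ℂ} {η : ℝ} (h : ∀ w : ℂ, w.im = η → f w = g w) :
    lineIntegral f η = lineIntegral g η :=
  intervalIntegral.integral_congr fun u _ => h _ (by simp)

namespace IsStripFunction

variable {φ : ℂ → ℂ} {β : ℂ} {δ : ℝ} {ι : Type*} [Fintype ι] [DecidableEq ι]

lemma analyticAt_sub_line (h : IsStripFunction φ β δ) {w : ℂ} (hw : 0 < w.im) (hw' : w.im < δ)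
    (a : ℝ) : AnalyticAt ℂ (fun w => φ (w - a)) w :=
  AnalyticAt.fun_comp (f := fun w : ℂ => w - a) (x := w) (h.analyticAt_line hw hw' a) (by fun_prop)

lemma analyticAt_real (h : IsStripFunction φ β δ) {t : ℝ} (ht : Complex.sin ((t : ℂ) / 2) ≠ 0) :
    AnalyticAt ℂ φ t := h.analytic _ (by simpa using h.pos) ht

lemma divSum_real (h : IsStripFunction φ β δ) {x : ι → ℝ}
    (hx : ∀ i j, i ≠ j → x i - x j ∉ {t : ℝ | Complex.sin ((t : ℂ) / 2) = 0}) :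
    divSum (fun t : ℝ => φ t) x = divSum φ fun i => (x i : ℂ) :=
  divSum_ofReal fun i j hij => (h.analyticAt_real (hx i j hij)).differentiableAt

/-- The functional equation with one point in the strip and the others on the real axis. -/
lemma deriv_fullProd_add_sum_eq_zero (h : IsStripFunction φ β δ)
    (hsol : IsSolution (Option ι) (fun t : ℝ => φ t) {t : ℝ | Complex.sin ((t : ℂ) / 2) = 0})
    {x : ι → ℝ} (hx : ∀ i j, i ≠ j → x i - x j ∉ {t : ℝ | Complex.sin ((t : ℂ) / 2) = 0})
    {w : ℂ} (hw : 0 < w.im) (hw' : w.im < δ) :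
    deriv (fullProd φ fun i => (x i : ℂ)) w +
      ∑ i, (φ (w - x i) * deriv (partialProd φ (fun i => (x i : ℂ)) i) (x i) -
        deriv φ (w - x i) * partialProd φ (fun i => (x i : ℂ)) i (x i)) = 0 := by
  set z : ι → ℂ := fun i => (x i : ℂ) with hz
  have hd : ∀ i, DifferentiableAt ℂ φ (w - z i) := fun i =>
    (h.analyticAt_line hw hw' (x i)).differentiableAt
  have hrev : ∀ i, φ (z i - w) = φ (w - z i) := fun i => by rw [← h.even]; congr 1; ring
  have hrev' : ∀ i, deriv φ (z i - w) = -deriv φ (w - z i) := fun i => by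
    rw [← deriv_neg_of_even h.even]; congr 1; ring
  have hdiff : ∀ i j, i ≠ j → DifferentiableAt ℂ φ (z i - z j) := fun i j hij => by
    have := (h.analyticAt_real (hx i j hij)).differentiableAt
    simpa [hz] using this
  have h2 := h.divSum_eq_zero (κ := Option ι) hsol (x := fun o => o.elim 0 x)
    (e := fun o => o.elim true fun _ => false) (by
      rintro (_ | i) (_ | j) hij he
      · exact absurd rfl hij
      · simp at he
      · simp at he
      · exact hx i j (by simpa using hij)) hw hw'
  have h3 : (fun o : Option ι => (((o.elim 0 x : ℝ) : ℂ) +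
      if (o.elim true fun _ => false) = true then w else 0)) = addPoint w z := by
    funext o; cases o <;> simp [hz]
  rw [h3, divSum_addPoint (fun i => by
    have : DifferentiableAt ℂ (fun u => φ (-u)) (z i - w) :=
      DifferentiableAt.comp (g := φ) (f := fun u : ℂ => -u) _ (by simpa using hd i)
        differentiableAt_id.neg
    simpa only [h.even] using this) hdiff] at h2
  rw [← h2]
  congr 1
  refine Finset.sum_congr rfl fun i _ => ?_
  rw [hrev, hrev']
  simp only [hz]
  ring

/-- If the integral of the solution over a period does not vanish, one point can be removed. -/
lemma isSolution_of_lineIntegral_ne_zero (h : IsStripFunction φ β δ) {η : ℝ} (hη : 0 < η)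
    (hη' : η < δ) (hne : lineIntegral φ η ≠ 0)
    (hsol : IsSolution (Option ι) (fun t : ℝ => φ t) {t : ℝ | Complex.sin ((t : ℂ) / 2) = 0}) :
    IsSolution ι (fun t : ℝ => φ t) {t : ℝ | Complex.sin ((t : ℂ) / 2) = 0} := by
  intro x hx
  rw [h.divSum_real hx]
  set z : ι → ℂ := fun i => (x i : ℂ) with hz
  set V : ι → ℂ := fun i => partialProd φ z i (z i) with hV
  set V' : ι → ℂ := fun i => deriv (partialProd φ z i) (z i) with hV'
  have hline' : ∀ w : ℂ, w.im = η → ∀ i, AnalyticAt ℂ (fun w => φ (w - z i)) w := fun w hw i =>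
    h.analyticAt_sub_line (by rw [hw]; exact hη) (by rw [hw]; exact hη') (x i)
  -- The equation with w in the strip says that ∑ φ(w − z i)V' i is the derivative of a periodic
  -- function, so its integral over a period is 0. By translation that integral is ∫φ times ∑ V' i,
  -- the left hand side of the equation for x.
  have h1 : ∀ w : ℂ, w.im = η → HasDerivAt
      (fun w => ∑ i, φ (w - z i) * V i - fullProd φ z w) (∑ i, φ (w - z i) * V' i) w := by
    intro w hw
    have hd : ∀ i, DifferentiableAt ℂ φ (w - z i) := fun i =>
      (h.analyticAt_line (by rw [hw]; exact hη) (by rw [hw]; exact hη') (x i)).differentiableAt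
    have h2 := h.deriv_fullProd_add_sum_eq_zero hsol hx (w := w) (by rw [hw]; exact hη)
      (by rw [hw]; exact hη')
    have h4 : HasDerivAt (fun w => ∑ i, φ (w - z i) * V i) (∑ i, deriv φ (w - z i) * V i) w := by
      refine HasDerivAt.fun_sum fun i _ => ?_
      exact ((hd i).hasDerivAt.comp_sub_const w (z i)).mul_const _
    refine (h4.sub (differentiableAt_fullProd hd).hasDerivAt).congr_deriv ?_
    rw [Finset.sum_sub_distrib] at h2
    linear_combination -h2
  have h2 := lineIntegral_eq_zero_of_hasDerivAt (η := η) (fun w => by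
    simp only [fullProd, hz, h.periodic_sub]) h1 (fun w hw =>
      Finset.analyticAt_fun_sum _ fun i _ => (hline' w hw i).mul analyticAt_const)
  rw [lineIntegral_sum _ (f := fun i w => φ (w - z i) * V' i)
    (fun i _ w hw => (hline' w hw i).mul analyticAt_const)] at h2
  have h3 : ∀ i, lineIntegral (fun w => φ (w - z i) * V' i) η = lineIntegral φ η * V' i := fun i => by
    rw [lineIntegral_mul_const, hz, lineIntegral_comp_sub h.periodic]
  rw [Finset.sum_congr rfl fun i _ => h3 i, ← Finset.mul_sum] at h2
  exact (mul_eq_zero.1 h2).resolve_left hne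

/-- If the autocorrelation of the solution does not vanish, two points can be removed. -/
lemma isSolution_of_autocorrelation_ne_zero (h : IsStripFunction φ β δ) {η : ℝ} (hη : 0 < η)
    (hη' : η < δ) {v : ℝ} (hv : Complex.sin ((v : ℂ) / 2) ≠ 0)
    (hne : lineIntegral (fun w => φ (w + v) * φ w) η ≠ 0)
    (hsol : IsSolution (Option (Option ι)) (fun t : ℝ => φ t)
      {t : ℝ | Complex.sin ((t : ℂ) / 2) = 0}) :
    IsSolution ι (fun t : ℝ => φ t) {t : ℝ | Complex.sin ((t : ℂ) / 2) = 0} := by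
  intro x hx
  rw [h.divSum_real hx]
  set z : ι → ℂ := fun i => (x i : ℂ) with hz
  set V : ι → ℂ := fun i => partialProd φ z i (z i) with hV
  set V' : ι → ℂ := fun i => deriv (partialProd φ z i) (z i) with hV'
  have hline : ∀ w : ℂ, w.im = η → ∀ i, AnalyticAt ℂ φ (w - z i) := fun w hw i =>
    h.analyticAt_line (by rw [hw]; exact hη) (by rw [hw]; exact hη') (x i)
  have hline' : ∀ w : ℂ, w.im = η → ∀ i, AnalyticAt ℂ (fun w => φ (w - z i)) w := fun w hw i =>
    h.analyticAt_sub_line (by rw [hw]; exact hη) (by rw [hw]; exact hη') (x i)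
  have him : ∀ w : ℂ, w.im = η → (w + v).im = η := fun w hw => by simpa using hw
  have hline2 : ∀ w : ℂ, w.im = η → ∀ i, AnalyticAt ℂ (fun w => φ (w + v - z i)) w := fun w hw i =>
    AnalyticAt.fun_comp (f := fun w : ℂ => w + v) (x := w) (hline' _ (him w hw) i) (by fun_prop)
  have hdiff : ∀ i j, i ≠ j → DifferentiableAt ℂ φ (z i - z j) := fun i j hij => by
    have := (h.analyticAt_real (hx i j hij)).differentiableAt
    simpa [hz] using this
  have hG : ∀ w : ℂ, w.im = η → AnalyticAt ℂ (fullProd φ z) w := fun w hw =>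
    Finset.analyticAt_fun_prod _ fun i _ => hline' w hw i
  have hG2 : ∀ w : ℂ, w.im = η → AnalyticAt ℂ (fun w => fullProd φ z (w + v)) w := fun w hw =>
    AnalyticAt.fun_comp (f := fun w : ℂ => w + v) (x := w) (hG _ (him w hw)) (by fun_prop)
  have hprod : ∀ w : ℂ, w.im = η → AnalyticAt ℂ (fun w => ∑ i, φ (w + v - z i) * φ (w - z i) * V' i) w :=
    fun w hw => Finset.analyticAt_fun_sum _ fun i _ =>
      ((hline2 w hw i).mul (hline' w hw i)).mul analyticAt_const
  -- The points w + v and w move together. The summand φ'(v)(G(w + v) − G(w)), where G is the full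
  -- product, has integral 0 by translation invariance. What remains is the autocorrelation at v
  -- times the left hand side of the equation for x.
  have h1 : ∀ w : ℂ, w.im = η → HasDerivAt
      (fun w => ∑ i, φ (w + v - z i) * φ (w - z i) * V i -
        φ v * (fullProd φ z (w + v) + fullProd φ z w))
      (∑ i, φ (w + v - z i) * φ (w - z i) * V' i +
        deriv φ v * (fullProd φ z (w + v) - fullProd φ z w)) w := by
    intro w hw
    have hd := fun i => (hline w hw i).differentiableAt
    have hd2 := fun i => (hline _ (him w hw) i).differentiableAt
    have h2 := h.divSum_eq_zero (κ := Option (Option ι)) hsol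
      (x := fun o => o.elim v fun o => o.elim 0 x)
      (e := fun o => o.elim true fun o => o.elim true fun _ => false) (by
        rintro (_ | _ | i) (_ | _ | j) hij he
        · exact absurd rfl hij
        · simpa using hv
        · simp at he
        · simp only [Option.elim, zero_sub]
          rw [Complex.ofReal_neg, neg_div, Complex.sin_neg]
          exact neg_ne_zero.2 hv
        · exact absurd rfl hij
        · simp at he
        · simp at he
        · simp at he
        · exact hx i j (by simpa using hij)) (w := w) (by rw [hw]; exact hη) (by rw [hw]; exact hη')
    have h3 : (fun o : Option (Option ι) => (((o.elim v fun o => o.elim 0 x : ℝ) : ℂ) +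
        if (o.elim true fun o => o.elim true fun _ => false) = true then w else 0)) =
        addPoint (w + v) (addPoint w z) := by
      funext o; rcases o with _ | _ | i <;> simp [hz, add_comm]
    have hdv : DifferentiableAt ℂ φ (w + v - w) := by
      rw [add_sub_cancel_left]; exact (h.analyticAt_real hv).differentiableAt
    rw [h3, divSum_addPoint_addPoint h.even hdv hd2 hd hdiff, add_sub_cancel_left] at h2
    have h4 : HasDerivAt (fun w => ∑ i, φ (w + v - z i) * φ (w - z i) * V i)
        (∑ i, (deriv φ (w + v - z i) * φ (w - z i) + φ (w + v - z i) * deriv φ (w - z i)) * V i) w := by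
      refine HasDerivAt.fun_sum fun i _ => ?_
      have e1 : HasDerivAt (fun w => φ (w + v - z i)) (deriv φ (w + v - z i)) w :=
        HasDerivAt.comp_add_const w (v : ℂ) ((hd2 i).hasDerivAt.comp_sub_const (w + v) (z i))
      exact (e1.mul ((hd i).hasDerivAt.comp_sub_const w (z i))).mul_const _
    have h5 : HasDerivAt (fun w => φ v * (fullProd φ z (w + v) + fullProd φ z w))
        (φ v * (deriv (fullProd φ z) (w + v) + deriv (fullProd φ z) w)) w :=
      ((HasDerivAt.comp_add_const w (v : ℂ) (differentiableAt_fullProd hd2).hasDerivAt).add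
        (differentiableAt_fullProd hd).hasDerivAt).const_mul _
    refine (h4.sub h5).congr_deriv ?_
    rw [Finset.sum_sub_distrib] at h2
    linear_combination -h2
  have h2 := lineIntegral_eq_zero_of_hasDerivAt (η := η) (fun w => by
    have e : ∀ i, w + 2 * Real.pi + v - z i = w + v + 2 * Real.pi - (x i : ℝ) := fun i => by
      simp only [hz]; ring
    simp only [fullProd, e]
    simp only [hz, h.periodic_sub]) h1 (fun w hw =>
      (hprod w hw).add (analyticAt_const.mul ((hG2 w hw).sub (hG w hw))))
  have hGper : ∀ w, fullProd φ z (w + 2 * Real.pi) = fullProd φ z w := fun w => by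
    simp only [fullProd, hz, h.periodic_sub]
  have hGv : lineIntegral (fun w => fullProd φ z (w + v)) η = lineIntegral (fullProd φ z) η := by
    rw [← lineIntegral_comp_sub hGper η (-v)]
    refine lineIntegral_congr fun w _ => ?_
    congr 1; push_cast; ring
  rw [lineIntegral_add (g := fun w => deriv φ v * (fullProd φ z (w + v) - fullProd φ z w)) hprod (fun w hw => analyticAt_const.mul ((hG2 w hw).sub (hG w hw))),
    lineIntegral_const_mul, lineIntegral_sub hG2 hG, hGv, sub_self, mul_zero, add_zero,
    lineIntegral_sum _ (f := fun i w => φ (w + v - z i) * φ (w - z i) * V' i) (fun i _ w hw =>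
      ((hline2 w hw i).mul (hline' w hw i)).mul analyticAt_const)] at h2
  have h3 : ∀ i, lineIntegral (fun w => φ (w + v - z i) * φ (w - z i) * V' i) η =
      lineIntegral (fun w => φ (w + v) * φ w) η * V' i := fun i => by
    rw [lineIntegral_mul_const, ← lineIntegral_comp_sub (f := fun w => φ (w + v) * φ w)
      (fun w => by
        rw [h.periodic, show w + 2 * (Real.pi : ℂ) + v = w + v + 2 * Real.pi by ring, h.periodic])
      η (x i)]
    congr 1
    refine lineIntegral_congr fun w _ => ?_
    simp only [hz]
    rw [show w + v - (x i : ℂ) = w - x i + v by ring]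
  rw [Finset.sum_congr rfl fun i _ => h3 i, ← Finset.mul_sum] at h2
  exact (mul_eq_zero.1 h2).resolve_left hne

end IsStripFunction

/-! ### Fourier coefficients and the vanishing autocorrelation -/

/-- The function `1 / (4 sin² (z / 2))`, written in terms of `e^{iz}`. -/
noncomputable def inverseSinSq (z : ℂ) : ℂ :=
  -Complex.exp (Complex.I * z) / (1 - Complex.exp (Complex.I * z)) ^ 2

lemma exp_I_mul_eq_one_iff {z : ℂ} :
    Complex.exp (Complex.I * z) = 1 ↔ Complex.sin (z / 2) = 0 := by
  rw [Complex.exp_eq_one_iff, sin_half_eq_zero_iff]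
  refine exists_congr fun k => ?_
  constructor
  · intro h
    apply mul_left_cancel₀ Complex.I_ne_zero
    rw [h]; ring
  · rintro rfl; ring

lemma exp_I_mul_periodic (z : ℂ) :
    Complex.exp (Complex.I * (z + 2 * Real.pi)) = Complex.exp (Complex.I * z) := by
  rw [mul_add, Complex.exp_add, show Complex.I * (2 * Real.pi) = 2 * Real.pi * Complex.I by ring,
    Complex.exp_two_pi_mul_I, mul_one]

lemma inverseSinSq_periodic (z : ℂ) : inverseSinSq (z + 2 * Real.pi) = inverseSinSq z := by
  unfold inverseSinSq; rw [exp_I_mul_periodic]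

lemma inverseSinSq_neg (z : ℂ) : inverseSinSq (-z) = inverseSinSq z := by
  unfold inverseSinSq
  rw [mul_neg, Complex.exp_neg]
  have hq := Complex.exp_ne_zero (Complex.I * z)
  set q := Complex.exp (Complex.I * z)
  by_cases h : q = 1
  · simp [h]
  · have h1 : 1 - q ≠ 0 := sub_ne_zero.2 (Ne.symm h)
    have h2 : 1 - q⁻¹ ≠ 0 := sub_ne_zero.2 fun h3 => h (by rw [← inv_inv q, ← h3, inv_one])
    have h3 : 1 - q⁻¹ = -(1 - q) / q := by field_simp; ring
    rw [h3]; field_simp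

lemma analyticAt_inverseSinSq {z : ℂ} (h : Complex.sin (z / 2) ≠ 0) :
    AnalyticAt ℂ inverseSinSq z := by
  have h1 : (1 - Complex.exp (Complex.I * z)) ^ 2 ≠ 0 :=
    pow_ne_zero 2 (sub_ne_zero.2 fun h1 => h (exp_I_mul_eq_one_iff.1 h1.symm))
  unfold inverseSinSq
  exact AnalyticAt.div (by fun_prop) (by fun_prop) h1

/-- Up to a constant this is the trigonometric ℘ function with c = i/2, from which the behaviour at
the pole is taken as well. -/
lemma inverseSinSq_eq_sinh (z : ℂ) :
    inverseSinSq z = (Complex.I / 2) ^ 2 / Complex.sinh (Complex.I / 2 * z) ^ 2 := by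
  unfold inverseSinSq Complex.sinh
  have h1 : Complex.exp (Complex.I * z) = Complex.exp (Complex.I / 2 * z) ^ 2 := by
    rw [← Complex.exp_nat_mul]; congr 1; push_cast; ring
  rw [h1, Complex.exp_neg]
  have hq := Complex.exp_ne_zero (Complex.I / 2 * z)
  set q := Complex.exp (Complex.I / 2 * z)
  by_cases h : q ^ 2 = 1
  · have : q - q⁻¹ = 0 := by field_simp; rw [h, sub_self, mul_zero]
    simp [h, this]
  · have h2 : 1 - q ^ 2 ≠ 0 := sub_ne_zero.2 (Ne.symm h)
    have h3 : q - q⁻¹ = -(1 - q ^ 2) / q := by field_simp; ring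
    rw [h3]
    field_simp
    rw [Complex.I_sq]

lemma exists_pole_inverseSinSq : ∃ s : ℂ → ℂ, AnalyticAt ℂ s 0 ∧
    ∀ᶠ u in 𝓝[≠] (0 : ℂ), inverseSinSq u = 1 / u ^ 2 + s u := by
  obtain ⟨g, hg, h⟩ := (isWeierstrassLike_trigonometric
    (div_ne_zero Complex.I_ne_zero two_ne_zero : Complex.I / 2 ≠ 0)).pole
  refine ⟨fun u => g u - (Complex.I / 2) ^ 2 / 3, hg.sub analyticAt_const, ?_⟩
  filter_upwards [h] with u hu
  rw [inverseSinSq_eq_sinh]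
  linear_combination hu

/-- The character `e^{-imz}`. -/
noncomputable def expChar (m : ℤ) (z : ℂ) : ℂ := Complex.exp (-(Complex.I * m * z))

lemma expChar_periodic (m : ℤ) (z : ℂ) : expChar m (z + 2 * Real.pi) = expChar m z := by
  unfold expChar
  rw [show -(Complex.I * m * (z + 2 * Real.pi)) = -(Complex.I * m * z) +
    ((-m : ℤ) : ℂ) * (2 * Real.pi * Complex.I) by push_cast; ring, Complex.exp_add,
    Complex.exp_int_mul_two_pi_mul_I, mul_one]

lemma expChar_add (m : ℤ) (z w : ℂ) : expChar m (z + w) = expChar m z * expChar m w := by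
  unfold expChar; rw [← Complex.exp_add]; congr 1; ring

lemma expChar_neg_mul (m : ℤ) (z : ℂ) : expChar (-m) z * expChar m z = 1 := by
  unfold expChar; rw [← Complex.exp_add, ← Complex.exp_zero]; congr 1; push_cast; ring

lemma analyticAt_expChar (m : ℤ) (z : ℂ) : AnalyticAt ℂ (expChar m) z := by
  unfold expChar; fun_prop

lemma norm_expChar (m : ℤ) {z : ℂ} : ‖expChar m z‖ = Real.exp (m * z.im) := by
  unfold expChar
  rw [Complex.norm_exp]
  congr 1; simp

lemma lineIntegral_expChar (m : ℤ) (η : ℝ) :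
    lineIntegral (expChar m) η = if m = 0 then 2 * (Real.pi : ℂ) else 0 := by
  split_ifs with h
  · subst h
    simp [lineIntegral, expChar]
  · have h' : Complex.I * m ≠ 0 := mul_ne_zero Complex.I_ne_zero (by exact_mod_cast h)
    refine lineIntegral_eq_zero_of_hasDerivAt (P := fun z => expChar m z / (-(Complex.I * m)))
      (fun z => by simp only [expChar_periodic]) (fun w _ => ?_) fun w _ => analyticAt_expChar m w
    have h1 : HasDerivAt (expChar m) (expChar m w * (-(Complex.I * m * 1))) w :=
      (((hasDerivAt_id w).const_mul (Complex.I * m)).neg).cexp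
    exact (h1.div_const _).congr_deriv (by field_simp)

/-- Above the real axis |e^{iz}| < 1, and the function is the series −∑ n e^{inz}. On integrating
termwise, only n = m can contribute. -/
lemma lineIntegral_inverseSinSq {η : ℝ} (hη : 0 < η) (m : ℤ) :
    lineIntegral (fun w => inverseSinSq w * expChar m w) η =
      if 0 < m then -(2 * Real.pi * m : ℂ) else 0 := by
  set ρ := Real.exp (-η) with hρ
  have hρ0 : 0 < ρ := Real.exp_pos _
  have hρ1 : ρ < 1 := by rw [hρ, Real.exp_lt_one_iff]; linarith
  have hq : ∀ w : ℂ, w.im = η → ‖Complex.exp (Complex.I * w)‖ = ρ := fun w hw => by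
    rw [Complex.norm_exp, hρ]; congr 1; simp [hw]
  have hs : ∀ w : ℂ, w.im = η → HasSum (fun n : ℕ => -(n : ℂ) * expChar (m - n) w)
      (inverseSinSq w * expChar m w) := by
    intro w hw
    have h1 := (hasSum_coe_mul_geometric_of_norm_lt_one (𝕜 := ℂ)
      (by rw [hq w hw]; exact hρ1)).mul_right (-expChar m w)
    have e : (fun n : ℕ => -(n : ℂ) * expChar (m - n) w) =
        fun n : ℕ => (n : ℂ) * Complex.exp (Complex.I * w) ^ n * -expChar m w := by
      funext n
      have : expChar (m - n) w = Complex.exp (Complex.I * w) ^ n * expChar m w := by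
        unfold expChar
        rw [← Complex.exp_nat_mul, ← Complex.exp_add]; congr 1; push_cast; ring
      rw [this]; ring
    have e' : inverseSinSq w * expChar m w = Complex.exp (Complex.I * w) /
        (1 - Complex.exp (Complex.I * w)) ^ 2 * -expChar m w := by
      unfold inverseSinSq; ring
    rwa [e, e']
  have hsum := intervalIntegral.hasSum_integral_of_dominated_convergence
    (μ := MeasureTheory.volume) (a := 0) (b := 2 * Real.pi)
    (F := fun (n : ℕ) (u : ℝ) => -(n : ℂ) * expChar (m - n) (u + η * Complex.I))
    (f := fun u : ℝ => inverseSinSq (u + η * Complex.I) * expChar m (u + η * Complex.I))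
    (fun n _ => n * ρ ^ n * Real.exp (m * η))
    (fun n => by
      refine Continuous.aestronglyMeasurable (continuous_const.mul ?_)
      exact continuous_line (f := expChar (m - n)) fun w _ => analyticAt_expChar _ w)
    (fun n => Eventually.of_forall fun u _ => by
      rw [norm_mul, norm_neg, Complex.norm_natCast, norm_expChar, mul_assoc]
      refine mul_le_mul_of_nonneg_left (le_of_eq ?_) (Nat.cast_nonneg n)
      rw [hρ, ← Real.exp_nat_mul, ← Real.exp_add]
      congr 1
      have : ((u : ℂ) + η * Complex.I).im = η := by simp
      rw [this]; push_cast; ring)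
    (Eventually.of_forall fun u _ => by
      have := (hasSum_coe_mul_geometric_of_norm_lt_one (𝕜 := ℝ)
        (by rw [Real.norm_of_nonneg hρ0.le]; exact hρ1)).summable
      exact this.mul_right _)
    intervalIntegrable_const
    (Eventually.of_forall fun u _ => hs _ (by simp))
  have hterm : ∀ n : ℕ, ∫ u in (0 : ℝ)..(2 * Real.pi), -(n : ℂ) * expChar (m - n) (u + η * Complex.I) =
      -(n : ℂ) * if m - n = 0 then 2 * (Real.pi : ℂ) else 0 := fun n => by
    rw [← lineIntegral_expChar (m - n) η, lineIntegral, intervalIntegral.integral_const_mul]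
  simp only [hterm] at hsum
  refine hsum.unique ?_
  split_ifs with hm
  · obtain ⟨k, rfl⟩ := Int.eq_ofNat_of_zero_le hm.le
    have h1 := hasSum_single (f := fun n : ℕ => -(n : ℂ) *
      if (k : ℤ) - n = 0 then 2 * (Real.pi : ℂ) else 0) k (fun n hn => by
        have : (k : ℤ) - n ≠ 0 := by omega
        simp [this])
    simp only [sub_self, if_true] at h1
    have e : -(2 * Real.pi * ((k : ℤ) : ℂ)) = -(k : ℂ) * (2 * Real.pi) := by push_cast; ring
    rw [e]
    exact h1
  · have : (fun n : ℕ => -(n : ℂ) * if m - n = 0 then 2 * (Real.pi : ℂ) else 0) = fun _ => 0 := by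
      funext n
      by_cases h : m - n = 0
      · have : n = 0 := by omega
        simp [this]
      · simp [h]
    rw [this]
    exact hasSum_zero

/-- Cauchy's theorem for a rectangle, whose vertical sides cancel by periodicity. -/
lemma lineIntegral_eq_lineIntegral_zero {f : ℂ → ℂ} {η : ℝ} (hp : ∀ z, f (z + 2 * Real.pi) = f z)
    (hη : 0 ≤ η) (hf : ∀ z : ℂ, 0 ≤ z.im → z.im ≤ η → AnalyticAt ℂ f z) :
    lineIntegral f η = lineIntegral f 0 := by
  have h := Complex.integral_boundary_rect_eq_zero_of_differentiableOn f 0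
    ((2 * Real.pi : ℝ) + η * Complex.I) (fun z hz => by
      rw [Complex.mem_reProdIm] at hz
      have h1 := hz.2
      simp only [Complex.zero_im, Complex.add_im, Complex.ofReal_im, Complex.mul_im,
        Complex.ofReal_re, Complex.I_im, mul_one, Complex.I_re, mul_zero, add_zero, zero_add] at h1
      rw [Set.uIcc_of_le hη] at h1
      exact (hf z h1.1 h1.2).differentiableAt.differentiableWithinAt)
  have h2 : ∀ y : ℝ, f (((2 * Real.pi : ℝ) : ℂ) + y * Complex.I) = f (((0 : ℝ) : ℂ) + y * Complex.I) := by
    intro y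
    rw [← hp (((0 : ℝ) : ℂ) + y * Complex.I)]; congr 1; push_cast; ring
  simp only [Complex.zero_im, Complex.zero_re, Complex.add_im, Complex.add_re, Complex.ofReal_im,
    Complex.mul_im, Complex.mul_re, Complex.ofReal_re, Complex.I_im, mul_one, Complex.I_re, mul_zero,
    add_zero, zero_add, sub_zero, h2] at h
  unfold lineIntegral
  linear_combination -h

lemma lineIntegral_comp_neg {f : ℂ → ℂ} (hp : ∀ z, f (z + 2 * Real.pi) = f z) :
    lineIntegral (fun w => f (-w)) 0 = lineIntegral f 0 := by
  unfold lineIntegral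
  simp only [Complex.ofReal_zero, zero_mul, add_zero]
  have h1 := intervalIntegral.integral_comp_neg (a := 0) (b := 2 * Real.pi) fun u : ℝ => f u
  push_cast at h1
  rw [h1]
  have hper : Function.Periodic (fun u : ℝ => f u) (2 * Real.pi) := fun u => by
    have := hp u
    push_cast
    exact this
  have h2 := hper.intervalIntegral_add_eq (-(2 * Real.pi)) 0
  simpa using h2

/-- The Fourier coefficients of the convolution of a periodic function with its reflection. -/
lemma lineIntegral_mul_eq_zero_of_autocorrelation {f : ℂ → ℂ} {η : ℝ}
    (hp : ∀ z, f (z + 2 * Real.pi) = f z) (hf : ∀ w : ℂ, w.im = η → AnalyticAt ℂ f w)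
    (hK : ∀ v : ℝ, Complex.sin ((v : ℂ) / 2) ≠ 0 → lineIntegral (fun w => f (w + v) * f w) η = 0)
    (m : ℤ) : lineIntegral (fun w => f w * expChar m w) η *
      lineIntegral (fun w => f w * expChar (-m) w) η = 0 := by
  have hpi := Real.pi_pos
  have hcf := continuous_line hf
  have hce : ∀ m, Continuous fun u : ℝ => expChar m (u + η * Complex.I) := fun m =>
    continuous_line fun w _ => analyticAt_expChar m w
  have hcont : Continuous (Function.uncurry fun v u : ℝ =>
      f (u + η * Complex.I + v) * f (u + η * Complex.I) * expChar m v) := by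
    have e : (Function.uncurry fun v u : ℝ =>
        f (u + η * Complex.I + v) * f (u + η * Complex.I) * expChar m v) = fun p : ℝ × ℝ =>
        (fun u : ℝ => f (u + η * Complex.I)) (p.2 + p.1) * (fun u : ℝ => f (u + η * Complex.I)) p.2 *
          expChar m p.1 := by
      funext p
      simp only [Function.uncurry]
      congr 3; push_cast; ring
    rw [e]
    refine ((hcf.comp (by fun_prop)).mul (hcf.comp (by fun_prop))).mul ?_
    unfold expChar; fun_prop
  -- By Fubini the m-th Fourier coefficient of the autocorrelation is the product of the
  -- coefficients of f of orders m and −m. The autocorrelation vanishes for 0 < v < 2π, which is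
  -- almost everywhere.
  have hswap := MeasureTheory.intervalIntegral_intervalIntegral_swap (a := 0) (b := 2 * Real.pi)
    (c := 0) (d := 2 * Real.pi) (F := fun v u : ℝ =>
      f (u + η * Complex.I + v) * f (u + η * Complex.I) * expChar m v)
    ((hcont.continuousOn.integrableOn_compact (isCompact_uIcc.prod isCompact_uIcc)).mono_set
      (Set.prod_mono Set.uIoc_subset_uIcc Set.uIoc_subset_uIcc))
  have hleft : ∫ v in (0 : ℝ)..(2 * Real.pi), ∫ u in (0 : ℝ)..(2 * Real.pi),
      f (u + η * Complex.I + v) * f (u + η * Complex.I) * expChar m v = 0 := by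
    refine intervalIntegral.integral_zero_ae ?_
    have hae : ∀ᵐ v : ℝ, v ≠ 2 * Real.pi := by
      rw [MeasureTheory.ae_iff]; simp
    filter_upwards [hae] with v hv hmem
    rw [Set.uIoc_of_le (by positivity)] at hmem
    rw [intervalIntegral.integral_mul_const]
    have h1 := hK v (by
      rw [Ne, sin_half_eq_zero_iff]
      rintro ⟨k, hk⟩
      have hk : v = 2 * Real.pi * k := by exact_mod_cast hk
      have h2 : v < 2 * Real.pi := lt_of_le_of_ne hmem.2 hv
      have h3 := hmem.1
      rw [hk] at h2 h3
      have h4 : (0 : ℝ) < k := by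
        by_contra h; push Not at h
        nlinarith
      have h5 : (1 : ℝ) ≤ k := by
        have : 0 < k := by exact_mod_cast h4
        exact_mod_cast this
      nlinarith)
    unfold lineIntegral at h1
    rw [h1, zero_mul]
  have hright : ∀ u : ℝ, ∫ v in (0 : ℝ)..(2 * Real.pi),
      f (u + η * Complex.I + v) * f (u + η * Complex.I) * expChar m v =
      f (u + η * Complex.I) * expChar (-m) (u + η * Complex.I) *
        lineIntegral (fun w => f w * expChar m w) η := by
    intro u
    rw [← lineIntegral_comp_sub (f := fun w => f w * expChar m w)
      (fun z => by rw [hp, expChar_periodic]) η (-u), lineIntegral,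
      ← intervalIntegral.integral_const_mul]
    refine intervalIntegral.integral_congr fun v _ => ?_
    have e1 : (v : ℂ) + η * Complex.I - ((-u : ℝ) : ℂ) = u + η * Complex.I + v := by push_cast; ring
    rw [e1, expChar_add m (u + η * Complex.I) v]
    linear_combination (-f (u + η * Complex.I + v) * f (u + η * Complex.I) * expChar m v) *
      expChar_neg_mul m (u + η * Complex.I)
  rw [hleft] at hswap
  simp only [hright] at hswap
  rw [intervalIntegral.integral_mul_const] at hswap
  rw [hswap, mul_comm]
  rfl

/-- A continuous periodic function with finitely many Fourier coefficients is the sum of its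
Fourier series. -/
lemma eq_sum_of_lineIntegral_eq_zero {g : ℂ → ℂ} (hp : ∀ z, g (z + 2 * Real.pi) = g z)
    (hg : Continuous fun x : ℝ => g x) {N : ℕ}
    (h0 : ∀ m : ℤ, (N : ℤ) < |m| → lineIntegral (fun w => g w * expChar m w) 0 = 0) (x : ℝ) :
    g x = ∑ m ∈ Finset.Icc (-(N : ℤ)) N,
      lineIntegral (fun w => g w * expChar m w) 0 / (2 * Real.pi) * expChar (-m) x := by
  have : Fact (0 < 2 * Real.pi) := ⟨by positivity⟩
  have hpi := Real.pi_pos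
  have hper : Function.Periodic (fun x : ℝ => g x) (2 * Real.pi) := fun u => by
    have := hp u
    push_cast
    exact this
  set f : C(AddCircle (2 * Real.pi), ℂ) := ⟨hper.lift, continuous_coinduced_dom.mpr hg⟩ with hf
  have hfx : ∀ x : ℝ, f (x : AddCircle (2 * Real.pi)) = g x := fun x => hper.lift_coe x
  have hfour : ∀ (m : ℤ) (x : ℝ), fourier m (x : AddCircle (2 * Real.pi)) = expChar (-m) x := by
    intro m x
    rw [fourier_coe_apply, expChar]
    congr 1
    have : (Real.pi : ℂ) ≠ 0 := Complex.ofReal_ne_zero.2 hpi.ne'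
    push_cast
    field_simp
  have hcoef : ∀ m : ℤ, fourierCoeff f m =
      lineIntegral (fun w => g w * expChar m w) 0 / (2 * Real.pi) := by
    intro m
    rw [fourierCoeff_eq_intervalIntegral f m 0, lineIntegral, zero_add]
    have : ∀ x : ℝ, fourier (-m) (x : AddCircle (2 * Real.pi)) • f (x : AddCircle (2 * Real.pi)) =
        g (x + (0 : ℝ) * Complex.I) * expChar m (x + (0 : ℝ) * Complex.I) := fun x => by
      rw [hfx, hfour, neg_neg, smul_eq_mul, mul_comm]; simp
    simp only [this]
    rw [Complex.real_smul]
    push_cast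
    ring
  have hz : ∀ m ∉ Finset.Icc (-(N : ℤ)) N, fourierCoeff f m = 0 := by
    intro m hm
    rw [hcoef, h0 m, zero_div]
    rw [Finset.mem_Icc, ← abs_le] at hm
    exact not_le.1 hm
  have hsum := has_pointwise_sum_fourier_series_of_summable (f := f)
    (summable_of_ne_finset_zero hz) (x : AddCircle (2 * Real.pi))
  rw [← hfx, hsum.unique (hasSum_sum_of_ne_finset_zero (s := Finset.Icc (-(N : ℤ)) N)
    fun m hm => by rw [hz m hm, zero_smul])]
  exact Finset.sum_congr rfl fun m _ => by rw [hcoef, hfour, smul_eq_mul]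

lemma norm_lineIntegral_expChar_le {g : ℂ → ℂ} {C : ℝ}
    (hC : ∀ x ∈ Set.Icc 0 (2 * Real.pi), ‖g (x : ℝ)‖ ≤ C) (m : ℤ) :
    ‖lineIntegral (fun w => g w * expChar m w) 0‖ ≤ C * (2 * Real.pi) := by
  have hpi := Real.pi_pos
  have := intervalIntegral.norm_integral_le_of_norm_le_const (a := 0) (b := 2 * Real.pi) (C := C)
    (f := fun u : ℝ => g (u + (0 : ℝ) * Complex.I) * expChar m (u + (0 : ℝ) * Complex.I))
    (fun u hu => by
      rw [Set.uIoc_of_le (by positivity)] at hu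
      rw [norm_mul, norm_expChar]
      simpa using hC u ⟨hu.1.le, hu.2⟩)
  rw [sub_zero, abs_of_pos (by positivity)] at this
  exact this

namespace IsStripFunction

variable {φ : ℂ → ℂ} {β : ℂ} {δ : ℝ}

/-- The difference to a multiple of `1 / (4 sin² (z / 2))` extends analytically over the poles. -/
lemma exists_regularPart (h : IsStripFunction φ β δ) : ∃ g : ℂ → ℂ, (∀ z, g (-z) = g z) ∧
    (∀ z, g (z + 2 * Real.pi) = g z) ∧ (∀ z : ℂ, |z.im| < δ → AnalyticAt ℂ g z) ∧
    ∀ z, Complex.sin (z / 2) ≠ 0 → φ z = β * inverseSinSq z + g z := by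
  classical
  have hpi := Real.pi_pos
  obtain ⟨G, hG, hφG⟩ := h.pole
  obtain ⟨s, hs, hts⟩ := exists_pole_inverseSinSq
  set g : ℂ → ℂ := fun z => if Complex.sin (z / 2) = 0 then G 0 - β * s 0 else
    φ z - β * inverseSinSq z with hg
  have hper : ∀ z, g (z + 2 * Real.pi) = g z := by
    intro z
    have : Complex.sin ((z + 2 * Real.pi) / 2) = -Complex.sin (z / 2) := by
      rw [← Complex.sin_add_pi]; congr 1; ring
    simp only [hg, h.periodic, inverseSinSq_periodic, this, neg_eq_zero]
  have hP : Function.Periodic g (2 * Real.pi : ℂ) := hper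
  have hg0 : AnalyticAt ℂ g 0 := by
    have ha : AnalyticAt ℂ (fun u => G u - β * s u) 0 := hG.sub (analyticAt_const.mul hs)
    refine ha.congr ?_
    have hsmall : ∀ᶠ u : ℂ in 𝓝 0, ‖u‖ < 2 * Real.pi := by
      have hc : ContinuousAt (fun u : ℂ => ‖u‖) 0 := by fun_prop
      exact hc.eventually_lt_const (by simpa using hpi)
    filter_upwards [eventually_nhdsWithin_iff.1 hφG, eventually_nhdsWithin_iff.1 hts, hsmall]
      with u h1 h2 h3
    by_cases hu : u = 0
    · subst hu; simp [hg]
    · have h4 : Complex.sin (u / 2) ≠ 0 := by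
        rw [Ne, sin_half_eq_zero_iff]
        rintro ⟨k, rfl⟩
        have hk : k ≠ 0 := by rintro rfl; simp at hu
        have h5 : (1 : ℝ) ≤ ‖(k : ℂ)‖ := by
          rw [Complex.norm_intCast]; exact_mod_cast Int.one_le_abs hk
        rw [norm_mul, norm_mul, Complex.norm_ofNat, Complex.norm_real,
          Real.norm_of_nonneg hpi.le] at h3
        nlinarith
      simp only [hg, h4, if_false]
      rw [h1 hu, h2 hu]
      ring
  refine ⟨g, fun z => ?_, hper, fun z hz => ?_, fun z hz => ?_⟩
  · have : Complex.sin (-z / 2) = -Complex.sin (z / 2) := by rw [neg_div, Complex.sin_neg]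
    simp only [hg, this, neg_eq_zero, h.even, inverseSinSq_neg]
  · by_cases h0 : Complex.sin (z / 2) = 0
    · obtain ⟨k, rfl⟩ := sin_half_eq_zero_iff.1 h0
      have h1 : g = fun w => g (w - 2 * Real.pi * k) := by
        funext w
        have := hP.sub_int_mul_eq (x := w) k
        rw [← this]; congr 1; ring
      rw [h1]
      exact AnalyticAt.fun_comp (f := fun w : ℂ => w - 2 * Real.pi * k) (by rwa [sub_self])
        (by fun_prop)
    · refine ((h.analytic z hz h0).sub (analyticAt_const.mul (analyticAt_inverseSinSq h0))).congr
        (f := fun w => φ w - β * inverseSinSq w) ?_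
      have hc : Continuous fun w : ℂ => Complex.sin (w / 2) := by fun_prop
      filter_upwards [hc.continuousAt.eventually_ne h0] with w hw
      simp only [hg, hw, if_false]
  · simp only [hg, hz, if_false]; ring

section Coefficients

variable {g : ℂ → ℂ}

lemma lineIntegral_mul_expChar_neg (hge : ∀ z, g (-z) = g z) (hgp : ∀ z, g (z + 2 * Real.pi) = g z)
    (m : ℤ) : lineIntegral (fun w => g w * expChar (-m) w) 0 =
      lineIntegral (fun w => g w * expChar m w) 0 := by
  rw [← lineIntegral_comp_neg (f := fun w => g w * expChar m w)
    fun z => by rw [hgp, expChar_periodic]]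
  refine lineIntegral_congr fun w _ => ?_
  rw [hge]; congr 1
  unfold expChar; congr 1; push_cast; ring

/-- The line of integration can be moved to the real axis for the regular part g alone. The polar
part is integrated above the axis, where it contributes for positive m only. -/
lemma lineIntegral_mul_expChar
    (hgp : ∀ z, g (z + 2 * Real.pi) = g z) (hga : ∀ z : ℂ, |z.im| < δ → AnalyticAt ℂ g z)
    (hφg : ∀ z, Complex.sin (z / 2) ≠ 0 → φ z = β * inverseSinSq z + g z) {η : ℝ} (hη : 0 < η)
    (hη' : η < δ) (m : ℤ) : lineIntegral (fun w => φ w * expChar m w) η =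
      β * (if 0 < m then -(2 * Real.pi * m : ℂ) else 0) +
        lineIntegral (fun w => g w * expChar m w) 0 := by
  have hs : ∀ w : ℂ, w.im = η → Complex.sin (w / 2) ≠ 0 := fun w hw =>
    sin_half_ne_zero_of_im_ne_zero (by rw [hw]; exact hη.ne')
  have hg : ∀ w : ℂ, |w.im| < δ → AnalyticAt ℂ (fun w => g w * expChar m w) w := fun w hw =>
    (hga w hw).mul (analyticAt_expChar m w)
  rw [← lineIntegral_inverseSinSq hη, ← lineIntegral_const_mul,
    ← lineIntegral_eq_lineIntegral_zero (η := η) (fun z => by rw [hgp, expChar_periodic]) hη.le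
      (fun z h1 h2 => hg z (by rw [abs_of_nonneg h1]; exact h2.trans_lt hη')),
    ← lineIntegral_add (f := fun w => β * (inverseSinSq w * expChar m w))
      (g := fun w => g w * expChar m w) (fun w hw => analyticAt_const.mul
        ((analyticAt_inverseSinSq (hs w hw)).mul (analyticAt_expChar m w)))
      (fun w hw => hg w (by rw [hw, abs_of_pos hη]; exact hη'))]
  refine lineIntegral_congr fun w hw => ?_
  rw [hφg w (hs w hw)]; ring

end Coefficients

/-- A function with vanishing autocorrelation is a multiple of `1 / (4 sin² (z / 2))` up to a
trigonometric polynomial. -/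
lemma exists_eq_of_autocorrelation_eq_zero (h : IsStripFunction φ β δ) {η : ℝ} (hη : 0 < η)
    (hη' : η < δ)
    (hK : ∀ v : ℝ, Complex.sin ((v : ℂ) / 2) ≠ 0 → lineIntegral (fun w => φ (w + v) * φ w) η = 0) :
    (∀ x : ℝ, Complex.sin ((x : ℂ) / 2) ≠ 0 → φ x = β * inverseSinSq x) ∨
    ∃ (N : ℕ) (c : ℤ → ℂ), 1 ≤ N ∧ (∀ m, c (-m) = c m) ∧ c N ≠ 0 ∧
      ∀ x : ℝ, Complex.sin ((x : ℂ) / 2) ≠ 0 → φ x = β * inverseSinSq x +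
        ∑ m ∈ Finset.Icc (-(N : ℤ)) N, c m * expChar (-m) x := by
  have hpi := Real.pi_pos
  have hpi' : (2 * Real.pi : ℂ) ≠ 0 := by simp
  obtain ⟨g, hge, hgp, hga, hφg⟩ := h.exists_regularPart
  set γ : ℤ → ℂ := fun m => lineIntegral (fun w => g w * expChar m w) 0 with hγ
  have hγe : ∀ m, γ (-m) = γ m := lineIntegral_mul_expChar_neg hge hgp
  have hcont : Continuous fun x : ℝ => g x := by
    rw [continuous_iff_continuousAt]
    exact fun x => (hga x (by simp [h.pos])).continuousAt.comp
      Complex.continuous_ofReal.continuousAt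
  -- The product of the coefficients of orders m and −m. The polar part enters only the first one
  -- and γ is even, so γ(m) is either 0 or 2πmβ. As γ is bounded, the second value is impossible for
  -- large m, and g is a trigonometric polynomial.
  have hmul : ∀ m : ℤ, 0 ≤ m → (β * -(2 * Real.pi * m) + γ m) * γ m = 0 := by
    intro m hm
    have h1 := lineIntegral_mul_eq_zero_of_autocorrelation h.periodic
      (fun w hw => h.analytic w (by rw [hw, abs_of_pos hη]; exact hη')
        (sin_half_ne_zero_of_im_ne_zero (by rw [hw]; exact hη.ne'))) hK m
    rw [lineIntegral_mul_expChar hgp hga hφg hη hη', lineIntegral_mul_expChar hgp hga hφg hη hη',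
      if_neg (by omega : ¬ 0 < -m), mul_zero, zero_add] at h1
    have h2 : (if 0 < m then -(2 * Real.pi * m : ℂ) else 0) = -(2 * Real.pi * m) := by
      split_ifs with h3
      · rfl
      · have : m = 0 := by omega
        simp [this]
    rw [h2] at h1
    rw [← h1, lineIntegral_mul_expChar_neg hge hgp]
  have hγ0 : γ 0 = 0 := by simpa using hmul 0 le_rfl
  obtain ⟨C, hC⟩ := isCompact_Icc.exists_bound_of_continuousOn (s := Set.Icc 0 (2 * Real.pi))
    hcont.continuousOn
  have hbd : ∀ m, ‖γ m‖ ≤ C * (2 * Real.pi) := norm_lineIntegral_expChar_le hC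
  obtain ⟨M, hM⟩ := exists_nat_gt (C / ‖β‖)
  have hβ : 0 < ‖β‖ := norm_pos_iff.2 h.ne_zero
  have hlarge : ∀ m : ℕ, M ≤ m → γ m = 0 := by
    intro m hm
    rcases mul_eq_zero.1 (hmul m (Int.natCast_nonneg m)) with h1 | h1
    · exfalso
      have h2 : γ m = β * (2 * Real.pi * m) := by
        push_cast at h1; linear_combination h1
      have h3 := hbd m
      rw [h2, norm_mul, norm_mul, norm_mul, Complex.norm_ofNat, Complex.norm_real,
        Real.norm_of_nonneg hpi.le, Complex.norm_natCast] at h3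
      have h4 : (M : ℝ) ≤ m := by exact_mod_cast hm
      rw [div_lt_iff₀ hβ] at hM
      have h5 : C < m * ‖β‖ := hM.trans_le (mul_le_mul_of_nonneg_right h4 hβ.le)
      nlinarith
    · exact h1
  have hexp : ∀ N : ℕ, (∀ m : ℕ, N < m → γ m = 0) → ∀ x : ℝ, g x =
      ∑ m ∈ Finset.Icc (-(N : ℤ)) N, γ m / (2 * Real.pi) * expChar (-m) x := by
    intro N hN x
    refine eq_sum_of_lineIntegral_eq_zero hgp hcont (fun m hm => ?_) x
    have h1 : γ |m| = γ m := by
      rcases abs_choice m with h | h <;> rw [h]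
      exact hγe m
    obtain ⟨k, hk⟩ := Int.eq_ofNat_of_zero_le (abs_nonneg m)
    change γ m = 0
    rw [← h1, hk]
    exact hN k (by rw [hk] at hm; exact_mod_cast hm)
  by_cases hall : ∀ m : ℕ, γ m = 0
  · left
    intro x hx
    rw [hφg _ hx, hexp 0 (fun m _ => hall m) x]
    simp [hγ0]
  · right
    classical
    push Not at hall
    obtain ⟨m, hm⟩ := hall
    have hmM : m ≤ M := by
      by_contra h'; exact hm (hlarge m (by omega))
    set N := Nat.findGreatest (fun m : ℕ => γ m ≠ 0) M with hN
    have hN1 : γ N ≠ 0 := Nat.findGreatest_spec (P := fun m : ℕ => γ m ≠ 0) hmM hm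
    have hN2 : ∀ k : ℕ, N < k → γ k = 0 := by
      intro k hk
      by_cases hkM : k ≤ M
      · by_contra h'
        exact Nat.findGreatest_is_greatest hk hkM h'
      · exact hlarge k (by omega)
    refine ⟨N, fun m => γ m / (2 * Real.pi), ?_, fun m => by simp only [hγe],
      div_ne_zero hN1 hpi', fun x hx => ?_⟩
    · by_contra h'
      have : N = 0 := by omega
      rw [this] at hN1
      exact hN1 (by simpa using hγ0)
    · rw [hφg _ hx, hexp N hN2 x]

end IsStripFunction

lemma exists_sub_regular (ι : Type*) [Fintype ι] : ∃ x : ι → ℝ, ∀ i j, i ≠ j →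
    x i - x j ∉ {t : ℝ | Complex.sin ((t : ℂ) / 2) = 0} := by
  have hpi := Real.pi_gt_three
  set e := Fintype.equivFin ι
  refine ⟨fun i => (e i : ℕ) / (Fintype.card ι : ℝ), fun i j hij hmem => ?_⟩
  obtain ⟨k, hk⟩ := sin_half_eq_zero_iff.1 hmem
  have hk : ((e i : ℕ) : ℝ) / (Fintype.card ι : ℝ) - ((e j : ℕ) : ℝ) / (Fintype.card ι : ℝ) =
    2 * Real.pi * k := by exact_mod_cast hk
  have h01 : ∀ i, 0 ≤ ((e i : ℕ) : ℝ) / (Fintype.card ι : ℝ) ∧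
      ((e i : ℕ) : ℝ) / (Fintype.card ι : ℝ) < 1 := fun i => by
    have h1 : ((e i : ℕ) : ℝ) < Fintype.card ι := by exact_mod_cast (e i).2
    have h0 : (0 : ℝ) ≤ ((e i : ℕ) : ℝ) := Nat.cast_nonneg _
    exact ⟨by positivity, (div_lt_one (h0.trans_lt h1)).2 h1⟩
  have hi := h01 i
  have hj := h01 j
  have hk0 : k = 0 := by
    rcases lt_trichotomy k 0 with h0 | h0 | h0
    · have : (k : ℝ) ≤ -1 := by exact_mod_cast Int.le_sub_one_of_lt h0
      nlinarith
    · exact h0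
    · have : (1 : ℝ) ≤ k := by exact_mod_cast h0
      nlinarith
  have hc : (Fintype.card ι : ℝ) ≠ 0 := by
    have := Fintype.card_pos_iff.2 ⟨i⟩
    exact_mod_cast this.ne'
  rw [hk0, Int.cast_zero, mul_zero, sub_eq_zero, div_left_inj' hc] at hk
  exact hij (e.injective (Fin.ext (by exact_mod_cast hk)))

/-! ### Growth in the imaginary direction excludes trigonometric polynomials -/

section Growth

variable {ψ A : ℂ → ℂ} {N : ℕ}

lemma hasDerivAt_expChar (m : ℤ) (u : ℂ) :
    HasDerivAt (expChar m) (-(Complex.I * m) * expChar m u) u := by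
  have h1 : HasDerivAt (expChar m) (expChar m u * (-(Complex.I * m * 1))) u :=
    (((hasDerivAt_id u).const_mul (Complex.I * m)).neg).cexp
  exact h1.congr_deriv (by ring)

lemma exp_I_mul_line (y a : ℝ) : Complex.exp (Complex.I * (y * Complex.I - a)) =
    Real.exp (-y) * Complex.exp (-(Complex.I * a)) := by
  rw [Complex.ofReal_exp, ← Complex.exp_add]
  congr 1
  push_cast
  linear_combination (y : ℂ) * Complex.I_sq

lemma tendsto_exp_I_mul_line (a : ℝ) :
    Tendsto (fun y : ℝ => Complex.exp (Complex.I * (y * Complex.I - a))) atTop (𝓝 0) := by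
  simp only [exp_I_mul_line]
  have h1 : Tendsto (fun y : ℝ => ((Real.exp (-y) : ℝ) : ℂ)) atTop (𝓝 ((0 : ℝ) : ℂ)) :=
    (Complex.continuous_ofReal.tendsto 0).comp Real.tendsto_exp_neg_atTop_nhds_zero
  simpa using h1.mul_const (Complex.exp (-(Complex.I * a)))

lemma expChar_line (N : ℕ) (y a : ℝ) : expChar N (y * Complex.I - a) * (Real.exp (-y) : ℂ) ^ N =
    expChar (-N) a := by
  unfold expChar
  rw [Complex.ofReal_exp, ← Complex.exp_nat_mul, ← Complex.exp_add]
  congr 1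
  push_cast
  linear_combination (-(N : ℂ) * y) * Complex.I_sq

/-- The behaviour of a function with a pole of order `N` in `e^{iz}` as `Im z → ∞`. -/
lemma tendsto_line (hA : AnalyticAt ℂ A 0)
    (hψ : ∀ u : ℂ, 0 < u.im → ψ u = expChar N u * A (Complex.exp (Complex.I * u))) (a : ℝ) :
    Tendsto (fun y : ℝ => ψ (y * Complex.I - a) * (Real.exp (-y) : ℂ) ^ N) atTop
      (𝓝 (expChar (-N) a * A 0)) ∧
    Tendsto (fun y : ℝ => deriv ψ (y * Complex.I - a) * (Real.exp (-y) : ℂ) ^ N) atTop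
      (𝓝 (-(Complex.I * N) * (expChar (-N) a * A 0))) := by
  have hq := tendsto_exp_I_mul_line a
  have hAq := hA.continuousAt.tendsto.comp hq
  have him : ∀ y : ℝ, ((y : ℂ) * Complex.I - a).im = y := fun y => by simp
  constructor
  · refine (hAq.const_mul (expChar (-N) a)).congr' ?_
    filter_upwards [eventually_gt_atTop 0] with y hy
    rw [hψ _ (by rwa [him]), ← expChar_line N y a, Function.comp_apply]
    ring
  · have hA' := (hA.deriv.continuousAt.tendsto.comp hq).mul (hq.mul_const Complex.I)
    have h1 := ((hAq.const_mul (-(Complex.I * N))).add hA').const_mul (expChar (-N) a)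
    rw [zero_mul, mul_zero, add_zero] at h1
    rw [show -(Complex.I * N) * (expChar (-N) a * A 0) =
      expChar (-N) a * (-(Complex.I * N) * A 0) by ring]
    refine h1.congr' ?_
    filter_upwards [eventually_gt_atTop 0, hq.eventually hA.eventually_analyticAt] with y hy hAy
    set u : ℂ := y * Complex.I - a with hu
    have hd : HasDerivAt (fun u => expChar N u * A (Complex.exp (Complex.I * u)))
        (-(Complex.I * N) * expChar N u * A (Complex.exp (Complex.I * u)) + expChar N u *
          (deriv A (Complex.exp (Complex.I * u)) * (Complex.exp (Complex.I * u) * (Complex.I * 1)))) u := by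
      have h2 : HasDerivAt (fun u => Complex.exp (Complex.I * u))
          (Complex.exp (Complex.I * u) * (Complex.I * 1)) u :=
        ((hasDerivAt_id u).const_mul Complex.I).cexp
      have h3 := hasDerivAt_expChar N u
      push_cast at h3
      exact h3.mul (hAy.differentiableAt.hasDerivAt.comp u h2)
    have hev : ψ =ᶠ[𝓝 u] fun u => expChar N u * A (Complex.exp (Complex.I * u)) := by
      have : ∀ᶠ v : ℂ in 𝓝 u, 0 < v.im :=
        Complex.continuous_im.continuousAt.eventually_const_lt (by rw [hu, him]; exact hy)
      filter_upwards [this] with v hv using hψ v hv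
    rw [hev.deriv_eq, hd.deriv, ← expChar_line N y a, Function.comp_apply, Function.comp_apply]
    ring

/-- A solution cannot have a pole in `e^{iz}`. -/
lemma not_isSolution_of_pole {β : ℂ} (h : ∀ δ > 0, IsStripFunction ψ β δ) (hN : 1 ≤ N)
    (hA : AnalyticAt ℂ A 0) (hA0 : A 0 ≠ 0)
    (hψ : ∀ u : ℂ, 0 < u.im → ψ u = expChar N u * A (Complex.exp (Complex.I * u)))
    {ι : Type*} [Fintype ι] [DecidableEq ι] (hι : 2 ≤ Fintype.card ι) :
    ¬ IsSolution (Option ι) (fun t : ℝ => ψ t) {t : ℝ | Complex.sin ((t : ℂ) / 2) = 0} := by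
  intro hsol
  obtain ⟨x, hx⟩ := exists_sub_regular ι
  set V : ι → ℂ := fun i => partialProd ψ (fun i => (x i : ℂ)) i (x i)
  set V' : ι → ℂ := fun i => deriv (partialProd ψ (fun i => (x i : ℂ)) i) (x i)
  -- One point is at height y, the others are real. Each ψ(iy − x i) and its derivative have exact
  -- order 1/R. The derivative of the full product has order R to the power −|ι|, the other terms
  -- only order 1/R. As |ι| ≥ 2, multiplication by R to the power |ι| leaves −iN|ι| ∏ l i ≠ 0 in the
  -- limit.
  set R : ℝ → ℂ := fun y => (Real.exp (-y) : ℂ) ^ N with hR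
  have hR0 : Tendsto R atTop (𝓝 0) := by
    have h1 : Tendsto (fun y : ℝ => ((Real.exp (-y) : ℝ) : ℂ)) atTop (𝓝 ((0 : ℝ) : ℂ)) :=
      (Complex.continuous_ofReal.tendsto 0).comp Real.tendsto_exp_neg_atTop_nhds_zero
    have := h1.pow N
    rwa [Complex.ofReal_zero, zero_pow (by omega)] at this
  set l : ι → ℂ := fun i => expChar (-N) (x i) * A 0 with hl
  have hl0 : ∀ i, l i ≠ 0 := fun i => mul_ne_zero (Complex.exp_ne_zero _) hA0
  have h1 := fun i => (tendsto_line hA hψ (x i)).1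
  have h2 := fun i => (tendsto_line hA hψ (x i)).2
  have hlim : Tendsto (fun y : ℝ => ∑ i, (deriv ψ (y * Complex.I - x i) * R y) *
      ∏ j ∈ Finset.univ.erase i, (ψ (y * Complex.I - x j) * R y) +
      R y ^ (Fintype.card ι - 1) * ∑ i, ((ψ (y * Complex.I - x i) * R y) * V' i -
        (deriv ψ (y * Complex.I - x i) * R y) * V i)) atTop
      (𝓝 (∑ i, (-(Complex.I * N) * l i) * ∏ j ∈ Finset.univ.erase i, l j +
        0 ^ (Fintype.card ι - 1) * ∑ i, (l i * V' i - (-(Complex.I * N) * l i) * V i))) :=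
    (tendsto_finsetSum _ fun i _ => (h2 i).mul (tendsto_finsetProd _ fun j _ => h1 j)).add
      ((hR0.pow _).mul (tendsto_finsetSum _ fun i _ =>
        ((h1 i).mul_const _).sub ((h2 i).mul_const _)))
  have hzero := tendsto_nhds_unique (hlim.congr' (f₂ := fun _ => 0) (by
    filter_upwards [eventually_gt_atTop 0] with y hy
    have him : ((y : ℂ) * Complex.I).im = y := by simp
    have hs := h (y + 1) (by linarith)
    have h3 := hs.deriv_fullProd_add_sum_eq_zero hsol hx (w := y * Complex.I) (by rwa [him])
      (by rw [him]; linarith)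
    rw [deriv_fullProd fun i => (hs.analyticAt_line (w := y * Complex.I) (by rwa [him])
      (by rw [him]; linarith) (x i)).differentiableAt] at h3
    have hcard : R y ^ Fintype.card ι = R y * R y ^ (Fintype.card ι - 1) := by
      rw [← pow_succ']; congr 1; omega
    have e1 : ∀ i, (deriv ψ (y * Complex.I - x i) * R y) *
        ∏ j ∈ Finset.univ.erase i, (ψ (y * Complex.I - x j) * R y) =
        R y ^ Fintype.card ι * (deriv ψ (y * Complex.I - x i) *
          partialProd ψ (fun i => (x i : ℂ)) i (y * Complex.I)) := fun i => by
      rw [Finset.prod_mul_distrib, Finset.prod_const, Finset.card_erase_of_mem (Finset.mem_univ i),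
        Finset.card_univ, hcard, partialProd]
      ring
    have e2 : R y ^ (Fintype.card ι - 1) * ∑ i, ((ψ (y * Complex.I - x i) * R y) * V' i -
        (deriv ψ (y * Complex.I - x i) * R y) * V i) = R y ^ Fintype.card ι *
        ∑ i, (ψ (y * Complex.I - x i) * V' i - deriv ψ (y * Complex.I - x i) * V i) := by
      rw [hcard, Finset.mul_sum, Finset.mul_sum]
      exact Finset.sum_congr rfl fun i _ => by ring
    rw [Finset.sum_congr rfl fun i _ => e1 i, e2, ← Finset.mul_sum, ← mul_add, h3, mul_zero]))
    tendsto_const_nhds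
  rw [zero_pow (by omega), zero_mul, add_zero] at hzero
  have e3 : ∀ i, -(Complex.I * N) * l i * ∏ j ∈ Finset.univ.erase i, l j =
      -(Complex.I * N) * ∏ j, l j := fun i => by
    rw [← Finset.mul_prod_erase Finset.univ l (Finset.mem_univ i)]; ring
  rw [Finset.sum_congr rfl fun i _ => e3 i, Finset.sum_const, Finset.card_univ, nsmul_eq_mul] at hzero
  have hN0 : (N : ℂ) ≠ 0 := by exact_mod_cast (by omega : N ≠ 0)
  have hc0 : (Fintype.card ι : ℂ) ≠ 0 := by exact_mod_cast (by omega : Fintype.card ι ≠ 0)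
  exact mul_ne_zero hc0 (mul_ne_zero (neg_ne_zero.2 (mul_ne_zero Complex.I_ne_zero hN0))
    (Finset.prod_ne_zero_iff.2 fun i _ => hl0 i)) hzero

end Growth

lemma IsSolution.congr {ι : Type*} [Fintype ι] [DecidableEq ι] {p q : ℝ → ℂ} {S : Set ℝ}
    (hp : IsSolution ι p S) (hS : IsClosed S) (h : ∀ x ∉ S, p x = q x) : IsSolution ι q S := by
  intro x hx
  rw [← hp x hx]
  refine divSum_congr fun i j hij => ?_
  filter_upwards [hS.isOpen_compl.mem_nhds (hx i j hij)] with t ht using (h t ht).symm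

lemma isClosed_sin_half_eq_zero : IsClosed {t : ℝ | Complex.sin ((t : ℂ) / 2) = 0} :=
  isClosed_eq (by fun_prop) continuous_const

/-- A multiple of `1 / (4 sin² (z / 2))` plus a nonconstant trigonometric polynomial is not a
solution. -/
lemma not_isSolution_of_trigonometric_polynomial {β : ℂ} (hβ : β ≠ 0) {N : ℕ} (hN : 1 ≤ N)
    {c : ℤ → ℂ} (hc : ∀ m, c (-m) = c m) (hcN : c N ≠ 0) {ι : Type*} [Fintype ι] [DecidableEq ι]
    (hι : 2 ≤ Fintype.card ι) :
    ¬ IsSolution (Option ι) (fun t : ℝ => β * inverseSinSq t +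
      ∑ m ∈ Finset.Icc (-(N : ℤ)) N, c m * expChar (-m) t)
        {t : ℝ | Complex.sin ((t : ℂ) / 2) = 0} := by
  set ψ : ℂ → ℂ := fun z => β * inverseSinSq z +
    ∑ m ∈ Finset.Icc (-(N : ℤ)) N, c m * expChar (-m) z with hψ
  -- ψ(z) = e^{−iNz}A(q) for q = e^{iz}. The polar part acquires a zero of order N + 1 at q = 0, so
  -- A(0) is c(−N) = c(N).
  set A : ℂ → ℂ := fun q => β * (-q ^ (N + 1) / (1 - q) ^ 2) +
    ∑ m ∈ Finset.Icc (-(N : ℤ)) N, c m * q ^ (m + N).toNat with hA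
  have hpoly : ∀ z, AnalyticAt ℂ (fun z => ∑ m ∈ Finset.Icc (-(N : ℤ)) N, c m * expChar (-m) z) z :=
    fun z => Finset.analyticAt_fun_sum _ fun m _ => analyticAt_const.mul (analyticAt_expChar _ z)
  have hstrip : ∀ δ > 0, IsStripFunction ψ β δ := by
    intro δ hδ
    refine ⟨fun z => ?_, fun z => ?_, hβ, hδ, fun z _ hz => ?_, ?_⟩
    · simp only [hψ, inverseSinSq_neg]
      congr 1
      refine Finset.sum_nbij' (fun m => -m) (fun m => -m) ?_ ?_ (fun m _ => neg_neg m)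
        (fun m _ => neg_neg m) fun m _ => ?_
      · intro m hm; rw [Finset.mem_Icc] at hm ⊢; omega
      · intro m hm; rw [Finset.mem_Icc] at hm ⊢; omega
      · rw [hc]; congr 1
        unfold expChar; congr 1; push_cast; ring
    · simp only [hψ, inverseSinSq_periodic, expChar_periodic]
    · exact (analyticAt_const.mul (analyticAt_inverseSinSq hz)).add (hpoly z)
    · obtain ⟨s, hs, hts⟩ := exists_pole_inverseSinSq
      refine ⟨fun u => β * s u + ∑ m ∈ Finset.Icc (-(N : ℤ)) N, c m * expChar (-m) u,
        (analyticAt_const.mul hs).add (hpoly 0), ?_⟩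
      filter_upwards [hts] with u hu
      simp only [hψ, hu]
      ring
  have hAa : AnalyticAt ℂ A 0 := by
    refine AnalyticAt.add (analyticAt_const.mul (AnalyticAt.div (by fun_prop) (by fun_prop)
      (by simp))) (Finset.analyticAt_fun_sum _ fun m _ => by fun_prop)
  have hA0 : A 0 = c N := by
    simp only [hA]
    rw [Finset.sum_eq_single (-(N : ℤ))]
    · simp [hc]
    · intro m hm hne
      rw [Finset.mem_Icc] at hm
      have : (m + N).toNat ≠ 0 := by omega
      rw [zero_pow this, mul_zero]
    · intro h
      exact absurd (Finset.mem_Icc.2 ⟨le_rfl, by omega⟩) h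
  refine not_isSolution_of_pole (ψ := ψ) hstrip hN hAa (by rwa [hA0]) (fun u _ => ?_) hι
  have hpow : ∀ k : ℕ, expChar N u * Complex.exp (Complex.I * u) ^ k = expChar (N - k) u := by
    intro k
    unfold expChar
    rw [← Complex.exp_nat_mul, ← Complex.exp_add]
    congr 1; push_cast; ring
  simp only [hψ, hA]
  rw [mul_add, Finset.mul_sum]
  congr 1
  · have h1 := hpow (N + 1)
    have h2 : expChar (N - (N + 1 : ℕ)) u = Complex.exp (Complex.I * u) := by
      unfold expChar; congr 1; push_cast; ring
    rw [h2] at h1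
    unfold inverseSinSq
    linear_combination (β / (1 - Complex.exp (Complex.I * u)) ^ 2) * h1
  · refine Finset.sum_congr rfl fun m hm => ?_
    rw [Finset.mem_Icc] at hm
    have h1 := hpow (m + N).toNat
    have h2 : (N : ℤ) - ((m + N).toNat : ℤ) = -m := by omega
    rw [h2] at h1
    linear_combination -c m * h1

lemma eventuallyEq_zero_of_real {f φ : ℂ → ℂ} (hf : MeromorphicAt f 0) (hφ : MeromorphicAt φ 0)
    (h : ∀ᶠ t : ℝ in 𝓝[≠] 0, f t = φ t) : ∀ᶠ z in 𝓝[≠] (0 : ℂ), f z = φ z := by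
  have ht := tendsto_ofReal_punctured 0
  rw [Complex.ofReal_zero] at ht
  exact (hf.frequently_eq_iff_eventuallyEq hφ).1 (ht.frequently h.frequently)

lemma eventually_sin_half_ne_zero : ∀ᶠ t : ℝ in 𝓝[≠] 0, Complex.sin ((t : ℂ) / 2) ≠ 0 := by
  have hpi := Real.pi_pos
  have h : Set.Ioo (-(2 * Real.pi)) (2 * Real.pi) ∈ 𝓝 (0 : ℝ) :=
    Ioo_mem_nhds (by linarith) (by linarith)
  filter_upwards [nhdsWithin_le_nhds h, self_mem_nhdsWithin] with t ht ht0
  rw [Ne, sin_half_eq_zero_iff]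
  rintro ⟨k, hk⟩
  have hk : t = 2 * Real.pi * k := by exact_mod_cast hk
  rcases lt_trichotomy k 0 with h0 | rfl | h0
  · have : (k : ℝ) ≤ -1 := by exact_mod_cast Int.le_sub_one_of_lt h0
    nlinarith [ht.1]
  · exact ht0 (by simpa using hk)
  · have : (1 : ℝ) ≤ k := by exact_mod_cast h0
    nlinarith [ht.2]

lemma IsSolution.fin_three_of_two_step {p : ℝ → ℂ} {S : Set ℝ}
    (hstep : ∀ m : ℕ, IsSolution (Option (Option (Fin m))) p S → IsSolution (Fin m) p S) {m : ℕ}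
    (hsol : IsSolution (Fin (2 * m + 3)) p S) : IsSolution (Fin 3) p S := by
  induction m with
  | zero => exact hsol
  | succ m ih => exact ih (hstep _ (hsol.of_card_eq (by simp; ring)))

/-! ### Conclusion for the periodic class -/

/-- The odd primitive `-cot (z / 2) / 2` of `1 / (4 sin² (z / 2))`. -/
noncomputable def inverseSinSqPrimitive (z : ℂ) : ℂ :=
  Complex.I / 2 * ((1 + Complex.exp (Complex.I * z)) / (1 - Complex.exp (Complex.I * z)))

lemma inverseSinSqPrimitive_neg (z : ℂ) :
    inverseSinSqPrimitive (-z) = -inverseSinSqPrimitive z := by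
  unfold inverseSinSqPrimitive
  rw [mul_neg, Complex.exp_neg]
  have hq := Complex.exp_ne_zero (Complex.I * z)
  set q := Complex.exp (Complex.I * z)
  by_cases h : q = 1
  · simp [h]
  · have h1 : 1 - q ≠ 0 := sub_ne_zero.2 (Ne.symm h)
    have h3 : 1 - q⁻¹ = -(1 - q) / q := by field_simp; ring
    rw [h3]; field_simp; ring

lemma inverseSinSqPrimitive_pi : inverseSinSqPrimitive Real.pi = 0 := by
  unfold inverseSinSqPrimitive
  rw [mul_comm Complex.I (Real.pi : ℂ), Complex.exp_pi_mul_I]; simp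

lemma hasDerivAt_inverseSinSqPrimitive {z : ℂ} (h : Complex.sin (z / 2) ≠ 0) :
    HasDerivAt inverseSinSqPrimitive (inverseSinSq z) z := by
  have h1 : 1 - Complex.exp (Complex.I * z) ≠ 0 :=
    sub_ne_zero.2 fun h1 => h (exp_I_mul_eq_one_iff.1 h1.symm)
  have hq : HasDerivAt (fun z => Complex.exp (Complex.I * z))
      (Complex.exp (Complex.I * z) * (Complex.I * 1)) z :=
    ((hasDerivAt_id z).const_mul Complex.I).cexp
  refine (((hq.const_add 1).div (hq.const_sub 1) h1).const_mul (Complex.I / 2)).congr_deriv ?_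
  unfold inverseSinSq
  field_simp
  linear_combination 2 * Complex.I_sq

namespace IsStripFunction

variable {φ : ℂ → ℂ} {β : ℂ} {δ : ℝ}

lemma meromorphicAt_zero (h : IsStripFunction φ β δ) : MeromorphicAt φ 0 := by
  obtain ⟨G, hG, hφG⟩ := h.pole
  have h1 : MeromorphicAt (fun u => β / u ^ 2 + G u) 0 :=
    ((MeromorphicAt.const β 0).div ((MeromorphicAt.id 0).pow 2)).add hG.meromorphicAt
  exact h1.congr (by filter_upwards [hφG] with u hu using hu.symm)

end IsStripFunction

namespace ClassBTwoPi

variable {f φ : ℂ → ℂ} {β : ℂ} {δ : ℝ}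

/-- The coefficient `a₀` is the integral over a period above the real axis. -/
lemma hasTransformCoeff_zero (hf : ClassBTwoPi f) (he : ∀ x : ℝ, f (-(x : ℂ)) = f x)
    (h : IsStripFunction φ β δ) (hφf : ∀ x : ℝ, φ x = f x) {η : ℝ} (hη : 0 < η) (hη' : η < δ)
    (h0 : lineIntegral φ η = 0) : HasTransformCoeff f 0 0 := by
  have hpi := Real.pi_pos
  obtain ⟨g, hge, hgp, hga, hφg⟩ := h.exists_regularPart
  have hgr : ∀ x : ℝ, AnalyticAt ℂ g x := fun x => hga x (by simp [h.pos])
  have hgc : Continuous fun x : ℝ => g x := by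
    rw [continuous_iff_continuousAt]
    exact fun x => (hgr x).continuousAt.comp Complex.continuous_ofReal.continuousAt
  have hgint : ∫ x in (0 : ℝ)..(2 * Real.pi), g x = 0 := by
    have h1 := IsStripFunction.lineIntegral_mul_expChar (φ := φ) hgp hga hφg hη hη' 0
    have h2 : ∀ (F : ℂ → ℂ) (η : ℝ), lineIntegral (fun w => F w * expChar 0 w) η =
        lineIntegral F η := fun F η => lineIntegral_congr fun w _ => by simp [expChar]
    rw [h2, h2, h0, if_neg (lt_irrefl 0), mul_zero, zero_add] at h1
    simpa [lineIntegral] using h1.symm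
  set A : ℝ → ℂ := fun x => ∫ t in (0 : ℝ)..x, g t with hA
  have hAd : ∀ x : ℝ, HasDerivAt A (g x) x := fun x =>
    intervalIntegral.integral_hasDerivAt_right (hgc.intervalIntegrable _ _)
      (hgc.stronglyMeasurableAtFilter _ _) hgc.continuousAt
  have hAodd : ∀ x, A (-x) = -A x := by
    intro x
    have h1 := intervalIntegral.integral_comp_neg (a := 0) (b := x) (fun t : ℝ => g t)
    simp only [Complex.ofReal_neg, hge, neg_zero] at h1
    simp only [hA]
    rw [h1, intervalIntegral.integral_symm]
  have hApi : A Real.pi = 0 := by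
    have hper : Function.Periodic (fun x : ℝ => g x) (2 * Real.pi) := fun x => by
      have := hgp x
      push_cast
      exact this
    have h1 := hper.intervalIntegral_add_eq 0 (-Real.pi)
    rw [zero_add, hgint, show -Real.pi + 2 * Real.pi = Real.pi by ring,
      ← intervalIntegral.integral_add_adjacent_intervals (b := 0) (hgc.intervalIntegrable _ _)
        (hgc.intervalIntegrable _ _), intervalIntegral.integral_symm] at h1
    have h2 : A (-Real.pi) = ∫ t in (0 : ℝ)..(-Real.pi), g t := rfl
    rw [← h2, hAodd] at h1
    change 0 = - -A Real.pi + A Real.pi at h1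
    linear_combination (-1 / 2 : ℂ) * h1
  -- The mean of the indented integrals from −π to π is 2F(π). The cotangent part vanishes at π. So
  -- does A, since it is odd and the integral of g over a period is the integral of φ at height η,
  -- which is 0.
  set F : ℝ → ℂ := fun x => β * inverseSinSqPrimitive x + A x with hF
  obtain ⟨Ψ, -, h2, h3⟩ := exists_analyticAt_extension (hgr 0) hAd
  rw [Complex.ofReal_zero] at h2
  have hm0 : MeromorphicAt f 0 := by simpa using hf.meromorphicAt 0
  have hfφ := eventuallyEq_zero_of_real hm0 h.meromorphicAt_zero
    (Eventually.of_forall fun t => (hφf t).symm)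
  have hsin : ∀ᶠ w in 𝓝[≠] (0 : ℂ), Complex.sin (w / 2) ≠ 0 := by
    have han : AnalyticAt ℂ (fun w : ℂ => Complex.sin (w / 2)) 0 := by fun_prop
    refine (han.eventually_eq_zero_or_eventually_ne_zero).resolve_left fun hz => ?_
    have h4 : Tendsto (fun t : ℝ => (t : ℂ)) (𝓝[≠] 0) (𝓝 0) := by
      have := tendsto_ofReal_punctured 0
      rw [Complex.ofReal_zero] at this
      exact this.mono_right nhdsWithin_le_nhds
    obtain ⟨t, ht1, ht2⟩ := ((h4.eventually hz).and eventually_sin_half_ne_zero).exists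
    exact ht2 ht1
  have hmean := meanIntegral_eq_two_mul (f := f) (F := F)
    (Φ := fun z => β * inverseSinSqPrimitive z + Ψ z) he (fun x => by
      simp only [hF, hAodd, Complex.ofReal_neg, inverseSinSqPrimitive_neg]; ring) (by
      filter_upwards [h2.filter_mono nhdsWithin_le_nhds, hm0.eventually_analyticAt, hfφ, hsin]
        with w hw hfw hfφw hs
      refine ⟨(((hasDerivAt_inverseSinSqPrimitive hs).const_mul β).add hw).congr_deriv ?_,
        hfw.continuousAt⟩
      rw [hfφw, hφg w hs]) (by
      filter_upwards [h3.filter_mono nhdsWithin_le_nhds] with t ht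
      simp only [hF]; rw [ht])
  have hreg : ∀ x : ℝ, x ∈ Set.Ioc 0 Real.pi → Complex.sin ((x : ℂ) / 2) ≠ 0 := by
    intro x hx
    have h5 := Real.sin_pos_of_pos_of_lt_pi (x := x / 2) (by linarith [hx.1]) (by linarith [hx.2])
    have h6 : Complex.sin ((x : ℂ) / 2) = ((Real.sin (x / 2) : ℝ) : ℂ) := by push_cast; rfl
    rw [h6]
    exact Complex.ofReal_ne_zero.2 h5.ne'
  have hle : ∀ᶠ r in 𝓝[>] (0 : ℝ), r ≤ Real.pi :=
    nhdsWithin_le_nhds (Iic_mem_nhds hpi)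
  filter_upwards [hmean, hle] with r hr hrpi
  have h7 := hr Real.pi hrpi (fun x hx => by
      refine (((hasDerivAt_inverseSinSqPrimitive (hreg x hx)).comp_ofReal.const_mul β).add
        (hAd x)).congr_deriv ?_
      rw [← hφf, hφg _ (hreg x hx)])
    (fun x hx => (hf.analyticAt_iff.2 (hreg x hx)).continuousAt)
  rw [Int.cast_zero, h7]
  simp [hF, inverseSinSqPrimitive_pi, hApi]

lemma isWeierstrassForm_of_eq_inverseSinSq (hf : ClassBTwoPi f)
    (h : ∀ x : ℝ, Complex.sin ((x : ℂ) / 2) ≠ 0 → f x = β * inverseSinSq x) :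
    IsWeierstrassForm f := by
  have hmer : ∀ z : ℂ, MeromorphicAt (fun z => -(β * ((Complex.I / 2) ^ 2 / 3)) +
      β * ((Complex.I / 2) ^ 2 / Complex.sinh (Complex.I / 2 * z) ^ 2 + (Complex.I / 2) ^ 2 / 3)) z :=
    fun z => by fun_prop
  refine ⟨-(β * ((Complex.I / 2) ^ 2 / 3)), β, _, _, _, IsWeierstrassP.trigonometric (Complex.I / 2)
    (div_ne_zero Complex.I_ne_zero two_ne_zero), fun x => ?_⟩
  refine eventuallyEq_real_of_eventuallyEq hf.meromorphicAt (fun x => hmer x) ?_ x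
  refine eventuallyEq_zero_of_real (by simpa using hf.meromorphicAt 0) (hmer 0) ?_
  filter_upwards [eventually_sin_half_ne_zero] with t ht
  rw [h t ht, inverseSinSq_eq_sinh]; ring

/-- If ∫φ ≠ 0, points are removed one at a time. Otherwise a₀ = 0, so n is even and the number of
points is odd; a nonzero value of the autocorrelation then removes two points at a time until three
are left. If the autocorrelation vanishes identically, φ is a multiple of 1/(4 sin²(z/2)), because a
further trigonometric polynomial is excluded by its growth. -/
theorem isWeierstrassForm (hf : ClassBTwoPi f) (he : ∀ x : ℝ, f (-(x : ℂ)) = f x) {n : ℕ}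
    (hn : 2 ≤ n) (hsol : SolvesEquation n f) (hc : Even n ∨ ¬ HasTransformCoeff f 0 0) :
    IsWeierstrassForm f := by
  rw [solvesEquation_iff] at hsol
  have hfin : IsSolution (Fin 3) (fun x : ℝ => f x) {x : ℝ | ¬ AnalyticAt ℂ f x} →
      IsWeierstrassForm f := fun h =>
    isWeierstrassForm_of_isSolution hf.meromorphicAt hf.pole_zero he (h.of_card_eq (by simp))
  have hS : {x : ℝ | ¬ AnalyticAt ℂ f x} = {t : ℝ | Complex.sin ((t : ℂ) / 2) = 0} := by
    ext x
    simp only [Set.mem_ofPred_eq, hf.analyticAt_iff, not_not]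
  obtain ⟨φ, β, δ, h, hφf⟩ := hf.exists_isStripFunction he
  have hfun : (fun x : ℝ => f x) = fun x : ℝ => φ x := funext fun x => (hφf x).symm
  rw [hS, hfun] at hsol hfin
  obtain ⟨η, hη, hη'⟩ := exists_between h.pos
  by_cases h0 : lineIntegral φ η = 0
  · obtain ⟨k, hk⟩ := hc.resolve_right fun h' =>
      h' (hf.hasTransformCoeff_zero he h hφf hη hη' h0)
    obtain ⟨j, rfl⟩ := Nat.exists_eq_add_of_le (show 1 ≤ k by omega)
    by_cases hK : ∃ v : ℝ, Complex.sin ((v : ℂ) / 2) ≠ 0 ∧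
        lineIntegral (fun w => φ (w + v) * φ w) η ≠ 0
    · obtain ⟨v, hv, hne⟩ := hK
      have hsol' : IsSolution (Fin (2 * j + 3)) (fun t : ℝ => φ t)
          {t : ℝ | Complex.sin ((t : ℂ) / 2) = 0} := hsol.of_card_eq (by simp; omega)
      exact hfin (hsol'.fin_three_of_two_step fun m hm =>
        h.isSolution_of_autocorrelation_ne_zero hη hη' hv hne hm)
    · push Not at hK
      rcases h.exists_eq_of_autocorrelation_eq_zero hη hη' hK with h1 | ⟨N, c, hN, hc, hcN, h1⟩
      · exact hf.isWeierstrassForm_of_eq_inverseSinSq (β := β) fun x hx => by rw [← hφf, h1 x hx]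
      · exact absurd ((hsol.of_card_eq (κ := Option (Fin n)) (by simp)).congr
          isClosed_sin_half_eq_zero fun x hx => h1 x hx)
          (not_isSolution_of_trigonometric_polynomial h.ne_zero hN hc hcN (by simpa using hn))
  · obtain ⟨j, rfl⟩ := Nat.exists_eq_add_of_le hn
    have hsol' : IsSolution (Fin (j + 3)) (fun t : ℝ => φ t)
        {t : ℝ | Complex.sin ((t : ℂ) / 2) = 0} := hsol.of_card_eq (by simp; omega)
    exact hfin (hsol'.fin_three fun m hm => h.isSolution_of_lineIntegral_ne_zero hη hη' h0 hm)

end ClassBTwoPi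

end PoincareFE

theorem theorem4 (n : ℕ) (hn : 2 ≤ n) (f : ℂ → ℂ)
    (hf : PoincareFE.ClassB f ∨ PoincareFE.ClassBTwoPi f)
    (heven : ∀ x : ℝ, f (-(x : ℂ)) = f x) :
    (Even n → (PoincareFE.SolvesEquation n f ↔ PoincareFE.IsWeierstrassForm f)) ∧
    (Odd n → PoincareFE.TransformNeZeroAtZero f →
      (PoincareFE.SolvesEquation n f ↔ PoincareFE.IsWeierstrassForm f)) := by
  have ho : meromorphicOrderAt f 0 = ((-2 : ℤ) : WithTop ℤ) :=
    hf.elim (fun h => h.pole) fun h => h.pole_zero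
  refine ⟨fun hev => ⟨fun hsol => ?_, PoincareFE.solvesEquation_of_isWeierstrassForm ho heven⟩,
    fun _ ht => ⟨fun hsol => ?_, PoincareFE.solvesEquation_of_isWeierstrassForm ho heven⟩⟩
  · rcases hf with hf | hf
    · exact hf.isWeierstrassForm heven hn hsol (Or.inl hev)
    · exact hf.isWeierstrassForm heven hn hsol (Or.inl hev)
  · rcases ht with ⟨hf, ht⟩ | ⟨hf, ht⟩
    · exact hf.isWeierstrassForm heven hn hsol (Or.inr ht)
    · exact hf.isWeierstrassForm heven hn hsol (Or.inr ht)
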